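/- Let $n\ge 2$ and let $M$ be a smooth manifold of dimension $2n-1$ (without boundary, Hausdorff, second countable) with a cooriented contact structure $\xi$. The manifold $M$ is oriented by $\alpha\wedge d\alpha^{n-1}$, for any contact form $\alpha$ defining the cooriented hyperplane field $\xi$. A contact vector field is a smooth vector field $X$ with $\mathcal L_X\alpha=g\alpha$ for a function $g$; a vector field $X$ is negatively transverse to $\xi$ if $\alpha(X)<0$ everywhere. An open book decomposition $(B,\varphi)$ of $M$ consists of a closed codimension $2$ submanifold $B$ (the binding) and a smooth fibration $\varphi\colon M\setminus B\to\mathbb S^1$ (whose fibres are the pages) which is the angular coordinate of $D^2$ in some tubular neighbourhood $B\times D^2$ of $B$. The pages are cooriented by $\varphi$, and $B$ is oriented as their boundary. The open book supports $\xi$ if $B$ is a positive contact submanifold and some contact form $\alpha$ defining $\xi$ is such that $d\alpha$ is positively symplectic on the pages. A smooth map $\phi=(\phi_1,\phi_2)\colon M\to\mathbb R^2$ defines $(B,\varphi)$ if $\phi$ is transverse to $0$, $B=\phi^{-1}(0)$ and $\varphi=\phi/\|\phi\|$ on $M\setminus B$. **(1)** Let $(B,\varphi)$ be an open book decomposition of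 $M$ supporting $\xi$ and let $\alpha$ be any contact form defining $\xi$ such that $d\alpha$ is positively symplectic on the pages. Then there is a smooth map $\phi=(\phi_1,\phi_2)\colon M\to\mathbb R^2$ defining $(B,\varphi)$ such that the contact vector fields $X$ and $Y$ with contact Hamiltonians $\alpha(X)=\phi_1$ and $\alpha(Y)=-\phi_2$ have Lie bracket $[X,Y]$ everywhere negatively transverse to $\xi$. **(2)** Conversely, suppose that $M$ is closed and non-empty and that $X,Y$ are contact vector fields with $[X,Y]$ everywhere negatively transverse to $\xi$. For $\theta\in\mathbb R$ put $X_\theta=\cos\theta\,X+\sin\theta\,Y$, $Y_\theta=X_{\theta+\pi/2}$, $\Sigma_\theta=\{p : X_\theta(p)\in\xi_p\}$ and $F_\theta=\{p\in\Sigma_\theta : Y_\theta(p)\text{ is positively transverse to }\xi_p\}$, and let $K=\{p : X(p)\in\xi_p,\ Y(p)\in\xi_p\}=\{\alpha(X)=\alpha(Y)=0\}$. Then: (a) each $\Sigma_\theta$ is a non-empty regular hypersurface which is $\xi$-convex, i.e. transverse to some contact vector field; moreover $\Sigma_\theta\setminus K=F_\theta\cup F_{\theta+\pi}$. (b) $K$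 is non-empty, and whenever $\theta\not\equiv\theta' \pmod\pi$, the intersection $\Sigma_\theta\cap\Sigma_{\theta'}$ is transverse and equal to $K$. (c) The rule $\varphi(p)=e^{i\theta}$ if $p\in F_{-\theta}$ gives a well-defined map $\varphi\colon M\setminus K\to\mathbb S^1$, and $(K,\varphi)$ is an open book decomposition of $M$ supporting $\xi$. There is also an open book decomposition $(K,\varphi')$ of $M$ supporting $\xi$, with the same pages up to a rotation of $\mathbb S^1$, namely $\varphi'(p)=e^{i\theta}$ if and only if $p\in F_{-\theta-\pi/2}$, and for every contact form $\alpha$ defining $\xi$ it is defined by the map $(\alpha(X),-\alpha(Y))\colon M\to\mathbb R^2$. -/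

import Mathlib

open scoped Manifold ContDiff Topology

noncomputable section

namespace OBD

/-! ### Differential forms of low degree on a manifold -/

section Forms

variable {d : ℕ} {M : Type*} [TopologicalSpace M] [ChartedSpace (EuclideanSpace ℝ (Fin d)) M]

/-- The vector field `X` on a `d`-dimensional manifold without boundary is smooth. -/
def IsSmoothField [IsManifold (𝓡 d) ∞ M] (X : ∀ p : M, TangentSpace (𝓡 d) p) : Prop :=
  ContMDiff (𝓡 d) (𝓡 d).tangent ∞ (fun p => (⟨p, X p⟩ : TangentBundle (𝓡 d) M))

/-- The 1-form `α` is smooth, as a section of the cotangent bundle. -/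
def IsSmoothForm [IsManifold (𝓡 d) ∞ M] (α : ∀ p : M, TangentSpace (𝓡 d) p →L[ℝ] ℝ) : Prop :=
  ContMDiff (𝓡 d) ((𝓡 d).prod 𝓘(ℝ, EuclideanSpace ℝ (Fin d) →L[ℝ] ℝ)) ∞
    (fun p => Bundle.TotalSpace.mk' (EuclideanSpace ℝ (Fin d) →L[ℝ] ℝ)
      (E := fun q : M => (TangentSpace (𝓡 d) q →L[ℝ] ℝ)) p (α p))

/-- The expression of the 1-form `α` in the preferred chart at `p`, that is, its pullback by the
inverse of that chart. -/
def localForm (α : ∀ p : M, TangentSpace (𝓡 d) p →L[ℝ] ℝ) (p : M) :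
    EuclideanSpace ℝ (Fin d) → EuclideanSpace ℝ (Fin d) →L[ℝ] ℝ :=
  fun x => (α ((extChartAt (𝓡 d) p).symm x)).comp
    (mfderiv 𝓘(ℝ, EuclideanSpace ℝ (Fin d)) (𝓡 d) (extChartAt (𝓡 d) p).symm x)

/-- The exterior derivative `dα` at `p`, computed in the preferred chart at `p`; the convention is
`dα(X, Y) = X(α(Y)) - Y(α(X)) - α([X, Y])`. -/
def dForm (α : ∀ p : M, TangentSpace (𝓡 d) p →L[ℝ] ℝ) (p : M)
    (v w : TangentSpace (𝓡 d) p) : ℝ :=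
  let D := fderiv ℝ (localForm α p) (extChartAt (𝓡 d) p p)
  let v' := mvfderiv (𝓡 d) (extChartAt (𝓡 d) p) p v
  let w' := mvfderiv (𝓡 d) (extChartAt (𝓡 d) p) p w
  D v' w' - D w' v'

/-- The Lie derivative of `α` along `X`, by Cartan's formula `d(α(X)) + ι_X dα`. -/
def lieForm (X : ∀ p : M, TangentSpace (𝓡 d) p) (α : ∀ p : M, TangentSpace (𝓡 d) p →L[ℝ] ℝ)
    (p : M) (v : TangentSpace (𝓡 d) p) : ℝ :=
  mvfderiv (𝓡 d) (fun q => α q (X q)) p v + dForm α p (X p) v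

end Forms

section Wedge

variable {V : Type*}

/-- `η ∧ ⋯ ∧ η` (`k` factors) for a 2-form `η` on a vector space, with the normalization
`(a ∧ b)(v, w) = a(v) b(w) - a(w) b(v)`. -/
def twoFormPow (η : V → V → ℝ) (k : ℕ) (v : Fin (2 * k) → V) : ℝ :=
  (1 / 2 ^ k : ℝ) * ∑ σ : Equiv.Perm (Fin (2 * k)), ((Equiv.Perm.sign σ : ℤ) : ℝ) *
    ∏ i : Fin k, η (v (σ ⟨2 * i.1, by omega⟩)) (v (σ ⟨2 * i.1 + 1, by omega⟩))

/-- `a ∧ η ∧ ⋯ ∧ η` (`k` factors `η`) for a 1-form `a` and a 2-form `η` on a vector space, with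
the same normalization. -/
def wedgeTwoFormPow (a : V → ℝ) (η : V → V → ℝ) (k : ℕ) (v : Fin (2 * k + 1) → V) : ℝ :=
  (1 / 2 ^ k : ℝ) * ∑ σ : Equiv.Perm (Fin (2 * k + 1)), ((Equiv.Perm.sign σ : ℤ) : ℝ) *
    (a (v (σ 0)) *
      ∏ i : Fin k, η (v (σ ⟨2 * i.1 + 1, by omega⟩)) (v (σ ⟨2 * i.1 + 2, by omega⟩)))

end Wedge

/-! ### Contact structures

The manifold has dimension `2 * m + 3 = 2 * n - 1`, where `n = m + 2 ≥ 2`. -/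

section Contact

variable (m : ℕ) (M : Type*) [TopologicalSpace M]
  [ChartedSpace (EuclideanSpace ℝ (Fin (2 * m + 3))) M]

variable {m M} in
/-- The top-degree form `α ∧ (dα)^(n-1)` at `p`. When `α` is a contact form, it orients `M`. -/
def contactVolume (α : ∀ p : M, TangentSpace (𝓡 (2 * m + 3)) p →L[ℝ] ℝ) (p : M)
    (v : Fin (2 * (m + 1) + 1) → TangentSpace (𝓡 (2 * m + 3)) p) : ℝ :=
  wedgeTwoFormPow (α p) (dForm α p) (m + 1) v

variable [IsManifold (𝓡 (2 * m + 3)) ∞ M]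

variable {m M} in
/-- Contact forms: smooth 1-forms with `α ∧ (dα)^(n-1)` nowhere zero. -/
def IsContactForm (α : ∀ p : M, TangentSpace (𝓡 (2 * m + 3)) p →L[ℝ] ℝ) : Prop :=
  IsSmoothForm α ∧ ∀ p, ∃ v, contactVolume α p v ≠ 0

/-- A (cooriented) contact structure: the hyperplane field `ξ = ker α` of a contact form `α`,
cooriented by `α`; `pos p` is the set of the tangent vectors at `p` positively transverse
to `ξ`. -/
structure ContactStructure where
  plane : ∀ p : M, Submodule ℝ (TangentSpace (𝓡 (2 * m + 3)) p)
  pos : ∀ p : M, Set (TangentSpace (𝓡 (2 * m + 3)) p)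
  exists_form : ∃ α : ∀ p : M, TangentSpace (𝓡 (2 * m + 3)) p →L[ℝ] ℝ, IsContactForm α ∧
    ∀ p v, (v ∈ plane p ↔ α p v = 0) ∧ (v ∈ pos p ↔ 0 < α p v)

variable {m M}

/-- `α` is a contact form defining the cooriented contact structure `ξ`. -/
def ContactStructure.IsDefinedBy (ξ : ContactStructure m M)
    (α : ∀ p : M, TangentSpace (𝓡 (2 * m + 3)) p →L[ℝ] ℝ) : Prop :=
  IsContactForm α ∧ ∀ p v, (v ∈ ξ.plane p ↔ α p v = 0) ∧ (v ∈ ξ.pos p ↔ 0 < α p v)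

/-- `X` is everywhere negatively transverse to `ξ`. -/
def ContactStructure.NegTransverse (ξ : ContactStructure m M)
    (X : ∀ p : M, TangentSpace (𝓡 (2 * m + 3)) p) : Prop :=
  ∀ p, -X p ∈ ξ.pos p

/-- `X` is a contact vector field for `ξ`: it is smooth, and `L_X α = g α` for a function `g`
(automatically smooth), for every contact form `α` defining `ξ`. -/
def ContactStructure.IsContactField (ξ : ContactStructure m M)
    (X : ∀ p : M, TangentSpace (𝓡 (2 * m + 3)) p) : Prop :=
  IsSmoothField X ∧ ∀ α, ξ.IsDefinedBy α → ∃ g : M → ℝ, ∀ p v, lieForm X α p v = g p * α p v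

end Contact

/-! ### Hypersurfaces -/

section Hypersurfaces

variable {d : ℕ} {M : Type*} [TopologicalSpace M] [ChartedSpace (EuclideanSpace ℝ (Fin d)) M]

/-- `f = 0` is a regular equation of `S` in the open set `U`. At the points of `S ∩ U`, the tangent
space of `S` is then the kernel of the derivative of `f`. -/
def IsLocalEquation (S U : Set M) (f : M → ℝ) : Prop :=
  IsOpen U ∧ ContMDiffOn (𝓡 d) 𝓘(ℝ, ℝ) ∞ f U ∧ (∀ p ∈ U, p ∈ S ↔ f p = 0) ∧
    ∀ p ∈ U ∩ S, mvfderiv (𝓡 d) f p ≠ 0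

/-- `S` is a regular (smooth, embedded) hypersurface. -/
def IsHypersurface (d : ℕ) {M : Type*} [TopologicalSpace M]
    [ChartedSpace (EuclideanSpace ℝ (Fin d)) M] (S : Set M) : Prop :=
  ∀ p ∈ S, ∃ (U : Set M) (f : M → ℝ), p ∈ U ∧ IsLocalEquation (d := d) S U f

/-- The vector field `Z` is transverse to the hypersurface `S`. -/
def IsTransverseField (Z : ∀ p : M, TangentSpace (𝓡 d) p) (S : Set M) : Prop :=
  ∀ p ∈ S, ∃ (U : Set M) (f : M → ℝ), p ∈ U ∧ IsLocalEquation (d := d) S U f ∧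
    mvfderiv (𝓡 d) f p (Z p) ≠ 0

/-- The hypersurfaces `S` and `S'` intersect transversely: `T_p S + T_p S' = T_p M` at every
`p ∈ S ∩ S'`. -/
def AreTransverse (d : ℕ) {M : Type*} [TopologicalSpace M]
    [ChartedSpace (EuclideanSpace ℝ (Fin d)) M] (S S' : Set M) : Prop :=
  ∀ p ∈ S ∩ S', ∃ (U U' : Set M) (f f' : M → ℝ), p ∈ U ∧ p ∈ U' ∧
    IsLocalEquation (d := d) S U f ∧ IsLocalEquation (d := d) S' U' f' ∧
    (mvfderiv (𝓡 d) f p).ker ⊔ (mvfderiv (𝓡 d) f' p).ker = ⊤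

end Hypersurfaces

/-- `S` is a `ξ`-convex hypersurface: it is transverse to some contact vector field. -/
def ContactStructure.IsConvex {m : ℕ} {M : Type*} [TopologicalSpace M]
    [ChartedSpace (EuclideanSpace ℝ (Fin (2 * m + 3))) M] [IsManifold (𝓡 (2 * m + 3)) ∞ M]
    (ξ : ContactStructure m M) (S : Set M) : Prop :=
  IsHypersurface (2 * m + 3) S ∧
    ∃ Z : ∀ p : M, TangentSpace (𝓡 (2 * m + 3)) p, ξ.IsContactField Z ∧ IsTransverseField Z S

/-! ### Open books -/

/-- An open book decomposition `(B, φ)` of a manifold without boundary: a closed subset `B` (the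
binding) and a smooth fibration `φ : M ∖ B → 𝕊¹` (the values of `φ` on `B` are irrelevant), such
that `B` has a tubular neighbourhood `B × D²` in which `φ` is the angular coordinate of the open
unit disk `D²`. In particular `B` is a submanifold of codimension two with trivial normal bundle.

The maps whose source or target is a product with `B` or with a fibre of `φ` are diffeomorphisms,
stated as partial bijections of the ambient manifolds which are smooth in both directions on these
submanifolds. -/
structure OpenBook (d : ℕ) (M : Type*) [TopologicalSpace M]
    [ChartedSpace (EuclideanSpace ℝ (Fin d)) M] where
  binding : Set M
  angle : M → Circle
  isClosed_binding : IsClosed binding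
  smooth_angle : ContMDiffOn (𝓡 d) (𝓡 1) ∞ angle bindingᶜ
  /-- Smooth local triviality of `φ : M ∖ B → 𝕊¹`, as `φ⁻¹(V) ≃ φ⁻¹(z) × V` over `V`. -/
  locally_trivial : ∀ z : Circle, ∃ (V : Set Circle) (e : PartialEquiv M (M × Circle)),
    IsOpen V ∧ z ∈ V ∧
    e.source = bindingᶜ ∩ angle ⁻¹' V ∧
    e.target = (bindingᶜ ∩ angle ⁻¹' {z}) ×ˢ V ∧
    ContMDiffOn (𝓡 d) ((𝓡 d).prod (𝓡 1)) ∞ e e.source ∧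
    ContMDiffOn ((𝓡 d).prod (𝓡 1)) (𝓡 d) ∞ e.symm e.target ∧
    ∀ p ∈ e.source, (e p).2 = angle p
  /-- The tubular neighbourhood of the binding, with `D²` the open unit disk of `ℂ = ℝ²`. -/
  normal_form : ∃ Ψ : PartialEquiv (M × ℂ) M,
    Ψ.source = binding ×ˢ Metric.ball (0 : ℂ) 1 ∧ IsOpen Ψ.target ∧
    ContMDiffOn ((𝓡 d).prod 𝓘(ℝ, ℂ)) (𝓡 d) ∞ Ψ Ψ.source ∧
    ContMDiffOn (𝓡 d) ((𝓡 d).prod 𝓘(ℝ, ℂ)) ∞ Ψ.symm Ψ.target ∧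
    (∀ b ∈ binding, Ψ (b, 0) = b) ∧
    ∀ b ∈ binding, ∀ z ∈ Metric.ball (0 : ℂ) 1, z ≠ 0 → (angle (Ψ (b, z)) : ℂ) = z / ‖z‖

section OpenBooks

variable {d : ℕ} {M : Type*} [TopologicalSpace M] [ChartedSpace (EuclideanSpace ℝ (Fin d)) M]

/-- On the open set `U`, the smooth map `h` to `ℂ = ℝ²` defines the open book `(B, φ)`: it is
transverse to `0`, its zero set is `B`, and `h / ‖h‖ = φ` away from `B`. At the points of `B ∩ U`,
the tangent space of `B` is then the kernel of the derivative of `h`. -/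
def OpenBook.IsDefinedOn (O : OpenBook d M) (U : Set M) (h : M → ℂ) : Prop :=
  IsOpen U ∧ ContMDiffOn (𝓡 d) 𝓘(ℝ, ℂ) ∞ h U ∧ (∀ p ∈ U, p ∈ O.binding ↔ h p = 0) ∧
    (∀ p ∈ U ∩ O.binding, Function.Surjective (mvfderiv (𝓡 d) h p)) ∧
    ∀ p ∈ U \ O.binding, (O.angle p : ℂ) = h p / ‖h p‖

/-- The map `h : M → ℂ = ℝ²` defines the open book `(B, φ)`. -/
def OpenBook.IsDefinedBy (O : OpenBook d M) (h : M → ℂ) : Prop :=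
  O.IsDefinedOn Set.univ h

/-- The derivative of `φ : M ∖ B → 𝕊¹`, as a real-valued 1-form: the pullback of the angular form
of the unit circle, with its usual (counterclockwise) orientation. -/
def OpenBook.dAngle (O : OpenBook d M) (p : M) (v : TangentSpace (𝓡 d) p) : ℝ :=
  ((starRingEnd ℂ) (O.angle p : ℂ) * mvfderiv (𝓡 d) (fun q => (O.angle q : ℂ)) p v).im

end OpenBooks

section Supports

variable {m : ℕ} {M : Type*} [TopologicalSpace M]
  [ChartedSpace (EuclideanSpace ℝ (Fin (2 * m + 3))) M]

/-- `dα` is positively symplectic on the pages: `(dα)^(n-1)` is positive on the positive bases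
of the tangent spaces of the fibres of `φ`. Here `M` is oriented by `α ∧ (dα)^(n-1)`, and a fibre is
oriented by its coorientation: a basis `v` of its tangent space is positive when `(ν, v)` is positive
in `M` for the vectors `ν` with `dφ(ν) > 0`. -/
def OpenBook.PagesPositive (O : OpenBook (2 * m + 3) M)
    (α : ∀ p : M, TangentSpace (𝓡 (2 * m + 3)) p →L[ℝ] ℝ) : Prop :=
  ∀ p ∉ O.binding, ∀ (ν : TangentSpace (𝓡 (2 * m + 3)) p)
    (v : Fin (2 * (m + 1)) → TangentSpace (𝓡 (2 * m + 3)) p),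
    0 < O.dAngle p ν → (∀ i, O.dAngle p (v i) = 0) →
    0 < contactVolume α p (Fin.cons ν v) → 0 < twoFormPow (dForm α p) (m + 1) v

/-- `α` induces a positive contact form on the binding: `α ∧ (dα)^(n-2)` is positive on the
positive bases of the tangent spaces of `B`. Here `B` is oriented as the boundary of the pages or,
equivalently, by the coorientation given by the disk `D²` of the tubular neighbourhood: a basis `w`
of its tangent space is positive when `(u₁, u₂, w)` is positive in `M` for the pairs `(u₁, u₂)` whose
image by the derivative of a local defining map `h` is a positive basis of `ℝ²`. -/
def OpenBook.BindingPositive (O : OpenBook (2 * m + 3) M)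
    (α : ∀ p : M, TangentSpace (𝓡 (2 * m + 3)) p →L[ℝ] ℝ) : Prop :=
  ∀ p ∈ O.binding, ∃ (U : Set M) (h : M → ℂ), p ∈ U ∧ O.IsDefinedOn U h ∧
    ∀ (u₁ u₂ : TangentSpace (𝓡 (2 * m + 3)) p)
      (w : Fin (2 * m + 1) → TangentSpace (𝓡 (2 * m + 3)) p),
      0 < ((starRingEnd ℂ) (mvfderiv (𝓡 (2 * m + 3)) h p u₁) *
        mvfderiv (𝓡 (2 * m + 3)) h p u₂).im →
      (∀ i, mvfderiv (𝓡 (2 * m + 3)) h p (w i) = 0) →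
      0 < contactVolume α p (Fin.cons u₁ (Fin.cons u₂ w)) →
      0 < wedgeTwoFormPow (α p) (dForm α p) m w

/-- The open book `(B, φ)` supports `ξ` (is adapted to `ξ`): `B` is a positive contact submanifold,
and some contact form defining `ξ` has a differential which is positively symplectic on the fibres
of `φ`. -/
def OpenBook.Supports [IsManifold (𝓡 (2 * m + 3)) ∞ M] (O : OpenBook (2 * m + 3) M)
    (ξ : ContactStructure m M) : Prop :=
  (∀ α, ξ.IsDefinedBy α → O.BindingPositive α) ∧ ∃ α, ξ.IsDefinedBy α ∧ O.PagesPositive α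

end Supports

/-! ### The objects attached to a pair of contact vector fields -/

section Pairs

variable {m : ℕ} {M : Type*} [TopologicalSpace M]
  [ChartedSpace (EuclideanSpace ℝ (Fin (2 * m + 3))) M]

/-- `X_θ = cos θ X + sin θ Y`. -/
def rotField (X Y : ∀ p : M, TangentSpace (𝓡 (2 * m + 3)) p) (θ : ℝ) (p : M) :
    TangentSpace (𝓡 (2 * m + 3)) p :=
  Real.cos θ • X p + Real.sin θ • Y p

variable [IsManifold (𝓡 (2 * m + 3)) ∞ M]

/-- `Σ_θ = {X_θ ∈ ξ}`. -/
def sigmaSet (ξ : ContactStructure m M) (X Y : ∀ p : M, TangentSpace (𝓡 (2 * m + 3)) p)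
    (θ : ℝ) : Set M :=
  {p | rotField X Y θ p ∈ ξ.plane p}

/-- `K = {X ∈ ξ} ∩ {Y ∈ ξ}`, that is, `{α(X) = α(Y) = 0}`. -/
def zeroSet (ξ : ContactStructure m M) (X Y : ∀ p : M, TangentSpace (𝓡 (2 * m + 3)) p) : Set M :=
  {p | X p ∈ ξ.plane p ∧ Y p ∈ ξ.plane p}

/-- `F_θ`: the points of `Σ_θ` at which `Y_θ = X_{θ+π/2}` is positively transverse to `ξ`. -/
def pageSet (ξ : ContactStructure m M) (X Y : ∀ p : M, TangentSpace (𝓡 (2 * m + 3)) p)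
    (θ : ℝ) : Set M :=
  {p | p ∈ sigmaSet ξ X Y θ ∧ rotField X Y (θ + Real.pi / 2) p ∈ ξ.pos p}

end Pairs

end OBD

end

open scoped Manifold ContDiff Topology

noncomputable section

namespace OBD

/-! ### Linear algebra of wedge powers -/

section WedgeAlgebra

variable {V : Type*}

/-- The summand of `twoFormPow` attached to a permutation. -/
def pairTerm (η : V → V → ℝ) (k : ℕ) (v : Fin (2 * k) → V) (σ : Equiv.Perm (Fin (2 * k))) : ℝ :=
  ((Equiv.Perm.sign σ : ℤ) : ℝ) *
    ∏ i : Fin k, η (v (σ ⟨2 * i.1, by omega⟩)) (v (σ ⟨2 * i.1 + 1, by omega⟩))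

/-- The summand of `wedgeTwoFormPow` attached to a permutation. -/
def wedgeTerm (a : V → ℝ) (η : V → V → ℝ) (k : ℕ) (v : Fin (2 * k + 1) → V)
    (σ : Equiv.Perm (Fin (2 * k + 1))) : ℝ :=
  ((Equiv.Perm.sign σ : ℤ) : ℝ) * (a (v (σ 0)) *
      ∏ i : Fin k, η (v (σ ⟨2 * i.1 + 1, by omega⟩)) (v (σ ⟨2 * i.1 + 2, by omega⟩)))

theorem twoFormPow_eq_sum (η : V → V → ℝ) (k : ℕ) (v : Fin (2 * k) → V) :
    twoFormPow η k v = (1 / 2 ^ k : ℝ) * ∑ σ, pairTerm η k v σ := rfl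

theorem wedgeTwoFormPow_eq_sum (a : V → ℝ) (η : V → V → ℝ) (k : ℕ) (v : Fin (2 * k + 1) → V) :
    wedgeTwoFormPow a η k v = (1 / 2 ^ k : ℝ) * ∑ σ, wedgeTerm a η k v σ := rfl

theorem wedgeTerm_cons_zero (a : V → ℝ) (η : V → V → ℝ) (k : ℕ) (u : V) (v : Fin (2 * k) → V)
    (e : Equiv.Perm (Fin (2 * k))) :
    wedgeTerm a η k (Fin.cons u v) (Equiv.Perm.decomposeFin.symm (0, e)) =
      a u * pairTerm η k v e := by
  have h (j : Fin (2 * k)) : (Fin.cons u v : Fin (2 * k + 1) → V)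
      (Equiv.Perm.decomposeFin.symm (0, e) j.succ) = v (e j) := by simp
  have h1 (i : Fin k) : (⟨2 * i.1 + 1, by omega⟩ : Fin (2 * k + 1)) =
      Fin.succ ⟨2 * i.1, by omega⟩ := rfl
  have h2 (i : Fin k) : (⟨2 * i.1 + 2, by omega⟩ : Fin (2 * k + 1)) =
      Fin.succ ⟨2 * i.1 + 1, by omega⟩ := rfl
  simp only [wedgeTerm, pairTerm, h1, h2, h, Equiv.Perm.decomposeFin.symm_sign,
    Equiv.Perm.decomposeFin_symm_apply_zero, Fin.cons_zero]
  simp only [if_true, one_mul]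
  ring

/-- If only the permutations fixing `0` contribute, the wedge product is a plain product. -/
theorem wedgeTwoFormPow_cons (a : V → ℝ) (η : V → V → ℝ) (k : ℕ) (u : V) (v : Fin (2 * k) → V)
    (h : ∀ σ : Equiv.Perm (Fin (2 * k + 1)), σ 0 ≠ 0 → wedgeTerm a η k (Fin.cons u v) σ = 0) :
    wedgeTwoFormPow a η k (Fin.cons u v) = a u * twoFormPow η k v := by
  rw [wedgeTwoFormPow_eq_sum, twoFormPow_eq_sum,
    ← Equiv.sum_comp Equiv.Perm.decomposeFin.symm, Fintype.sum_prod_type,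
    Finset.sum_eq_single 0]
  · simp only [wedgeTerm_cons_zero]
    rw [← Finset.mul_sum]; ring
  · intro p _ hp
    refine Finset.sum_eq_zero fun e _ => h _ ?_
    simpa using hp
  · simp

/-- Contraction with a vector in the kernel of the 2-form. -/
theorem wedgeTwoFormPow_cons_of_kernel (a : V → ℝ) (η : V → V → ℝ) (k : ℕ) (u : V)
    (v : Fin (2 * k) → V) (h : ∀ w, η u w = 0) (h' : ∀ w, η w u = 0) :
    wedgeTwoFormPow a η k (Fin.cons u v) = a u * twoFormPow η k v := by
  refine wedgeTwoFormPow_cons a η k u v fun σ hσ => ?_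
  have hj : σ (σ.symm 0) = 0 := by simp
  have hj0 : σ.symm 0 ≠ 0 := by
    intro h0; rw [h0] at hj; exact hσ hj
  set j := σ.symm 0 with hjdef
  have hpos : 0 < j.1 := Nat.pos_of_ne_zero fun h => hj0 (Fin.ext h)
  have hjlt := j.2
  have hzero : ∃ i : Fin k, η ((Fin.cons u v : Fin (2 * k + 1) → V) (σ ⟨2 * i.1 + 1, by omega⟩))
      ((Fin.cons u v : Fin (2 * k + 1) → V) (σ ⟨2 * i.1 + 2, by omega⟩)) = 0 := by
    refine ⟨⟨(j.1 - 1) / 2, by omega⟩, ?_⟩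
    rcases Nat.even_or_odd' (j.1 - 1) with ⟨c, hc | hc⟩
    · have : (⟨2 * ((j.1 - 1) / 2) + 1, by omega⟩ : Fin (2 * k + 1)) = j := Fin.ext (by
        simp only; omega)
      simp only [this, hj, Fin.cons_zero, h]
    · have : (⟨2 * ((j.1 - 1) / 2) + 2, by omega⟩ : Fin (2 * k + 1)) = j := Fin.ext (by
        simp only; omega)
      simp only [this, hj, Fin.cons_zero, h']
  obtain ⟨i, hi⟩ := hzero
  rw [wedgeTerm, Finset.prod_eq_zero (Finset.mem_univ i) hi]
  ring

/-- Evaluation of the wedge product on vectors all but the first of which are in `ker a`. -/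
theorem wedgeTwoFormPow_cons_of_mem_ker (a : V → ℝ) (η : V → V → ℝ) (k : ℕ) (u : V)
    (v : Fin (2 * k) → V) (h : ∀ i, a (v i) = 0) :
    wedgeTwoFormPow a η k (Fin.cons u v) = a u * twoFormPow η k v := by
  refine wedgeTwoFormPow_cons a η k u v fun σ hσ => ?_
  obtain ⟨j, hj⟩ := Fin.exists_succ_eq.2 hσ
  rw [wedgeTerm, ← hj, Fin.cons_succ, h]
  ring

/-- The first index of the `i`-th pair. -/
def pairFst {k : ℕ} (i : Fin k) : Fin (2 * k) := ⟨2 * i.1, by omega⟩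

/-- The second index of the `i`-th pair. -/
def pairSnd {k : ℕ} (i : Fin k) : Fin (2 * k) := ⟨2 * i.1 + 1, by omega⟩

theorem pairFst_injective {k : ℕ} : Function.Injective (pairFst (k := k)) := fun i j h => by
  simp only [pairFst, Fin.mk.injEq] at h; exact Fin.ext (by omega)

theorem pairSnd_injective {k : ℕ} : Function.Injective (pairSnd (k := k)) := fun i j h => by
  simp only [pairSnd, Fin.mk.injEq] at h; exact Fin.ext (by omega)

theorem pairFst_ne_pairSnd {k : ℕ} (i j : Fin k) : pairFst i ≠ pairSnd j := fun h => by
  simp only [pairFst, pairSnd, Fin.mk.injEq] at h; omega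

theorem eq_pairFst_or_pairSnd {k : ℕ} (c : Fin (2 * k)) : ∃ i, c = pairFst i ∨ c = pairSnd i := by
  refine ⟨⟨c.1 / 2, by omega⟩, ?_⟩
  rcases Nat.even_or_odd' c.1 with ⟨i, hi | hi⟩
  · left; apply Fin.ext; simp only [pairFst]; omega
  · right; apply Fin.ext; simp only [pairSnd]; omega

theorem pairTerm_eq (η : V → V → ℝ) (k : ℕ) (v : Fin (2 * k) → V)
    (σ : Equiv.Perm (Fin (2 * k))) : pairTerm η k v σ = ((Equiv.Perm.sign σ : ℤ) : ℝ) *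
      ∏ i : Fin k, η (v (σ (pairFst i))) (v (σ (pairSnd i))) := rfl

theorem pairTerm_mul_swap {η : V → V → ℝ} (hη : ∀ v w, η v w = -η w v) (k : ℕ)
    (v : Fin (2 * k) → V) (σ : Equiv.Perm (Fin (2 * k))) (i : Fin k) :
    pairTerm η k v (σ * Equiv.swap (pairFst i) (pairSnd i)) = pairTerm η k v σ := by
  rw [pairTerm_eq, pairTerm_eq, ← Finset.mul_prod_erase _ _ (Finset.mem_univ i),
    ← Finset.mul_prod_erase _ (fun i => η (v (σ (pairFst i))) (v (σ (pairSnd i))))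
      (Finset.mem_univ i), Equiv.Perm.sign_mul, Equiv.Perm.sign_swap (pairFst_ne_pairSnd i i)]
  have h : ∀ j ∈ Finset.univ.erase i,
      η (v ((σ * Equiv.swap (pairFst i) (pairSnd i)) (pairFst j)))
        (v ((σ * Equiv.swap (pairFst i) (pairSnd i)) (pairSnd j))) =
      η (v (σ (pairFst j))) (v (σ (pairSnd j))) := by
    intro j hj
    have hji : j ≠ i := Finset.ne_of_mem_erase hj
    rw [Equiv.Perm.mul_apply, Equiv.Perm.mul_apply,
      Equiv.swap_apply_of_ne_of_ne (pairFst_injective.ne hji) (pairFst_ne_pairSnd j i),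
      Equiv.swap_apply_of_ne_of_ne (pairFst_ne_pairSnd i j).symm (pairSnd_injective.ne hji)]
  rw [Finset.prod_congr rfl h, Equiv.Perm.mul_apply, Equiv.Perm.mul_apply, Equiv.swap_apply_left,
    Equiv.swap_apply_right, hη]
  push_cast
  ring

theorem pairTerm_mul_swap_blocks (η : V → V → ℝ) (k : ℕ)
    (v : Fin (2 * k) → V) (σ : Equiv.Perm (Fin (2 * k))) (i j : Fin k) :
    pairTerm η k v (σ * (Equiv.swap (pairFst i) (pairFst j) *
      Equiv.swap (pairSnd i) (pairSnd j))) = pairTerm η k v σ := by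
  by_cases hij : i = j
  · subst hij
    congr 1
    ext l
    simp
  have hfst (l : Fin k) : (Equiv.swap (pairFst i) (pairFst j) *
      Equiv.swap (pairSnd i) (pairSnd j)) (pairFst l) = pairFst (Equiv.swap i j l) := by
    rw [Equiv.Perm.mul_apply, Equiv.swap_apply_of_ne_of_ne (pairFst_ne_pairSnd l i)
      (pairFst_ne_pairSnd l j), pairFst_injective.swap_apply]
  have hsnd (l : Fin k) : (Equiv.swap (pairFst i) (pairFst j) *
      Equiv.swap (pairSnd i) (pairSnd j)) (pairSnd l) = pairSnd (Equiv.swap i j l) := by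
    rw [Equiv.Perm.mul_apply, pairSnd_injective.swap_apply i j l, Equiv.swap_apply_of_ne_of_ne
      (pairFst_ne_pairSnd i _).symm (pairFst_ne_pairSnd j _).symm]
  rw [pairTerm_eq, pairTerm_eq, Equiv.Perm.sign_mul, Equiv.Perm.sign_mul,
    Equiv.Perm.sign_swap (pairFst_injective.ne hij),
    Equiv.Perm.sign_swap (pairSnd_injective.ne hij)]
  simp only [Equiv.Perm.mul_apply σ, hfst, hsnd, neg_mul_neg, mul_one]
  rw [Equiv.prod_comp (Equiv.swap i j) (fun l => η (v (σ (pairFst l))) (v (σ (pairSnd l))))]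

theorem sum_pairTerm_of_apply_eq {η : V → V → ℝ} (hη : ∀ v w, η v w = -η w v) (k : ℕ)
    (v : Fin (2 * k) → V) (i : Fin k) (c : Fin (2 * k)) (x : Fin (2 * k)) :
    ∑ σ with σ c = x, pairTerm η k v σ = ∑ σ with σ (pairFst i) = x, pairTerm η k v σ := by
  obtain ⟨π, hπ, hinv⟩ : ∃ π : Equiv.Perm (Fin (2 * k)), π (pairFst i) = c ∧
      ∀ σ, pairTerm η k v (σ * π) = pairTerm η k v σ := by
    obtain ⟨j, rfl | rfl⟩ := eq_pairFst_or_pairSnd c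
    · refine ⟨_, ?_, fun σ => pairTerm_mul_swap_blocks η k v σ i j⟩
      rw [Equiv.Perm.mul_apply, Equiv.swap_apply_of_ne_of_ne (pairFst_ne_pairSnd _ _)
        (pairFst_ne_pairSnd _ _), Equiv.swap_apply_left]
    · refine ⟨(Equiv.swap (pairFst i) (pairFst j) * Equiv.swap (pairSnd i) (pairSnd j)) *
        Equiv.swap (pairFst i) (pairSnd i), ?_, fun σ => ?_⟩
      · rw [Equiv.Perm.mul_apply, Equiv.swap_apply_left, Equiv.Perm.mul_apply,
          Equiv.swap_apply_left, Equiv.swap_apply_of_ne_of_ne (pairFst_ne_pairSnd _ _).symm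
          (pairFst_ne_pairSnd _ _).symm]
      · rw [← mul_assoc, pairTerm_mul_swap hη, pairTerm_mul_swap_blocks]
  refine Finset.sum_bij' (fun σ _ => σ * π) (fun σ _ => σ * π⁻¹) ?_ ?_ ?_ ?_ ?_
  · intro σ hσ
    simp only [Finset.mem_filter, Finset.mem_univ, true_and] at hσ ⊢
    rw [Equiv.Perm.mul_apply, hπ, hσ]
  · intro σ hσ
    simp only [Finset.mem_filter, Finset.mem_univ, true_and] at hσ ⊢
    rw [← hπ]; simp [hσ]
  · intro σ _; simp
  · intro σ _; simp
  · intro σ _; exact (hinv σ).symm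

theorem sum_pairTerm {η : V → V → ℝ} (hη : ∀ v w, η v w = -η w v) (k : ℕ)
    (v : Fin (2 * k) → V) (i : Fin k) (x : Fin (2 * k)) :
    ∑ σ, pairTerm η k v σ = (2 * k) * ∑ σ with σ (pairFst i) = x, pairTerm η k v σ := by
  have h (c : Fin (2 * k)) :
      ∑ σ with σ.symm x = c, pairTerm η k v σ =
        ∑ σ with σ (pairFst i) = x, pairTerm η k v σ := by
    rw [← sum_pairTerm_of_apply_eq hη k v i c x]
    congr 1
    ext σ
    rw [Finset.mem_filter, Finset.mem_filter, Equiv.symm_apply_eq, eq_comm]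
  rw [← Finset.sum_fiberwise Finset.univ (fun σ : Equiv.Perm (Fin (2 * k)) => σ.symm x)]
  simp only [h]
  simp

theorem pairTerm_cons_decomposeFin (η : V → V → ℝ) (k : ℕ) (u : V) (w : Fin (2 * k + 1) → V)
    (e : Equiv.Perm (Fin (2 * k + 1))) :
    pairTerm η (k + 1) (Fin.cons u w : Fin (2 * k + 1 + 1) → V)
      (Equiv.Perm.decomposeFin.symm (0, e) : Equiv.Perm (Fin (2 * k + 1 + 1))) =
        wedgeTerm (η u) η k w e := by
  have h (j : Fin (2 * k + 1)) : (Fin.cons u w : Fin (2 * k + 1 + 1) → V)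
    (Equiv.Perm.decomposeFin.symm (0, e) j.succ) = w (e j) := by simp
  have h0 : (Fin.cons u w : Fin (2 * k + 1 + 1) → V)
    (Equiv.Perm.decomposeFin.symm (0, e) 0) = u := by simp
  have hs : Equiv.Perm.sign (Equiv.Perm.decomposeFin.symm (0, e) :
    Equiv.Perm (Fin (2 * k + 1 + 1))) = Equiv.Perm.sign e := by
    rw [Equiv.Perm.decomposeFin.symm_sign]; simp
  rw [pairTerm, wedgeTerm, Fin.prod_univ_succ]
  refine congrArg₂ _ (congrArg (fun z : ℤˣ => ((z : ℤ) : ℝ)) hs) (congrArg₂ _ ?_ ?_)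
  · exact congrArg₂ η h0 (h 0)
  · refine Finset.prod_congr rfl fun i _ => ?_
    exact congrArg₂ η (h ⟨2 * i.1 + 1, by omega⟩) (h ⟨2 * i.1 + 2, by omega⟩)

/-- Contraction of a power of a 2-form: `ι_u η^(k+1) = (k+1) (ι_u η) ∧ η^k`. -/
theorem twoFormPow_cons {η : V → V → ℝ} (hη : ∀ v w, η v w = -η w v) (k : ℕ)
    (u : V) (w : Fin (2 * k + 1) → V) :
    twoFormPow η (k + 1) (Fin.cons u w : Fin (2 * k + 1 + 1) → V) =
      (k + 1) * wedgeTwoFormPow (η u) η k w := by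
  have hfix : (∑ σ with σ (pairFst (0 : Fin (k + 1))) = (0 : Fin (2 * k + 1 + 1)),
      pairTerm η (k + 1) (Fin.cons u w : Fin (2 * k + 1 + 1) → V) σ) =
        ∑ e, wedgeTerm (η u) η k w e := by
    rw [Finset.sum_filter]
    refine Eq.trans (Equiv.sum_comp (Equiv.Perm.decomposeFin (n := 2 * k + 1)).symm
      (fun σ : Equiv.Perm (Fin (2 * k + 1 + 1)) => if σ 0 = 0 then
        pairTerm η (k + 1) (Fin.cons u w : Fin (2 * k + 1 + 1) → V) σ else 0)).symm ?_
    rw [Fintype.sum_prod_type, Finset.sum_eq_single 0]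
    · refine Finset.sum_congr rfl fun e _ => ?_
      rw [if_pos (by simp)]
      exact pairTerm_cons_decomposeFin η k u w e
    · intro p _ hp
      refine Finset.sum_eq_zero fun e _ => if_neg ?_
      simpa using hp
    · simp
  rw [twoFormPow_eq_sum, sum_pairTerm hη (k + 1) _ 0 (0 : Fin (2 * k + 1 + 1)), hfix,
    wedgeTwoFormPow_eq_sum]
  push_cast
  field_simp
  ring

/-- If `u` and `u'` are `η`-orthogonal to the remaining vectors, they split off. -/
theorem twoFormPow_cons_cons {η : V → V → ℝ} (hη : ∀ v w, η v w = -η w v) (k : ℕ)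
    (u u' : V) (w : Fin (2 * k) → V) (h : ∀ i, η u (w i) = 0) :
    twoFormPow η (k + 1) (Fin.cons u (Fin.cons u' w : Fin (2 * k + 1) → V) :
      Fin (2 * k + 1 + 1) → V) = (k + 1) * (η u u' * twoFormPow η k w) := by
  rw [twoFormPow_cons hη, wedgeTwoFormPow_cons_of_mem_ker _ _ _ _ _ h]

end WedgeAlgebra

/-! ### Wedge powers as alternating maps -/

section AlternatingForms

variable {V : Type*} [AddCommGroup V] [Module ℝ V]

theorem exists_multilinearMap_of_update {N : ℕ} (F : (Fin N → V) → ℝ)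
    (h : ∀ v j, ∃ L : V →ₗ[ℝ] ℝ, ∀ x, F (Function.update v j x) = L x) :
    ∃ Φ : MultilinearMap ℝ (fun _ : Fin N => V) ℝ, ∀ v, Φ v = F v := by
  refine ⟨MultilinearMap.mk' F (fun v j x y => ?_) (fun v j c x => ?_), fun v => rfl⟩
  · obtain ⟨L, hL⟩ := h v j
    rw [hL, hL, hL, map_add]
  · obtain ⟨L, hL⟩ := h v j
    rw [hL, hL, map_smul]

theorem exists_alternatingMap_sum {N : ℕ} (c : ℝ) (F : (Fin N → V) → ℝ)
    (h : ∀ v j, ∃ L : V →ₗ[ℝ] ℝ, ∀ x, F (Function.update v j x) = L x) :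
    ∃ A : V [⋀^Fin N]→ₗ[ℝ] ℝ, ∀ v, A v =
      c * ∑ σ : Equiv.Perm (Fin N), ((Equiv.Perm.sign σ : ℤ) : ℝ) * F (v ∘ σ) := by
  obtain ⟨Φ, hΦ⟩ := exists_multilinearMap_of_update F h
  refine ⟨c • MultilinearMap.alternatization Φ, fun v => ?_⟩
  rw [AlternatingMap.smul_apply, MultilinearMap.alternatization_apply, smul_eq_mul]
  congr 1
  refine Finset.sum_congr rfl fun σ _ => ?_
  rw [MultilinearMap.domDomCongr_apply, hΦ, Units.smul_def, zsmul_eq_mul]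
  rfl

theorem exists_linear_prod_update {N k : ℕ} (η : V →ₗ[ℝ] V →ₗ[ℝ] ℝ) (p q : Fin k → Fin N)
    (hp : Function.Injective p) (hq : Function.Injective q) (hpq : ∀ i j, p i ≠ q j)
    (v : Fin N → V) (j : Fin N) (hj : ∃ i, j = p i ∨ j = q i) :
    ∃ L : V →ₗ[ℝ] ℝ, ∀ x,
      ∏ i, η (Function.update v j x (p i)) (Function.update v j x (q i)) = L x := by
  obtain ⟨i, rfl | rfl⟩ := hj
  · refine ⟨(∏ l ∈ Finset.univ.erase i, η (v (p l)) (v (q l))) • η.flip (v (q i)), fun x => ?_⟩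
    rw [← Finset.mul_prod_erase _ _ (Finset.mem_univ i), Function.update_self,
      Function.update_of_ne (hpq i i).symm, LinearMap.smul_apply, LinearMap.flip_apply,
      smul_eq_mul, mul_comm]
    congr 1
    refine Finset.prod_congr rfl fun l hl => ?_
    rw [Function.update_of_ne (hp.ne (Finset.ne_of_mem_erase hl)),
      Function.update_of_ne (hpq i l).symm]
  · refine ⟨(∏ l ∈ Finset.univ.erase i, η (v (p l)) (v (q l))) • η (v (p i)), fun x => ?_⟩
    rw [← Finset.mul_prod_erase _ _ (Finset.mem_univ i), Function.update_self,
      Function.update_of_ne (hpq i i), LinearMap.smul_apply, smul_eq_mul, mul_comm]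
    congr 1
    refine Finset.prod_congr rfl fun l hl => ?_
    rw [Function.update_of_ne (hq.ne (Finset.ne_of_mem_erase hl)),
      Function.update_of_ne (hpq l i)]

theorem exists_alternating_wedgeTwoFormPow (a : V →ₗ[ℝ] ℝ) (η : V →ₗ[ℝ] V →ₗ[ℝ] ℝ) (k : ℕ) :
    ∃ A : V [⋀^Fin (2 * k + 1)]→ₗ[ℝ] ℝ, ∀ v,
      A v = wedgeTwoFormPow (fun x => a x) (fun x y => η x y) k v := by
  refine exists_alternatingMap_sum (1 / 2 ^ k : ℝ)
    (fun v : Fin (2 * k + 1) → V => a (v 0) *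
      ∏ i : Fin k, η (v (Fin.succ (pairFst i))) (v (Fin.succ (pairSnd i))))
    fun v j => ?_
  refine Fin.cases ?_ (fun j => ?_) j
  · refine ⟨(∏ i : Fin k, η (v (Fin.succ (pairFst i))) (v (Fin.succ (pairSnd i)))) • a,
      fun x => ?_⟩
    rw [Function.update_self, LinearMap.smul_apply, smul_eq_mul, mul_comm]
    congr 1
  · obtain ⟨L, hL⟩ := exists_linear_prod_update η (fun i => Fin.succ (pairFst i))
      (fun i => Fin.succ (pairSnd i)) ((Fin.succ_injective _).comp pairFst_injective)
      ((Fin.succ_injective _).comp pairSnd_injective)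
      (fun i j => (Fin.succ_injective _).ne (pairFst_ne_pairSnd i j)) v j.succ (by
        obtain ⟨i, h | h⟩ := eq_pairFst_or_pairSnd j
        · exact ⟨i, Or.inl (by rw [h])⟩
        · exact ⟨i, Or.inr (by rw [h])⟩)
    refine ⟨a (v 0) • L, fun x => ?_⟩
    rw [hL, Function.update_of_ne (Fin.succ_ne_zero j).symm]
    rfl

theorem exists_alternating_pos {N : ℕ} {F : V [⋀^Fin (N + 1)]→ₗ[ℝ] ℝ} (hF : ∃ v, F v ≠ 0) :
    ∃ v, 0 < F v := by
  obtain ⟨v, hv⟩ := hF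
  rcases lt_or_gt_of_ne hv with h | h
  · refine ⟨Function.update v 0 (-v 0), ?_⟩
    rw [← neg_one_smul ℝ (v 0), F.map_update_smul, Function.update_eq_self]
    simpa using h
  · exact ⟨v, h⟩

variable [FiniteDimensional ℝ V]

theorem alternating_eq_zero_of_card {N : ℕ} (A : V [⋀^Fin N]→ₗ[ℝ] ℝ) (T : Submodule ℝ V)
    (hT : Module.finrank ℝ T < N) (v : Fin N → V) (hv : ∀ i, v i ∈ T) : A v = 0 := by
  apply A.map_linearDependent
  intro hli
  have h1 : LinearIndependent ℝ (fun i => (⟨v i, hv i⟩ : T)) :=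
    LinearIndependent.of_comp T.subtype hli
  have := h1.fintype_card_le_finrank
  simp at this
  omega

/-- A nonzero alternating form of top degree has no kernel. -/
theorem eq_zero_of_alternating_update {N : ℕ} (hN : Module.finrank ℝ V = N)
    {A : V [⋀^Fin N]→ₗ[ℝ] ℝ} {v : Fin N → V} (hA : A v ≠ 0) {u : V}
    (hu : ∀ i, A (Function.update v i u) = 0) : u = 0 := by
  have hli : LinearIndependent ℝ v := by
    by_contra h; exact hA (A.map_linearDependent v h)
  rcases Nat.eq_zero_or_pos N with rfl | hpos
  · exact finrank_zero_iff_forall_zero.1 hN u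
  have : Nonempty (Fin N) := ⟨⟨0, hpos⟩⟩
  let b := basisOfLinearIndependentOfCardEqFinrank hli (by simp [hN])
  have hb : ⇑b = v := coe_basisOfLinearIndependentOfCardEqFinrank hli _
  apply b.ext_elem
  intro i
  have h1 := hu i
  rw [← b.sum_repr u, A.map_update_sum, Finset.sum_eq_single i] at h1
  · rw [A.map_update_smul, hb, Function.update_eq_self, smul_eq_mul] at h1
    simpa using (mul_eq_zero.1 h1).resolve_right hA
  · intro j _ hj
    rw [A.map_update_smul, hb, A.map_update_self v hj.symm, smul_zero]
  · simp

theorem alternating_cons_swap {N : ℕ} (A : V [⋀^Fin (N + 2)]→ₗ[ℝ] ℝ) (u u' : V)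
    (w : Fin N → V) : A (Fin.cons u (Fin.cons u' w : Fin (N + 1) → V)) =
      -A (Fin.cons u' (Fin.cons u w : Fin (N + 1) → V)) := by
  have := A.map_swap (Fin.cons u' (Fin.cons u w : Fin (N + 1) → V)) (i := 0) (j := 1) (by simp)
  rw [← this]
  congr 1
  ext i
  refine Fin.cases ?_ (fun i => ?_) i
  · simp
  · refine Fin.cases ?_ (fun i => ?_) i
    · simp
    · rw [Function.comp_apply, Equiv.swap_apply_of_ne_of_ne]
      · simp
      · exact Fin.succ_ne_zero _
      · intro h
        exact Fin.succ_ne_zero i (Fin.succ_injective _ h)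

/-- A functional vanishes on all but one of the vectors of some basis. -/
theorem exists_basis_succ_mem_ker {N : ℕ} (hN : Module.finrank ℝ V = N + 1) (f : V →ₗ[ℝ] ℝ) :
    ∃ b : Module.Basis (Fin (N + 1)) ℝ V, ∀ i : Fin N, f (b i.succ) = 0 := by
  by_cases hf : f = 0
  · exact ⟨Module.finBasisOfFinrankEq ℝ V hN, fun i => by simp [hf]⟩
  obtain ⟨ν, hν⟩ : ∃ ν, f ν ≠ 0 := by
    by_contra hcon
    push Not at hcon
    exact hf (LinearMap.ext hcon)
  have hker : Module.finrank ℝ (LinearMap.ker f) = N := by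
    have h1 := LinearMap.finrank_range_add_finrank_ker f
    rw [LinearMap.range_eq_top.2 (LinearMap.surjective hf), finrank_top, Module.finrank_self,
      hN] at h1
    omega
  let b := Module.finBasisOfFinrankEq ℝ (LinearMap.ker f) hker
  have hli : LinearIndependent ℝ (Fin.cons ν (fun i => (b i : V)) : Fin (N + 1) → V) := by
    rw [linearIndependent_finCons]
    refine ⟨b.linearIndependent.map' (LinearMap.ker f).subtype (Submodule.ker_subtype _), ?_⟩
    intro hmem
    refine hν (Submodule.span_le.2 ?_ hmem : ν ∈ LinearMap.ker f)
    rintro _ ⟨i, rfl⟩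
    exact (b i).2
  refine ⟨basisOfLinearIndependentOfCardEqFinrank hli (by simp [hN]), fun i => ?_⟩
  rw [coe_basisOfLinearIndependentOfCardEqFinrank, Fin.cons_succ]
  exact (b i).2

/-- Two vectors completing a family in the kernel of `θ` span the same volume up to `θ`. -/
theorem alternating_cons_proportional {N : ℕ} (hN : Module.finrank ℝ V = N + 1)
    (A : V [⋀^Fin (N + 1)]→ₗ[ℝ] ℝ) {θ : V →ₗ[ℝ] ℝ} (hθ : θ ≠ 0) {v : Fin N → V}
    (hv : ∀ i, θ (v i) = 0) (u ν : V) :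
    θ ν * A (Fin.cons u v) = θ u * A (Fin.cons ν v) := by
  have hker : Module.finrank ℝ (LinearMap.ker θ) < N + 1 := by
    rw [← hN]
    refine Submodule.finrank_lt fun h => hθ ?_
    exact LinearMap.ker_eq_top.1 h
  have h0 : A (Fin.cons (θ ν • u - θ u • ν) v) = 0 := by
    refine alternating_eq_zero_of_card A _ hker _ fun i => ?_
    refine Fin.cases ?_ (fun j => ?_) i
    · simp [mul_comm]
    · simpa using hv j
  have h1 : A (Fin.cons (θ ν • u - θ u • ν) v) =
      A.curryLeft (θ ν • u - θ u • ν) v := rfl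
  rw [h1, map_sub, map_smul, map_smul] at h0
  have h2 : θ ν * A (Fin.cons u v) - θ u * A (Fin.cons ν v) = 0 := h0
  linarith

/-- Expansion of an alternating form on two vectors completing a family of common zeros of two
functionals. -/
theorem alternating_cons_cons_det {N : ℕ} (A : V [⋀^Fin (N + 2)]→ₗ[ℝ] ℝ) {x y : V →ₗ[ℝ] ℝ}
    {T : Submodule ℝ V} (hT : ∀ u, u ∈ T ↔ x u = 0 ∧ y u = 0) (hN : Module.finrank ℝ T = N)
    {e₁ e₂ : V} (hx₁ : x e₁ = 1) (hy₁ : y e₁ = 0) (hx₂ : x e₂ = 0) (hy₂ : y e₂ = 1)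
    {w : Fin N → V} (hw : ∀ i, w i ∈ T) (u₁ u₂ : V) :
    A (Fin.cons u₁ (Fin.cons u₂ w : Fin (N + 1) → V)) = (x u₁ * y u₂ - x u₂ * y u₁) *
      A (Fin.cons e₁ (Fin.cons e₂ w : Fin (N + 1) → V)) := by
  let B : V → V → ℝ := fun u u' => (A.curryLeft u).curryLeft u' w
  have hB (u u' : V) : A (Fin.cons u (Fin.cons u' w : Fin (N + 1) → V)) = B u u' := rfl
  have hadd1 (u v u' : V) : B (u + v) u' = B u u' + B v u' := by
    simp only [B, map_add, AlternatingMap.curryLeft_add, AlternatingMap.add_apply,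
      LinearMap.add_apply]
  have hsmul1 (c : ℝ) (u u' : V) : B (c • u) u' = c * B u u' := by
    simp only [B, map_smul, AlternatingMap.curryLeft_smul, AlternatingMap.smul_apply,
      LinearMap.smul_apply, smul_eq_mul]
  have hadd2 (u v u' : V) : B u' (u + v) = B u' u + B u' v := by
    simp only [B, map_add, AlternatingMap.add_apply]
  have hsmul2 (c : ℝ) (u u' : V) : B u' (c • u) = c * B u' u := by
    simp only [B, map_smul, AlternatingMap.smul_apply, smul_eq_mul]
  have hskew (u u' : V) : B u u' = - B u' u := by
    have hself (v : V) : B v v = 0 := by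
      rw [← hB]
      refine A.map_eq_zero_of_eq _ (i := 0) (j := 1) ?_ (by simp)
      rfl
    have := hself (u + u')
    rw [hadd1, hadd2, hadd2, hself, hself] at this
    linarith
  have hTB (t u : V) (ht : t ∈ T) : B t u = 0 := by
    rw [hskew, ← hB, neg_eq_zero]
    refine alternating_eq_zero_of_card (A.curryLeft u) T (by omega) _ fun i => ?_
    refine Fin.cases ?_ (fun j => ?_) i
    · simpa using ht
    · simpa using hw j
  have hdec (u : V) : ∃ t ∈ T, u = x u • e₁ + y u • e₂ + t := by
    refine ⟨u - (x u • e₁ + y u • e₂), (hT _).2 ?_, by abel⟩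
    simp [hx₁, hx₂, hy₁, hy₂]
  have hself (v : V) : B v v = 0 := by have := hskew v v; linarith
  obtain ⟨t₁, ht₁, h₁⟩ := hdec u₁
  obtain ⟨t₂, ht₂, h₂⟩ := hdec u₂
  have hexp : B u₁ u₂ = B (x u₁ • e₁ + y u₁ • e₂ + t₁) (x u₂ • e₁ + y u₂ • e₂ + t₂) := by
    rw [← h₁, ← h₂]
  rw [hB, hB, hexp, hadd1, hTB t₁ _ ht₁, hadd2, hskew _ t₂, hTB t₂ _ ht₂]
  simp only [hadd1, hadd2, hsmul1, hsmul2, hself, hskew e₂ e₁]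
  ring

end AlternatingForms

/-! ### Contact linear algebra -/

section ContactAlgebra

variable {V : Type*} [AddCommGroup V] [Module ℝ V] [FiniteDimensional ℝ V]

/-- A skew form on an odd-dimensional space is degenerate. -/
theorem exists_kernel_of_skew {k : ℕ} (hV : Module.finrank ℝ V = 2 * k + 1)
    (η : V →ₗ[ℝ] V →ₗ[ℝ] ℝ) (hη : ∀ v w, η v w = -η w v) : ∃ u ≠ 0, ∀ w, η u w = 0 := by
  let b := (Module.finBasisOfFinrankEq ℝ V hV)
  let A : Matrix (Fin (2 * k + 1)) (Fin (2 * k + 1)) ℝ := fun i j => η (b i) (b j)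
  have hA : A.transpose = -A := by
    ext i j; exact hη (b j) (b i)
  have hdet : A.det = 0 := by
    have h := A.det_transpose
    rw [hA, Matrix.det_neg, Fintype.card_fin, pow_succ, pow_mul] at h
    norm_num at h
    linarith
  obtain ⟨v, hv, hAv⟩ := Matrix.exists_mulVec_eq_zero_iff.2 hdet
  refine ⟨∑ j, v j • b j, ?_, fun w => ?_⟩
  · intro h
    apply hv
    ext j
    exact Fintype.linearIndependent_iff.1 b.linearIndependent v h j
  · rw [hη, neg_eq_zero]
    have : ∀ i, η (b i) (∑ j, v j • b j) = 0 := by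
      intro i
      have := congrFun hAv i
      rw [map_sum]
      simpa [Matrix.mulVec, dotProduct, A, mul_comm] using this
    have h2 : η.flip (∑ j, v j • b j) = 0 := b.ext fun i => this i
    exact congrArg (fun f => f w) h2

/-- If `a ∧ η^k ≠ 0` in top degree then `ker a ∩ ker η = 0`. -/
theorem eq_zero_of_mem_kernels
    {k : ℕ} (hV : Module.finrank ℝ V = 2 * k + 1) {a : V →ₗ[ℝ] ℝ} {η : V →ₗ[ℝ] V →ₗ[ℝ] ℝ}
    (hη : ∀ v w, η v w = -η w v)
    (hvol : ∃ v, wedgeTwoFormPow (fun x => a x) (fun x y => η x y) k v ≠ 0) {u : V}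
    (ha : a u = 0) (hu : ∀ w, η u w = 0) : u = 0 := by
  obtain ⟨A, hA⟩ := exists_alternating_wedgeTwoFormPow a η k
  obtain ⟨v, hv⟩ := hvol
  rw [← hA] at hv
  have h0 (w : Fin (2 * k) → V) : A (Fin.cons u w) = 0 := by
    rw [hA, wedgeTwoFormPow_cons_of_kernel _ _ _ _ _ hu (fun w => by rw [hη, hu, neg_zero]), ha,
      zero_mul]
  refine eq_zero_of_alternating_update hV hv fun i => ?_
  have hswap := A.map_perm (Function.update v i u) (Equiv.swap 0 i)
  have : Function.update v i u ∘ (Equiv.swap 0 i) =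
      (Fin.cons u (Fin.tail (Function.update v i u ∘ (Equiv.swap 0 i))) : Fin (2 * k + 1) → V) := by
    ext j
    refine Fin.cases ?_ (fun j => rfl) j
    simp
  rw [this, h0] at hswap
  have h1 := hswap.symm
  rwa [smul_eq_zero_iff_eq] at h1

/-- The pair `(a, η)` satisfies the contact condition `a ∧ η^(m+1) ≠ 0` in dimension `2m+3`. -/
structure IsContactPair (m : ℕ) (a : V →ₗ[ℝ] ℝ) (η : V →ₗ[ℝ] V →ₗ[ℝ] ℝ) : Prop where
  finrank_eq : Module.finrank ℝ V = 2 * (m + 1) + 1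
  skew : ∀ v w, η v w = -η w v
  volume_ne_zero : ∃ v, wedgeTwoFormPow (fun x => a x) (fun x y => η x y) (m + 1) v ≠ 0

namespace IsContactPair

variable {m : ℕ} {a : V →ₗ[ℝ] ℝ} {η : V →ₗ[ℝ] V →ₗ[ℝ] ℝ} (h : IsContactPair m a η)
include h

theorem self_eq_zero (v : V) : η v v = 0 := by
  have := h.skew v v; linarith

theorem eq_zero {u : V} (ha : a u = 0) (hu : ∀ w, η u w = 0) : u = 0 :=
  eq_zero_of_mem_kernels h.finrank_eq h.skew h.volume_ne_zero ha hu

theorem exists_reeb : ∃ R, a R = 1 ∧ ∀ w, η R w = 0 := by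
  obtain ⟨u, hu0, hu⟩ := exists_kernel_of_skew h.finrank_eq η h.skew
  have ha : a u ≠ 0 := fun ha => hu0 (h.eq_zero ha hu)
  refine ⟨(a u)⁻¹ • u, ?_, fun w => ?_⟩
  · simp [ha]
  · simp [hu]

theorem flat_bijective : Function.Bijective (η + (LinearMap.toSpanSingleton ℝ _ a) ∘ₗ a) := by
  have hinj : Function.Injective (η + (LinearMap.toSpanSingleton ℝ _ a) ∘ₗ a) := by
    rw [injective_iff_map_eq_zero]
    intro u hu
    obtain ⟨R, haR, hR⟩ := h.exists_reeb
    have h1 (w : V) : η u w + a u * a w = 0 := by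
      have := congrArg (fun f => f w) hu
      simpa using this
    have h2 : a u = 0 := by
      have := h1 R
      rw [h.skew, hR, haR] at this
      linarith
    exact h.eq_zero h2 fun w => by simpa [h2] using h1 w
  refine ⟨hinj, ?_⟩
  refine (LinearMap.injective_iff_surjective_of_finrank_eq_finrank ?_).1 hinj
  exact (Subspace.dual_finrank_eq).symm

/-- A Reeb vector crossing the pages positively makes the pages positively symplectic. -/
theorem pow_pos_of_reeb {R : V} (haR : a R = 1) (hR : ∀ w, η R w = 0) {θ : V →ₗ[ℝ] ℝ}
    (hθR : 0 < θ R) (ν : V) (v : Fin (2 * (m + 1)) → V) (hν : 0 < θ ν) (hv : ∀ i, θ (v i) = 0)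
    (hpos : 0 < wedgeTwoFormPow (fun x => a x) (fun x y => η x y) (m + 1) (Fin.cons ν v)) :
    0 < twoFormPow (fun x y => η x y) (m + 1) v := by
  obtain ⟨A, hA⟩ := exists_alternating_wedgeTwoFormPow a η (m + 1)
  have hθ : θ ≠ 0 := by rintro rfl; simp at hθR
  have h1 := alternating_cons_proportional h.finrank_eq A hθ hv R ν
  rw [hA, hA, wedgeTwoFormPow_cons_of_kernel (fun x => a x) (fun x y => η x y) _ R v hR
    (fun w => by rw [h.skew, hR, neg_zero])] at h1
  simp only [haR, one_mul] at h1
  have := mul_pos hθR hpos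
  rw [← h1] at this
  exact (mul_pos_iff_of_pos_left hν).1 this

/-- If the pages are positively symplectic, the Reeb vector crosses them positively. -/
theorem reeb_pos_of_pow_pos {R : V} (haR : a R = 1) (hR : ∀ w, η R w = 0) {θ : V →ₗ[ℝ] ℝ}
    (hθ : θ ≠ 0) (hpages : ∀ (ν : V) (v : Fin (2 * (m + 1)) → V), 0 < θ ν → (∀ i, θ (v i) = 0) →
      0 < wedgeTwoFormPow (fun x => a x) (fun x y => η x y) (m + 1) (Fin.cons ν v) →
      0 < twoFormPow (fun x y => η x y) (m + 1) v) : 0 < θ R := by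
  obtain ⟨A, hA⟩ := exists_alternating_wedgeTwoFormPow a η (m + 1)
  obtain ⟨ν, hν⟩ : ∃ ν, θ ν = 1 := by
    obtain ⟨ν, hν⟩ : ∃ ν, θ ν ≠ 0 := by
      by_contra hcon
      push Not at hcon
      exact hθ (LinearMap.ext hcon)
    exact ⟨(θ ν)⁻¹ • ν, by simp [hν]⟩
  have hker : Module.finrank ℝ (LinearMap.ker θ) = 2 * (m + 1) := by
    have h1 := LinearMap.finrank_range_add_finrank_ker θ
    have h2 : LinearMap.range θ = ⊤ := LinearMap.range_eq_top.2 fun c => ⟨c • ν, by simp [hν]⟩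
    rw [h2, finrank_top, Module.finrank_self, h.finrank_eq] at h1
    omega
  have hνker : ν ∉ LinearMap.ker θ := by simp [hν]
  let b := Module.finBasisOfFinrankEq ℝ (LinearMap.ker θ) hker
  have hli : LinearIndependent ℝ (Fin.cons ν (fun i => (b i : V)) :
      Fin (2 * (m + 1) + 1) → V) := by
    rw [linearIndependent_finCons]
    refine ⟨b.linearIndependent.map' (LinearMap.ker θ).subtype (Submodule.ker_subtype _), ?_⟩
    intro hmem
    refine hνker (Submodule.span_le.2 ?_ hmem)
    rintro _ ⟨i, rfl⟩
    exact (b i).2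
  obtain ⟨F, hF⟩ : ∃ F : (LinearMap.ker θ) [⋀^Fin (2 * m + 1 + 1)]→ₗ[ℝ] ℝ,
      ∀ w, F w = A (Fin.cons ν (fun i => (w i : V))) :=
    ⟨(A.curryLeft ν).compLinearMap (LinearMap.ker θ).subtype, fun w => rfl⟩
  have hF0 : ∃ w, F w ≠ 0 := by
    refine ⟨b, ?_⟩
    rw [hF]
    intro h0
    obtain ⟨v, hv⟩ := h.volume_ne_zero
    rw [← hA] at hv
    let B := basisOfLinearIndependentOfCardEqFinrank hli (by simp [h.finrank_eq])
    have hB : ⇑B = _ := coe_basisOfLinearIndependentOfCardEqFinrank hli _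
    apply hv
    rw [A.eq_smul_basis_det B, hB]
    have h0' : A (Fin.cons ν (fun i => (b i : V)) : Fin (2 * (m + 1) + 1) → V) = 0 := h0
    rw [h0']
    simp
  obtain ⟨w, hw⟩ := exists_alternating_pos hF0
  rw [hF] at hw
  have h1 := alternating_cons_proportional h.finrank_eq A hθ (v := fun i => (w i : V))
    (fun i => (w i).2) R ν
  have h2 : 0 < twoFormPow (fun x y => η x y) (m + 1) (fun i => (w i : V)) :=
    hpages ν _ (by rw [hν]; exact one_pos) (fun i => (w i).2) (by rw [← hA]; exact hw)
  have h3 : A (Fin.cons R fun i => (w i : V)) =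
      twoFormPow (fun x y => η x y) (m + 1) (fun i => (w i : V)) := by
    rw [hA]
    refine (wedgeTwoFormPow_cons_of_kernel (fun x => a x) (fun x y => η x y) _ R _ hR
      (fun w => by rw [h.skew, hR, neg_zero])).trans ?_
    simp only [haR, one_mul]
  rw [h3, hν, one_mul] at h1
  rw [h1] at h2
  exact (pos_iff_pos_of_mul_pos h2).2 hw

/-- The volume spanned by two Hamiltonian vectors and vectors tangent to the common level. -/
theorem volume_cons_cons_hamiltonian {x y : V →ₗ[ℝ] ℝ} {T : Submodule ℝ V}
    (hT : ∀ u ∈ T, x u = 0 ∧ y u = 0) (hdim : Module.finrank ℝ T = 2 * m + 1) {cx : ℝ}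
    {Zx Zy : V} (hZx : a Zx = 0) (hZy : a Zy = 0) (hx : ∀ w, η Zx w = cx * a w - x w)
    {w : Fin (2 * m + 1) → V} (hw : ∀ i, w i ∈ T) :
    wedgeTwoFormPow (fun x => a x) (fun x y => η x y) (m + 1)
      (Fin.cons Zx (Fin.cons Zy w : Fin (2 * m + 1 + 1) → V) : Fin (2 * m + 1 + 1 + 1) → V) =
      (m + 1) * η Zx Zy * wedgeTwoFormPow (fun x => a x) (fun x y => η x y) m w := by
  obtain ⟨A, hA⟩ := exists_alternating_wedgeTwoFormPow a η (m + 1)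
  obtain ⟨A', hA'⟩ := exists_alternating_wedgeTwoFormPow a η m
  obtain ⟨b, hb⟩ := exists_basis_succ_mem_ker hdim (a ∘ₗ T.subtype)
  obtain ⟨w', rfl⟩ : ∃ w' : Fin (2 * m + 1) → T, w = fun i => (w' i : V) :=
    ⟨fun i => ⟨w i, hw i⟩, rfl⟩
  let F : T [⋀^Fin (2 * m + 1)]→ₗ[ℝ] ℝ :=
    ((A.curryLeft Zx).curryLeft Zy).compLinearMap T.subtype
  let G : T [⋀^Fin (2 * m + 1)]→ₗ[ℝ] ℝ :=
    ((m + 1) * η Zx Zy) • A'.compLinearMap T.subtype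
  have hFG : F b = G b := by
    have hbcons : (fun i => (b i : V)) = (Fin.cons (b 0 : V) (fun i => (b (Fin.succ i) : V)) :
        Fin (2 * m + 1) → V) := by
      ext i; refine Fin.cases rfl (fun i => rfl) i
    have h1 : F b = A (Fin.cons (b 0 : V) (Fin.cons Zx (Fin.cons Zy
        (fun i => (b (Fin.succ i) : V)) : Fin (2 * m + 1) → V) : Fin (2 * m + 1 + 1) → V)) := by
      change A (Fin.cons Zx (Fin.cons Zy (fun i => (b i : V)) : Fin (2 * m + 1 + 1) → V)) = _
      rw [hbcons]
      refine (alternating_cons_swap (A.curryLeft Zx) _ _ _).trans ?_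
      rw [neg_eq_iff_eq_neg]
      exact alternating_cons_swap A _ _ _
    have h2 : G b = ((m + 1) * η Zx Zy) * A' (Fin.cons (b 0 : V)
        (fun i => (b (Fin.succ i) : V))) := by
      rw [← hbcons]; rfl
    have hbT (i) : x (b i : V) = 0 ∧ y (b i : V) = 0 := hT _ (b i).2
    have hba (i : Fin (2 * m)) : a (b (Fin.succ i) : V) = 0 := hb i
    rw [h1, h2, hA, hA', wedgeTwoFormPow_cons_of_mem_ker (fun x => a x) (fun x y => η x y) m _ _ hba]
    have h3 := wedgeTwoFormPow_cons_of_mem_ker (fun x => a x) (fun x y => η x y) (m + 1) (b 0 : V)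
      (Fin.cons Zx (Fin.cons Zy (fun i => (b (Fin.succ i) : V)) : Fin (2 * m + 1) → V) :
        Fin (2 * m + 1 + 1) → V) (fun i => by
          refine Fin.cases hZx (fun i => ?_) i
          refine Fin.cases hZy (fun i => ?_) i
          exact hba i)
    have h4 := twoFormPow_cons_cons (η := fun x y => η x y) h.skew m Zx Zy
      (fun i => (b (Fin.succ i) : V)) (fun i => by
        simp only [hx, hba, (hbT _).1]; ring)
    refine h3.trans ?_
    rw [h4]
    ring
  have hFG' : F = G := by
    rw [F.eq_smul_basis_det b, G.eq_smul_basis_det b, hFG]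
  have := congrArg (fun f => f w') hFG'
  rw [← hA, ← hA']
  exact this

theorem binding_pos_aux {x y : V →ₗ[ℝ] ℝ} {T : Submodule ℝ V}
    (hT : ∀ u, u ∈ T ↔ x u = 0 ∧ y u = 0) (hdim : Module.finrank ℝ T = 2 * m + 1) {cx cy : ℝ}
    {Zx Zy : V} (hZx : a Zx = 0) (hZy : a Zy = 0) (hx : ∀ w, η Zx w = cx * a w - x w)
    (hy : ∀ w, η Zy w = cy * a w - y w)
    {e₁ e₂ : V} (hx₁ : x e₁ = 1) (hy₁ : y e₁ = 0) (hx₂ : x e₂ = 0) (hy₂ : y e₂ = 1)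
    {w : Fin (2 * m + 1) → V} (hw : ∀ i, w i ∈ T) (u₁ u₂ : V) :
    η Zx Zy ^ 2 * wedgeTwoFormPow (fun x => a x) (fun x y => η x y) (m + 1)
      (Fin.cons u₁ (Fin.cons u₂ w : Fin (2 * m + 1 + 1) → V) : Fin (2 * m + 1 + 1 + 1) → V) =
      (x u₁ * y u₂ - x u₂ * y u₁) * ((m + 1) * η Zx Zy *
        wedgeTwoFormPow (fun x => a x) (fun x y => η x y) m w) := by
  obtain ⟨A, hA⟩ := exists_alternating_wedgeTwoFormPow a η (m + 1)
  rw [← h.volume_cons_cons_hamiltonian (fun u hu => (hT u).1 hu) hdim hZx hZy hx hw]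
  have h1 := alternating_cons_cons_det A hT hdim hx₁ hy₁ hx₂ hy₂ hw u₁ u₂
  have h2 := alternating_cons_cons_det A hT hdim hx₁ hy₁ hx₂ hy₂ hw Zx Zy
  have e1 : x Zx = 0 := by have := hx Zx; rw [h.self_eq_zero, hZx] at this; linarith
  have e2 : y Zy = 0 := by have := hy Zy; rw [h.self_eq_zero, hZy] at this; linarith
  have e3 : x Zy = -η Zx Zy := by have := hx Zy; rw [hZy] at this; linarith
  have e4 : y Zx = η Zx Zy := by
    have := hy Zx; rw [h.skew, hZx] at this; linarith
  rw [e1, e2, e3, e4] at h2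
  rw [hA] at h1 h2
  rw [← hA (Fin.cons Zx _)] at h2
  erw [← hA (Fin.cons Zx _), h2, h1]
  ring

theorem binding_wedge_pos {x y : V →ₗ[ℝ] ℝ} {T : Submodule ℝ V}
    (hT : ∀ u, u ∈ T ↔ x u = 0 ∧ y u = 0) (hdim : Module.finrank ℝ T = 2 * m + 1) {cx cy : ℝ}
    {Zx Zy : V} (hZx : a Zx = 0) (hZy : a Zy = 0) (hx : ∀ w, η Zx w = cx * a w - x w)
    (hy : ∀ w, η Zy w = cy * a w - y w)
    {e₁ e₂ : V} (hx₁ : x e₁ = 1) (hy₁ : y e₁ = 0) (hx₂ : x e₂ = 0) (hy₂ : y e₂ = 1)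
    (hs : 0 < η Zx Zy) (u₁ u₂ : V)
    {w : Fin (2 * m + 1) → V} (hw : ∀ i, w i ∈ T) (hu : 0 < x u₁ * y u₂ - x u₂ * y u₁)
    (hpos : 0 < wedgeTwoFormPow (fun x => a x) (fun x y => η x y) (m + 1)
      (Fin.cons u₁ (Fin.cons u₂ w : Fin (2 * m + 1 + 1) → V) : Fin (2 * m + 1 + 1 + 1) → V)) :
    0 < wedgeTwoFormPow (fun x => a x) (fun x y => η x y) m w := by
  have h1 := h.binding_pos_aux hT hdim hZx hZy hx hy hx₁ hy₁ hx₂ hy₂ hw u₁ u₂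
  have h2 : 0 < η Zx Zy ^ 2 * wedgeTwoFormPow (fun x => a x) (fun x y => η x y) (m + 1)
      (Fin.cons u₁ (Fin.cons u₂ w : Fin (2 * m + 1 + 1) → V) : Fin (2 * m + 1 + 1 + 1) → V) := by
    positivity
  rw [h1] at h2
  have h3 := (mul_pos_iff_of_pos_left hu).1 h2
  refine (mul_pos_iff_of_pos_left ?_).1 h3
  positivity

theorem hamiltonian_pos_of_binding {x y : V →ₗ[ℝ] ℝ} {T : Submodule ℝ V}
    (hT : ∀ u, u ∈ T ↔ x u = 0 ∧ y u = 0) (hdim : Module.finrank ℝ T = 2 * m + 1) {cx cy : ℝ}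
    {Zx Zy : V} (hZx : a Zx = 0) (hZy : a Zy = 0) (hx : ∀ w, η Zx w = cx * a w - x w)
    (hy : ∀ w, η Zy w = cy * a w - y w)
    {e₁ e₂ : V} (hx₁ : x e₁ = 1) (hy₁ : y e₁ = 0) (hx₂ : x e₂ = 0) (hy₂ : y e₂ = 1)
    (hB : ∀ (u₁ u₂ : V) (w : Fin (2 * m + 1) → V), 0 < x u₁ * y u₂ - x u₂ * y u₁ →
      (∀ i, x (w i) = 0 ∧ y (w i) = 0) →
      0 < wedgeTwoFormPow (fun x => a x) (fun x y => η x y) (m + 1)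
      (Fin.cons u₁ (Fin.cons u₂ w : Fin (2 * m + 1 + 1) → V) : Fin (2 * m + 1 + 1 + 1) → V) →
      0 < wedgeTwoFormPow (fun x => a x) (fun x y => η x y) m w) :
    0 < η Zx Zy := by
  obtain ⟨A, hA⟩ := exists_alternating_wedgeTwoFormPow a η (m + 1)
  let b := Module.finBasisOfFinrankEq ℝ T hdim
  have hxT (i) : x (b i : V) = 0 ∧ y (b i : V) = 0 := (hT _).1 (b i).2
  have hspan : Submodule.span ℝ (Set.range fun i => (b i : V)) ≤ T := by
    rw [Submodule.span_le]; rintro _ ⟨i, rfl⟩; exact (b i).2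
  have hli : LinearIndependent ℝ (Fin.cons e₁ (Fin.cons e₂ (fun i => (b i : V)) :
      Fin (2 * m + 1 + 1) → V) : Fin (2 * m + 1 + 1 + 1) → V) := by
    rw [linearIndependent_finCons, linearIndependent_finCons]
    refine ⟨⟨b.linearIndependent.map' T.subtype (Submodule.ker_subtype _), fun hmem => ?_⟩,
      fun hmem => ?_⟩
    · have := ((hT _).1 (hspan hmem)).2
      rw [hy₂] at this; exact one_ne_zero this
    · have : Submodule.span ℝ (Set.range (Fin.cons e₂ (fun i => (b i : V)) :
          Fin (2 * m + 1 + 1) → V)) ≤ LinearMap.ker x := by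
        rw [Submodule.span_le]; rintro _ ⟨i, rfl⟩
        refine Fin.cases ?_ (fun i => ?_) i
        · simpa using hx₂
        · simpa using (hxT i).1
      have := this hmem
      rw [LinearMap.mem_ker, hx₁] at this; exact one_ne_zero this
  obtain ⟨F, hF⟩ : ∃ F : T [⋀^Fin (2 * m + 1)]→ₗ[ℝ] ℝ, ∀ w, F w =
      A (Fin.cons e₁ (Fin.cons e₂ (fun i => (w i : V)) : Fin (2 * m + 1 + 1) → V)) :=
    ⟨((A.curryLeft e₁).curryLeft e₂).compLinearMap T.subtype, fun w => rfl⟩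
  have hF0 : ∃ w, F w ≠ 0 := by
    refine ⟨b, ?_⟩
    rw [hF]
    intro h0
    obtain ⟨v, hv⟩ := h.volume_ne_zero
    rw [← hA] at hv
    let B := basisOfLinearIndependentOfCardEqFinrank hli (by rw [h.finrank_eq]; simp; omega)
    have hB : ⇑B = _ := coe_basisOfLinearIndependentOfCardEqFinrank hli _
    apply hv
    have h1 : A v = A B * B.det v := by
      have := congrArg (fun f => f v) (A.eq_smul_basis_det B)
      exact this
    rw [h1, hB]
    erw [h0]
    simp
  obtain ⟨w, hw⟩ := exists_alternating_pos hF0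
  rw [hF, hA] at hw
  have hxw (i) : x (w i : V) = 0 ∧ y (w i : V) = 0 := (hT _).1 (w i).2
  have hwedge := hB e₁ e₂ (fun i => (w i : V)) (by simp [hx₁, hy₂, hx₂, hy₁]) hxw hw
  have h1 := h.binding_pos_aux hT hdim hZx hZy hx hy hx₁ hy₁ hx₂ hy₂ (fun i => (w i).2) e₁ e₂
  rw [hx₁, hy₂, hx₂, hy₁] at h1
  by_cases hs : η Zx Zy = 0
  · exfalso
    have e1 : x Zx = 0 := by have := hx Zx; rw [h.self_eq_zero, hZx] at this; linarith
    have e2 : y Zy = 0 := by have := hy Zy; rw [h.self_eq_zero, hZy] at this; linarith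
    have e3 : x Zy = 0 := by have := hx Zy; rw [hZy] at this; linarith
    have e4 : y Zx = 0 := by have := hy Zx; rw [h.skew, hZx] at this; linarith
    obtain ⟨p, q, hpq, hpq0⟩ : ∃ p q : ℝ, p * cx + q * cy = 0 ∧ (p ≠ 0 ∨ q ≠ 0) := by
      by_cases hc : cx = 0
      · exact ⟨1, 0, by simp [hc], Or.inl one_ne_zero⟩
      · exact ⟨-cy, cx, by ring, Or.inr hc⟩
    have hkey (v : V) : η (p • Zx + q • Zy) v = - (p * x v + q * y v) := by
      simp only [map_add, map_smul, LinearMap.add_apply, LinearMap.smul_apply, hx, hy, smul_eq_mul]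
      linear_combination a v * hpq
    have hmem : p • Zx + q • Zy ∈ T := (hT _).2 (by simp [e1, e2, e3, e4])
    have hz : (⟨p • Zx + q • Zy, hmem⟩ : T) = 0 := by
      refine eq_zero_of_mem_kernels (a := a ∘ₗ T.subtype)
        (η := (η.domRestrict₁₂ T T)) hdim (fun v w => h.skew _ _)
        ⟨w, hwedge.ne'⟩ ?_ fun v => ?_
      · simp [hZx, hZy]
      · rw [LinearMap.domRestrict₁₂_apply, hkey, ((hT v).1 v.2).1, ((hT v).1 v.2).2]
        simp
    have hz' : p • Zx + q • Zy = 0 := congrArg Subtype.val hz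
    have k1 := hkey e₁
    have k2 := hkey e₂
    rw [hz'] at k1 k2
    simp only [map_zero, LinearMap.zero_apply, hx₁, hy₁, hx₂, hy₂] at k1 k2
    rcases hpq0 with hp | hq
    · apply hp; linarith
    · apply hq; linarith
  · have h2 : 0 < η Zx Zy ^ 2 * wedgeTwoFormPow (fun x => a x) (fun x y => η x y) (m + 1)
        (Fin.cons e₁ (Fin.cons e₂ (fun i => (w i : V)) : Fin (2 * m + 1 + 1) → V) :
          Fin (2 * m + 1 + 1 + 1) → V) := mul_pos (by positivity) hw
    rw [h1] at h2
    have h3 : 0 < η Zx Zy * ((m + 1) *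
        wedgeTwoFormPow (fun x => a x) (fun x y => η x y) m (fun i => (w i : V))) := by
      linarith
    exact (mul_pos_iff_of_pos_right (by positivity)).1 h3

end IsContactPair

end ContactAlgebra

/-! ### Calculus in charts -/

/-- The exterior derivative of a 1-form on a vector space. -/
def extD {E : Type*} [NormedAddCommGroup E] [NormedSpace ℝ E] (A : E → E →L[ℝ] ℝ) (x : E) :
    E →L[ℝ] E →L[ℝ] ℝ :=
  fderiv ℝ A x - (fderiv ℝ A x).flip

theorem extD_apply {E : Type*} [NormedAddCommGroup E] [NormedSpace ℝ E] (A : E → E →L[ℝ] ℝ)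
    (x v w : E) : extD A x v w = fderiv ℝ A x v w - fderiv ℝ A x w v := rfl

theorem ContDiffAt.extD {E : Type*} [NormedAddCommGroup E] [NormedSpace ℝ E] {A : E → E →L[ℝ] ℝ}
    {x : E} (hA : ContDiffAt ℝ ∞ A x) : ContDiffAt ℝ ∞ (extD A) x := by
  have h1 : ContDiffAt ℝ ∞ (fderiv ℝ A) x := hA.fderiv_right (by simp)
  have hflip : IsBoundedLinearMap ℝ (fun B : E →L[ℝ] E →L[ℝ] ℝ => B.flip) :=
    IsLinearMap.with_bound ⟨fun _ _ => rfl, fun _ _ => rfl⟩ 1 fun B => by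
      rw [one_mul, ContinuousLinearMap.opNorm_flip]
  have h2 := IsBoundedLinearMap.contDiff (𝕜 := ℝ) (E := E →L[ℝ] E →L[ℝ] ℝ)
    (F := E →L[ℝ] E →L[ℝ] ℝ) (n := ∞) hflip
  exact h1.sub (h2.contDiffAt.comp x h1)

/-- Naturality of the exterior derivative of 1-forms. -/
theorem extD_pullback {E : Type*} [NormedAddCommGroup E] [NormedSpace ℝ E] {A : E → E →L[ℝ] ℝ}
    {τ : E → E} {x : E} (hA : ContDiffAt ℝ ∞ A (τ x)) (hτ : ContDiffAt ℝ ∞ τ x) (v w : E) :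
    extD (fun y => (A (τ y)).comp (fderiv ℝ τ y)) x v w =
      extD A (τ x) (fderiv ℝ τ x v) (fderiv ℝ τ x w) := by
  have hτ' : DifferentiableAt ℝ (fderiv ℝ τ) x :=
    (hτ.fderiv_right (m := 1) (by norm_cast)).differentiableAt (by simp)
  have hAτ : HasFDerivAt (fun y => A (τ y)) ((fderiv ℝ A (τ x)).comp (fderiv ℝ τ x)) x :=
    (hA.differentiableAt (by simp)).hasFDerivAt.comp x (hτ.differentiableAt (by simp)).hasFDerivAt
  have h := hAτ.clm_comp hτ'.hasFDerivAt
  have hsym : IsSymmSndFDerivAt ℝ τ x := hτ.isSymmSndFDerivAt (by simp; norm_cast)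
  rw [extD_apply, extD_apply, h.fderiv]
  have := hsym v w
  simp [this]

section ChartCalculus

variable {d : ℕ} {M : Type*} [TopologicalSpace M] [ChartedSpace (EuclideanSpace ℝ (Fin d)) M]

/-- The derivative at `q` of the preferred chart at `p`. -/
def chartDeriv (p q : M) : TangentSpace (𝓡 d) q →L[ℝ] EuclideanSpace ℝ (Fin d) :=
  mvfderiv (𝓡 d) (extChartAt (𝓡 d) p) q

/-- The derivative of the inverse of the preferred chart at `p`. -/
def chartSymmDeriv (p : M) (x : EuclideanSpace ℝ (Fin d)) :
    EuclideanSpace ℝ (Fin d) →L[ℝ] TangentSpace (𝓡 d) ((extChartAt (𝓡 d) p).symm x) :=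
  mfderiv 𝓘(ℝ, EuclideanSpace ℝ (Fin d)) (𝓡 d) (extChartAt (𝓡 d) p).symm x

theorem isOpen_chart_target (p : M) : IsOpen (extChartAt (𝓡 d) p).target :=
  isOpen_extChartAt_target p

theorem chart_target_mem_nhds {p : M} {x : EuclideanSpace ℝ (Fin d)}
    (hx : x ∈ (extChartAt (𝓡 d) p).target) : (extChartAt (𝓡 d) p).target ∈ 𝓝 x :=
  (isOpen_chart_target p).mem_nhds hx

variable [IsManifold (𝓡 d) ∞ M]

theorem contMDiffAt_chart {p q : M} (hq : q ∈ (extChartAt (𝓡 d) p).source) :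
    ContMDiffAt (𝓡 d) 𝓘(ℝ, EuclideanSpace ℝ (Fin d)) ∞ (extChartAt (𝓡 d) p) q :=
  contMDiffAt_extChartAt' (by simpa using hq)

theorem contMDiffAt_chart_symm {p : M} {x : EuclideanSpace ℝ (Fin d)}
    (hx : x ∈ (extChartAt (𝓡 d) p).target) :
    ContMDiffAt 𝓘(ℝ, EuclideanSpace ℝ (Fin d)) (𝓡 d) ∞ (extChartAt (𝓡 d) p).symm x :=
  (contMDiffOn_extChartAt_symm p).contMDiffAt (chart_target_mem_nhds hx)

theorem chartDeriv_chartSymmDeriv {p : M} {x : EuclideanSpace ℝ (Fin d)}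
    (hx : x ∈ (extChartAt (𝓡 d) p).target) (v : EuclideanSpace ℝ (Fin d)) :
    chartDeriv p ((extChartAt (𝓡 d) p).symm x) (chartSymmDeriv p x v) = v := by
  have : IsManifold (𝓡 d) 1 M := .of_le (n := ∞) (by norm_cast)
  have h := mfderiv_extChartAt_comp_mfderivWithin_extChartAt_symm (I := 𝓡 d) hx
  rw [ModelWithCorners.range_eq_univ, mfderivWithin_univ] at h
  exact congrArg (fun f => f v) h

theorem chartSymmDeriv_chartDeriv {p : M} {x : EuclideanSpace ℝ (Fin d)}
    (hx : x ∈ (extChartAt (𝓡 d) p).target)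
    (v : TangentSpace (𝓡 d) ((extChartAt (𝓡 d) p).symm x)) :
    chartSymmDeriv p x (chartDeriv p ((extChartAt (𝓡 d) p).symm x) v) = v := by
  have : IsManifold (𝓡 d) 1 M := .of_le (n := ∞) (by norm_cast)
  have h := mfderivWithin_extChartAt_symm_comp_mfderiv_extChartAt (I := 𝓡 d) hx
  rw [ModelWithCorners.range_eq_univ, mfderivWithin_univ] at h
  exact congrArg (fun f => f v) h

/-- The derivative of a function is the derivative of its expression in a chart. -/
theorem mvfderiv_eq_chart {F : Type*} [NormedAddCommGroup F] [NormedSpace ℝ F] {f : M → F}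
    {p : M} {x : EuclideanSpace ℝ (Fin d)} (hx : x ∈ (extChartAt (𝓡 d) p).target)
    (hf : MDifferentiableAt (𝓡 d) 𝓘(ℝ, F) f ((extChartAt (𝓡 d) p).symm x))
    (v : EuclideanSpace ℝ (Fin d)) :
    mvfderiv (𝓡 d) f ((extChartAt (𝓡 d) p).symm x) (chartSymmDeriv p x v) =
      fderiv ℝ (f ∘ (extChartAt (𝓡 d) p).symm) x v := by
  have h := mfderiv_comp x hf ((contMDiffAt_chart_symm hx).mdifferentiableAt (by simp))
  rw [mfderiv_eq_fderiv] at h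
  rw [h]
  rfl

end ChartCalculus

section Smoothness

variable {d : ℕ} {M : Type*} [TopologicalSpace M] [ChartedSpace (EuclideanSpace ℝ (Fin d)) M]

/-- The expression of a vector field in the preferred chart at `p`. -/
def localField (X : ∀ p : M, TangentSpace (𝓡 d) p) (p : M) (x : EuclideanSpace ℝ (Fin d)) :
    EuclideanSpace ℝ (Fin d) :=
  chartDeriv p ((extChartAt (𝓡 d) p).symm x) (X ((extChartAt (𝓡 d) p).symm x))

theorem localForm_apply (α : ∀ p : M, TangentSpace (𝓡 d) p →L[ℝ] ℝ) (p : M)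
    (x v : EuclideanSpace ℝ (Fin d)) : localForm α p x v =
      α ((extChartAt (𝓡 d) p).symm x) (chartSymmDeriv p x v) := rfl

theorem dForm_self (α : ∀ p : M, TangentSpace (𝓡 d) p →L[ℝ] ℝ) (p : M)
    (v w : TangentSpace (𝓡 d) p) : dForm α p v w =
      extD (localForm α p) (extChartAt (𝓡 d) p p) (chartDeriv p p v) (chartDeriv p p w) := rfl

variable [IsManifold (𝓡 d) ∞ M]

theorem localForm_localField (α : ∀ p : M, TangentSpace (𝓡 d) p →L[ℝ] ℝ)
    (X : ∀ p : M, TangentSpace (𝓡 d) p) {p : M} {x : EuclideanSpace ℝ (Fin d)}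
    (hx : x ∈ (extChartAt (𝓡 d) p).target) : localForm α p x (localField X p x) =
      α ((extChartAt (𝓡 d) p).symm x) (X ((extChartAt (𝓡 d) p).symm x)) := by
  rw [localForm_apply, localField, chartSymmDeriv_chartDeriv hx]

theorem contMDiffAt_of_chart {F : Type*} [NormedAddCommGroup F] [NormedSpace ℝ F] {f : M → F}
    {p q : M} (hq : q ∈ (extChartAt (𝓡 d) p).source)
    (hf : ContDiffAt ℝ ∞ (f ∘ (extChartAt (𝓡 d) p).symm) (extChartAt (𝓡 d) p q)) :
    ContMDiffAt (𝓡 d) 𝓘(ℝ, F) ∞ f q := by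
  have h := hf.contMDiffAt.comp q (contMDiffAt_chart hq)
  refine h.congr_of_eventuallyEq ?_
  filter_upwards [extChartAt_source_mem_nhds' hq] with y hy
  exact (congrArg f ((extChartAt (𝓡 d) p).left_inv hy)).symm

theorem contDiffAt_comp_chart_symm {F : Type*} [NormedAddCommGroup F] [NormedSpace ℝ F] {f : M → F}
    {p : M} {x : EuclideanSpace ℝ (Fin d)} (hx : x ∈ (extChartAt (𝓡 d) p).target)
    (hf : ContMDiffAt (𝓡 d) 𝓘(ℝ, F) ∞ f ((extChartAt (𝓡 d) p).symm x)) :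
    ContDiffAt ℝ ∞ (f ∘ (extChartAt (𝓡 d) p).symm) x :=
  (hf.comp x (contMDiffAt_chart_symm hx)).contDiffAt

theorem trivializationAt_apply_eq_chartDeriv {p q : M} (hq : q ∈ (chartAt (EuclideanSpace ℝ (Fin d)) p).source)
    (v : TangentSpace (𝓡 d) q) :
    (trivializationAt (EuclideanSpace ℝ (Fin d)) (TangentSpace (𝓡 d)) p ⟨q, v⟩).2 =
      chartDeriv p q v := by
  have : IsManifold (𝓡 d) 1 M := .of_le (n := ∞) (by norm_cast)
  have h := TangentBundle.continuousLinearMapAt_trivializationAt (I := 𝓡 d) (x₀ := p) hq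
  have h2 := congrArg (fun f => f v) h
  refine Eq.trans ?_ h2
  rw [Bundle.Trivialization.continuousLinearMapAt_apply]
  rw [Bundle.Trivialization.linearMapAt_apply, if_pos]
  simpa using hq

theorem IsSmoothField.contDiffAt_localField {X : ∀ p : M, TangentSpace (𝓡 d) p}
    (hX : IsSmoothField X) {p : M} {x : EuclideanSpace ℝ (Fin d)}
    (hx : x ∈ (extChartAt (𝓡 d) p).target) : ContDiffAt ℝ ∞ (localField X p) x := by
  have hq : (extChartAt (𝓡 d) p).symm x ∈ (chartAt (EuclideanSpace ℝ (Fin d)) p).source := by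
    simpa using (extChartAt (𝓡 d) p).map_target hx
  have h1 := (hX ((extChartAt (𝓡 d) p).symm x))
  have h2 := (Bundle.Trivialization.contMDiffAt_iff
    (e := trivializationAt (EuclideanSpace ℝ (Fin d)) (TangentSpace (𝓡 d)) p) (by simpa using hq)).1 h1
  have h3 := contDiffAt_comp_chart_symm hx h2.2
  refine h3.congr_of_eventuallyEq ?_
  filter_upwards [chart_target_mem_nhds hx] with y hy
  have hy' : (extChartAt (𝓡 d) p).symm y ∈ (chartAt (EuclideanSpace ℝ (Fin d)) p).source := by
    simpa using (extChartAt (𝓡 d) p).map_target hy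
  exact (trivializationAt_apply_eq_chartDeriv hy' _).symm

theorem isSmoothField_of_localField {X : ∀ p : M, TangentSpace (𝓡 d) p}
    (hX : ∀ p, ContDiffAt ℝ ∞ (localField X p) (extChartAt (𝓡 d) p p)) : IsSmoothField X := by
  intro p
  refine (Bundle.contMDiffAt_section (F := EuclideanSpace ℝ (Fin d))
    (E := (TangentSpace (𝓡 d) : M → Type _)) p).2 ?_
  refine contMDiffAt_of_chart (p := p) (mem_extChartAt_source p) ?_
  refine (hX p).congr_of_eventuallyEq ?_
  filter_upwards [chart_target_mem_nhds (mem_extChartAt_target p)] with y hy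
  have hy' : (extChartAt (𝓡 d) p).symm y ∈ (chartAt (EuclideanSpace ℝ (Fin d)) p).source := by
    simpa using (extChartAt (𝓡 d) p).map_target hy
  exact (trivializationAt_apply_eq_chartDeriv hy' _)

theorem trivializationAt_form_apply (α : ∀ p : M, TangentSpace (𝓡 d) p →L[ℝ] ℝ) {p : M}
    {x : EuclideanSpace ℝ (Fin d)} (hx : x ∈ (extChartAt (𝓡 d) p).target) :
    (trivializationAt (EuclideanSpace ℝ (Fin d) →L[ℝ] ℝ)
      (fun q : M => (TangentSpace (𝓡 d) q →L[ℝ] ℝ)) p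
      ⟨(extChartAt (𝓡 d) p).symm x, α ((extChartAt (𝓡 d) p).symm x)⟩).2 = localForm α p x := by
  have : IsManifold (𝓡 d) 1 M := .of_le (n := ∞) (by norm_cast)
  have hq : (extChartAt (𝓡 d) p).symm x ∈ (chartAt (EuclideanSpace ℝ (Fin d)) p).source := by
    simpa using (extChartAt (𝓡 d) p).map_target hx
  rw [hom_trivializationAt_apply]
  ext v
  have h1 := TangentBundle.symmL_trivializationAt (I := 𝓡 d) hq
  rw [ModelWithCorners.range_eq_univ, mfderivWithin_univ, (extChartAt (𝓡 d) p).right_inv hx] at h1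
  have h2 := congrArg (fun f => f v) h1
  simp only [ContinuousLinearMap.inCoordinates, ContinuousLinearMap.comp_apply]
  rw [h2]
  exact congrArg (fun f : ℝ →L[ℝ] ℝ => f _)
    (Bundle.Trivial.continuousLinearMapAt_trivialization ℝ M ℝ _)

theorem IsSmoothForm.contDiffAt_localForm {α : ∀ p : M, TangentSpace (𝓡 d) p →L[ℝ] ℝ}
    (hα : IsSmoothForm α) {p : M} {x : EuclideanSpace ℝ (Fin d)}
    (hx : x ∈ (extChartAt (𝓡 d) p).target) : ContDiffAt ℝ ∞ (localForm α p) x := by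
  have hq : (extChartAt (𝓡 d) p).symm x ∈ (chartAt (EuclideanSpace ℝ (Fin d)) p).source := by
    simpa using (extChartAt (𝓡 d) p).map_target hx
  have h1 := (hα ((extChartAt (𝓡 d) p).symm x))
  have h2 := (Bundle.Trivialization.contMDiffAt_iff
    (e := trivializationAt (EuclideanSpace ℝ (Fin d) →L[ℝ] ℝ)
      (fun q : M => (TangentSpace (𝓡 d) q →L[ℝ] ℝ)) p) (by simpa using hq)).1 h1
  have h3 := contDiffAt_comp_chart_symm hx h2.2
  refine h3.congr_of_eventuallyEq ?_
  filter_upwards [chart_target_mem_nhds hx] with y hy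
  exact (trivializationAt_form_apply α hy).symm

theorem isSmoothForm_of_localForm {α : ∀ p : M, TangentSpace (𝓡 d) p →L[ℝ] ℝ}
    (hα : ∀ p, ContDiffAt ℝ ∞ (localForm α p) (extChartAt (𝓡 d) p p)) : IsSmoothForm α := by
  intro p
  refine (Bundle.contMDiffAt_section (F := EuclideanSpace ℝ (Fin d) →L[ℝ] ℝ)
    (E := fun q : M => (TangentSpace (𝓡 d) q →L[ℝ] ℝ)) p).2 ?_
  refine contMDiffAt_of_chart (p := p) (mem_extChartAt_source p) ?_
  refine (hα p).congr_of_eventuallyEq ?_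
  filter_upwards [chart_target_mem_nhds (mem_extChartAt_target p)] with y hy
  exact trivializationAt_form_apply α hy

theorem contDiffAt_chart_transition {p q : M} {x : EuclideanSpace ℝ (Fin d)}
    (hx : x ∈ (extChartAt (𝓡 d) q).target)
    (hq : (extChartAt (𝓡 d) q).symm x ∈ (extChartAt (𝓡 d) p).source) :
    ContDiffAt ℝ ∞ (extChartAt (𝓡 d) p ∘ (extChartAt (𝓡 d) q).symm) x :=
  contDiffAt_comp_chart_symm hx (contMDiffAt_chart hq)

theorem chartDeriv_chartSymmDeriv' {p q : M} {x : EuclideanSpace ℝ (Fin d)}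
    (hx : x ∈ (extChartAt (𝓡 d) q).target)
    (hq : (extChartAt (𝓡 d) q).symm x ∈ (extChartAt (𝓡 d) p).source)
    (v : EuclideanSpace ℝ (Fin d)) :
    chartDeriv p ((extChartAt (𝓡 d) q).symm x) (chartSymmDeriv q x v) =
      fderiv ℝ (extChartAt (𝓡 d) p ∘ (extChartAt (𝓡 d) q).symm) x v :=
  mvfderiv_eq_chart hx ((contMDiffAt_chart hq).mdifferentiableAt (by simp)) v

theorem localForm_chart_transition (α : ∀ p : M, TangentSpace (𝓡 d) p →L[ℝ] ℝ) {p q : M}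
    {x : EuclideanSpace ℝ (Fin d)} (hx : x ∈ (extChartAt (𝓡 d) q).target)
    (hq : (extChartAt (𝓡 d) q).symm x ∈ (extChartAt (𝓡 d) p).source) :
    localForm α q x = (localForm α p ((extChartAt (𝓡 d) p ∘ (extChartAt (𝓡 d) q).symm) x)).comp
      (fderiv ℝ (extChartAt (𝓡 d) p ∘ (extChartAt (𝓡 d) q).symm) x) := by
  ext v
  rw [ContinuousLinearMap.comp_apply, ← chartDeriv_chartSymmDeriv' hx hq, localForm_apply,
    localForm_apply]
  have key : ∀ (q' : M) (u : TangentSpace (𝓡 d) q') (y : EuclideanSpace ℝ (Fin d)),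
      y ∈ (extChartAt (𝓡 d) p).target → (extChartAt (𝓡 d) p).symm y = q' →
      α q' u = α ((extChartAt (𝓡 d) p).symm y) (chartSymmDeriv p y (chartDeriv p q' u)) := by
    rintro q' u y hy rfl
    rw [chartSymmDeriv_chartDeriv hy]
  exact key _ _ _ ((extChartAt (𝓡 d) p).map_source hq) ((extChartAt (𝓡 d) p).left_inv hq)

/-- The exterior derivative may be computed in any chart. -/
theorem dForm_eq_chart {α : ∀ p : M, TangentSpace (𝓡 d) p →L[ℝ] ℝ} (hα : IsSmoothForm α)
    {p q : M} (hq : q ∈ (extChartAt (𝓡 d) p).source) (v w : TangentSpace (𝓡 d) q) :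
    dForm α q v w = extD (localForm α p) (extChartAt (𝓡 d) p q) (chartDeriv p q v)
      (chartDeriv p q w) := by
  set x := extChartAt (𝓡 d) q q with hxdef
  have hx : x ∈ (extChartAt (𝓡 d) q).target := mem_extChartAt_target q
  have hsx : (extChartAt (𝓡 d) q).symm x = q := extChartAt_to_inv q
  set τ := extChartAt (𝓡 d) p ∘ (extChartAt (𝓡 d) q).symm with hτ
  have hτx : τ x = extChartAt (𝓡 d) p q := by rw [hτ, Function.comp_apply, hsx]
  have hev : localForm α q =ᶠ[𝓝 x] fun y => (localForm α p (τ y)).comp (fderiv ℝ τ y) := by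
    have hcont : ContinuousAt (extChartAt (𝓡 d) q).symm x :=
      (contMDiffAt_chart_symm hx).continuousAt
    have hnhds : (extChartAt (𝓡 d) p).source ∈ 𝓝 ((extChartAt (𝓡 d) q).symm x) := by
      rw [hsx]; exact extChartAt_source_mem_nhds' hq
    filter_upwards [chart_target_mem_nhds hx, hcont.preimage_mem_nhds hnhds] with y hy hy'
    exact localForm_chart_transition α hy hy'
  have hderiv (u : TangentSpace (𝓡 d) q) : chartDeriv p q u = fderiv ℝ τ x (chartDeriv q q u) := by
    have key : ∀ (q' : M) (u : TangentSpace (𝓡 d) q'), (extChartAt (𝓡 d) q).symm x = q' →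
        chartDeriv p q' u = fderiv ℝ τ x (chartDeriv q q' u) := by
      rintro q' u rfl
      rw [hτ, ← chartDeriv_chartSymmDeriv' hx (by rw [hsx]; exact hq),
        chartSymmDeriv_chartDeriv hx]
    exact key q u hsx
  have hA : ContDiffAt ℝ ∞ (localForm α p) (τ x) := by
    rw [hτx]; exact hα.contDiffAt_localForm ((extChartAt (𝓡 d) p).map_source hq)
  rw [dForm_self, hderiv, hderiv, ← hτx, ← extD_pullback hA
    (contDiffAt_chart_transition hx (by rw [hsx]; exact hq))]
  rw [extD_apply, extD_apply, hev.fderiv_eq]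

theorem dForm_chart {α : ∀ p : M, TangentSpace (𝓡 d) p →L[ℝ] ℝ} (hα : IsSmoothForm α)
    {p : M} {x : EuclideanSpace ℝ (Fin d)} (hx : x ∈ (extChartAt (𝓡 d) p).target)
    (v w : TangentSpace (𝓡 d) ((extChartAt (𝓡 d) p).symm x)) :
    dForm α ((extChartAt (𝓡 d) p).symm x) v w = extD (localForm α p) x
      (chartDeriv p _ v) (chartDeriv p _ w) := by
  rw [dForm_eq_chart hα ((extChartAt (𝓡 d) p).map_target hx), (extChartAt (𝓡 d) p).right_inv hx]

end Smoothness

section SmoothOperations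

variable {d : ℕ} {M : Type*} [TopologicalSpace M] [ChartedSpace (EuclideanSpace ℝ (Fin d)) M]
  [IsManifold (𝓡 d) ∞ M]

theorem contMDiff_of_chart {F : Type*} [NormedAddCommGroup F] [NormedSpace ℝ F] {f : M → F}
    (hf : ∀ p, ContDiffAt ℝ ∞ (f ∘ (extChartAt (𝓡 d) p).symm) (extChartAt (𝓡 d) p p)) :
    ContMDiff (𝓡 d) 𝓘(ℝ, F) ∞ f :=
  fun p => contMDiffAt_of_chart (mem_extChartAt_source p) (hf p)

theorem mvfderiv_comp_chart_symm {F : Type*} [NormedAddCommGroup F] [NormedSpace ℝ F] {f : M → F}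
    (hf : ContMDiff (𝓡 d) 𝓘(ℝ, F) ∞ f) (X : ∀ p : M, TangentSpace (𝓡 d) p) {p : M}
    {x : EuclideanSpace ℝ (Fin d)} (hx : x ∈ (extChartAt (𝓡 d) p).target) :
    mvfderiv (𝓡 d) f ((extChartAt (𝓡 d) p).symm x) (X ((extChartAt (𝓡 d) p).symm x)) =
      fderiv ℝ (f ∘ (extChartAt (𝓡 d) p).symm) x (localField X p x) := by
  rw [← mvfderiv_eq_chart hx (hf.mdifferentiableAt (by simp)), localField,
    chartSymmDeriv_chartDeriv hx]

theorem contDiffAt_comp_chart_symm' {F : Type*} [NormedAddCommGroup F] [NormedSpace ℝ F]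
    {f : M → F} (hf : ContMDiff (𝓡 d) 𝓘(ℝ, F) ∞ f) {p : M}
    {x : EuclideanSpace ℝ (Fin d)} (hx : x ∈ (extChartAt (𝓡 d) p).target) :
    ContDiffAt ℝ ∞ (f ∘ (extChartAt (𝓡 d) p).symm) x :=
  contDiffAt_comp_chart_symm hx hf.contMDiffAt

/-- The derivative of a smooth function along a smooth vector field is smooth. -/
theorem IsSmoothField.contMDiff_mvfderiv {F : Type*} [NormedAddCommGroup F] [NormedSpace ℝ F]
    {f : M → F} {X : ∀ p : M, TangentSpace (𝓡 d) p} (hX : IsSmoothField X)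
    (hf : ContMDiff (𝓡 d) 𝓘(ℝ, F) ∞ f) :
    ContMDiff (𝓡 d) 𝓘(ℝ, F) ∞ (fun q => mvfderiv (𝓡 d) f q (X q)) := by
  refine contMDiff_of_chart fun p => ?_
  have hp := mem_extChartAt_target (I := 𝓡 d) p
  have h1 := ((contDiffAt_comp_chart_symm' hf hp).fderiv_right (m := ∞) (by simp)).clm_apply
    (hX.contDiffAt_localField hp)
  refine h1.congr_of_eventuallyEq ?_
  filter_upwards [chart_target_mem_nhds hp] with y hy
  exact mvfderiv_comp_chart_symm hf X hy

theorem IsSmoothForm.contMDiff_apply {α : ∀ p : M, TangentSpace (𝓡 d) p →L[ℝ] ℝ}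
    {X : ∀ p : M, TangentSpace (𝓡 d) p} (hα : IsSmoothForm α) (hX : IsSmoothField X) :
    ContMDiff (𝓡 d) 𝓘(ℝ, ℝ) ∞ (fun q => α q (X q)) := by
  refine contMDiff_of_chart fun p => ?_
  have hp := mem_extChartAt_target (I := 𝓡 d) p
  have h1 := (hα.contDiffAt_localForm hp).clm_apply (hX.contDiffAt_localField hp)
  refine h1.congr_of_eventuallyEq ?_
  filter_upwards [chart_target_mem_nhds hp] with y hy
  exact (localForm_localField α X hy).symm

theorem isSmoothForm_mvfderiv {f : M → ℝ} (hf : ContMDiff (𝓡 d) 𝓘(ℝ, ℝ) ∞ f) :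
    IsSmoothForm (fun p => mvfderiv (𝓡 d) f p) := by
  refine isSmoothForm_of_localForm fun p => ?_
  have hp := mem_extChartAt_target (I := 𝓡 d) p
  refine ((contDiffAt_comp_chart_symm' hf hp).fderiv_right (m := ∞) (by simp)).congr_of_eventuallyEq ?_
  filter_upwards [chart_target_mem_nhds hp] with y hy
  ext v
  exact mvfderiv_eq_chart hy (hf.mdifferentiableAt (by simp)) v

theorem IsSmoothForm.smul {α : ∀ p : M, TangentSpace (𝓡 d) p →L[ℝ] ℝ} {u : M → ℝ}
    (hα : IsSmoothForm α) (hu : ContMDiff (𝓡 d) 𝓘(ℝ, ℝ) ∞ u) :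
    IsSmoothForm (fun p => u p • α p) := by
  refine isSmoothForm_of_localForm fun p => ?_
  have hp := mem_extChartAt_target (I := 𝓡 d) p
  exact (contDiffAt_comp_chart_symm' hu hp).smul (hα.contDiffAt_localForm hp)

theorem IsSmoothForm.sub {α β : ∀ p : M, TangentSpace (𝓡 d) p →L[ℝ] ℝ}
    (hα : IsSmoothForm α) (hβ : IsSmoothForm β) : IsSmoothForm (fun p => α p - β p) := by
  refine isSmoothForm_of_localForm fun p => ?_
  have hp := mem_extChartAt_target (I := 𝓡 d) p
  exact (hα.contDiffAt_localForm hp).sub (hβ.contDiffAt_localForm hp)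

theorem IsSmoothField.smul {X : ∀ p : M, TangentSpace (𝓡 d) p} {u : M → ℝ}
    (hX : IsSmoothField X) (hu : ContMDiff (𝓡 d) 𝓘(ℝ, ℝ) ∞ u) :
    IsSmoothField (fun p => u p • X p) := by
  refine isSmoothField_of_localField fun p => ?_
  have hp := mem_extChartAt_target (I := 𝓡 d) p
  refine ((contDiffAt_comp_chart_symm' hu hp).smul
    (hX.contDiffAt_localField hp)).congr_of_eventuallyEq (.of_forall fun y => ?_)
  exact (chartDeriv p _).map_smul _ _

theorem IsSmoothField.add {X Y : ∀ p : M, TangentSpace (𝓡 d) p}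
    (hX : IsSmoothField X) (hY : IsSmoothField Y) : IsSmoothField (fun p => X p + Y p) := by
  refine isSmoothField_of_localField fun p => ?_
  have hp := mem_extChartAt_target (I := 𝓡 d) p
  refine ((hX.contDiffAt_localField hp).add
    (hY.contDiffAt_localField hp)).congr_of_eventuallyEq (.of_forall fun y => ?_)
  exact (chartDeriv p _).map_add _ _

/-- The exterior derivative as a bilinear form. -/
def dFormLin (α : ∀ p : M, TangentSpace (𝓡 d) p →L[ℝ] ℝ) (p : M) :
    TangentSpace (𝓡 d) p →ₗ[ℝ] TangentSpace (𝓡 d) p →ₗ[ℝ] ℝ :=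
  LinearMap.mk₂ ℝ (dForm α p)
    (fun u v w => by simp only [dForm_self, map_add, add_apply])
    (fun c v w => by simp only [dForm_self, map_smul, smul_apply])
    (fun u v w => by simp only [dForm_self, map_add])
    (fun c v w => by simp only [dForm_self, map_smul])

omit [IsManifold (𝓡 d) ∞ M] in
theorem dFormLin_apply (α : ∀ p : M, TangentSpace (𝓡 d) p →L[ℝ] ℝ) (p : M)
    (v w : TangentSpace (𝓡 d) p) : dFormLin α p v w = dForm α p v w := rfl

omit [IsManifold (𝓡 d) ∞ M] in
theorem dForm_skew (α : ∀ p : M, TangentSpace (𝓡 d) p →L[ℝ] ℝ) (p : M)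
    (v w : TangentSpace (𝓡 d) p) : dForm α p v w = - dForm α p w v := by
  rw [dForm_self, dForm_self, extD_apply, extD_apply, neg_sub]

theorem mvfderiv_eq_chart_self {F : Type*} [NormedAddCommGroup F] [NormedSpace ℝ F] {f : M → F}
    {p : M} (hf : MDifferentiableAt (𝓡 d) 𝓘(ℝ, F) f p) (v : TangentSpace (𝓡 d) p) :
    mvfderiv (𝓡 d) f p v =
      fderiv ℝ (f ∘ (extChartAt (𝓡 d) p).symm) (extChartAt (𝓡 d) p p) (chartDeriv p p v) := by
  have hp := mem_extChartAt_target (I := 𝓡 d) p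
  have key : ∀ (q : M) (v : TangentSpace (𝓡 d) q),
      (extChartAt (𝓡 d) p).symm (extChartAt (𝓡 d) p p) = q →
      MDifferentiableAt (𝓡 d) 𝓘(ℝ, F) f q → mvfderiv (𝓡 d) f q v =
      fderiv ℝ (f ∘ (extChartAt (𝓡 d) p).symm) (extChartAt (𝓡 d) p p) (chartDeriv p q v) := by
    rintro q v rfl hf
    rw [← mvfderiv_eq_chart hp hf, chartSymmDeriv_chartDeriv hp]
  exact key p v (extChartAt_to_inv p) hf

theorem localForm_self (α : ∀ p : M, TangentSpace (𝓡 d) p →L[ℝ] ℝ) (p : M)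
    (v : TangentSpace (𝓡 d) p) :
    localForm α p (extChartAt (𝓡 d) p p) (chartDeriv p p v) = α p v := by
  have hp := mem_extChartAt_target (I := 𝓡 d) p
  have key : ∀ (q : M) (v : TangentSpace (𝓡 d) q),
      (extChartAt (𝓡 d) p).symm (extChartAt (𝓡 d) p p) = q →
      localForm α p (extChartAt (𝓡 d) p p) (chartDeriv p q v) = α q v := by
    rintro q v rfl
    rw [localForm_apply, chartSymmDeriv_chartDeriv hp]
  exact key p v (extChartAt_to_inv p)

omit [IsManifold (𝓡 d) ∞ M] in
theorem localField_self (X : ∀ p : M, TangentSpace (𝓡 d) p) (p : M) :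
    localField X p (extChartAt (𝓡 d) p p) = chartDeriv p p (X p) := by
  have key : ∀ q : M, q = p → chartDeriv p q (X q) = chartDeriv p p (X p) := by
    rintro q rfl; rfl
  exact key _ (extChartAt_to_inv p)

theorem dForm_smul {α : ∀ p : M, TangentSpace (𝓡 d) p →L[ℝ] ℝ} {u : M → ℝ}
    (hα : IsSmoothForm α) (hu : ContMDiff (𝓡 d) 𝓘(ℝ, ℝ) ∞ u) (p : M)
    (v w : TangentSpace (𝓡 d) p) : dForm (fun p => u p • α p) p v w =
      mvfderiv (𝓡 d) u p v * α p w - mvfderiv (𝓡 d) u p w * α p v + u p * dForm α p v w := by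
  have hp := mem_extChartAt_target (I := 𝓡 d) p
  have hu' := (contDiffAt_comp_chart_symm' hu hp).differentiableAt (by simp)
  have hα' := (hα.contDiffAt_localForm hp).differentiableAt (by simp)
  have h := (hu'.hasFDerivAt.smul hα'.hasFDerivAt).fderiv
  have hsm : localForm (fun p => u p • α p) p =
    (u ∘ (extChartAt (𝓡 d) p).symm) • localForm α p := rfl
  have hup : (u ∘ (extChartAt (𝓡 d) p).symm) (extChartAt (𝓡 d) p p) = u p :=
    congrArg u (extChartAt_to_inv p)
  rw [dForm_self, dForm_self, extD_apply, extD_apply, hsm, h,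
    mvfderiv_eq_chart_self (hu.mdifferentiableAt (by simp)),
    mvfderiv_eq_chart_self (hu.mdifferentiableAt (by simp)), ← localForm_self α p v,
    ← localForm_self α p w, hup]
  simp only [add_apply, smul_apply, ContinuousLinearMap.smulRight_apply, smul_eq_mul]
  ring

theorem mlieBracket_chart {X Y : ∀ p : M, TangentSpace (𝓡 d) p} (p : M) :
    chartDeriv p p (VectorField.mlieBracket (𝓡 d) X Y p) =
      VectorField.lieBracket ℝ (localField X p) (localField Y p) (extChartAt (𝓡 d) p p) := by
  have hp := mem_extChartAt_target (I := 𝓡 d) p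
  have hpull (X : ∀ p : M, TangentSpace (𝓡 d) p) (x : EuclideanSpace ℝ (Fin d))
      (hx : x ∈ (extChartAt (𝓡 d) p).target) :
      VectorField.mpullbackWithin 𝓘(ℝ, EuclideanSpace ℝ (Fin d)) (𝓡 d)
        (extChartAt (𝓡 d) p).symm X (Set.range (𝓡 d)) x = localField X p x := by
    rw [VectorField.mpullbackWithin_apply, ModelWithCorners.range_eq_univ, mfderivWithin_univ]
    have := ContinuousLinearMap.inverse_eq (f := chartSymmDeriv p x)
      (g := chartDeriv p ((extChartAt (𝓡 d) p).symm x))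
      (by ext1 v; exact chartSymmDeriv_chartDeriv hx v)
      (by ext1 v; exact chartDeriv_chartSymmDeriv hx v)
    exact congrArg (fun f => f (X ((extChartAt (𝓡 d) p).symm x))) this
  rw [← VectorField.mlieBracketWithin_univ, VectorField.mlieBracketWithin_apply]
  have hinv : ∀ v, chartDeriv p p ((mfderiv (𝓡 d) 𝓘(ℝ, EuclideanSpace ℝ (Fin d))
      (extChartAt (𝓡 d) p) p).inverse v) = v := by
    have key : ∀ q : M, (extChartAt (𝓡 d) p).symm (extChartAt (𝓡 d) p p) = q →
      ∀ v, chartDeriv p q ((mfderiv (𝓡 d) 𝓘(ℝ, EuclideanSpace ℝ (Fin d))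
      (extChartAt (𝓡 d) p) q).inverse v) = v := by
      rintro q rfl v
      have := ContinuousLinearMap.inverse_eq (g := chartSymmDeriv p (extChartAt (𝓡 d) p p))
        (f := chartDeriv p ((extChartAt (𝓡 d) p).symm (extChartAt (𝓡 d) p p)))
        (by ext1 v; exact chartDeriv_chartSymmDeriv hp v)
        (by ext1 v; exact chartSymmDeriv_chartDeriv hp v)
      refine Eq.trans ?_ (chartDeriv_chartSymmDeriv hp v)
      exact congrArg (fun f => chartDeriv p _ (f v)) this
    exact key p (extChartAt_to_inv p)
  refine (hinv _).trans ?_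
  have hset : (extChartAt (𝓡 d) p).symm ⁻¹' Set.univ ∩ Set.range (𝓡 d) = Set.univ := by
    rw [ModelWithCorners.range_eq_univ, Set.preimage_univ, Set.inter_univ]
  rw [hset]
  refine (congrFun (VectorField.lieBracketWithin_univ (𝕜 := ℝ)) _).trans ?_
  exact Filter.EventuallyEq.lieBracket_vectorField_eq
    (Filter.eventually_of_mem (chart_target_mem_nhds hp) (hpull X))
    (Filter.eventually_of_mem (chart_target_mem_nhds hp) (hpull Y))

/-- Palais' formula for the exterior derivative. -/
theorem apply_mlieBracket {α : ∀ p : M, TangentSpace (𝓡 d) p →L[ℝ] ℝ}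
    {X Y : ∀ p : M, TangentSpace (𝓡 d) p} (hα : IsSmoothForm α) (hX : IsSmoothField X)
    (hY : IsSmoothField Y) (p : M) :
    α p (VectorField.mlieBracket (𝓡 d) X Y p) =
      mvfderiv (𝓡 d) (fun q => α q (Y q)) p (X p) - mvfderiv (𝓡 d) (fun q => α q (X q)) p (Y p)
        - dForm α p (X p) (Y p) := by
  have hp := mem_extChartAt_target (I := 𝓡 d) p
  have hα' := (hα.contDiffAt_localForm hp).differentiableAt (by simp)
  have hX' := (hX.contDiffAt_localField hp).differentiableAt (by simp)
  have hY' := (hY.contDiffAt_localField hp).differentiableAt (by simp)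
  have hderiv (X : ∀ p : M, TangentSpace (𝓡 d) p) (hX : IsSmoothField X) :
      fderiv ℝ ((fun q => α q (X q)) ∘ (extChartAt (𝓡 d) p).symm) (extChartAt (𝓡 d) p p) =
        fderiv ℝ (fun x => localForm α p x (localField X p x)) (extChartAt (𝓡 d) p p) := by
    refine Filter.EventuallyEq.fderiv_eq ?_
    filter_upwards [chart_target_mem_nhds hp] with y hy
    exact (localForm_localField α X hy).symm
  rw [mvfderiv_eq_chart_self ((hα.contMDiff_apply hY).mdifferentiableAt (by simp)),
    mvfderiv_eq_chart_self ((hα.contMDiff_apply hX).mdifferentiableAt (by simp)),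
    hderiv X hX, hderiv Y hY, dForm_self, extD_apply, ← localForm_self, mlieBracket_chart,
    (hα'.hasFDerivAt.clm_apply hY'.hasFDerivAt).fderiv,
    (hα'.hasFDerivAt.clm_apply hX'.hasFDerivAt).fderiv, VectorField.lieBracket,
    ← localField_self, ← localField_self]
  simp only [add_apply, ContinuousLinearMap.comp_apply, ContinuousLinearMap.flip_apply, map_sub]
  ring

end SmoothOperations

instance {d : ℕ} {M : Type*} [TopologicalSpace M] [ChartedSpace (EuclideanSpace ℝ (Fin d)) M]
    (p : M) : FiniteDimensional ℝ (TangentSpace (𝓡 d) p) :=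
  inferInstanceAs (FiniteDimensional ℝ (EuclideanSpace ℝ (Fin d)))

/-! ### Contact vector fields and contact Hamiltonians -/

section ContactFields

variable {m : ℕ} {M : Type*} [TopologicalSpace M]
  [ChartedSpace (EuclideanSpace ℝ (Fin (2 * m + 3))) M] [IsManifold (𝓡 (2 * m + 3)) ∞ M]
  {α : ∀ p : M, TangentSpace (𝓡 (2 * m + 3)) p →L[ℝ] ℝ}

theorem IsContactForm.isContactPair (hα : IsContactForm α) (p : M) :
    IsContactPair m (α p : TangentSpace (𝓡 (2 * m + 3)) p →ₗ[ℝ] ℝ) (dFormLin α p) where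
  finrank_eq := (finrank_euclideanSpace_fin (𝕜 := ℝ) (n := 2 * m + 3))
  skew := dForm_skew α p
  volume_ne_zero := hα.2 p

/-- The isomorphism `v ↦ ι_v dα + α(v) α`, in a chart. -/
def chartFlat (α : ∀ p : M, TangentSpace (𝓡 (2 * m + 3)) p →L[ℝ] ℝ) (p : M)
    (x : EuclideanSpace ℝ (Fin (2 * m + 3))) : EuclideanSpace ℝ (Fin (2 * m + 3)) →L[ℝ]
      EuclideanSpace ℝ (Fin (2 * m + 3)) →L[ℝ] ℝ :=
  extD (localForm α p) x + (localForm α p x).smulRight (localForm α p x)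

theorem chartFlat_chartDeriv (hα : IsSmoothForm α) {p : M}
    {x : EuclideanSpace ℝ (Fin (2 * m + 3))} (hx : x ∈ (extChartAt (𝓡 (2 * m + 3)) p).target)
    (v w : TangentSpace (𝓡 (2 * m + 3)) ((extChartAt (𝓡 (2 * m + 3)) p).symm x)) :
    chartFlat α p x (chartDeriv p _ v) (chartDeriv p _ w) =
      dForm α _ v w + α _ v * α _ w := by
  rw [dForm_chart hα hx]
  simp only [chartFlat, add_apply, ContinuousLinearMap.smulRight_apply, smul_apply, smul_eq_mul,
    localForm_apply, chartSymmDeriv_chartDeriv hx]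

theorem IsContactForm.flat_injective (hα : IsContactForm α) {p : M}
    {v : TangentSpace (𝓡 (2 * m + 3)) p} (hv : ∀ w, dForm α p v w + α p v * α p w = 0) :
    v = 0 := by
  refine (hα.isContactPair p).flat_bijective.1 ?_
  rw [map_zero]
  ext w
  exact hv w

theorem IsContactForm.flat_surjective (hα : IsContactForm α) {p : M}
    (η : TangentSpace (𝓡 (2 * m + 3)) p →L[ℝ] ℝ) :
    ∃ v, ∀ w, dForm α p v w + α p v * α p w = η w := by
  obtain ⟨v, hv⟩ := (hα.isContactPair p).flat_bijective.2 (η : _ →ₗ[ℝ] ℝ)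
  exact ⟨v, fun w => congrArg (fun f => f w) hv⟩

theorem IsContactForm.exists_chartFlat_equiv (hα : IsContactForm α) {p : M}
    {x : EuclideanSpace ℝ (Fin (2 * m + 3))} (hx : x ∈ (extChartAt (𝓡 (2 * m + 3)) p).target) :
    ∃ e : EuclideanSpace ℝ (Fin (2 * m + 3)) ≃L[ℝ] (EuclideanSpace ℝ (Fin (2 * m + 3)) →L[ℝ] ℝ),
      (e : _ →L[ℝ] _) = chartFlat α p x := by
  have hinj : Function.Injective (chartFlat α p x) := by
    rw [injective_iff_map_eq_zero]
    intro v hv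
    have : chartSymmDeriv p x v = 0 := by
      refine hα.flat_injective fun w => ?_
      rw [← chartFlat_chartDeriv hα.1 hx, chartDeriv_chartSymmDeriv hx, hv]
      rfl
    rw [← chartDeriv_chartSymmDeriv hx v, this, map_zero]
  have hsurj : Function.Surjective (chartFlat α p x) := by
    intro g
    obtain ⟨v, hv⟩ := hα.flat_surjective (g.comp (chartDeriv p ((extChartAt (𝓡 (2 * m + 3)) p).symm x)))
    refine ⟨chartDeriv p _ v, ?_⟩
    ext w
    have := hv (chartSymmDeriv p x w)
    rw [← chartFlat_chartDeriv hα.1 hx, ContinuousLinearMap.comp_apply,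
      chartDeriv_chartSymmDeriv hx] at this
    exact this
  exact ⟨ContinuousLinearEquiv.ofBijective (chartFlat α p x) (LinearMap.ker_eq_bot.2 hinj)
    (LinearMap.range_eq_top.2 hsurj), ContinuousLinearEquiv.coe_ofBijective _ _ _⟩

/-- The musical isomorphism of a contact form is smooth. -/
theorem IsContactForm.exists_field (hα : IsContactForm α)
    {η : ∀ p : M, TangentSpace (𝓡 (2 * m + 3)) p →L[ℝ] ℝ} (hη : IsSmoothForm η) :
    ∃ W : ∀ p : M, TangentSpace (𝓡 (2 * m + 3)) p, IsSmoothField W ∧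
      ∀ p w, dForm α p (W p) w + α p (W p) * α p w = η p w := by
  choose W hW using fun p => hα.flat_surjective (η p)
  refine ⟨W, isSmoothField_of_localField fun p => ?_, hW⟩
  have hp := mem_extChartAt_target (I := 𝓡 (2 * m + 3)) p
  have hA := hα.1.contDiffAt_localForm hp
  have hΦ : ContDiffAt ℝ ∞ (chartFlat α p) (extChartAt (𝓡 (2 * m + 3)) p p) :=
    (OBD.ContDiffAt.extD hA).add (hA.smulRight hA)
  obtain ⟨e, he⟩ := hα.exists_chartFlat_equiv hp
  have hinv : ContDiffAt ℝ ∞ (fun x => (chartFlat α p x).inverse)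
      (extChartAt (𝓡 (2 * m + 3)) p p) := by
    refine ContDiffAt.comp (g := ContinuousLinearMap.inverse) _ ?_ hΦ
    rw [← he]
    exact contDiffAt_map_inverse e
  refine (hinv.clm_apply (hη.contDiffAt_localForm hp)).congr_of_eventuallyEq ?_
  filter_upwards [chart_target_mem_nhds hp] with y hy
  obtain ⟨e, he⟩ := hα.exists_chartFlat_equiv hy
  rw [← he, ContinuousLinearMap.inverse_equiv]
  refine (e.symm_apply_eq.2 ?_).symm
  ext w
  have h1 := chartFlat_chartDeriv hα.1 hy (W _) (chartSymmDeriv p y w)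
  rw [hW, chartDeriv_chartSymmDeriv hy] at h1
  rw [localForm_apply, ← h1, ← he]
  rfl

/-- The Reeb vector field of a contact form. -/
theorem IsContactForm.exists_reeb (hα : IsContactForm α) :
    ∃ R : ∀ p : M, TangentSpace (𝓡 (2 * m + 3)) p, IsSmoothField R ∧
      (∀ p, α p (R p) = 1) ∧ ∀ p w, dForm α p (R p) w = 0 := by
  obtain ⟨R, hR, h⟩ := hα.exists_field hα.1
  have key (p : M) : α p (R p) = 1 ∧ ∀ w, dForm α p (R p) w = 0 := by
    obtain ⟨r, hr1, hr2⟩ := (hα.isContactPair p).exists_reeb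
    have : R p - r = 0 := by
      refine hα.flat_injective fun w => ?_
      have h1 := h p w
      have h2 : dForm α p r w = 0 := hr2 w
      have h3 : dForm α p (R p - r) w = dForm α p (R p) w - dForm α p r w :=
        congrArg (fun f => f w) ((dFormLin α p).map_sub (R p) r)
      have h4 : α p r = 1 := hr1
      rw [h3, map_sub, h4]
      linarith
    rw [sub_eq_zero.1 this]
    exact ⟨hr1, hr2⟩
  exact ⟨R, hR, fun p => (key p).1, fun p => (key p).2⟩

/-- The Reeb vector field of a contact form. -/
def reeb (hα : IsContactForm α) : ∀ p : M, TangentSpace (𝓡 (2 * m + 3)) p :=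
  hα.exists_reeb.choose

theorem isSmoothField_reeb (hα : IsContactForm α) : IsSmoothField (reeb hα) :=
  hα.exists_reeb.choose_spec.1

theorem apply_reeb (hα : IsContactForm α) (p : M) : α p (reeb hα p) = 1 :=
  hα.exists_reeb.choose_spec.2.1 p

theorem dForm_reeb (hα : IsContactForm α) (p : M) (w : TangentSpace (𝓡 (2 * m + 3)) p) :
    dForm α p (reeb hα p) w = 0 :=
  hα.exists_reeb.choose_spec.2.2 p w

/-- The horizontal vector field `Z` with `ι_Z dα = df(R) α - df`. -/
theorem IsContactForm.exists_horizontal (hα : IsContactForm α) {f : M → ℝ}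
    (hf : ContMDiff (𝓡 (2 * m + 3)) 𝓘(ℝ, ℝ) ∞ f) :
    ∃ Z : ∀ p : M, TangentSpace (𝓡 (2 * m + 3)) p, IsSmoothField Z ∧ (∀ p, α p (Z p) = 0) ∧
      ∀ p w, dForm α p (Z p) w =
        mvfderiv (𝓡 (2 * m + 3)) f p (reeb hα p) * α p w - mvfderiv (𝓡 (2 * m + 3)) f p w := by
  obtain ⟨Z, hZ, h⟩ := hα.exists_field ((hα.1.smul
    ((isSmoothField_reeb hα).contMDiff_mvfderiv hf)).sub (isSmoothForm_mvfderiv hf))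
  have h0 (p : M) : α p (Z p) = 0 := by
    have := h p (reeb hα p)
    rw [dForm_skew, dForm_reeb, apply_reeb] at this
    simpa [apply_reeb] using this
  refine ⟨Z, hZ, h0, fun p w => ?_⟩
  have := h p w
  rw [h0] at this
  simpa using this

/-- The horizontal vector field `Z` with `ι_Z dα = df(R) α - df`. -/
def horizontal (hα : IsContactForm α) {f : M → ℝ}
    (hf : ContMDiff (𝓡 (2 * m + 3)) 𝓘(ℝ, ℝ) ∞ f) : ∀ p : M, TangentSpace (𝓡 (2 * m + 3)) p :=
  (hα.exists_horizontal hf).choose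

section

variable (hα : IsContactForm α) {f g : M → ℝ} (hf : ContMDiff (𝓡 (2 * m + 3)) 𝓘(ℝ, ℝ) ∞ f)
  (hg : ContMDiff (𝓡 (2 * m + 3)) 𝓘(ℝ, ℝ) ∞ g)

theorem isSmoothField_horizontal : IsSmoothField (horizontal hα hf) :=
  (hα.exists_horizontal hf).choose_spec.1

theorem apply_horizontal (p : M) : α p (horizontal hα hf p) = 0 :=
  (hα.exists_horizontal hf).choose_spec.2.1 p

theorem dForm_horizontal (p : M) (w : TangentSpace (𝓡 (2 * m + 3)) p) :
    dForm α p (horizontal hα hf p) w =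
      mvfderiv (𝓡 (2 * m + 3)) f p (reeb hα p) * α p w - mvfderiv (𝓡 (2 * m + 3)) f p w :=
  (hα.exists_horizontal hf).choose_spec.2.2 p w

/-- The contact vector field with contact Hamiltonian `f`. -/
def contactField : ∀ p : M, TangentSpace (𝓡 (2 * m + 3)) p :=
  fun p => f p • reeb hα p + horizontal hα hf p

theorem isSmoothField_contactField : IsSmoothField (contactField hα hf) :=
  ((isSmoothField_reeb hα).smul hf).add (isSmoothField_horizontal hα hf)

theorem apply_contactField (p : M) : α p (contactField hα hf p) = f p := by
  rw [contactField, map_add, map_smul, apply_reeb, apply_horizontal]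
  simp

theorem dForm_contactField (p : M) (w : TangentSpace (𝓡 (2 * m + 3)) p) :
    dForm α p (contactField hα hf p) w =
      mvfderiv (𝓡 (2 * m + 3)) f p (reeb hα p) * α p w - mvfderiv (𝓡 (2 * m + 3)) f p w := by
  have h : dForm α p (contactField hα hf p) w =
      f p * dForm α p (reeb hα p) w + dForm α p (horizontal hα hf p) w := by
    simp only [← dFormLin_apply, contactField, map_add, map_smul, LinearMap.add_apply,
      LinearMap.smul_apply, smul_eq_mul]
  rw [h, dForm_reeb, dForm_horizontal]
  ring

theorem lieForm_contactField (p : M) (w : TangentSpace (𝓡 (2 * m + 3)) p) :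
    lieForm (contactField hα hf) α p w =
      mvfderiv (𝓡 (2 * m + 3)) f p (reeb hα p) * α p w := by
  have : (fun q => α q (contactField hα hf q)) = f := funext (apply_contactField hα hf)
  rw [lieForm, this, dForm_contactField]
  ring

end

theorem lieForm_smul {X : ∀ p : M, TangentSpace (𝓡 (2 * m + 3)) p} {u : M → ℝ}
    (hα : IsSmoothForm α) (hX : IsSmoothField X) (hu : ContMDiff (𝓡 (2 * m + 3)) 𝓘(ℝ, ℝ) ∞ u)
    (p : M) (v : TangentSpace (𝓡 (2 * m + 3)) p) :
    lieForm X (fun q => u q • α q) p v =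
      u p * lieForm X α p v + mvfderiv (𝓡 (2 * m + 3)) u p (X p) * α p v := by
  have h : mvfderiv (𝓡 (2 * m + 3)) (fun q => (u q • α q) (X q)) p v =
      u p * mvfderiv (𝓡 (2 * m + 3)) (fun q => α q (X q)) p v +
        α p (X p) * mvfderiv (𝓡 (2 * m + 3)) u p v := by
    have := mvfderiv_fun_mul (hu.mdifferentiableAt (x := p) (by simp))
      ((hα.contMDiff_apply hX).mdifferentiableAt (x := p) (by simp))
    refine (congrArg (fun f => f v) this).trans ?_
    simp
  rw [lieForm, h, dForm_smul hα hu, lieForm]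
  ring

namespace ContactStructure

variable {ξ : ContactStructure m M}

/-- Two contact forms defining the same contact structure are proportional. -/
theorem IsDefinedBy.exists_smul {α' : ∀ p : M, TangentSpace (𝓡 (2 * m + 3)) p →L[ℝ] ℝ}
    (hα : ξ.IsDefinedBy α) (hα' : ξ.IsDefinedBy α') :
    ∃ u : M → ℝ, ContMDiff (𝓡 (2 * m + 3)) 𝓘(ℝ, ℝ) ∞ u ∧ (∀ p, 0 < u p) ∧
      α' = fun p => u p • α p := by
  refine ⟨fun p => α' p (reeb hα.1 p), hα'.1.1.contMDiff_apply (isSmoothField_reeb hα.1),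
    fun p => ?_, ?_⟩
  · rw [← (hα'.2 p _).2, (hα.2 p _).2, apply_reeb]
    norm_num
  · funext p
    ext v
    have h : α' p (v - α p v • reeb hα.1 p) = 0 := by
      rw [← (hα'.2 p _).1, (hα.2 p _).1, map_sub, map_smul, apply_reeb]
      simp
    rw [map_sub, map_smul, sub_eq_zero] at h
    rw [h]
    simp [mul_comm]

/-- It suffices to check the contact condition for one contact form. -/
theorem IsDefinedBy.isContactField (hα : ξ.IsDefinedBy α)
    {X : ∀ p : M, TangentSpace (𝓡 (2 * m + 3)) p} (hX : IsSmoothField X) {g : M → ℝ}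
    (hg : ∀ p v, lieForm X α p v = g p * α p v) : ξ.IsContactField X := by
  refine ⟨hX, fun α' hα' => ?_⟩
  obtain ⟨u, hu, hu0, rfl⟩ := hα.exists_smul hα'
  refine ⟨fun p => g p + mvfderiv (𝓡 (2 * m + 3)) u p (X p) / u p, fun p v => ?_⟩
  rw [lieForm_smul hα.1.1 hX hu, hg]
  have := (hu0 p).ne'
  simp only [smul_apply, smul_eq_mul]
  field_simp

theorem IsDefinedBy.isContactField_contactField (hα : ξ.IsDefinedBy α) {f : M → ℝ}
    (hf : ContMDiff (𝓡 (2 * m + 3)) 𝓘(ℝ, ℝ) ∞ f) : ξ.IsContactField (contactField hα.1 hf) :=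
  hα.isContactField (isSmoothField_contactField hα.1 hf) (lieForm_contactField hα.1 hf)

theorem IsContactField.dForm_eq {X : ∀ p : M, TangentSpace (𝓡 (2 * m + 3)) p}
    (hX : ξ.IsContactField X) (hα : ξ.IsDefinedBy α) (p : M)
    (w : TangentSpace (𝓡 (2 * m + 3)) p) : dForm α p (X p) w =
      mvfderiv (𝓡 (2 * m + 3)) (fun q => α q (X q)) p (reeb hα.1 p) * α p w -
        mvfderiv (𝓡 (2 * m + 3)) (fun q => α q (X q)) p w := by
  obtain ⟨g, hg⟩ := hX.2 α hα
  have h1 := hg p (reeb hα.1 p)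
  rw [lieForm, dForm_skew, dForm_reeb, apply_reeb] at h1
  have h2 := hg p w
  rw [lieForm] at h2
  rw [show mvfderiv (𝓡 (2 * m + 3)) (fun q => α q (X q)) p (reeb hα.1 p) = g p by linarith]
  linarith

/-- The contact Hamiltonian of the bracket of two contact vector fields. -/
theorem IsContactField.apply_mlieBracket {X Y : ∀ p : M, TangentSpace (𝓡 (2 * m + 3)) p}
    (hX : ξ.IsContactField X) (hY : IsSmoothField Y) (hα : ξ.IsDefinedBy α) (p : M) :
    α p (VectorField.mlieBracket (𝓡 (2 * m + 3)) X Y p) =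
      mvfderiv (𝓡 (2 * m + 3)) (fun q => α q (Y q)) p (X p) -
        α p (Y p) * mvfderiv (𝓡 (2 * m + 3)) (fun q => α q (X q)) p (reeb hα.1 p) := by
  rw [OBD.apply_mlieBracket hα.1.1 hX.1 hY, hX.dForm_eq hα]
  ring

theorem IsContactField.mvfderiv_self {X : ∀ p : M, TangentSpace (𝓡 (2 * m + 3)) p}
    (hX : ξ.IsContactField X) (hα : ξ.IsDefinedBy α) (p : M) :
    mvfderiv (𝓡 (2 * m + 3)) (fun q => α q (X q)) p (X p) =
      α p (X p) * mvfderiv (𝓡 (2 * m + 3)) (fun q => α q (X q)) p (reeb hα.1 p) := by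
  have h1 := hX.dForm_eq hα p (X p)
  have h2 := dForm_skew α p (X p) (X p)
  linarith

theorem IsContactField.apply_mlieBracket' {X Y : ∀ p : M, TangentSpace (𝓡 (2 * m + 3)) p}
    (hX : IsSmoothField X) (hY : ξ.IsContactField Y) (hα : ξ.IsDefinedBy α) (p : M) :
    α p (VectorField.mlieBracket (𝓡 (2 * m + 3)) X Y p) =
      α p (X p) * mvfderiv (𝓡 (2 * m + 3)) (fun q => α q (Y q)) p (reeb hα.1 p) -
      mvfderiv (𝓡 (2 * m + 3)) (fun q => α q (X q)) p (Y p) := by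
  rw [OBD.apply_mlieBracket hα.1.1 hX hY.1, dForm_skew, hY.dForm_eq hα]
  ring

end ContactStructure

end ContactFields

/-! ### Maps defining an open book -/

section Derivatives

variable {d : ℕ} {M : Type*} [TopologicalSpace M] [ChartedSpace (EuclideanSpace ℝ (Fin d)) M]
  {F G : Type*} [NormedAddCommGroup F] [NormedSpace ℝ F] [NormedAddCommGroup G] [NormedSpace ℝ G]

theorem mvfderiv_comp_left {f : M → F} {g : F → G} {p : M}
    (hg : DifferentiableAt ℝ g (f p)) (hf : MDifferentiableAt (𝓡 d) 𝓘(ℝ, F) f p)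
    (v : TangentSpace (𝓡 d) p) :
    mvfderiv (𝓡 d) (fun q => g (f q)) p v = fderiv ℝ g (f p) (mvfderiv (𝓡 d) f p v) := by
  have h := mfderiv_comp p hg.mdifferentiableAt hf
  rw [mfderiv_eq_fderiv] at h
  exact congrArg (fun f => f v) h

theorem mvfderiv_clm_comp {f : M → F} (L : F →L[ℝ] G) {p : M}
    (hf : MDifferentiableAt (𝓡 d) 𝓘(ℝ, F) f p) (v : TangentSpace (𝓡 d) p) :
    mvfderiv (𝓡 d) (fun q => L (f q)) p v = L (mvfderiv (𝓡 d) f p v) := by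
  rw [mvfderiv_comp_left L.differentiableAt hf, L.fderiv]

theorem mvfderiv_re {f : M → ℂ} {p : M} (hf : MDifferentiableAt (𝓡 d) 𝓘(ℝ, ℂ) f p)
    (v : TangentSpace (𝓡 d) p) :
    mvfderiv (𝓡 d) (fun q => (f q).re) p v = (mvfderiv (𝓡 d) f p v).re :=
  mvfderiv_clm_comp Complex.reCLM hf v

theorem mvfderiv_im {f : M → ℂ} {p : M} (hf : MDifferentiableAt (𝓡 d) 𝓘(ℝ, ℂ) f p)
    (v : TangentSpace (𝓡 d) p) :
    mvfderiv (𝓡 d) (fun q => (f q).im) p v = (mvfderiv (𝓡 d) f p v).im :=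
  mvfderiv_clm_comp Complex.imCLM hf v

theorem mvfderiv_mul_apply {f g : M → ℝ} {p : M} (hf : MDifferentiableAt (𝓡 d) 𝓘(ℝ, ℝ) f p)
    (hg : MDifferentiableAt (𝓡 d) 𝓘(ℝ, ℝ) g p) (v : TangentSpace (𝓡 d) p) :
    mvfderiv (𝓡 d) (fun q => f q * g q) p v =
      f p * mvfderiv (𝓡 d) g p v + g p * mvfderiv (𝓡 d) f p v := by
  refine (congrArg (fun f => f v) (mvfderiv_fun_mul hf hg)).trans ?_
  simp

theorem mvfderiv_smul_apply {f : M → ℝ} {g : M → F} {p : M}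
    (hf : MDifferentiableAt (𝓡 d) 𝓘(ℝ, ℝ) f p)
    (hg : MDifferentiableAt (𝓡 d) 𝓘(ℝ, F) g p) (v : TangentSpace (𝓡 d) p) :
    mvfderiv (𝓡 d) (fun q => f q • g q) p v =
      f p • mvfderiv (𝓡 d) g p v + mvfderiv (𝓡 d) f p v • g p := by
  refine (congrArg (fun f => f v) (mvfderiv_fun_smul hf hg)).trans ?_
  simp

theorem mvfderiv_congr {f g : M → F} {p : M} (h : f =ᶠ[𝓝 p] g) :
    mvfderiv (𝓡 d) f p = mvfderiv (𝓡 d) g p := by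
  have h1 := h.mfderiv_eq (I := 𝓡 d) (I' := 𝓘(ℝ, F))
  ext v
  exact congrArg (fun f => f v) h1

end Derivatives

/-- Two maps to the plane with the same zeros and the same argument have proportional derivatives
at their common zeros. -/
theorem fderiv_proportional {V : Type*} [AddCommGroup V] [Module ℝ V] {L L' : V →ₗ[ℝ] ℂ}
    (hL : Function.Surjective L) (hL' : Function.Surjective L')
    (h : ∀ v, (‖L' v‖ : ℂ) * L v = ‖L v‖ * L' v) :
    ∃ c : ℝ, 0 < c ∧ ∀ v, L' v = c * L v := by
  have hker (e : V) (he : L e = 1) (v : V) (hv : L v = 0) : L' v = 0 := by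
    have h1 (t : ℝ) : L' e + t * L' v = ‖L' (e + t • v)‖ := by
      have := h (e + t • v)
      simp only [map_add, map_smul, he, hv, smul_zero, add_zero, mul_one, norm_one,
        Complex.ofReal_one, one_mul] at this
      rw [map_add, map_smul, this, Complex.real_smul]
    have him (t : ℝ) : (L' e).im + t * (L' v).im = 0 := by
      have := congrArg Complex.im (h1 t)
      simpa using this
    have hre (t : ℝ) : 0 ≤ (L' e).re + t * (L' v).re := by
      have := congrArg Complex.re (h1 t)
      simp only [Complex.add_re, Complex.mul_re, Complex.ofReal_re, Complex.ofReal_im, zero_mul,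
        sub_zero] at this
      rw [this]; exact norm_nonneg _
    apply Complex.ext
    · by_contra hne
      have := hre (-((L' e).re + 1) / (L' v).re)
      rw [div_mul_cancel₀ _ hne] at this
      linarith
    · have h0 := him 0
      have h1 := him 1
      simp only [Complex.zero_im]
      linarith
  obtain ⟨e₁, he₁⟩ := hL 1
  obtain ⟨e₂, he₂⟩ := hL Complex.I
  have h1 := h e₁
  have h2 := h e₂
  have h3 := h (e₁ + e₂)
  rw [he₁] at h1
  rw [he₂] at h2
  simp only [norm_one, Complex.ofReal_one, one_mul, mul_one, Complex.norm_I] at h1 h2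
  set a := ‖L' e₁‖
  set b := ‖L' e₂‖
  rw [map_add, map_add, he₁, he₂, ← h1, ← h2] at h3
  have hne : ‖(1 : ℂ) + Complex.I‖ ≠ 0 := by
    rw [norm_ne_zero_iff]
    intro h
    simpa using congrArg Complex.re h
  have hab : a = b := by
    have hre := congrArg Complex.re h3
    have him := congrArg Complex.im h3
    simp at hre him
    rw [hre] at him
    exact mul_left_cancel₀ hne him
  have hform (v : V) : L' v = a * L v := by
    have h0 : L (v - (L v).re • e₁ - (L v).im • e₂) = 0 := by
      rw [map_sub, map_sub, map_smul, map_smul, he₁, he₂]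
      apply Complex.ext <;> simp
    have h4 := hker e₁ he₁ _ h0
    rw [map_sub, map_sub, map_smul, map_smul, ← h1, ← h2, ← hab] at h4
    rw [sub_sub, sub_eq_zero] at h4
    rw [h4]
    apply Complex.ext <;> simp <;> ring
  refine ⟨a, lt_of_le_of_ne (norm_nonneg _) fun h0 => ?_, hform⟩
  obtain ⟨v, hv⟩ := hL' 1
  have := hform v
  rw [← h0, hv] at this
  simp at this

namespace OpenBook

section

variable {d : ℕ} {M : Type*} [TopologicalSpace M] [ChartedSpace (EuclideanSpace ℝ (Fin d)) M]
  {O : OpenBook d M}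

theorem contMDiffOn_coe_angle (O : OpenBook d M) :
    ContMDiffOn (𝓡 d) 𝓘(ℝ, ℂ) ∞ (fun q => (O.angle q : ℂ)) O.bindingᶜ := by
  have : Fact (Module.finrank ℝ ℂ = 1 + 1) := ⟨Complex.finrank_real_complex⟩
  exact (contMDiff_coe_sphere (n := 1) (E := ℂ) (m := ∞)).comp_contMDiffOn O.smooth_angle

theorem mdifferentiableAt_angle (O : OpenBook d M) {p : M} (hp : p ∉ O.binding) :
    MDifferentiableAt (𝓡 d) 𝓘(ℝ, ℂ) (fun q => (O.angle q : ℂ)) p :=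
  (O.contMDiffOn_coe_angle.contMDiffAt (O.isClosed_binding.isOpen_compl.mem_nhds hp)).mdifferentiableAt
    (by simp)

/-- The derivative of the angular function in terms of a defining map. -/
theorem IsDefinedOn.dAngle_eq {U : Set M} {h : M → ℂ} (hh : O.IsDefinedOn U h) {p : M}
    (hpU : p ∈ U) (hp : p ∉ O.binding) (v : TangentSpace (𝓡 d) p) :
    ((starRingEnd ℂ) (h p) * mvfderiv (𝓡 d) h p v).im = ‖h p‖ ^ 2 * O.dAngle p v := by
  obtain ⟨hU, hsm, hz, -, hang⟩ := hh
  have hp0 : h p ≠ 0 := fun h0 => hp ((hz p hpU).2 h0)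
  have hd : MDifferentiableAt (𝓡 d) 𝓘(ℝ, ℂ) h p :=
    (hsm.contMDiffAt (hU.mem_nhds hpU)).mdifferentiableAt (by simp)
  have hev : h =ᶠ[𝓝 p] fun q => ‖h q‖ • (O.angle q : ℂ) := by
    filter_upwards [hU.mem_nhds hpU, O.isClosed_binding.isOpen_compl.mem_nhds hp] with q hq hq'
    have h0 : h q ≠ 0 := fun h0 => hq' ((hz q hq).2 h0)
    rw [hang q ⟨hq, hq'⟩, Complex.real_smul]
    field_simp [Complex.ofReal_ne_zero.2 (norm_ne_zero_iff.2 h0)]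
  have hn : MDifferentiableAt (𝓡 d) 𝓘(ℝ, ℝ) (fun q => ‖h q‖) p :=
    ((contDiffAt_norm ℝ hp0 (n := 1)).differentiableAt (by simp)).mdifferentiableAt.comp p hd
  have hconj : (starRingEnd ℂ) (h p) = ‖h p‖ • (starRingEnd ℂ) (O.angle p : ℂ) := by
    conv_lhs => rw [hev.self_of_nhds]
    simp
  rw [mvfderiv_congr hev, mvfderiv_smul_apply hn (O.mdifferentiableAt_angle hp), hconj, dAngle]
  have hc : (starRingEnd ℂ) (O.angle p : ℂ) * (O.angle p : ℂ) = 1 := by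
    rw [mul_comm, Complex.mul_conj, Circle.normSq_coe, Complex.ofReal_one]
  have : ‖h p‖ • (starRingEnd ℂ) (O.angle p : ℂ) *
      (‖h p‖ • mvfderiv (𝓡 d) (fun q => (O.angle q : ℂ)) p v +
        mvfderiv (𝓡 d) (fun q => ‖h q‖) p v • (O.angle p : ℂ)) =
      ((‖h p‖ ^ 2 : ℝ) : ℂ) * ((starRingEnd ℂ) (O.angle p : ℂ) *
        mvfderiv (𝓡 d) (fun q => (O.angle q : ℂ)) p v) +
      ((‖h p‖ * mvfderiv (𝓡 d) (fun q => ‖h q‖) p v : ℝ) : ℂ) *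
        ((starRingEnd ℂ) (O.angle p : ℂ) * (O.angle p : ℂ)) := by
    simp only [Complex.real_smul]; push_cast; ring
  rw [this, hc, mul_one, Complex.add_im, Complex.ofReal_im, add_zero, Complex.im_ofReal_mul]

/-- The derivative of the angular function, as a linear form. -/
def dAngleLin (O : OpenBook d M) (p : M) : TangentSpace (𝓡 d) p →ₗ[ℝ] ℝ :=
  Complex.imLm ∘ₗ (LinearMap.mulLeft ℝ ((starRingEnd ℂ) (O.angle p : ℂ))) ∘ₗ
    (mvfderiv (𝓡 d) (fun q => (O.angle q : ℂ)) p : TangentSpace (𝓡 d) p →ₗ[ℝ] ℂ)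

theorem dAngleLin_apply (O : OpenBook d M) (p : M) (v : TangentSpace (𝓡 d) p) :
    O.dAngleLin p v = O.dAngle p v := rfl

/-- The angular function of an open book is a submersion. -/
theorem exists_dAngle_eq_one (O : OpenBook d M) {p : M} (hp : p ∉ O.binding) :
    ∃ v, O.dAngle p v = 1 := by
  obtain ⟨V, e, hV, hpV, hs, ht, hes, het, hang⟩ := O.locally_trivial (O.angle p)
  have hpe : p ∈ e.source := by rw [hs]; exact ⟨hp, hpV⟩
  have he2 : (e p).2 = O.angle p := hang p hpe
  let γ : ℝ → Circle := fun t => O.angle p * Circle.exp t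
  have hγ : ContMDiff 𝓘(ℝ, ℝ) (𝓡 1) ∞ γ := by
    have h1 : ContMDiff (𝓡 1) (𝓡 1) ∞ (fun z : Circle => O.angle p * z) :=
      contMDiff_mul_left.of_le le_top
    exact h1.comp contMDiff_circleExp
  let c : ℝ → M := fun t => e.symm ((e p).1, γ t)
  have hγ0 : γ 0 = O.angle p := by simp [γ]
  have hc0 : c 0 = p := by
    simp only [c, hγ0, ← he2]
    exact e.left_inv hpe
  have hmem : ∀ t ∈ γ ⁻¹' V, ((e p).1, γ t) ∈ e.target := by
    intro t ht'
    have := e.map_source hpe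
    rw [ht] at this ⊢
    exact ⟨this.1, ht'⟩
  have hopen : IsOpen (γ ⁻¹' V) := hV.preimage hγ.continuous
  have hc : ContMDiffOn 𝓘(ℝ, ℝ) (𝓡 d) ∞ c (γ ⁻¹' V) :=
    het.comp (contMDiff_const.prodMk hγ).contMDiffOn hmem
  have h0 : (0 : ℝ) ∈ γ ⁻¹' V := by
    rw [Set.mem_preimage, hγ0]; exact hpV
  have hcd : MDifferentiableAt 𝓘(ℝ, ℝ) (𝓡 d) c 0 :=
    (hc.contMDiffAt (hopen.mem_nhds h0)).mdifferentiableAt (by simp)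
  have hac : (fun t => (O.angle (c t) : ℂ)) =ᶠ[𝓝 0] fun t => (O.angle p : ℂ) * Complex.exp (t * Complex.I) := by
    filter_upwards [hopen.mem_nhds h0] with t ht'
    have h1 := hang (c t) (e.map_target (hmem t ht'))
    have h2 : e (c t) = ((e p).1, γ t) := e.right_inv (hmem t ht')
    rw [h2] at h1
    rw [← h1]
    simp [γ, Circle.coe_exp]
  have hder : HasDerivAt (fun t : ℝ => (O.angle p : ℂ) * Complex.exp (t * Complex.I))
      ((O.angle p : ℂ) * Complex.I) 0 := by
    have h1 : HasDerivAt (fun t : ℝ => (t : ℂ) * Complex.I) (1 * Complex.I) 0 :=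
      (Complex.ofRealCLM.hasDerivAt (x := (0 : ℝ))).mul_const Complex.I
    have := h1.cexp.const_mul (O.angle p : ℂ)
    simpa using this
  have key : ∀ q : M, c 0 = q → ∃ v : TangentSpace (𝓡 d) q,
      MDifferentiableAt (𝓡 d) 𝓘(ℝ, ℂ) (fun q => (O.angle q : ℂ)) q →
      mvfderiv (𝓡 d) (fun q => (O.angle q : ℂ)) q v = (O.angle p : ℂ) * Complex.I := by
    rintro q rfl
    refine ⟨mfderiv 𝓘(ℝ, ℝ) (𝓡 d) c 0 (1 : ℝ), fun hd => ?_⟩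
    have h1 := mfderiv_comp (0 : ℝ) hd hcd
    rw [mfderiv_eq_fderiv] at h1
    have h2 := congrArg (fun f => f (1 : ℝ)) h1
    refine Eq.trans h2.symm ?_
    have h3 : HasDerivAt ((fun q => (O.angle q : ℂ)) ∘ c) ((O.angle p : ℂ) * Complex.I) 0 :=
      hder.congr_of_eventuallyEq hac
    exact h3.deriv
  obtain ⟨v, hv⟩ := key p hc0
  refine ⟨v, ?_⟩
  rw [dAngle, hv (O.mdifferentiableAt_angle hp), ← mul_assoc, mul_comm ((starRingEnd ℂ) _),
    Complex.mul_conj, Circle.normSq_coe]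
  simp

end

end OpenBook

theorem norm_mul_fderiv_eq {E : Type*} [NormedAddCommGroup E] [NormedSpace ℝ E] {f g : E → ℂ}
    {x : E} (hf : DifferentiableAt ℝ f x) (hg : DifferentiableAt ℝ g x) (hf0 : f x = 0)
    (hg0 : g x = 0) (h : ∀ᶠ y in 𝓝 x, (‖g y‖ : ℂ) * f y = ‖f y‖ * g y) (v : E) :
    (‖fderiv ℝ g x v‖ : ℂ) * fderiv ℝ f x v = ‖fderiv ℝ f x v‖ * fderiv ℝ g x v := by
  have hlim {k : E → ℂ} (hk : DifferentiableAt ℝ k x) (hk0 : k x = 0) :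
      Filter.Tendsto (fun t : ℝ => t⁻¹ • k (x + t • v)) (𝓝[>] 0) (𝓝 (fderiv ℝ k x v)) := by
    have h1 := (hk.hasFDerivAt.hasLineDerivAt v).tendsto_slope_zero_right
    simpa [hk0] using h1
  have h1 := ((Complex.continuous_ofReal.tendsto _).comp (hlim hg hg0).norm).mul (hlim hf hf0)
  have h2 := ((Complex.continuous_ofReal.tendsto _).comp (hlim hf hf0).norm).mul (hlim hg hg0)
  refine tendsto_nhds_unique h1 (h2.congr' ?_)
  have hc : Filter.Tendsto (fun t : ℝ => x + t • v) (𝓝[>] 0) (𝓝 x) := by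
    have : Continuous (fun t : ℝ => x + t • v) := by fun_prop
    simpa using (this.tendsto 0).mono_left nhdsWithin_le_nhds
  filter_upwards [hc.eventually h] with t ht
  simp only [Function.comp, norm_smul, Complex.ofReal_mul]
  simp only [Complex.real_smul]
  linear_combination (-(‖t⁻¹‖ : ℂ) * (t⁻¹ : ℝ)) * ht

namespace OpenBook

section

variable {d : ℕ} {M : Type*} [TopologicalSpace M] [ChartedSpace (EuclideanSpace ℝ (Fin d)) M]
  {O : OpenBook d M}

theorem IsDefinedOn.mdifferentiableAt {U : Set M} {h : M → ℂ} (hh : O.IsDefinedOn U h) {p : M}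
    (hp : p ∈ U) : MDifferentiableAt (𝓡 d) 𝓘(ℝ, ℂ) h p :=
  (hh.2.1.contMDiffAt (hh.1.mem_nhds hp)).mdifferentiableAt (by simp)

theorem IsDefinedBy.contMDiff {h : M → ℂ} (hh : O.IsDefinedBy h) :
    ContMDiff (𝓡 d) 𝓘(ℝ, ℂ) ∞ h := contMDiffOn_univ.1 hh.2.1

theorem IsDefinedBy.mem_iff {h : M → ℂ} (hh : O.IsDefinedBy h) (p : M) :
    p ∈ O.binding ↔ h p = 0 := hh.2.2.1 p trivial

/-- At the binding, any two defining maps have proportional derivatives. -/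
theorem IsDefinedOn.exists_proportional [IsManifold (𝓡 d) ∞ M] {U U' : Set M} {h h' : M → ℂ}
    (hh : O.IsDefinedOn U h) (hh' : O.IsDefinedOn U' h') {p : M} (hp : p ∈ U) (hp' : p ∈ U')
    (hpB : p ∈ O.binding) :
    ∃ c : ℝ, 0 < c ∧ ∀ v, mvfderiv (𝓡 d) h' p v = c * mvfderiv (𝓡 d) h p v := by
  refine fderiv_proportional (L := (mvfderiv (𝓡 d) h p : TangentSpace (𝓡 d) p →ₗ[ℝ] ℂ))
    (L' := (mvfderiv (𝓡 d) h' p : TangentSpace (𝓡 d) p →ₗ[ℝ] ℂ))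
    (hh.2.2.2.1 p ⟨hp, hpB⟩) (hh'.2.2.2.1 p ⟨hp', hpB⟩) fun v => ?_
  have hx := mem_extChartAt_target (I := 𝓡 d) p
  have hsx := extChartAt_to_inv (I := 𝓡 d) p
  have hcont := (contMDiffAt_chart_symm hx).continuousAt
  have hsm {k : M → ℂ} {W : Set M} (hk : O.IsDefinedOn W k) (hpW : p ∈ W) :
      DifferentiableAt ℝ (k ∘ (extChartAt (𝓡 d) p).symm) (extChartAt (𝓡 d) p p) :=
    (contDiffAt_comp_chart_symm hx (by
      rw [hsx]; exact hk.2.1.contMDiffAt (hk.1.mem_nhds hpW))).differentiableAt (by simp)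
  have hzero {k : M → ℂ} {W : Set M} (hk : O.IsDefinedOn W k) (hpW : p ∈ W) :
      (k ∘ (extChartAt (𝓡 d) p).symm) (extChartAt (𝓡 d) p p) = 0 := by
    rw [Function.comp_apply, hsx]; exact (hk.2.2.1 p hpW).1 hpB
  have key := norm_mul_fderiv_eq (hsm hh hp) (hsm hh' hp') (hzero hh hp) (hzero hh' hp') ?_
    (chartDeriv p p v)
  · rw [← mvfderiv_eq_chart_self (hh.mdifferentiableAt hp),
      ← mvfderiv_eq_chart_self (hh'.mdifferentiableAt hp')] at key
    exact key
  · have hn : U ∩ U' ∈ 𝓝 ((extChartAt (𝓡 d) p).symm (extChartAt (𝓡 d) p p)) := by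
      rw [hsx]; exact Filter.inter_mem (hh.1.mem_nhds hp) (hh'.1.mem_nhds hp')
    filter_upwards [hcont.preimage_mem_nhds hn] with y hy
    simp only [Function.comp]
    set q := (extChartAt (𝓡 d) p).symm y
    by_cases hq : q ∈ O.binding
    · rw [(hh.2.2.1 q hy.1).1 hq, (hh'.2.2.1 q hy.2).1 hq]
    · have h1 := hh.2.2.2.2 q ⟨hy.1, hq⟩
      have h2 := hh'.2.2.2.2 q ⟨hy.2, hq⟩
      have h3 : (‖h q‖ : ℂ) ≠ 0 := by
        simpa using fun h0 => hq ((hh.2.2.1 q hy.1).2 h0)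
      have h4 : (‖h' q‖ : ℂ) ≠ 0 := by
        simpa using fun h0 => hq ((hh'.2.2.1 q hy.2).2 h0)
      rw [h1, div_eq_div_iff h3 h4] at h2
      linear_combination h2

theorem IsDefinedBy.smul_pos {h : M → ℂ} (hh : O.IsDefinedBy h) {F : M → ℝ}
    (hF : ContMDiff (𝓡 d) 𝓘(ℝ, ℝ) ∞ F) (hF0 : ∀ p, 0 < F p) :
    O.IsDefinedBy (fun p => F p • h p) := by
  refine ⟨isOpen_univ, (hF.smul hh.contMDiff).contMDiffOn, fun p _ => ?_, fun p hp => ?_,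
    fun p hp => ?_⟩
  · rw [hh.mem_iff, smul_eq_zero]
    simp [(hF0 p).ne']
  · intro z
    obtain ⟨v, hv⟩ := hh.2.2.2.1 p hp ((F p)⁻¹ • z)
    refine ⟨v, ?_⟩
    rw [mvfderiv_smul_apply (hF.mdifferentiableAt (by simp)) (hh.contMDiff.mdifferentiableAt (by simp)),
      hv, (hh.mem_iff p).1 hp.2, smul_zero, add_zero, smul_inv_smul₀ (hF0 p).ne']
  · have := (hF0 p).ne'
    have hn : ‖F p • h p‖ = F p * ‖h p‖ := by rw [norm_smul, Real.norm_of_nonneg (hF0 p).le]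
    change _ = F p • h p / (‖F p • h p‖ : ℂ)
    rw [hh.2.2.2.2 p hp, hn, Complex.real_smul]
    push_cast
    rw [mul_div_mul_left]
    exact_mod_cast this

/-- Every open book decomposition is defined, near its binding, by a map to the plane. -/
theorem exists_isDefinedOn (O : OpenBook d M) : ∃ (U : Set M) (h : M → ℂ),
    O.binding ⊆ U ∧ O.IsDefinedOn U h := by
  obtain ⟨Ψ, hsrc, hopen, hΨ, hΨs, hzero, hang⟩ := O.normal_form
  have h0src {b : M} (hb : b ∈ O.binding) : (b, (0 : ℂ)) ∈ Ψ.source := by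
    rw [hsrc]; exact ⟨hb, by simp⟩
  have hinv {b : M} (hb : b ∈ O.binding) : Ψ.symm b = (b, 0) := by
    conv_lhs => rw [← hzero b hb]
    exact Ψ.left_inv (h0src hb)
  have hsub : O.binding ⊆ Ψ.target := fun b hb => by
    rw [← hzero b hb]; exact Ψ.map_source (h0src hb)
  have hmem {p : M} (hp : p ∈ Ψ.target) : p ∈ O.binding ↔ (Ψ.symm p).2 = 0 := by
    refine ⟨fun hb => by rw [hinv hb], fun h => ?_⟩
    have h1 := Ψ.map_target hp
    have h2 := Ψ.right_inv hp
    rw [hsrc] at h1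
    have : Ψ.symm p = ((Ψ.symm p).1, 0) := Prod.ext rfl h
    rw [this, hzero _ h1.1] at h2
    rw [← h2]; exact h1.1
  have hsnd : ContMDiffOn (𝓡 d) 𝓘(ℝ, ℂ) ∞ (fun p => (Ψ.symm p).2) Ψ.target :=
    contMDiff_snd.comp_contMDiffOn hΨs
  refine ⟨Ψ.target, fun p => (Ψ.symm p).2, hsub, hopen, hsnd, fun p hp => hmem hp, ?_, ?_⟩
  · rintro p ⟨hpt, hpB⟩
    have hd : MDifferentiableAt (𝓡 d) 𝓘(ℝ, ℂ) (fun p => (Ψ.symm p).2) p :=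
      (hsnd.contMDiffAt (hopen.mem_nhds hpt)).mdifferentiableAt (by simp)
    let c : ℂ → M := fun z => Ψ (p, z)
    have hmaps : ∀ z ∈ Metric.ball (0 : ℂ) 1, (p, z) ∈ Ψ.source := fun z hz => by
      rw [hsrc]; exact ⟨hpB, hz⟩
    have hc : ContMDiffOn 𝓘(ℝ, ℂ) (𝓡 d) ∞ c (Metric.ball (0 : ℂ) 1) :=
      hΨ.comp (contMDiff_const.prodMk contMDiff_id).contMDiffOn hmaps
    have hball : Metric.ball (0 : ℂ) 1 ∈ 𝓝 (0 : ℂ) := Metric.ball_mem_nhds _ one_pos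
    have hcd : MDifferentiableAt 𝓘(ℝ, ℂ) (𝓡 d) c 0 :=
      (hc.contMDiffAt hball).mdifferentiableAt (by simp)
    have key : ∀ q : M, c 0 = q → MDifferentiableAt (𝓡 d) 𝓘(ℝ, ℂ) (fun p => (Ψ.symm p).2) q →
        Function.Surjective (mvfderiv (𝓡 d) (fun p => (Ψ.symm p).2) q) := by
      rintro q rfl hd z
      refine ⟨mfderiv 𝓘(ℝ, ℂ) (𝓡 d) c 0 z, ?_⟩
      have h1 := mfderiv_comp (0 : ℂ) hd hcd
      rw [mfderiv_eq_fderiv] at h1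
      refine (congrArg (fun f => f z) h1).symm.trans ?_
      have hid : ((fun p => (Ψ.symm p).2) ∘ c) =ᶠ[𝓝 0] id := by
        filter_upwards [hball] with w hw
        simp only [Function.comp, c]
        rw [Ψ.left_inv (hmaps w hw)]
        rfl
      rw [hid.fderiv_eq, fderiv_id]
      rfl
    exact key p (hzero p hpB) hd
  · rintro p ⟨hpt, hpB⟩
    have h1 := Ψ.map_target hpt
    have h2 := Ψ.right_inv hpt
    rw [hsrc] at h1
    have h3 := hang _ h1.1 _ h1.2 fun h => hpB ((hmem hpt).2 h)
    rwa [Prod.mk.eta, h2] at h3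

variable [T2Space M] [SecondCountableTopology M] [IsManifold (𝓡 d) ∞ M]

/-- Every open book decomposition is defined by a map to the plane. -/
theorem exists_isDefinedBy (O : OpenBook d M) : ∃ h : M → ℂ, O.IsDefinedBy h := by
  have : LocallyCompactSpace M := ChartedSpace.locallyCompactSpace (EuclideanSpace ℝ (Fin d)) M
  have : SigmaCompactSpace M := sigmaCompactSpace_of_locallyCompact_secondCountable
  obtain ⟨U, k, hBU, hk⟩ := O.exists_isDefinedOn
  obtain ⟨U', hU'o, hBU', hU'U⟩ := normal_exists_closure_subset O.isClosed_binding hk.1 hBU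
  obtain ⟨χ, h1, h0, hχ⟩ := exists_contMDiffMap_one_nhds_of_subset_interior (𝓡 d) (n := ⊤)
    O.isClosed_binding (hU'o.interior_eq.symm ▸ hBU' : O.binding ⊆ interior U')
  have hχsm : ContMDiff (𝓡 d) 𝓘(ℝ, ℝ) ∞ χ := χ.contMDiff
  have hone {p : M} (hp : p ∈ O.binding) : ∀ᶠ q in 𝓝 p, χ q = 1 :=
    (eventually_nhdsSet_iff_forall.1 h1) p hp
  have hzero {p : M} (hp : p ∉ U) : ∀ᶠ q in 𝓝 p, χ q = 0 := by
    filter_upwards [isClosed_closure.isOpen_compl.mem_nhds fun h => hp (hU'U h)] with q hq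
    exact h0 q fun hq' => hq (subset_closure hq')
  let h : M → ℂ := fun p => χ p • k p + (1 - χ p) • (O.angle p : ℂ)
  have hoff {p : M} (hp : p ∉ O.binding) : ∃ r : ℝ, 0 < r ∧ h p = r • (O.angle p : ℂ) := by
    by_cases hpU : p ∈ U
    · have hk0 : 0 < ‖k p‖ := norm_pos_iff.2 fun hk0 => hp ((hk.2.2.1 p hpU).2 hk0)
      refine ⟨χ p * ‖k p‖ + (1 - χ p), ?_, ?_⟩
      · obtain ⟨ha, hb⟩ := hχ p
        rcases ha.lt_or_eq with ha | ha
        · have := mul_pos ha hk0; linarith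
        · rw [← ha]; norm_num
      · have h3 : k p = ‖k p‖ • (O.angle p : ℂ) := by
          rw [hk.2.2.2.2 p ⟨hpU, hp⟩, Complex.real_smul]
          have := Complex.ofReal_ne_zero.2 hk0.ne'
          field_simp
        simp only [h]
        conv_lhs => rw [h3]
        rw [smul_smul, ← add_smul]
    · refine ⟨1, one_pos, ?_⟩
      have := (hzero hpU).self_of_nhds
      simp [h, this]
  have hnear {p : M} (hp : p ∈ O.binding) : h =ᶠ[𝓝 p] k := by
    filter_upwards [hone hp] with q hq
    simp [h, hq]
  have hsm : ContMDiff (𝓡 d) 𝓘(ℝ, ℂ) ∞ h := by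
    intro p
    by_cases hp : p ∈ O.binding
    · exact (hk.2.1.contMDiffAt (hk.1.mem_nhds (hBU hp))).congr_of_eventuallyEq (hnear hp)
    · refine ContMDiffAt.add ?_ ((contMDiff_const.sub hχsm).contMDiffAt.smul
        (O.contMDiffOn_coe_angle.contMDiffAt (O.isClosed_binding.isOpen_compl.mem_nhds hp)))
      by_cases hpU : p ∈ U
      · exact hχsm.contMDiffAt.smul (hk.2.1.contMDiffAt (hk.1.mem_nhds hpU))
      · refine (contMDiffAt_const (c := (0 : ℂ))).congr_of_eventuallyEq ?_
        filter_upwards [hzero hpU] with q hq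
        simp [hq]
  refine ⟨h, isOpen_univ, hsm.contMDiffOn, fun p _ => ?_, fun p hp => ?_, fun p hp => ?_⟩
  · by_cases hp : p ∈ O.binding
    · simp only [hp, true_iff]
      rw [(hnear hp).self_of_nhds]
      exact (hk.2.2.1 p (hBU hp)).1 hp
    · simp only [hp, false_iff]
      obtain ⟨r, hr, hr'⟩ := hoff hp
      rw [hr']
      exact smul_ne_zero hr.ne' (Circle.coe_ne_zero _)
  · rw [mvfderiv_congr (hnear hp.2)]
    exact hk.2.2.2.1 p ⟨hBU hp.2, hp.2⟩
  · obtain ⟨r, hr, hr'⟩ := hoff hp.2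
    rw [hr', norm_smul, Real.norm_of_nonneg hr.le, Circle.norm_coe, mul_one, Complex.real_smul,
      mul_div_cancel_left₀ _ (Complex.ofReal_ne_zero.2 hr.ne')]

end

end OpenBook

section ContactPlane

variable {m : ℕ} {M : Type*} [TopologicalSpace M]
  [ChartedSpace (EuclideanSpace ℝ (Fin (2 * m + 3))) M] [IsManifold (𝓡 (2 * m + 3)) ∞ M]
  {α : ∀ p : M, TangentSpace (𝓡 (2 * m + 3)) p →L[ℝ] ℝ} (hα : IsContactForm α)
  {x y F : M → ℝ} (hx : ContMDiff (𝓡 (2 * m + 3)) 𝓘(ℝ, ℝ) ∞ x)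
  (hy : ContMDiff (𝓡 (2 * m + 3)) 𝓘(ℝ, ℝ) ∞ y) (hF : ContMDiff (𝓡 (2 * m + 3)) 𝓘(ℝ, ℝ) ∞ F)

theorem mvfderiv_horizontal (p : M) :
    mvfderiv (𝓡 (2 * m + 3)) y p (horizontal hα hx p) =
      dForm α p (horizontal hα hx p) (horizontal hα hy p) := by
  rw [dForm_skew, dForm_horizontal, apply_horizontal]
  ring

theorem mvfderiv_horizontal_skew (p : M) :
    mvfderiv (𝓡 (2 * m + 3)) y p (horizontal hα hx p) =
      -mvfderiv (𝓡 (2 * m + 3)) x p (horizontal hα hy p) := by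
  rw [mvfderiv_horizontal hα hx hy, dForm_skew, ← mvfderiv_horizontal hα hy hx]

theorem mvfderiv_horizontal_self (p : M) :
    mvfderiv (𝓡 (2 * m + 3)) x p (horizontal hα hx p) = 0 := by
  have := mvfderiv_horizontal_skew hα hx hx p
  linarith

theorem horizontal_eq {p : M} {z : TangentSpace (𝓡 (2 * m + 3)) p} (hz : α p z = 0)
    {c : ℝ} (h : ∀ w, dForm α p z w = c * α p w - mvfderiv (𝓡 (2 * m + 3)) x p w) :
    z = horizontal hα hx p := by
  have hc : c = mvfderiv (𝓡 (2 * m + 3)) x p (reeb hα p) := by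
    have := h (reeb hα p)
    rw [dForm_skew, dForm_reeb, apply_reeb] at this
    linarith
  have h0 : z - horizontal hα hx p = 0 := by
    refine (hα.isContactPair p).eq_zero ?_ fun w => ?_
    · refine ((α p).map_sub _ _).trans ?_
      rw [hz, apply_horizontal, sub_zero]
    · rw [map_sub, LinearMap.sub_apply, dFormLin_apply, dFormLin_apply, h, dForm_horizontal, hc,
        sub_self]
  exact sub_eq_zero.1 h0

theorem horizontal_mul (p : M) : horizontal hα (hF.mul hx) p =
    F p • horizontal hα hx p + x p • horizontal hα hF p := by
  symm
  refine horizontal_eq hα (hF.mul hx) ?_ (c := F p * mvfderiv (𝓡 (2 * m + 3)) x p (reeb hα p) +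
    x p * mvfderiv (𝓡 (2 * m + 3)) F p (reeb hα p)) fun w => ?_
  · rw [map_add, map_smul, map_smul, apply_horizontal, apply_horizontal]
    simp
  · have h1 := mvfderiv_mul_apply (hF.mdifferentiableAt (x := p) (by simp))
      (hx.mdifferentiableAt (by simp)) w
    have h2 : mvfderiv (𝓡 (2 * m + 3)) (F * x) p w = mvfderiv (𝓡 (2 * m + 3)) (fun q => F q * x q) p w := rfl
    rw [h2, h1, ← dFormLin_apply]
    simp only [map_add, map_smul, LinearMap.add_apply, LinearMap.smul_apply, smul_eq_mul,
      dFormLin_apply, dForm_horizontal]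
    ring

/-- The contact bracket `{x, y}` is the sum of `x R(y) - y R(x)` and of `Λ(dx, dy)`. -/
theorem mvfderiv_contactField_sub (p : M) :
    mvfderiv (𝓡 (2 * m + 3)) y p (contactField hα hx p) -
      y p * mvfderiv (𝓡 (2 * m + 3)) x p (reeb hα p) =
    x p * mvfderiv (𝓡 (2 * m + 3)) y p (reeb hα p) -
      y p * mvfderiv (𝓡 (2 * m + 3)) x p (reeb hα p) +
      mvfderiv (𝓡 (2 * m + 3)) y p (horizontal hα hx p) := by
  rw [contactField, map_add, map_smul, smul_eq_mul]
  ring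

include hx hy hF in
theorem reeb_part_mul (p : M) :
    F p * x p * mvfderiv (𝓡 (2 * m + 3)) (fun q => F q * y q) p (reeb hα p) -
      F p * y p * mvfderiv (𝓡 (2 * m + 3)) (fun q => F q * x q) p (reeb hα p) =
    F p ^ 2 * (x p * mvfderiv (𝓡 (2 * m + 3)) y p (reeb hα p) -
      y p * mvfderiv (𝓡 (2 * m + 3)) x p (reeb hα p)) := by
  have hFd := hF.mdifferentiableAt (x := p) (by simp)
  rw [mvfderiv_mul_apply hFd (hx.mdifferentiableAt (by simp)),
    mvfderiv_mul_apply hFd (hy.mdifferentiableAt (by simp))]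
  ring

include hy in
theorem horizontal_part_mul (p : M) :
    mvfderiv (𝓡 (2 * m + 3)) (fun q => F q * y q) p (horizontal hα (hF.mul hx) p) =
    F p ^ 2 * mvfderiv (𝓡 (2 * m + 3)) y p (horizontal hα hx p) +
    F p * (y p * mvfderiv (𝓡 (2 * m + 3)) F p (horizontal hα hx p) -
      x p * mvfderiv (𝓡 (2 * m + 3)) F p (horizontal hα hy p)) := by
  have hFd := hF.mdifferentiableAt (x := p) (by simp)
  have h1 := mvfderiv_horizontal_skew hα hF hy p
  have h2 := mvfderiv_horizontal_self hα hF p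
  rw [mvfderiv_mul_apply hFd (hy.mdifferentiableAt (by simp)), horizontal_mul hα hx hF]
  simp only [map_add, map_smul, smul_eq_mul, h1, h2]
  ring

end ContactPlane

section Binding

variable {m : ℕ} {M : Type*} [TopologicalSpace M]
  [ChartedSpace (EuclideanSpace ℝ (Fin (2 * m + 3))) M] [IsManifold (𝓡 (2 * m + 3)) ∞ M]
  {α : ∀ p : M, TangentSpace (𝓡 (2 * m + 3)) p →L[ℝ] ℝ} (hα : IsContactForm α)
  {O : OpenBook (2 * m + 3) M}

theorem OpenBook.PagesPositive.dAngle_reeb_pos (h : O.PagesPositive α) {p : M}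
    (hp : p ∉ O.binding) : 0 < O.dAngle p (reeb hα p) := by
  refine (hα.isContactPair p).reeb_pos_of_pow_pos (θ := O.dAngleLin p) (apply_reeb hα p)
    (dForm_reeb hα p) ?_ (h p hp)
  intro h0
  obtain ⟨v, hv⟩ := O.exists_dAngle_eq_one hp
  rw [← O.dAngleLin_apply, h0] at hv
  simp at hv

theorem OpenBook.pagesPositive_of_dAngle_reeb_pos
    (h : ∀ p ∉ O.binding, 0 < O.dAngle p (reeb hα p)) : O.PagesPositive α :=
  fun p hp ν v hν hv hpos => (hα.isContactPair p).pow_pos_of_reeb (θ := O.dAngleLin p)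
    (apply_reeb hα p) (dForm_reeb hα p) (h p hp) ν v hν hv hpos

theorem im_conj_mul (z w : ℂ) : ((starRingEnd ℂ) z * w).im = z.re * w.im - w.re * z.im := by
  simp; ring

section

variable {h : M → ℂ} (hh : O.IsDefinedBy h) {x y : M → ℝ}
  (hx : ContMDiff (𝓡 (2 * m + 3)) 𝓘(ℝ, ℝ) ∞ x) (hy : ContMDiff (𝓡 (2 * m + 3)) 𝓘(ℝ, ℝ) ∞ y)
  (hxy : h = fun p => (⟨x p, y p⟩ : ℂ))
include hxy

omit [IsManifold (𝓡 (2 * m + 3)) ∞ M] in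
include hh in
theorem OpenBook.IsDefinedBy.mvfderiv_eq (p : M) (v : TangentSpace (𝓡 (2 * m + 3)) p) :
    mvfderiv (𝓡 (2 * m + 3)) h p v =
      ⟨mvfderiv (𝓡 (2 * m + 3)) x p v, mvfderiv (𝓡 (2 * m + 3)) y p v⟩ := by
  have hd := hh.contMDiff.mdifferentiableAt (x := p) (by simp)
  have h1 := mvfderiv_re hd v
  have h2 := mvfderiv_im hd v
  subst hxy
  exact Complex.ext h1.symm h2.symm

omit [IsManifold (𝓡 (2 * m + 3)) ∞ M] in
include hh in
theorem OpenBook.IsDefinedBy.finrank_ker {p : M} (hp : p ∈ O.binding) :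
    ∃ T : Submodule ℝ (TangentSpace (𝓡 (2 * m + 3)) p),
      (∀ u, u ∈ T ↔ mvfderiv (𝓡 (2 * m + 3)) x p u = 0 ∧ mvfderiv (𝓡 (2 * m + 3)) y p u = 0) ∧
      Module.finrank ℝ T = 2 * m + 1 := by
  refine ⟨LinearMap.ker (mvfderiv (𝓡 (2 * m + 3)) h p : TangentSpace (𝓡 (2 * m + 3)) p →ₗ[ℝ] ℂ),
    fun u => ?_, ?_⟩
  · rw [LinearMap.mem_ker]
    change mvfderiv (𝓡 (2 * m + 3)) h p u = 0 ↔ _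
    rw [hh.mvfderiv_eq hxy, Complex.ext_iff]
    rfl
  · have h1 := LinearMap.finrank_range_add_finrank_ker
      (mvfderiv (𝓡 (2 * m + 3)) h p : TangentSpace (𝓡 (2 * m + 3)) p →ₗ[ℝ] ℂ)
    rw [LinearMap.range_eq_top.2 (hh.2.2.2.1 p ⟨trivial, hp⟩), finrank_top,
      Complex.finrank_real_complex] at h1
    have h2 : Module.finrank ℝ (TangentSpace (𝓡 (2 * m + 3)) p) = 2 * m + 3 :=
      finrank_euclideanSpace_fin (𝕜 := ℝ) (n := 2 * m + 3)
    omega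

include hh hy in
/-- The binding is a positive contact submanifold exactly when the horizontal part of the contact
bracket of the components of a defining map is positive along it. -/
theorem OpenBook.IsDefinedBy.horizontal_pos (hB : O.BindingPositive α) {p : M}
    (hp : p ∈ O.binding) : 0 < mvfderiv (𝓡 (2 * m + 3)) y p (horizontal hα hx p) := by
  obtain ⟨T, hT, hdim⟩ := hh.finrank_ker hxy hp
  obtain ⟨e₁, he₁⟩ := hh.2.2.2.1 p ⟨trivial, hp⟩ 1
  obtain ⟨e₂, he₂⟩ := hh.2.2.2.1 p ⟨trivial, hp⟩ Complex.I
  rw [hh.mvfderiv_eq hxy, Complex.ext_iff] at he₁ he₂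
  obtain ⟨U, h', hpU, hh', hpos⟩ := hB p hp
  obtain ⟨c, hc, hprop⟩ := IsDefinedOn.exists_proportional hh hh' trivial hpU hp
  rw [mvfderiv_horizontal hα hx hy]
  refine (hα.isContactPair p).hamiltonian_pos_of_binding
    (x := (mvfderiv (𝓡 (2 * m + 3)) x p : TangentSpace (𝓡 (2 * m + 3)) p →ₗ[ℝ] ℝ))
    (y := (mvfderiv (𝓡 (2 * m + 3)) y p : TangentSpace (𝓡 (2 * m + 3)) p →ₗ[ℝ] ℝ)) hT hdim
    (apply_horizontal hα hx p) (apply_horizontal hα hy p) (dForm_horizontal hα hx p)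
    (dForm_horizontal hα hy p) he₁.1 he₁.2 he₂.1 he₂.2 fun u₁ u₂ w hu hw hvol => ?_
  refine hpos u₁ u₂ w ?_ (fun i => ?_) hvol
  · rw [hprop, hprop, hh.mvfderiv_eq hxy, hh.mvfderiv_eq hxy, map_mul, Complex.conj_ofReal,
      mul_mul_mul_comm, ← Complex.ofReal_mul, Complex.im_ofReal_mul, im_conj_mul]
    exact mul_pos (mul_pos hc hc) hu
  · rw [hprop, hh.mvfderiv_eq hxy]
    have h1 := (hw i).1
    have h2 := (hw i).2
    simp only [ContinuousLinearMap.coe_coe] at h1 h2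
    rw [h1, h2]
    exact mul_zero _

include hh hy in
theorem OpenBook.IsDefinedBy.bindingPositive
    (hpos : ∀ p ∈ O.binding, 0 < mvfderiv (𝓡 (2 * m + 3)) y p (horizontal hα hx p)) :
    O.BindingPositive α := by
  intro p hp
  obtain ⟨T, hT, hdim⟩ := hh.finrank_ker hxy hp
  obtain ⟨e₁, he₁⟩ := hh.2.2.2.1 p ⟨trivial, hp⟩ 1
  obtain ⟨e₂, he₂⟩ := hh.2.2.2.1 p ⟨trivial, hp⟩ Complex.I
  rw [hh.mvfderiv_eq hxy, Complex.ext_iff] at he₁ he₂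
  have hs := hpos p hp
  rw [mvfderiv_horizontal hα hx hy] at hs
  refine ⟨Set.univ, h, trivial, hh, fun u₁ u₂ w hu hw hvol => ?_⟩
  rw [im_conj_mul, hh.mvfderiv_eq hxy, hh.mvfderiv_eq hxy] at hu
  refine (hα.isContactPair p).binding_wedge_pos
    (x := (mvfderiv (𝓡 (2 * m + 3)) x p : TangentSpace (𝓡 (2 * m + 3)) p →ₗ[ℝ] ℝ))
    (y := (mvfderiv (𝓡 (2 * m + 3)) y p : TangentSpace (𝓡 (2 * m + 3)) p →ₗ[ℝ] ℝ)) hT hdim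
    (apply_horizontal hα hx p) (apply_horizontal hα hy p) (dForm_horizontal hα hx p)
    (dForm_horizontal hα hy p) he₁.1 he₁.2 he₂.1 he₂.2 hs u₁ u₂ (fun i => (hT _).2 ?_) hu hvol
  have := hw i
  rw [hh.mvfderiv_eq hxy, Complex.ext_iff] at this
  exact this

include hh in
omit [IsManifold (𝓡 (2 * m + 3)) ∞ M] in
theorem OpenBook.IsDefinedBy.sq_mul_dAngle {p : M} (hp : p ∉ O.binding)
    (v : TangentSpace (𝓡 (2 * m + 3)) p) :
    (x p ^ 2 + y p ^ 2) * O.dAngle p v =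
      x p * mvfderiv (𝓡 (2 * m + 3)) y p v - y p * mvfderiv (𝓡 (2 * m + 3)) x p v := by
  have h1 := IsDefinedOn.dAngle_eq hh (p := p) trivial hp v
  rw [im_conj_mul, hh.mvfderiv_eq hxy] at h1
  rw [← Complex.normSq_eq_norm_sq] at h1
  subst hxy
  simp only [Complex.normSq_apply] at h1
  linarith

end

end Binding

section SmallFunction

variable {d : ℕ} {M : Type*} [TopologicalSpace M] [ChartedSpace (EuclideanSpace ℝ (Fin d)) M]

theorem mvfderiv_sum_apply {ι : Type*} (s : Finset ι) {f : ι → M → ℝ} {p : M}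
    (hf : ∀ i, MDifferentiableAt (𝓡 d) 𝓘(ℝ, ℝ) (f i) p) (v : TangentSpace (𝓡 d) p) :
    mvfderiv (𝓡 d) (fun q => ∑ i ∈ s, f i q) p v = ∑ i ∈ s, mvfderiv (𝓡 d) (f i) p v := by
  classical
  have key : MDifferentiableAt (𝓡 d) 𝓘(ℝ, ℝ) (fun q => ∑ i ∈ s, f i q) p ∧
      mvfderiv (𝓡 d) (fun q => ∑ i ∈ s, f i q) p v = ∑ i ∈ s, mvfderiv (𝓡 d) (f i) p v := by
    induction s using Finset.induction_on with
    | empty =>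
      simp only [Finset.sum_empty]
      refine ⟨mdifferentiableAt_const, ?_⟩
      rw [mvfderiv_const]; rfl
    | insert i s hi ih =>
      simp only [Finset.sum_insert hi]
      refine ⟨(hf i).add ih.1, ?_⟩
      refine (congrArg (fun f => f v) (mvfderiv_fun_add (hf i) ih.1)).trans ?_
      rw [add_apply, ih.2]
  exact key.2

variable [IsManifold (𝓡 d) ∞ M] [T2Space M] [SecondCountableTopology M]

/-- There are positive smooth functions which are arbitrarily small, together with their
derivatives along two given vector fields. -/
theorem exists_contMDiff_small {Z₁ Z₂ : ∀ p : M, TangentSpace (𝓡 d) p} (hZ₁ : IsSmoothField Z₁)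
    (hZ₂ : IsSmoothField Z₂) {e : M → ℝ} (he : Continuous e) (he0 : ∀ p, 0 < e p) :
    ∃ δ : M → ℝ, ContMDiff (𝓡 d) 𝓘(ℝ, ℝ) ∞ δ ∧ (∀ p, 0 < δ p) ∧
      ∀ p, δ p + |mvfderiv (𝓡 d) δ p (Z₁ p)| + |mvfderiv (𝓡 d) δ p (Z₂ p)| < e p := by
  classical
  have : LocallyCompactSpace M := ChartedSpace.locallyCompactSpace (EuclideanSpace ℝ (Fin d)) M
  have : SigmaCompactSpace M := sigmaCompactSpace_of_locallyCompact_secondCountable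
  choose K hK hKp using fun p : M => exists_compact_mem_nhds p
  obtain ⟨f, hf⟩ := SmoothPartitionOfUnity.exists_isSubordinate (𝓡 d) (isClosed_univ (X := M))
    (fun p => interior (K p)) (fun _ => isOpen_interior)
    (fun p _ => Set.mem_iUnion.2 ⟨p, mem_interior_iff_mem_nhds.2 (hKp p)⟩)
  have hcomp (i : M) : IsCompact (tsupport (f i)) :=
    (hK i).of_isClosed_subset (isClosed_tsupport _) ((hf i).trans interior_subset)
  have hsm (i : M) : ContMDiff (𝓡 d) 𝓘(ℝ, ℝ) ∞ (f i) := (f i).contMDiff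
  have hlf : LocallyFinite fun i => tsupport (f i) := f.locallyFinite.closure
  have hfin (i : M) := hlf.finite_nonempty_inter_compact (hcomp i)
  let N : M → ℕ := fun i => (hfin i).toFinset.card
  let g : M → M → ℝ := fun i p =>
    f i p + |mvfderiv (𝓡 d) (f i) p (Z₁ p)| + |mvfderiv (𝓡 d) (f i) p (Z₂ p)|
  have hg0 (i p : M) (hp : p ∉ tsupport (f i)) : g i p = 0 := by
    have hev : (f i : M → ℝ) =ᶠ[𝓝 p] fun _ => 0 := by
      filter_upwards [(isClosed_tsupport (f i)).isOpen_compl.mem_nhds hp] with q hq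
      exact image_eq_zero_of_notMem_tsupport hq
    simp only [g]
    rw [mvfderiv_congr hev, hev.self_of_nhds, mvfderiv_const]
    simp
  have hgc (i : M) : Continuous (g i) :=
    ((hsm i).continuous.add (hZ₁.contMDiff_mvfderiv (hsm i)).continuous.abs).add
      (hZ₂.contMDiff_mvfderiv (hsm i)).continuous.abs
  have hgnn (i p : M) : 0 ≤ g i p :=
    add_nonneg (add_nonneg (f.nonneg i p) (abs_nonneg _)) (abs_nonneg _)
  have hc (i : M) : ∃ c : ℝ, 0 < c ∧ ∀ p, c * g i p ≤ e p / (N i + 1) := by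
    have hcs : HasCompactSupport fun p => (N i + 1) * g i p / e p := by
      refine HasCompactSupport.intro (hcomp i) fun p hp => ?_
      rw [hg0 i p hp]; simp
    obtain ⟨C, hC⟩ := hcs.exists_bound_of_continuous
      ((continuous_const.mul (hgc i)).div he fun p => (he0 p).ne')
    refine ⟨(|C| + 1)⁻¹, by positivity, fun p => ?_⟩
    have h1 := (le_abs_self _).trans ((hC p).trans (le_abs_self C))
    rw [div_le_iff₀ (he0 p)] at h1
    rw [inv_mul_le_iff₀ (by positivity), mul_div_assoc', le_div_iff₀ (by positivity)]
    have := he0 p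
    nlinarith
  choose c hc0 hc using hc
  let δ : M → ℝ := fun p => ∑ᶠ i, c i * f i p
  have hlf' : LocallyFinite fun i => Function.support fun p => c i * f i p :=
    f.locallyFinite.subset fun i => Function.support_mul_subset_right _ _
  have hδ : ContMDiff (𝓡 d) 𝓘(ℝ, ℝ) ∞ δ :=
    contMDiff_finsum (fun i => contMDiff_const.mul (hsm i)) hlf'
  have hloc (p : M) : ∃ s : Finset M, (∀ i, f i p ≠ 0 → i ∈ s) ∧
      δ =ᶠ[𝓝 p] fun q => ∑ i ∈ s, c i * f i q := by
    obtain ⟨W, hW, hWf⟩ := hlf p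
    refine ⟨hWf.toFinset, fun i hi => ?_, ?_⟩
    · rw [Set.Finite.mem_toFinset]
      exact ⟨p, subset_tsupport _ hi, mem_of_mem_nhds hW⟩
    · filter_upwards [hW] with q hq
      refine finsum_eq_sum_of_support_subset _ fun i hi => ?_
      rw [Set.Finite.coe_toFinset]
      exact ⟨q, subset_tsupport _ (right_ne_zero_of_mul hi), hq⟩
  refine ⟨δ, hδ, fun p => ?_, fun p => ?_⟩
  · obtain ⟨s, hs, hev⟩ := hloc p
    rw [hev.self_of_nhds]
    obtain ⟨i, hi⟩ := f.exists_pos_of_mem (Set.mem_univ p)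
    exact Finset.sum_pos' (fun j _ => mul_nonneg (hc0 j).le (f.nonneg j p))
      ⟨i, hs i hi.ne', mul_pos (hc0 i) hi⟩
  · obtain ⟨s, hs, hev⟩ := hloc p
    have hd (i : M) : MDifferentiableAt (𝓡 d) 𝓘(ℝ, ℝ) (fun q => c i * f i q) p :=
      (contMDiff_const.mul (hsm i)).mdifferentiableAt (by simp)
    have hder (v : TangentSpace (𝓡 d) p) :
        mvfderiv (𝓡 d) δ p v = ∑ i ∈ s, c i * mvfderiv (𝓡 d) (f i) p v := by
      rw [mvfderiv_congr hev, mvfderiv_sum_apply s hd]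
      refine Finset.sum_congr rfl fun i _ => ?_
      rw [mvfderiv_mul_apply mdifferentiableAt_const ((hsm i).mdifferentiableAt (by simp)),
        mvfderiv_const]
      simp
    have habs (v : TangentSpace (𝓡 d) p) :
        |mvfderiv (𝓡 d) δ p v| ≤ ∑ i ∈ s, c i * |mvfderiv (𝓡 d) (f i) p v| := by
      rw [hder]
      refine (Finset.abs_sum_le_sum_abs _ _).trans (le_of_eq (Finset.sum_congr rfl fun i _ => ?_))
      rw [abs_mul, abs_of_pos (hc0 i)]
    have h1 : δ p + |mvfderiv (𝓡 d) δ p (Z₁ p)| + |mvfderiv (𝓡 d) δ p (Z₂ p)| ≤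
        ∑ i ∈ s, c i * g i p := by
      refine (add_le_add (add_le_add hev.self_of_nhds.le (habs _)) (habs _)).trans (le_of_eq ?_)
      rw [← Finset.sum_add_distrib, ← Finset.sum_add_distrib]
      exact Finset.sum_congr rfl fun i _ => by simp only [g]; ring
    refine h1.trans_lt ?_
    set s' := s.filter fun i => p ∈ tsupport (f i) with hs'
    have h2 : ∑ i ∈ s, c i * g i p = ∑ i ∈ s', c i * g i p := by
      refine (Finset.sum_filter_of_ne fun i _ hne => ?_).symm
      by_contra hp
      exact hne (by rw [hg0 i p hp, mul_zero])
    have h3 : ∀ i ∈ s', c i * g i p ≤ e p / (s'.card + 1) := by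
      intro i hi
      refine (hc i p).trans ?_
      have hcard : s'.card ≤ N i := by
        refine Finset.card_le_card fun j hj => ?_
        rw [Set.Finite.mem_toFinset]
        exact ⟨p, (Finset.mem_filter.1 hj).2, (Finset.mem_filter.1 hi).2⟩
      have := (he0 p).le
      gcongr
    rw [h2]
    refine (Finset.sum_le_sum h3).trans_lt ?_
    rw [Finset.sum_const, nsmul_eq_mul, mul_div_assoc', div_lt_iff₀ (by positivity)]
    have := he0 p
    nlinarith

end SmallFunction

section FromOpenBooks

variable {m : ℕ} {M : Type*} [TopologicalSpace M] [T2Space M] [SecondCountableTopology M]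
  [ChartedSpace (EuclideanSpace ℝ (Fin (2 * m + 3))) M] [IsManifold (𝓡 (2 * m + 3)) ∞ M]
  {α : ∀ p : M, TangentSpace (𝓡 (2 * m + 3)) p →L[ℝ] ℝ} (hα : IsContactForm α)
  {O : OpenBook (2 * m + 3) M}

theorem smul_mk_eq (F x y : ℝ) : F • (⟨x, y⟩ : ℂ) = ⟨F * x, F * y⟩ := by
  apply Complex.ext <;> simp

/-- A supporting open book is defined by a map whose components have positive horizontal bracket on
the preimage of the unit disk. -/
theorem OpenBook.BindingPositive.exists_isDefinedBy (hB : O.BindingPositive α) :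
    ∃ (x y : M → ℝ) (hx : ContMDiff (𝓡 (2 * m + 3)) 𝓘(ℝ, ℝ) ∞ x)
      (_ : ContMDiff (𝓡 (2 * m + 3)) 𝓘(ℝ, ℝ) ∞ y),
      O.IsDefinedBy (fun p => (⟨x p, y p⟩ : ℂ)) ∧
      ∀ p, x p ^ 2 + y p ^ 2 < 1 →
        0 < mvfderiv (𝓡 (2 * m + 3)) y p (horizontal hα hx p) := by
  obtain ⟨h, hh⟩ := O.exists_isDefinedBy
  set x : M → ℝ := fun p => (h p).re with hxdef
  set y : M → ℝ := fun p => (h p).im with hydef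
  have hx : ContMDiff (𝓡 (2 * m + 3)) 𝓘(ℝ, ℝ) ∞ x :=
    Complex.reCLM.contDiff.contMDiff.comp hh.contMDiff
  have hy : ContMDiff (𝓡 (2 * m + 3)) 𝓘(ℝ, ℝ) ∞ y :=
    Complex.imCLM.contDiff.contMDiff.comp hh.contMDiff
  have hxy : h = fun p => (⟨x p, y p⟩ : ℂ) := rfl
  set D : M → ℝ := fun p => mvfderiv (𝓡 (2 * m + 3)) y p (horizontal hα hx p) with hD
  have hDc : Continuous D :=
    ((isSmoothField_horizontal hα hx).contMDiff_mvfderiv hy).continuous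
  have hDB (p : M) (hp : p ∈ O.binding) : 0 < D p := hh.horizontal_pos hα hx hy hxy hB hp
  obtain ⟨δ, hδ, hδ0, hsmall⟩ := exists_contMDiff_small (isSmoothField_horizontal hα hx)
    (isSmoothField_horizontal hα hy) (e := fun p => max ‖h p‖ (D p) / 2)
    ((hh.contMDiff.continuous.norm.max hDc).div_const 2) (fun p => by
      by_cases hp : p ∈ O.binding
      · exact half_pos (lt_max_of_lt_right (hDB p hp))
      · exact half_pos (lt_max_of_lt_left (norm_pos_iff.2 fun h0 => hp ((hh.mem_iff p).2 h0))))
  set u : M → ℝ := fun p => (δ p)⁻¹ with hudef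
  have hu : ContMDiff (𝓡 (2 * m + 3)) 𝓘(ℝ, ℝ) ∞ u := hδ.inv₀ fun p => (hδ0 p).ne'
  have hu0 (p : M) : 0 < u p := inv_pos.2 (hδ0 p)
  have hdu (p : M) (v : TangentSpace (𝓡 (2 * m + 3)) p) :
      mvfderiv (𝓡 (2 * m + 3)) u p v = -(u p ^ 2 * mvfderiv (𝓡 (2 * m + 3)) δ p v) := by
    have h1 := mvfderiv_mul_apply (hδ.mdifferentiableAt (x := p) (by simp))
      (hu.mdifferentiableAt (x := p) (by simp)) v
    have h2 : (fun q => δ q * u q) = fun _ => 1 := by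
      funext q; exact mul_inv_cancel₀ (hδ0 q).ne'
    have h4 : u p * δ p = 1 := inv_mul_cancel₀ (hδ0 p).ne'
    rw [h2, mvfderiv_const] at h1
    have h3 : δ p * mvfderiv (𝓡 (2 * m + 3)) u p v + u p * mvfderiv (𝓡 (2 * m + 3)) δ p v = 0 :=
      h1.symm
    linear_combination u p * h3 - mvfderiv (𝓡 (2 * m + 3)) u p v * h4
  refine ⟨fun p => u p * x p, fun p => u p * y p, hu.mul hx, hu.mul hy, ?_, fun p hp => ?_⟩
  · have := hh.smul_pos hu hu0
    rw [hxy] at this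
    simpa only [smul_mk_eq] using this
  · have h1 := horizontal_part_mul hα hx hy hu p
    refine lt_of_lt_of_eq ?_ h1.symm
    rw [hdu, hdu]
    have hu4 : u p * δ p = 1 := inv_mul_cancel₀ (hδ0 p).ne'
    have hnorm : ‖h p‖ ^ 2 = x p ^ 2 + y p ^ 2 := by
      rw [← Complex.normSq_eq_norm_sq, Complex.normSq_apply]; ring
    have hlt : u p * ‖h p‖ < 1 := by
      have : (u p * ‖h p‖) ^ 2 < 1 := by rw [mul_pow, hnorm]; linarith
      exact (sq_lt_one_iff₀ (mul_nonneg (hu0 p).le (norm_nonneg _))).1 this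
    have hlt' : ‖h p‖ < δ p := by
      have := mul_lt_mul_of_pos_left hlt (hδ0 p)
      rwa [← mul_assoc, mul_comm (δ p), hu4, one_mul, mul_one] at this
    have hs := hsmall p
    set s₁ := mvfderiv (𝓡 (2 * m + 3)) δ p (horizontal hα hx p)
    set s₂ := mvfderiv (𝓡 (2 * m + 3)) δ p (horizontal hα hy p)
    have ha1 := abs_nonneg s₁
    have ha2 := abs_nonneg s₂
    have hDp : ‖h p‖ < D p := by
      by_contra hcon
      rw [max_eq_left (not_lt.1 hcon)] at hs
      have := norm_nonneg (h p)
      linarith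
    rw [max_eq_right hDp.le] at hs
    have hD0 : 0 < D p := (norm_nonneg _).trans_lt hDp
    have hxn : u p * |x p| ≤ 1 :=
      (mul_le_mul_of_nonneg_left (Complex.abs_re_le_norm (h p)) (hu0 p).le).trans hlt.le
    have hyn : u p * |y p| ≤ 1 :=
      (mul_le_mul_of_nonneg_left (Complex.abs_im_le_norm (h p)) (hu0 p).le).trans hlt.le
    have hb1 : u p * y p * s₁ ≤ |s₁| := by
      refine (le_abs_self _).trans ?_
      rw [abs_mul, abs_mul, abs_of_pos (hu0 p)]
      exact mul_le_of_le_one_left ha1 hyn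
    have hb2 : -(u p * x p * s₂) ≤ |s₂| := by
      refine (neg_le_abs _).trans ?_
      rw [abs_mul, abs_mul, abs_of_pos (hu0 p)]
      exact mul_le_of_le_one_left ha2 hxn
    have hfin : 0 < D p - (u p * y p * s₁ - u p * x p * s₂) := by
      have := hδ0 p
      linarith
    have := mul_pos (pow_pos (hu0 p) 2) hfin
    calc 0 < _ := this
      _ = _ := by simp only [D]; ring

/-- From supporting open books to pairs of contact vector fields. -/
theorem OpenBook.exists_bracket_pos (hB : O.BindingPositive α) (hP : O.PagesPositive α) :
    ∃ (x y : M → ℝ) (hx : ContMDiff (𝓡 (2 * m + 3)) 𝓘(ℝ, ℝ) ∞ x)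
      (_ : ContMDiff (𝓡 (2 * m + 3)) 𝓘(ℝ, ℝ) ∞ y),
      O.IsDefinedBy (fun p => (⟨x p, y p⟩ : ℂ)) ∧
      ∀ p, 0 < mvfderiv (𝓡 (2 * m + 3)) y p (contactField hα hx p) -
        y p * mvfderiv (𝓡 (2 * m + 3)) x p (reeb hα p) := by
  obtain ⟨x, y, hx, hy, hh, hpos⟩ := hB.exists_isDefinedBy hα
  let b : ℝ → ℝ := fun t => Real.smoothTransition (1 - t)
  have hb : ContDiff ℝ ∞ b := Real.smoothTransition.contDiff.comp (contDiff_const.sub contDiff_id)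
  have hb0 (t : ℝ) : 0 ≤ b t := Real.smoothTransition.nonneg _
  have hb1 : b 0 = 1 := by simp [b]
  have hb' (t : ℝ) : deriv b t ≤ 0 := by
    refine Antitone.deriv_nonpos ?_
    intro s t hst
    exact Real.smoothTransition.monotone (by linarith)
  have hbz {t : ℝ} (ht : 1 ≤ t) : b t - deriv b t * t = 0 := by
    have h1 : b t = 0 := Real.smoothTransition.zero_of_nonpos (by linarith)
    have h2 : IsLocalMin b t := Filter.Eventually.of_forall fun s => by rw [h1]; exact hb0 s
    rw [h1, h2.deriv_eq_zero]; ring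
  set r : M → ℝ := fun p => x p * x p + y p * y p with hr
  have hrsm : ContMDiff (𝓡 (2 * m + 3)) 𝓘(ℝ, ℝ) ∞ r := (hx.mul hx).add (hy.mul hy)
  have hr0 (p : M) : 0 ≤ r p := add_nonneg (mul_self_nonneg _) (mul_self_nonneg _)
  have hrB (p : M) : p ∈ O.binding ↔ r p = 0 := by
    rw [hh.mem_iff, Complex.ext_iff]
    simp only [Complex.zero_re, Complex.zero_im, r]
    constructor
    · rintro ⟨h1, h2⟩; rw [h1, h2]; ring
    · intro h
      constructor <;> nlinarith [mul_self_nonneg (x p), mul_self_nonneg (y p)]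
  set N : M → ℝ := fun p => r p + b (r p) with hN
  have hNsm : ContMDiff (𝓡 (2 * m + 3)) 𝓘(ℝ, ℝ) ∞ N := hrsm.add (hb.contMDiff.comp hrsm)
  have hN0 (p : M) : 0 < N p := by
    rcases (hr0 p).lt_or_eq with h | h
    · exact add_pos_of_pos_of_nonneg h (hb0 _)
    · simp only [N]; rw [← h, hb1]; norm_num
  set F : M → ℝ := fun p => (√(N p))⁻¹ with hFdef
  have hF0 (p : M) : 0 < F p := inv_pos.2 (Real.sqrt_pos.2 (hN0 p))
  have hF : ContMDiff (𝓡 (2 * m + 3)) 𝓘(ℝ, ℝ) ∞ F := by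
    refine ContMDiff.inv₀ (fun p => ?_) fun p => (Real.sqrt_pos.2 (hN0 p)).ne'
    exact (Real.contDiffAt_sqrt (hN0 p).ne').contMDiffAt.comp p hNsm.contMDiffAt
  have hFN (p : M) : F p * F p * N p = 1 := by
    have h1 := Real.mul_self_sqrt (hN0 p).le
    have h2 := (Real.sqrt_pos.2 (hN0 p)).ne'
    simp only [F]
    nth_rewrite 3 [← h1]
    field_simp
  have hdr (p : M) (v : TangentSpace (𝓡 (2 * m + 3)) p) : mvfderiv (𝓡 (2 * m + 3)) r p v =
      2 * (x p * mvfderiv (𝓡 (2 * m + 3)) x p v + y p * mvfderiv (𝓡 (2 * m + 3)) y p v) := by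
    have hxd := hx.mdifferentiableAt (x := p) (by simp)
    have hyd := hy.mdifferentiableAt (x := p) (by simp)
    refine (congrArg (fun f => f v) (mvfderiv_fun_add (hxd.mul hxd) (hyd.mul hyd))).trans ?_
    refine (congrArg₂ (· + ·) (mvfderiv_mul_apply hxd hxd v) (mvfderiv_mul_apply hyd hyd v)).trans ?_
    ring
  have hdN (p : M) (v : TangentSpace (𝓡 (2 * m + 3)) p) : mvfderiv (𝓡 (2 * m + 3)) N p v =
      (1 + deriv b (r p)) * mvfderiv (𝓡 (2 * m + 3)) r p v := by
    have hbd : DifferentiableAt ℝ b (r p) := hb.differentiable (by simp) _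
    have hd : DifferentiableAt ℝ (fun t => t + b t) (r p) := differentiableAt_id.add hbd
    refine (mvfderiv_comp_left hd (hrsm.mdifferentiableAt (by simp)) v).trans ?_
    rw [fderiv_eq_smul_deriv, deriv_fun_add differentiableAt_fun_id hbd, deriv_id'', smul_eq_mul,
      mul_comm]
  have hdF (p : M) (v : TangentSpace (𝓡 (2 * m + 3)) p) : mvfderiv (𝓡 (2 * m + 3)) F p v =
      -(F p ^ 3 * mvfderiv (𝓡 (2 * m + 3)) N p v) / 2 := by
    have hFd := hF.mdifferentiableAt (x := p) (by simp)
    have h1 := mvfderiv_mul_apply (hFd.mul hFd) (hNsm.mdifferentiableAt (x := p) (by simp)) v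
    have h2 : (fun q => (F * F) q * N q) = fun _ => 1 := funext hFN
    rw [h2, mvfderiv_const] at h1
    have h3 : (0 : ℝ) = _ := h1
    have h4 := mvfderiv_mul_apply hFd hFd v
    have h5 : mvfderiv (𝓡 (2 * m + 3)) (F * F) p v =
      mvfderiv (𝓡 (2 * m + 3)) (fun q => F q * F q) p v := rfl
    rw [h5, h4, Pi.mul_apply] at h3
    linear_combination (-F p / 2) * h3 - mvfderiv (𝓡 (2 * m + 3)) F p v * hFN p
  refine ⟨fun p => F p * x p, fun p => F p * y p, hF.mul hx, hF.mul hy, ?_, fun p => ?_⟩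
  · simpa only [smul_mk_eq] using hh.smul_pos hF hF0
  · set D := mvfderiv (𝓡 (2 * m + 3)) y p (horizontal hα hx p) with hD
    set a := x p * mvfderiv (𝓡 (2 * m + 3)) y p (reeb hα p) -
      y p * mvfderiv (𝓡 (2 * m + 3)) x p (reeb hα p) with ha
    have hD' : mvfderiv (𝓡 (2 * m + 3)) x p (horizontal hα hy p) = -D := by
      rw [mvfderiv_horizontal_skew hα hy hx]
    have key : mvfderiv (𝓡 (2 * m + 3)) (fun q => F q * y q) p
        (contactField hα (hF.mul hx) p) - F p * y p *
          mvfderiv (𝓡 (2 * m + 3)) (fun q => F q * x q) p (reeb hα p) =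
        F p ^ 4 * (N p * a + (b (r p) - deriv b (r p) * r p) * D) := by
      refine (mvfderiv_contactField_sub hα (hF.mul hx) p (y := fun q => F q * y q)).trans ?_
      have h1 := reeb_part_mul hα hx hy hF p
      have h2 := horizontal_part_mul hα hx hy hF p
      rw [← ha] at h1
      refine (congrArg₂ (· + ·) h1 h2).trans ?_
      rw [hdF, hdF, hdN, hdN, hdr, hdr, hD', mvfderiv_horizontal_self hα hx,
        mvfderiv_horizontal_self hα hy, ← hD]
      have h3 := hFN p
      simp only [N, r] at h3 ⊢
      linear_combination (-(F p ^ 2 * (a + D))) * h3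
    refine lt_of_lt_of_eq ?_ key.symm
    refine mul_pos (pow_pos (hF0 p) 4) ?_
    have hc : 0 ≤ (b (r p) - deriv b (r p) * r p) * D := by
      by_cases hr1 : 1 ≤ r p
      · rw [hbz hr1, zero_mul]
      · refine mul_nonneg ?_ (hpos p (by simp only [r] at hr1; nlinarith)).le
        have := mul_nonneg (neg_nonneg.2 (hb' (r p))) (hr0 p)
        have := hb0 (r p)
        linarith
    by_cases hpB : p ∈ O.binding
    · have hr0 := (hrB p).1 hpB
      have hx0 : x p = 0 := by
        simp only [r] at hr0; nlinarith [mul_self_nonneg (x p), mul_self_nonneg (y p)]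
      have hy0 : y p = 0 := by
        simp only [r] at hr0; nlinarith [mul_self_nonneg (x p), mul_self_nonneg (y p)]
      have ha0 : a = 0 := by rw [ha, hx0, hy0]; ring
      have := hpos p (by rw [hx0, hy0]; norm_num)
      rw [ha0, hr0, hb1]
      linarith
    · have h1 := hh.sq_mul_dAngle rfl hpB (reeb hα p)
      have h2 := hP.dAngle_reeb_pos hα hpB
      have h3 : 0 < a := by
        rw [ha, ← h1]
        refine mul_pos ?_ h2
        have := (hr0 p).lt_of_ne fun h => hpB ((hrB p).2 h.symm)
        simp only [r] at this
        linarith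
      have := mul_pos (hN0 p) h3
      linarith

theorem OpenBook.Supports.exists_contactFields {ξ : ContactStructure m M} (hO : O.Supports ξ)
    (hα : ξ.IsDefinedBy α) (hP : O.PagesPositive α) :
    ∃ h : M → ℂ, O.IsDefinedBy h ∧
      ∃ X Y : ∀ p : M, TangentSpace (𝓡 (2 * m + 3)) p,
        ξ.IsContactField X ∧ ξ.IsContactField Y ∧
        (∀ p, α p (X p) = (h p).re) ∧ (∀ p, α p (Y p) = -(h p).im) ∧
        ξ.NegTransverse (VectorField.mlieBracket (𝓡 (2 * m + 3)) X Y) := by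
  obtain ⟨x, y, hx, hy, hh, hpos⟩ := O.exists_bracket_pos hα.1 (hO.1 α hα) hP
  have hX := hα.isContactField_contactField hx
  have hY := hα.isContactField_contactField hy.neg
  refine ⟨_, hh, contactField hα.1 hx, contactField hα.1 hy.neg, hX, hY,
    apply_contactField hα.1 hx, apply_contactField hα.1 hy.neg, fun p => ?_⟩
  rw [(hα.2 p _).2, map_neg, hX.apply_mlieBracket hY.1 hα]
  have h1 : (fun q => α q (contactField hα.1 hy.neg q)) = fun q => -y q :=
    funext fun q => apply_contactField hα.1 hy.neg q
  have h2 : (fun q => α q (contactField hα.1 hx q)) = x := funext (apply_contactField hα.1 hx)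
  have h3 : mvfderiv (𝓡 (2 * m + 3)) (fun q => -y q) p = -mvfderiv (𝓡 (2 * m + 3)) y p :=
    mvfderiv_fun_neg
  rw [h1, h2, h3, apply_contactField]
  have := hpos p
  simp only [neg_apply]
  linarith

end FromOpenBooks

/-! ### Divergence of a vector field with respect to the density of a contact form -/

/-- Jacobi's formula. -/
theorem hasDerivAt_matrix_det {ι : Type*} [Fintype ι] [DecidableEq ι] {b : ℝ → Matrix ι ι ℝ}
    {b' : Matrix ι ι ℝ} {t : ℝ} (hb : ∀ i j, HasDerivAt (fun s => b s i j) (b' i j) t) :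
    HasDerivAt (fun s => (b s).det) ((b t).adjugate * b').trace t := by
  have h1 : HasDerivAt (fun s => (b s).det) (∑ σ : Equiv.Perm ι, (σ.sign : ℤ) •
      ∑ i, (∏ j ∈ Finset.univ.erase i, b t (σ j) j) • b' (σ i) i) t := by
    simp only [Matrix.det_apply]
    refine HasDerivAt.fun_sum fun σ _ => ?_
    have := (HasDerivAt.fun_finsetProd (u := Finset.univ)
      (f := fun i s => b s (σ i) i) (fun i _ => hb (σ i) i))
    have h2 := this.const_smul ((σ.sign : ℤ) : ℝ)
    refine (h2.congr_deriv ?_).congr_of_eventuallyEq (.of_forall fun s => ?_)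
    · rw [zsmul_eq_mul, smul_eq_mul]
    · simp only [Units.smul_def, Pi.smul_apply, zsmul_eq_mul, smul_eq_mul]
  refine h1.congr_deriv ?_
  have h2 : ((b t).adjugate * b').trace = ∑ i, ((b t).updateCol i (fun k => b' k i)).det := by
    rw [Matrix.trace]
    refine Finset.sum_congr rfl fun i _ => ?_
    rw [← Matrix.cramer_apply, Matrix.cramer_eq_adjugate_mulVec]
    rfl
  rw [h2]
  simp only [Matrix.det_apply, Finset.smul_sum]
  rw [Finset.sum_comm]
  refine Finset.sum_congr rfl fun i _ => Finset.sum_congr rfl fun σ _ => ?_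
  rw [← Finset.mul_prod_erase Finset.univ _ (Finset.mem_univ i), Matrix.updateCol_self]
  have : ∏ x ∈ Finset.univ.erase i, (b t).updateCol i (fun k => b' k i) (σ x) x =
      ∏ x ∈ Finset.univ.erase i, b t (σ x) x := by
    refine Finset.prod_congr rfl fun j hj => ?_
    rw [Matrix.updateCol_ne (Finset.ne_of_mem_erase hj)]
  rw [this, Units.smul_def, smul_eq_mul, mul_comm]

theorem trace_adjugate_mul_of_lie {ι : Type*} [Fintype ι] [DecidableEq ι] {b B' J C : Matrix ι ι ℝ}
    (hb : b.det ≠ 0) (h : B' + J.transpose * b + b * J = C) :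
    (b.adjugate * B').trace = b.det * ((b⁻¹ * C).trace - 2 * J.trace) := by
  have hu : IsUnit b.det := isUnit_iff_ne_zero.2 hb
  have hadj : b.adjugate = b.det • b⁻¹ := by
    rw [Matrix.inv_def, Ring.inverse_eq_inv', smul_smul, mul_inv_cancel₀ hb, one_smul]
  have hB : B' = C - J.transpose * b - b * J := by rw [← h]; abel
  rw [hadj, hB, Matrix.smul_mul, Matrix.trace_smul, smul_eq_mul, Matrix.mul_sub, Matrix.mul_sub,
    Matrix.trace_sub, Matrix.trace_sub, ← Matrix.mul_assoc, ← Matrix.mul_assoc,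
    Matrix.trace_mul_comm (b⁻¹ * J.transpose), ← Matrix.mul_assoc, Matrix.mul_nonsing_inv b hu,
    Matrix.nonsing_inv_mul b hu, Matrix.one_mul, Matrix.one_mul, Matrix.trace_transpose]
  ring

section Density

variable {d : ℕ}

/-- The vectors of the standard basis. -/
def stdVec (i : Fin d) : EuclideanSpace ℝ (Fin d) := EuclideanSpace.single i 1

theorem sum_stdVec (v : EuclideanSpace ℝ (Fin d)) : ∑ i, v i • stdVec i = v := by
  have := (EuclideanSpace.basisFun (Fin d) ℝ).sum_repr v
  simpa [stdVec] using this

/-- The matrix of the bilinear form `dA + A ⊗ A`. -/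
def formMatrix (A : EuclideanSpace ℝ (Fin d) → EuclideanSpace ℝ (Fin d) →L[ℝ] ℝ) (x : EuclideanSpace ℝ (Fin d)) : Matrix (Fin d) (Fin d) ℝ :=
  Matrix.of fun i j => extD A x (stdVec i) (stdVec j) + A x (stdVec i) * A x (stdVec j)

/-- The density of the 1-form `A`. -/
def formDensity (A : EuclideanSpace ℝ (Fin d) → EuclideanSpace ℝ (Fin d) →L[ℝ] ℝ) (x : EuclideanSpace ℝ (Fin d)) : ℝ := √|(formMatrix A x).det|

theorem formMatrix_mulVec (A : EuclideanSpace ℝ (Fin d) → EuclideanSpace ℝ (Fin d) →L[ℝ] ℝ) (x v : EuclideanSpace ℝ (Fin d)) (i : Fin d) :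
    (formMatrix A x).mulVec v i = extD A x (stdVec i) v + A x (stdVec i) * A x v := by
  conv_rhs => rw [← sum_stdVec v]
  simp only [map_sum, map_smul, smul_eq_mul, Matrix.mulVec, dotProduct, formMatrix, Matrix.of_apply,
    Finset.mul_sum, ← Finset.sum_add_distrib]
  exact Finset.sum_congr rfl fun j _ => by ring

theorem vecMul_formMatrix (A : EuclideanSpace ℝ (Fin d) → EuclideanSpace ℝ (Fin d) →L[ℝ] ℝ) (x v : EuclideanSpace ℝ (Fin d)) (j : Fin d) :
    Matrix.vecMul v (formMatrix A x) j = extD A x v (stdVec j) + A x v * A x (stdVec j) := by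
  conv_rhs => rw [← sum_stdVec v]
  simp only [map_sum, map_smul, smul_eq_mul, Matrix.vecMul, dotProduct, formMatrix, Matrix.of_apply,
    Finset.sum_mul, sum_apply, smul_apply, ← Finset.sum_add_distrib]
  exact Finset.sum_congr rfl fun j _ => by ring

theorem formMatrix_det_ne_zero {A : EuclideanSpace ℝ (Fin d) → EuclideanSpace ℝ (Fin d) →L[ℝ] ℝ} {x : EuclideanSpace ℝ (Fin d)}
    (h : ∀ v, (∀ w, extD A x v w + A x v * A x w = 0) → v = 0) : (formMatrix A x).det ≠ 0 := by
  intro h0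
  obtain ⟨v, hv, hv0⟩ := Matrix.exists_vecMul_eq_zero_iff.2 h0
  refine hv ?_
  have := h (WithLp.toLp 2 v) fun w => ?_
  · exact congrArg (WithLp.ofLp) this
  · rw [← sum_stdVec w]
    simp only [map_sum, map_smul, smul_eq_mul, Finset.mul_sum, ← Finset.sum_add_distrib]
    refine Finset.sum_eq_zero fun j _ => ?_
    have h1 := congrFun hv0 j
    have h2 := vecMul_formMatrix A x (WithLp.toLp 2 v) j
    rw [show Matrix.vecMul (WithLp.toLp 2 v : EuclideanSpace ℝ (Fin d)) (formMatrix A x) j = 0 from h1] at h2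
    linear_combination (-w j) * h2

theorem formMatrix_contDiffAt {A : EuclideanSpace ℝ (Fin d) → EuclideanSpace ℝ (Fin d) →L[ℝ] ℝ} {x : EuclideanSpace ℝ (Fin d)} (hA : ContDiffAt ℝ ∞ A x)
    (u v : EuclideanSpace ℝ (Fin d)) : ContDiffAt ℝ ∞ (fun y => extD A y u v + A y u * A y v) x :=
  (((OBD.ContDiffAt.extD hA).clm_apply contDiffAt_const).clm_apply contDiffAt_const).add
    ((hA.clm_apply contDiffAt_const).mul (hA.clm_apply contDiffAt_const))

theorem contDiffAt_formMatrix_det {A : EuclideanSpace ℝ (Fin d) → EuclideanSpace ℝ (Fin d) →L[ℝ] ℝ} {x : EuclideanSpace ℝ (Fin d)} (hA : ContDiffAt ℝ ∞ A x) :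
    ContDiffAt ℝ ∞ (fun y => (formMatrix A y).det) x := by
  simp only [Matrix.det_apply]
  refine ContDiffAt.sum fun σ _ => ?_
  simp only [Units.smul_def, zsmul_eq_mul]
  exact contDiffAt_const.mul (contDiffAt_prod fun i _ => formMatrix_contDiffAt hA _ _)

theorem formDensity_contDiffAt {A : EuclideanSpace ℝ (Fin d) → EuclideanSpace ℝ (Fin d) →L[ℝ] ℝ} {x : EuclideanSpace ℝ (Fin d)} (hA : ContDiffAt ℝ ∞ A x)
    (h0 : (formMatrix A x).det ≠ 0) : ContDiffAt ℝ ∞ (formDensity A) x :=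
  (Real.contDiffAt_sqrt (abs_pos.2 h0).ne').comp x
    (ContDiffAt.comp (g := fun t : ℝ => |t|) x (contDiffAt_abs h0) (contDiffAt_formMatrix_det hA))

theorem formDensity_pos {A : EuclideanSpace ℝ (Fin d) → EuclideanSpace ℝ (Fin d) →L[ℝ] ℝ} {x : EuclideanSpace ℝ (Fin d)} (h0 : (formMatrix A x).det ≠ 0) :
    0 < formDensity A x := Real.sqrt_pos.2 (abs_pos.2 h0)

theorem fderiv_formDensity {A : EuclideanSpace ℝ (Fin d) → EuclideanSpace ℝ (Fin d) →L[ℝ] ℝ} {x : EuclideanSpace ℝ (Fin d)} (hA : ContDiffAt ℝ ∞ A x)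
    (h0 : (formMatrix A x).det ≠ 0) (w : EuclideanSpace ℝ (Fin d)) : fderiv ℝ (formDensity A) x w =
      formDensity A x / (2 * (formMatrix A x).det) *
        fderiv ℝ (fun y => (formMatrix A y).det) x w := by
  set g := fun y => (formMatrix A y).det with hg
  have hgd : DifferentiableAt ℝ g x := (contDiffAt_formMatrix_det hA).differentiableAt (by simp)
  have hνd := (formDensity_contDiffAt hA h0).differentiableAt (by simp)
  set ν := formDensity A with hνdef
  have hsq : (ν * ν) * (ν * ν) = g * g := by
    funext y
    have h1 : ν y * ν y = |g y| := Real.mul_self_sqrt (abs_nonneg _)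
    simp only [Pi.mul_apply, h1, abs_mul_abs_self]
  have hν' := hνd.hasFDerivAt
  have h1 := ((hν'.mul hν').mul (hν'.mul hν')).fderiv
  rw [hsq, (hgd.hasFDerivAt.mul hgd.hasFDerivAt).fderiv] at h1
  replace h1 := DFunLike.congr_fun h1 w
  have hν := formDensity_pos h0
  have hν2 : (ν x * ν x) * (ν x * ν x) = g x * g x := congrFun hsq x
  simp only [add_apply, smul_apply, smul_eq_mul, Pi.mul_apply] at h1
  have h3 : g x ≠ 0 := h0
  have h4 : fderiv ℝ ν x w * (2 * g x) = ν x * fderiv ℝ g x w := by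
    have h5 : ν x ^ 3 ≠ 0 := (pow_pos hν 3).ne'
    apply mul_left_cancel₀ h5
    apply mul_left_cancel₀ (two_ne_zero (α := ℝ))
    linear_combination (-g x) * h1 - 2 * fderiv ℝ g x w * hν2
  change _ = ν x / (2 * g x) * _
  field_simp
  linarith

end Density

section LocalDivergence

variable {d : ℕ}

/-- The matrix of a linear map in the standard basis. -/
def stdMatrix (L : EuclideanSpace ℝ (Fin d) →L[ℝ] EuclideanSpace ℝ (Fin d)) : Matrix (Fin d) (Fin d) ℝ := Matrix.of fun k i => L (stdVec i) k

theorem stdMatrix_det (L : EuclideanSpace ℝ (Fin d) →L[ℝ] EuclideanSpace ℝ (Fin d)) : (stdMatrix L).det = L.det := by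
  have h : stdMatrix L = LinearMap.toMatrix (EuclideanSpace.basisFun (Fin d) ℝ).toBasis
      (EuclideanSpace.basisFun (Fin d) ℝ).toBasis (L : EuclideanSpace ℝ (Fin d) →ₗ[ℝ] EuclideanSpace ℝ (Fin d)) := by
    ext k i
    rw [LinearMap.toMatrix_apply]
    simp [stdMatrix, stdVec]
  rw [h, LinearMap.det_toMatrix]

theorem formMatrix_apply₂ (A : EuclideanSpace ℝ (Fin d) → EuclideanSpace ℝ (Fin d) →L[ℝ] ℝ) (x u v : EuclideanSpace ℝ (Fin d)) :
    extD A x u v + A x u * A x v = ∑ k, u k * (formMatrix A x).mulVec v k := by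
  conv_lhs => rw [← sum_stdVec u]
  simp only [formMatrix_mulVec, map_sum, map_smul, smul_eq_mul, sum_apply, smul_apply,
    Finset.sum_mul, ← Finset.sum_add_distrib]
  exact Finset.sum_congr rfl fun j _ => by ring

/-- Transformation of the density of a 1-form under pullback. -/
theorem formDensity_pullback {A A' : EuclideanSpace ℝ (Fin d) → EuclideanSpace ℝ (Fin d) →L[ℝ] ℝ} {τ : EuclideanSpace ℝ (Fin d) → EuclideanSpace ℝ (Fin d)} {x : EuclideanSpace ℝ (Fin d)}
    (hA : ContDiffAt ℝ ∞ A (τ x)) (hτ : ContDiffAt ℝ ∞ τ x)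
    (h : A' =ᶠ[𝓝 x] fun y => (A (τ y)).comp (fderiv ℝ τ y)) :
    formDensity A' x = |(fderiv ℝ τ x).det| * formDensity A (τ x) := by
  set J := stdMatrix (fderiv ℝ τ x) with hJ
  have hmat : formMatrix A' x = J.transpose * formMatrix A (τ x) * J := by
    ext i j
    have h1 : extD A' x (stdVec i) (stdVec j) =
        extD A (τ x) (fderiv ℝ τ x (stdVec i)) (fderiv ℝ τ x (stdVec j)) := by
      rw [← extD_pullback hA hτ, extD_apply, extD_apply, h.fderiv_eq]
    change extD A' x (stdVec i) (stdVec j) + A' x (stdVec i) * A' x (stdVec j) = _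
    rw [h1, h.self_of_nhds, ContinuousLinearMap.comp_apply, ContinuousLinearMap.comp_apply,
      formMatrix_apply₂, Matrix.mul_assoc, Matrix.mul_apply]
    rfl
  rw [formDensity, formDensity, hmat, Matrix.det_mul, Matrix.det_mul, Matrix.det_transpose, hJ,
    stdMatrix_det, ← Real.sqrt_sq (abs_nonneg (fderiv ℝ τ x).det), ← Real.sqrt_mul (sq_nonneg _),
    sq_abs, show (fderiv ℝ τ x).det * (formMatrix A (τ x)).det * (fderiv ℝ τ x).det =
      (fderiv ℝ τ x).det ^ 2 * (formMatrix A (τ x)).det by ring, abs_mul, abs_sq]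

theorem fderiv_formMatrix_det {A : EuclideanSpace ℝ (Fin d) → EuclideanSpace ℝ (Fin d) →L[ℝ] ℝ} {x : EuclideanSpace ℝ (Fin d)} (hA : ContDiffAt ℝ ∞ A x) (w : EuclideanSpace ℝ (Fin d)) :
    fderiv ℝ (fun y => (formMatrix A y).det) x w = ((formMatrix A x).adjugate *
      Matrix.of fun i j => fderiv ℝ (fun y => extD A y (stdVec i) (stdVec j) +
        A y (stdVec i) * A y (stdVec j)) x w).trace := by
  have hx : x + (0 : ℝ) • w = x := by simp
  have h1 := ((contDiffAt_formMatrix_det hA).differentiableAt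
    (by simp)).hasFDerivAt.hasLineDerivAt w
  have h2 := hasDerivAt_matrix_det (t := 0) (b := fun t : ℝ => formMatrix A (x + t • w))
    (b' := Matrix.of fun i j => fderiv ℝ (fun y => extD A y (stdVec i) (stdVec j) +
        A y (stdVec i) * A y (stdVec j)) x w) fun i j =>
      ((formMatrix_contDiffAt hA (stdVec i) (stdVec j)).differentiableAt
        (by simp)).hasFDerivAt.hasLineDerivAt w
  rw [hx] at h2
  exact HasDerivAt.unique h1 h2

variable {A θ : EuclideanSpace ℝ (Fin d) → EuclideanSpace ℝ (Fin d) →L[ℝ] ℝ} {W : EuclideanSpace ℝ (Fin d) → EuclideanSpace ℝ (Fin d)} {c : EuclideanSpace ℝ (Fin d) → ℝ} {x : EuclideanSpace ℝ (Fin d)}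

/-- The Lie derivative of `dA + A ⊗ A` along `W`, when `A(W) = 0` and `ι_W dA = c A - θ` with `θ`
closed. -/
theorem lie_formMatrix (hA : ContDiffAt ℝ ∞ A x) (hW : ContDiffAt ℝ ∞ W x)
    (hθ : ContDiffAt ℝ ∞ θ x) (hc : ContDiffAt ℝ ∞ c x)
    (hAW : ∀ᶠ y in 𝓝 x, A y (W y) = 0)
    (hΩ : ∀ᶠ y in 𝓝 x, ∀ v, extD A y (W y) v = c y * A y v - θ y v)
    (hcl : extD θ x = 0) (u v : EuclideanSpace ℝ (Fin d)) :
    fderiv ℝ (fun y => extD A y u v + A y u * A y v) x (W x) +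
      (extD A x (fderiv ℝ W x u) v + A x (fderiv ℝ W x u) * A x v) +
      (extD A x u (fderiv ℝ W x v) + A x u * A x (fderiv ℝ W x v)) =
    c x * (extD A x u v + A x u * A x v) + fderiv ℝ c x u * A x v - A x u * fderiv ℝ c x v +
      c x * (A x u * A x v) - θ x u * A x v - A x u * θ x v := by
  have hA1 := (hA.differentiableAt (by simp)).hasFDerivAt
  have hW1 := (hW.differentiableAt (by simp)).hasFDerivAt
  have hθ1 := (hθ.differentiableAt (by simp)).hasFDerivAt
  have hc1 := (hc.differentiableAt (by simp)).hasFDerivAt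
  have hA2 := ((hA.fderiv_right (m := 1) (by norm_cast)).differentiableAt (by simp)).hasFDerivAt
  have hsym : IsSymmSndFDerivAt ℝ A x := hA.isSymmSndFDerivAt (by simp; norm_cast)
  have hcl' (u v : EuclideanSpace ℝ (Fin d)) : fderiv ℝ θ x u v = fderiv ℝ θ x v u := by
    have := congrArg (fun f => f u v) hcl
    simp only [extD_apply] at this
    exact sub_eq_zero.1 this
  -- derivative of `A(W) = 0`
  have i1 (u : EuclideanSpace ℝ (Fin d)) : fderiv ℝ A x u (W x) + A x (fderiv ℝ W x u) = 0 := by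
    have h1 := (hA1.clm_apply hW1).unique
      ((hasFDerivAt_const (0 : ℝ) x).congr_of_eventuallyEq hAW)
    have h2 := DFunLike.congr_fun h1 u
    simp only [add_apply, ContinuousLinearMap.comp_apply, ContinuousLinearMap.flip_apply,
      zero_apply] at h2
    linarith
  have i2 (u : EuclideanSpace ℝ (Fin d)) : fderiv ℝ A x (W x) u - fderiv ℝ A x u (W x) = c x * A x u - θ x u :=
    hΩ.self_of_nhds u
  -- derivative of `ι_W dA = c A - θ`
  have i3 (u v : EuclideanSpace ℝ (Fin d)) : fderiv ℝ (fderiv ℝ A) x u (W x) v + fderiv ℝ A x (fderiv ℝ W x u) v -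
      (fderiv ℝ (fderiv ℝ A) x u v (W x) + fderiv ℝ A x v (fderiv ℝ W x u)) =
      fderiv ℝ c x u * A x v + c x * fderiv ℝ A x u v - fderiv ℝ θ x u v := by
    have h1 := ((hA2.clm_apply hW1).clm_apply (hasFDerivAt_const v x)).sub
      ((hA2.clm_apply (hasFDerivAt_const v x)).clm_apply hW1)
    have h2 := (hc1.mul (hA1.clm_apply (hasFDerivAt_const v x))).sub
      (hθ1.clm_apply (hasFDerivAt_const v x))
    have h3 := DFunLike.congr_fun (h1.unique (h2.congr_of_eventuallyEq
      (hΩ.mono fun y hy => hy v))) u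
    simp at h3
    linarith
  have hd1 : fderiv ℝ (fun y => extD A y u v + A y u * A y v) x (W x) =
      fderiv ℝ (fderiv ℝ A) x (W x) u v - fderiv ℝ (fderiv ℝ A) x (W x) v u +
        (A x u * fderiv ℝ A x (W x) v + A x v * fderiv ℝ A x (W x) u) := by
    have h1 := (((hA2.clm_apply (hasFDerivAt_const u x)).clm_apply (hasFDerivAt_const v x)).sub
      ((hA2.clm_apply (hasFDerivAt_const v x)).clm_apply (hasFDerivAt_const u x))).add
      ((hA1.clm_apply (hasFDerivAt_const u x)).mul (hA1.clm_apply (hasFDerivAt_const v x)))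
    have h2 := DFunLike.congr_fun h1.fderiv (W x)
    refine Eq.trans h2 ?_
    simp
  rw [hd1]
  have s1 := DFunLike.congr_fun (hsym u v) (W x)
  have s2 := DFunLike.congr_fun (hsym u (W x)) v
  have s3 := DFunLike.congr_fun (hsym v (W x)) u
  simp only [extD_apply]
  have a1 := i1 u
  have a2 := i1 v
  have b1 := i2 u
  have b2 := i2 v
  have c1 := i3 u v
  have c2 := i3 v u
  have e1 := hcl' u v
  linear_combination c1 - c2 + s1 - s2 + s3 + A x v * (a1 + b1) + A x u * (a2 + b2) - e1

/-- The divergence of `W` with respect to the density of the contact form `A`. -/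
theorem formDensity_divergence (hA : ContDiffAt ℝ ∞ A x) (hW : ContDiffAt ℝ ∞ W x)
    (hθ : ContDiffAt ℝ ∞ θ x) (hc : ContDiffAt ℝ ∞ c x)
    (hAW : ∀ᶠ y in 𝓝 x, A y (W y) = 0)
    (hΩ : ∀ᶠ y in 𝓝 x, ∀ v, extD A y (W y) v = c y * A y v - θ y v)
    (hcl : extD θ x = 0) (h0 : (formMatrix A x).det ≠ 0) {R : EuclideanSpace ℝ (Fin d)} (hAR : A x R = 1)
    (hR : ∀ v, extD A x R v = 0) (hθR : θ x R = c x) :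
    fderiv ℝ (formDensity A) x (W x) + formDensity A x * ∑ i, fderiv ℝ W x (stdVec i) i =
      formDensity A x * (c x * ((d - 1) / 2)) := by
  set b := formMatrix A x with hb
  set J := stdMatrix (fderiv ℝ W x) with hJ
  set B' : Matrix (Fin d) (Fin d) ℝ := Matrix.of fun i j =>
    fderiv ℝ (fun y => extD A y (stdVec i) (stdVec j) + A y (stdVec i) * A y (stdVec j)) x (W x)
    with hB'
  set a : Fin d → ℝ := fun i => A x (stdVec i) with ha
  set t : Fin d → ℝ := fun i => θ x (stdVec i) with ht
  set k : Fin d → ℝ := fun i => fderiv ℝ c x (stdVec i) with hk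
  set C : Matrix (Fin d) (Fin d) ℝ := c x • b + Matrix.vecMulVec k a - Matrix.vecMulVec a k +
    c x • Matrix.vecMulVec a a - Matrix.vecMulVec t a - Matrix.vecMulVec a t with hC
  have hu : IsUnit b.det := isUnit_iff_ne_zero.2 h0
  have hlie : B' + J.transpose * b + b * J = C := by
    ext i j
    have h1 := lie_formMatrix hA hW hθ hc hAW hΩ hcl (stdVec i) (stdVec j)
    have h2 := vecMul_formMatrix A x (fderiv ℝ W x (stdVec i)) j
    have h3 := formMatrix_mulVec A x (fderiv ℝ W x (stdVec j)) i
    rw [← h2, ← h3] at h1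
    exact h1
  have hdot (η : EuclideanSpace ℝ (Fin d) →L[ℝ] ℝ) (v : EuclideanSpace ℝ (Fin d)) : (v : EuclideanSpace ℝ (Fin d)).ofLp ⬝ᵥ (fun i => η (stdVec i)) = η v := by
    conv_rhs => rw [← sum_stdVec v]
    simp [dotProduct]
  have hbR : b.mulVec R = a := by
    funext i
    rw [hb, formMatrix_mulVec, hAR, mul_one, extD_apply]
    have := hR (stdVec i)
    rw [extD_apply] at this
    simp only [ha]
    linarith
  have hRb : Matrix.vecMul R b = a := by
    funext i
    rw [hb, vecMul_formMatrix, hAR, one_mul, hR, zero_add]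
  have hia : (b⁻¹).mulVec a = R := by
    rw [← hbR, Matrix.mulVec_mulVec, Matrix.nonsing_inv_mul b hu, Matrix.one_mulVec]
  have hai : Matrix.vecMul a b⁻¹ = R := by
    rw [← hRb, Matrix.vecMul_vecMul, Matrix.mul_nonsing_inv b hu, Matrix.vecMul_one]
  have htr1 (w : Fin d → ℝ) : (b⁻¹ * Matrix.vecMulVec a w).trace = R.ofLp ⬝ᵥ w := by
    rw [Matrix.mul_vecMulVec, hia, Matrix.trace_vecMulVec]
  have htr2 (w : Fin d → ℝ) : (b⁻¹ * Matrix.vecMulVec w a).trace = R.ofLp ⬝ᵥ w := by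
    rw [Matrix.trace_mul_comm, Matrix.vecMulVec_mul, hai, Matrix.trace_vecMulVec, dotProduct_comm]
  have hRa : R.ofLp ⬝ᵥ a = 1 := by rw [ha, hdot, hAR]
  have hRt : R.ofLp ⬝ᵥ t = c x := by rw [ht, hdot, hθR]
  have htrC : (b⁻¹ * C).trace = c x * (d - 1) := by
    rw [hC]
    simp only [Matrix.mul_add, Matrix.mul_sub, Matrix.mul_smul, Matrix.trace_add, Matrix.trace_sub,
      Matrix.trace_smul, htr1, htr2, hRa, hRt, Matrix.nonsing_inv_mul b hu, Matrix.trace_one,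
      Fintype.card_fin, smul_eq_mul]
    ring
  have hJtr : J.trace = ∑ i, fderiv ℝ W x (stdVec i) i := rfl
  rw [fderiv_formDensity hA h0, fderiv_formMatrix_det hA]
  change formDensity A x / (2 * b.det) * (b.adjugate * B').trace + _ = _
  rw [trace_adjugate_mul_of_lie h0 hlie, htrC, hJtr]
  field_simp
  ring

end LocalDivergence

section DivergenceTheorem

variable {d : ℕ}

theorem integral_fderiv_eq_zero {g : EuclideanSpace ℝ (Fin d) → ℝ} (hg : ContDiff ℝ ∞ g)
    (hcs : HasCompactSupport g) (v : EuclideanSpace ℝ (Fin d)) : ∫ x, fderiv ℝ g x v = 0 := by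
  have h := integral_mul_fderiv_eq_neg_fderiv_mul_of_integrable (𝕜 := ℝ) (μ := MeasureTheory.volume)
    (f := fun _ : EuclideanSpace ℝ (Fin d) => (1 : ℝ)) (g := g) (v := v) (by simp)
    (by
      simp only [one_mul]
      exact ((hg.continuous_fderiv (by simp)).clm_apply continuous_const).integrable_of_hasCompactSupport
        (hcs.fderiv_apply (𝕜 := ℝ) v))
    (by simpa using hg.continuous.integrable_of_hasCompactSupport hcs)
    (fun _ _ => differentiableAt_const _) (fun x _ => hg.differentiable (by simp) x)
  simpa using h

/-- The divergence theorem for compactly supported vector fields in an open set. -/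
theorem setIntegral_divergence {T K : Set (EuclideanSpace ℝ (Fin d))} (hT : IsOpen T)
    (hK : IsCompact K) (hKT : K ⊆ T) {ψ ν : EuclideanSpace ℝ (Fin d) → ℝ}
    {W : EuclideanSpace ℝ (Fin d) → EuclideanSpace ℝ (Fin d)}
    (hψ : ∀ x ∈ T, ContDiffAt ℝ ∞ ψ x) (hν : ∀ x ∈ T, ContDiffAt ℝ ∞ ν x)
    (hW : ∀ x ∈ T, ContDiffAt ℝ ∞ W x) (h0 : ∀ x ∈ T, x ∉ K → ψ x = 0) :
    ∫ x in T, (fderiv ℝ ψ x (W x) * ν x +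
      ψ x * (fderiv ℝ ν x (W x) + ν x * ∑ i, fderiv ℝ W x (stdVec i) i)) = 0 := by
  let g : Fin d → EuclideanSpace ℝ (Fin d) → ℝ := fun i => T.indicator fun x => ψ x * (ν x * W x i)
  have hoff (i : Fin d) (x) (hx : x ∉ K) : g i x = 0 := by
    by_cases hxT : x ∈ T
    · simp [g, hxT, h0 x hxT hx]
    · simp [g, hxT]
  have hcoord (i : Fin d) (x) (hx : x ∈ T) : ContDiffAt ℝ ∞ (fun y => W y i) x :=
    (EuclideanSpace.proj (𝕜 := ℝ) i).contDiff.contDiffAt.comp x (hW x hx)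
  have hev (i : Fin d) (x) (hx : x ∈ T) : g i =ᶠ[𝓝 x] fun y => ψ y * (ν y * W y i) := by
    filter_upwards [hT.mem_nhds hx] with y hy
    simp [g, hy]
  have hg (i : Fin d) : ContDiff ℝ ∞ (g i) := by
    rw [contDiff_iff_contDiffAt]
    intro x
    by_cases hx : x ∈ T
    · exact ((hψ x hx).mul ((hν x hx).mul (hcoord i x hx))).congr_of_eventuallyEq (hev i x hx)
    · refine (contDiffAt_const (c := (0 : ℝ))).congr_of_eventuallyEq ?_
      filter_upwards [hK.isClosed.isOpen_compl.mem_nhds fun h => hx (hKT h)] with y hy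
      exact hoff i y hy
  have hcs (i : Fin d) : HasCompactSupport (g i) := HasCompactSupport.intro hK (hoff i)
  have hint (i : Fin d) : MeasureTheory.Integrable fun x => fderiv ℝ (g i) x (stdVec i) :=
    (((hg i).continuous_fderiv (by simp)).clm_apply
      continuous_const).integrable_of_hasCompactSupport ((hcs i).fderiv_apply (𝕜 := ℝ) _)
  have hsum : ∫ x, ∑ i, fderiv ℝ (g i) x (stdVec i) = 0 := by
    rw [MeasureTheory.integral_finsetSum _ fun i _ => hint i]
    exact Finset.sum_eq_zero fun i _ => integral_fderiv_eq_zero (hg i) (hcs i) _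
  rw [← MeasureTheory.setIntegral_eq_integral_of_forall_compl_eq_zero (s := T)] at hsum
  · rw [← hsum]
    refine MeasureTheory.setIntegral_congr_fun hT.measurableSet fun x hx => ?_
    have hψ1 := ((hψ x hx).differentiableAt (by simp)).hasFDerivAt
    have hν1 := ((hν x hx).differentiableAt (by simp)).hasFDerivAt
    have hW1 := ((hW x hx).differentiableAt (by simp)).hasFDerivAt
    have hW2 (i : Fin d) : HasFDerivAt (fun y => W y i)
        ((EuclideanSpace.proj (𝕜 := ℝ) i).comp (fderiv ℝ W x)) x :=
      (EuclideanSpace.proj (𝕜 := ℝ) i).hasFDerivAt.comp x hW1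
    have hterm (i : Fin d) : fderiv ℝ (g i) x (stdVec i) =
        ψ x * (ν x * fderiv ℝ W x (stdVec i) i + W x i * fderiv ℝ ν x (stdVec i)) +
          ν x * W x i * fderiv ℝ ψ x (stdVec i) := by
      rw [(hev i x hx).fderiv_eq]
      have := (hψ1.mul (hν1.mul (hW2 i))).fderiv
      refine (DFunLike.congr_fun this (stdVec i)).trans ?_
      simp
      ring
    simp only [hterm]
    have e1 : fderiv ℝ ψ x (W x) = ∑ i, W x i * fderiv ℝ ψ x (stdVec i) := by
      conv_lhs => rw [← sum_stdVec (W x)]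
      simp
    have e2 : fderiv ℝ ν x (W x) = ∑ i, W x i * fderiv ℝ ν x (stdVec i) := by
      conv_lhs => rw [← sum_stdVec (W x)]
      simp
    rw [e1, e2, Finset.sum_mul, Finset.mul_sum, ← Finset.sum_add_distrib, Finset.mul_sum,
      ← Finset.sum_add_distrib]
    exact Finset.sum_congr rfl fun i _ => by ring
  · intro x hx
    refine Finset.sum_eq_zero fun i _ => ?_
    have : g i =ᶠ[𝓝 x] fun _ => 0 := by
      filter_upwards [hK.isClosed.isOpen_compl.mem_nhds fun h => hx (hKT h)] with y hy
      exact hoff i y hy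
    rw [this.fderiv_eq]
    simp

end DivergenceTheorem

section ChartIntegral

variable {m : ℕ} {M : Type*} [TopologicalSpace M]
  [ChartedSpace (EuclideanSpace ℝ (Fin (2 * m + 3))) M] [IsManifold (𝓡 (2 * m + 3)) ∞ M]
  {β : ∀ p : M, TangentSpace (𝓡 (2 * m + 3)) p →L[ℝ] ℝ}

/-- The density of `β` in the preferred chart at `p`. -/
def chartDensity (β : ∀ p : M, TangentSpace (𝓡 (2 * m + 3)) p →L[ℝ] ℝ) (p : M) :
    EuclideanSpace ℝ (Fin (2 * m + 3)) → ℝ := formDensity (localForm β p)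

/-- The integral of a function in the preferred chart at `p`, with respect to the density of `β`. -/
def chartIntegral (β : ∀ p : M, TangentSpace (𝓡 (2 * m + 3)) p →L[ℝ] ℝ) (p : M) (f : M → ℝ) : ℝ :=
  ∫ x in (extChartAt (𝓡 (2 * m + 3)) p).target,
    f ((extChartAt (𝓡 (2 * m + 3)) p).symm x) * chartDensity β p x

theorem IsContactForm.formMatrix_det_ne_zero (hβ : IsContactForm β) {p : M}
    {x : EuclideanSpace ℝ (Fin (2 * m + 3))} (hx : x ∈ (extChartAt (𝓡 (2 * m + 3)) p).target) :
    (formMatrix (localForm β p) x).det ≠ 0 := by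
  refine OBD.formMatrix_det_ne_zero fun v hv => ?_
  have : chartSymmDeriv p x v = 0 := by
    refine hβ.flat_injective fun w => ?_
    rw [dForm_chart hβ.1 hx, chartDeriv_chartSymmDeriv hx]
    have := hv (chartDeriv p _ w)
    rw [localForm_apply, localForm_apply, chartSymmDeriv_chartDeriv hx] at this
    exact this
  rw [← chartDeriv_chartSymmDeriv hx v, this, map_zero]

theorem IsContactForm.contDiffAt_chartDensity (hβ : IsContactForm β) {p : M}
    {x : EuclideanSpace ℝ (Fin (2 * m + 3))} (hx : x ∈ (extChartAt (𝓡 (2 * m + 3)) p).target) :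
    ContDiffAt ℝ ∞ (chartDensity β p) x :=
  formDensity_contDiffAt (hβ.1.contDiffAt_localForm hx) (hβ.formMatrix_det_ne_zero hx)

theorem IsContactForm.chartDensity_pos (hβ : IsContactForm β) {p : M}
    {x : EuclideanSpace ℝ (Fin (2 * m + 3))} (hx : x ∈ (extChartAt (𝓡 (2 * m + 3)) p).target) :
    0 < chartDensity β p x :=
  formDensity_pos (hβ.formMatrix_det_ne_zero hx)

/-- Invariance of the integral under changes of charts. -/
theorem chartIntegral_eq (hβ : IsSmoothForm β) (p q : M) {f : M → ℝ}
    (hp : ∀ y ∉ (extChartAt (𝓡 (2 * m + 3)) p).source, f y = 0)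
    (hq : ∀ y ∉ (extChartAt (𝓡 (2 * m + 3)) q).source, f y = 0) :
    chartIntegral β p f = chartIntegral β q f := by
  set ep := extChartAt (𝓡 (2 * m + 3)) p with hep
  set ef := extChartAt (𝓡 (2 * m + 3)) q with hef
  have hcont (p : M) : ContinuousOn (extChartAt (𝓡 (2 * m + 3)) p).symm
      (extChartAt (𝓡 (2 * m + 3)) p).target := continuousOn_extChartAt_symm p
  set Up := ep.target ∩ ep.symm ⁻¹' ef.source with hUp
  set Uq := ef.target ∩ ef.symm ⁻¹' ep.source with hUq
  have hUqo : IsOpen Uq := (hcont q).isOpen_inter_preimage (isOpen_extChartAt_target q)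
    (isOpen_extChartAt_source p)
  set τ := ep ∘ ef.symm with hτ
  have himg : τ '' Uq = Up := by
    ext x
    constructor
    · rintro ⟨y, ⟨hy, hy'⟩, rfl⟩
      refine ⟨ep.map_source hy', ?_⟩
      rw [Set.mem_preimage, hτ, Function.comp_apply, ep.left_inv hy']
      exact ef.map_target hy
    · rintro ⟨hx, hx'⟩
      refine ⟨ef (ep.symm x), ⟨ef.map_source hx', ?_⟩, ?_⟩
      · rw [Set.mem_preimage, ef.left_inv hx']
        exact ep.map_target hx
      · rw [hτ, Function.comp_apply, ef.left_inv hx', ep.right_inv hx]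
  have hinj : Set.InjOn τ Uq := by
    rintro y ⟨hy, hy'⟩ z ⟨hz, hz'⟩ h
    exact ef.symm.injOn hy hz (ep.injOn hy' hz' h)
  have hder (x) (hx : x ∈ Uq) : HasFDerivWithinAt τ (fderiv ℝ τ x) Uq x :=
    ((contDiffAt_chart_transition hx.1 hx.2).differentiableAt
      (by simp)).hasFDerivAt.hasFDerivWithinAt
  have hres (p q : M) (hq : ∀ y ∉ (extChartAt (𝓡 (2 * m + 3)) q).source, f y = 0) :
      chartIntegral β p f = ∫ x in (extChartAt (𝓡 (2 * m + 3)) p).target ∩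
        (extChartAt (𝓡 (2 * m + 3)) p).symm ⁻¹' (extChartAt (𝓡 (2 * m + 3)) q).source,
        f ((extChartAt (𝓡 (2 * m + 3)) p).symm x) * chartDensity β p x := by
    refine MeasureTheory.setIntegral_eq_of_subset_of_forall_sdiff_eq_zero
      (isOpen_extChartAt_target p).measurableSet Set.inter_subset_left fun x hx => ?_
    rw [hq _ fun h => hx.2 ⟨hx.1, h⟩, zero_mul]
  rw [hres p q hq, hres q p hp]
  change ∫ x in Up, _ = ∫ x in Uq, _
  rw [← himg, MeasureTheory.integral_image_eq_integral_abs_det_fderiv_smul _ hUqo.measurableSet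
    hder hinj]
  refine MeasureTheory.setIntegral_congr_fun hUqo.measurableSet fun x hx => ?_
  have h1 : chartDensity β q x = |(fderiv ℝ τ x).det| * chartDensity β p (τ x) := by
    refine formDensity_pullback (hβ.contDiffAt_localForm (ep.map_source hx.2))
      (contDiffAt_chart_transition hx.1 hx.2) ?_
    filter_upwards [hUqo.mem_nhds hx] with y hy
    exact localForm_chart_transition β hy.1 hy.2
  have h2 : ep.symm (τ x) = ef.symm x := ep.left_inv hx.2
  simp only [smul_eq_mul]
  rw [mul_left_comm, ← h1]
  exact congrArg (fun q => f q * _) h2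

end ChartIntegral

section ClosedTransverse

variable {m : ℕ} {M : Type*} [TopologicalSpace M]
  [ChartedSpace (EuclideanSpace ℝ (Fin (2 * m + 3))) M] [IsManifold (𝓡 (2 * m + 3)) ∞ M]
  {β : ∀ p : M, TangentSpace (𝓡 (2 * m + 3)) p →L[ℝ] ℝ}

section Integrable

variable [CompactSpace M]

theorem isCompact_chart_image_tsupport {p : M} {f : M → ℝ}
    (hs : tsupport f ⊆ (extChartAt (𝓡 (2 * m + 3)) p).source) :
    IsCompact (extChartAt (𝓡 (2 * m + 3)) p '' tsupport f) :=
  (isClosed_tsupport f).isCompact.image_of_continuousOn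
    ((continuousOn_extChartAt (I := 𝓡 (2 * m + 3)) p).mono hs)

theorem chart_image_tsupport_subset {p : M} {f : M → ℝ}
    (hs : tsupport f ⊆ (extChartAt (𝓡 (2 * m + 3)) p).source) :
    extChartAt (𝓡 (2 * m + 3)) p '' tsupport f ⊆ (extChartAt (𝓡 (2 * m + 3)) p).target := by
  rintro _ ⟨q, hq, rfl⟩
  exact (extChartAt (𝓡 (2 * m + 3)) p).map_source (hs hq)

theorem eq_zero_of_notMem_chart_image {p : M} {f : M → ℝ} {x : EuclideanSpace ℝ (Fin (2 * m + 3))}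
    (hx : x ∈ (extChartAt (𝓡 (2 * m + 3)) p).target)
    (hx' : x ∉ extChartAt (𝓡 (2 * m + 3)) p '' tsupport f) :
    f ((extChartAt (𝓡 (2 * m + 3)) p).symm x) = 0 := by
  by_contra h
  exact hx' ⟨_, subset_tsupport f h, (extChartAt (𝓡 (2 * m + 3)) p).right_inv hx⟩

theorem IsContactForm.integrableOn_chart (hβ : IsContactForm β) {p : M} {f : M → ℝ}
    (hf : Continuous f) (hs : tsupport f ⊆ (extChartAt (𝓡 (2 * m + 3)) p).source) :
    MeasureTheory.IntegrableOn
      (fun x => f ((extChartAt (𝓡 (2 * m + 3)) p).symm x) * chartDensity β p x)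
      (extChartAt (𝓡 (2 * m + 3)) p).target := by
  refine MeasureTheory.IntegrableOn.of_forall_sdiff_eq_zero (ContinuousOn.integrableOn_compact
    (isCompact_chart_image_tsupport hs) ?_) (isOpen_extChartAt_target p).measurableSet ?_
  · have h := chart_image_tsupport_subset hs
    refine (hf.comp_continuousOn ((continuousOn_extChartAt_symm p).mono h)).mul fun x hx => ?_
    exact (hβ.contDiffAt_chartDensity (h hx)).continuousAt.continuousWithinAt
  · rintro x ⟨hx, hx'⟩
    rw [eq_zero_of_notMem_chart_image hx hx', zero_mul]

theorem IsContactForm.chartIntegral_sum (hβ : IsContactForm β) {p : M} {ι : Type*} (s : Finset ι)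
    {f : ι → M → ℝ} (hf : ∀ i, Continuous (f i))
    (hs : ∀ i, tsupport (f i) ⊆ (extChartAt (𝓡 (2 * m + 3)) p).source) :
    chartIntegral β p (fun q => ∑ i ∈ s, f i q) = ∑ i ∈ s, chartIntegral β p (f i) := by
  simp only [chartIntegral, Finset.sum_mul]
  exact MeasureTheory.integral_finsetSum _ fun i _ => hβ.integrableOn_chart (hf i) (hs i)

theorem IsContactForm.chartIntegral_pos (hβ : IsContactForm β) {p : M} {f : M → ℝ}
    (hf : Continuous f) (hs : tsupport f ⊆ (extChartAt (𝓡 (2 * m + 3)) p).source)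
    (h0 : ∀ q, 0 ≤ f q) {q : M} (hq : 0 < f q) : 0 < chartIntegral β p f := by
  have hT := isOpen_extChartAt_target (I := 𝓡 (2 * m + 3)) p
  rw [chartIntegral, MeasureTheory.setIntegral_pos_iff_support_of_nonneg_ae _
    (hβ.integrableOn_chart hf hs)]
  · have hU : IsOpen ((extChartAt (𝓡 (2 * m + 3)) p).target ∩
        (extChartAt (𝓡 (2 * m + 3)) p).symm ⁻¹' {q | 0 < f q}) :=
      (continuousOn_extChartAt_symm p).isOpen_inter_preimage hT (isOpen_lt continuous_const hf)
    have hqs := hs (subset_tsupport f hq.ne')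
    refine lt_of_lt_of_le (hU.measure_pos _ ⟨extChartAt (𝓡 (2 * m + 3)) p q,
      (extChartAt (𝓡 (2 * m + 3)) p).map_source hqs, ?_⟩) (MeasureTheory.measure_mono ?_)
    · change 0 < f _
      rwa [(extChartAt (𝓡 (2 * m + 3)) p).left_inv hqs]
    · rintro x ⟨hx, hx'⟩
      exact ⟨mul_ne_zero (ne_of_gt hx') (hβ.chartDensity_pos hx).ne', hx⟩
  · exact MeasureTheory.ae_restrict_of_forall_mem hT.measurableSet fun x hx =>
      mul_nonneg (h0 _) (hβ.chartDensity_pos hx).le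

/-- The divergence theorem in a chart. -/
theorem IsContactForm.chartIntegral_divergence (hβ : IsContactForm β)
    {θ : ∀ p : M, TangentSpace (𝓡 (2 * m + 3)) p →L[ℝ] ℝ} (hθ : IsSmoothForm θ)
    (hcl : ∀ p v w, dForm θ p v w = 0) {V : ∀ p : M, TangentSpace (𝓡 (2 * m + 3)) p}
    (hV : IsSmoothField V) (hβV : ∀ p, β p (V p) = 0) {c : M → ℝ}
    (hc : ContMDiff (𝓡 (2 * m + 3)) 𝓘(ℝ, ℝ) ∞ c) (hcθ : ∀ p, c p = θ p (reeb hβ p))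
    (hΩ : ∀ p w, dForm β p (V p) w = c p * β p w - θ p w) {f : M → ℝ}
    (hf : ContMDiff (𝓡 (2 * m + 3)) 𝓘(ℝ, ℝ) ∞ f) {p : M}
    (hs : tsupport f ⊆ (extChartAt (𝓡 (2 * m + 3)) p).source) :
    chartIntegral β p (fun q => mvfderiv (𝓡 (2 * m + 3)) f q (V q) + f q * (c q * (m + 1))) = 0 := by
  have hT := isOpen_extChartAt_target (I := 𝓡 (2 * m + 3)) p
  rw [← setIntegral_divergence hT (isCompact_chart_image_tsupport hs)
    (chart_image_tsupport_subset hs) (ψ := f ∘ (extChartAt (𝓡 (2 * m + 3)) p).symm)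
    (ν := chartDensity β p) (W := localField V p)
    (fun x hx => contDiffAt_comp_chart_symm' hf hx) (fun x hx => hβ.contDiffAt_chartDensity hx)
    (fun x hx => hV.contDiffAt_localField hx)
    (fun x hx hx' => eq_zero_of_notMem_chart_image hx hx')]
  refine MeasureTheory.setIntegral_congr_fun hT.measurableSet fun x hx => ?_
  have hdiv := formDensity_divergence (A := localForm β p) (W := localField V p)
    (θ := localForm θ p) (c := c ∘ (extChartAt (𝓡 (2 * m + 3)) p).symm)
    (R := localField (reeb hβ) p x)
    (hβ.1.contDiffAt_localForm hx) (hV.contDiffAt_localField hx)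
    (hθ.contDiffAt_localForm hx) (contDiffAt_comp_chart_symm' hc hx)
    (by
      filter_upwards [chart_target_mem_nhds hx] with y hy
      rw [localForm_localField β V hy, hβV])
    (by
      filter_upwards [chart_target_mem_nhds hx] with y hy v
      have := hΩ ((extChartAt (𝓡 (2 * m + 3)) p).symm y) (chartSymmDeriv p y v)
      rw [dForm_chart hβ.1 hy, chartDeriv_chartSymmDeriv hy] at this
      exact this)
    (by
      ext v w
      have := hcl ((extChartAt (𝓡 (2 * m + 3)) p).symm x) (chartSymmDeriv p x v)
        (chartSymmDeriv p x w)
      rw [dForm_chart hθ hx, chartDeriv_chartSymmDeriv hx, chartDeriv_chartSymmDeriv hx] at this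
      exact this)
    (hβ.formMatrix_det_ne_zero hx)
    (by rw [localForm_localField β _ hx, apply_reeb])
    (by
      intro v
      have := dForm_reeb hβ ((extChartAt (𝓡 (2 * m + 3)) p).symm x) (chartSymmDeriv p x v)
      rw [dForm_chart hβ.1 hx, chartDeriv_chartSymmDeriv hx] at this
      exact this)
    (by rw [localForm_localField θ _ hx, Function.comp_apply, hcθ])
  change fderiv ℝ (chartDensity β p) x _ + chartDensity β p x * _ = chartDensity β p x * _ at hdiv
  simp only [hdiv]
  rw [mvfderiv_comp_chart_symm hf V hx]
  push_cast
  simp only [Function.comp_apply]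
  ring

end Integrable

/-- On a closed manifold, no closed 1-form is positive on the Reeb vector field of a contact
form. -/
theorem IsContactForm.not_forall_closed_pos [T2Space M] [CompactSpace M] [Nonempty M]
    (hβ : IsContactForm β)
    {θ : ∀ p : M, TangentSpace (𝓡 (2 * m + 3)) p →L[ℝ] ℝ} (hθ : IsSmoothForm θ)
    (hcl : ∀ p v w, dForm θ p v w = 0) (hpos : ∀ p, 0 < θ p (reeb hβ p)) : False := by
  set c : M → ℝ := fun p => θ p (reeb hβ p) with hcdef
  have hc : ContMDiff (𝓡 (2 * m + 3)) 𝓘(ℝ, ℝ) ∞ c := hθ.contMDiff_apply (isSmoothField_reeb hβ)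
  obtain ⟨V, hV, hVe⟩ := hβ.exists_field (η := fun p => c p • β p - θ p) ((hβ.1.smul hc).sub hθ)
  have hβV (p) : β p (V p) = 0 := by
    have := hVe p (reeb hβ p)
    rw [dForm_skew, dForm_reeb] at this
    simpa [apply_reeb, hcdef] using this
  have hΩ (p w) : dForm β p (V p) w = c p * β p w - θ p w := by
    have := hVe p w
    rw [hβV, zero_mul, add_zero] at this
    simpa using this
  obtain ⟨f, hfs⟩ := SmoothPartitionOfUnity.exists_isSubordinate_chartAt_source (𝓡 (2 * m + 3)) M
  have hfs' (i : M) : tsupport (f i) ⊆ (extChartAt (𝓡 (2 * m + 3)) i).source := by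
    rw [extChartAt_source]
    exact hfs i
  have hsm (i : M) : ContMDiff (𝓡 (2 * m + 3)) 𝓘(ℝ, ℝ) ∞ (f i) := (f i).contMDiff
  obtain ⟨s, hs⟩ := f.locallyFinite.finite_nonempty_of_compact.exists_finset
  have hsum (p : M) : ∑ i ∈ s, f i p = 1 := by
    rw [← finsum_eq_sum_of_support_subset]
    · exact f.sum_eq_one (Set.mem_univ p)
    · intro i hi
      exact (hs i).2 ⟨p, hi⟩
  set g : M → M → ℝ := fun i q => mvfderiv (𝓡 (2 * m + 3)) (f i) q (V q) with hg
  have hgc (i : M) : ContMDiff (𝓡 (2 * m + 3)) 𝓘(ℝ, ℝ) ∞ (g i) := hV.contMDiff_mvfderiv (hsm i)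
  have hg0 (q : M) : ∑ i ∈ s, g i q = 0 := by
    have h1 := mvfderiv_sum_apply s (f := fun i => (f i : M → ℝ)) (p := q) (fun i => (hsm i).mdifferentiableAt (by simp)) (V q)
    rw [← h1]
    have : (fun q => ∑ i ∈ s, f i q) = fun _ => (1 : ℝ) := funext hsum
    rw [this]
    simp [mvfderiv_const]
  have hgsupp (i : M) : tsupport (g i) ⊆ tsupport (f i) := by
    refine closure_minimal (fun q hq => ?_) (isClosed_tsupport _)
    by_contra h
    have h0 : (f i : M → ℝ) =ᶠ[𝓝 q] fun _ => 0 := notMem_tsupport_iff_eventuallyEq.1 h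
    refine hq ?_
    rw [hg]
    simp only
    rw [mvfderiv_congr h0]
    simp [mvfderiv_const]
  set κ : M → ℝ := fun q => c q * (m + 1) with hκ
  have hκc : Continuous κ := hc.continuous.mul continuous_const
  have hκpos (q) : 0 < κ q := mul_pos (hpos q) (by positivity)
  have hmul (i : M) {k : M → ℝ} : tsupport (fun q => f i q * k q) ⊆ tsupport (f i) :=
    closure_mono (Function.support_mul_subset_left _ _)
  have hmul' (i j : M) : tsupport (fun q => f j q * g i q) ⊆ tsupport (g i) :=
    closure_mono (Function.support_mul_subset_right _ _)
  have h1 (i : M) : chartIntegral β i (g i) + chartIntegral β i (fun q => f i q * κ q) = 0 := by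
    have h := hβ.chartIntegral_divergence hθ hcl hV hβV hc (fun _ => rfl) hΩ (hsm i) (hfs' i)
    rw [← h]
    refine Eq.trans (MeasureTheory.integral_add
      (hβ.integrableOn_chart (hgc i).continuous ((hgsupp i).trans (hfs' i)))
      (hβ.integrableOn_chart ((hsm i).continuous.mul hκc) ((hmul i).trans (hfs' i)))).symm ?_
    refine MeasureTheory.integral_congr_ae (Filter.Eventually.of_forall fun x => ?_)
    simp only [hg, hκ]
    exact (add_mul _ _ _).symm
  have h2 (i : M) : chartIntegral β i (g i) = ∑ j ∈ s, chartIntegral β j (fun q => f j q * g i q) := by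
    have h : g i = fun q => ∑ j ∈ s, f j q * g i q := by
      funext q
      rw [← Finset.sum_mul, hsum, one_mul]
    conv_lhs => rw [h]
    rw [hβ.chartIntegral_sum s (f := fun j q => f j q * g i q) (fun j => (hsm j).continuous.mul (hgc i).continuous)
      (fun j => (hmul' i j).trans ((hgsupp i).trans (hfs' i)))]
    refine Finset.sum_congr rfl fun j _ => chartIntegral_eq hβ.1 i j (fun q hq => ?_) fun q hq => ?_
    · exact image_eq_zero_of_notMem_tsupport (f := fun q => f j q * g i q) fun h =>
        hq (((hmul' i j).trans ((hgsupp i).trans (hfs' i))) h)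
    · exact image_eq_zero_of_notMem_tsupport (f := fun q => f j q * g i q) fun h => hq (((hmul j).trans (hfs' j)) h)
  have h3 : ∑ i ∈ s, chartIntegral β i (g i) = 0 := by
    simp only [h2]
    rw [Finset.sum_comm]
    refine Finset.sum_eq_zero fun j _ => ?_
    rw [← hβ.chartIntegral_sum s (f := fun i q => f j q * g i q) (fun i => (hsm j).continuous.mul (hgc i).continuous)
      (fun i => (hmul j).trans (hfs' j))]
    simp only [← Finset.mul_sum, hg0]
    simp [chartIntegral]
  have h4 : ∑ i ∈ s, chartIntegral β i (fun q => f i q * κ q) = 0 := by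
    have := Finset.sum_congr (rfl : s = s) fun i _ => h1 i
    rw [Finset.sum_add_distrib, h3, zero_add, Finset.sum_const_zero] at this
    exact this
  refine absurd h4 (ne_of_gt ?_)
  have hpos' (i) : ∀ q, 0 ≤ f i q * κ q := fun q => mul_nonneg (f.nonneg i q) (hκpos q).le
  have hstrict (i) (hi : i ∈ s) : 0 < chartIntegral β i (fun q => f i q * κ q) := by
    obtain ⟨q, hq⟩ := (hs i).1 hi
    refine hβ.chartIntegral_pos ((hsm i).continuous.mul hκc) ((hmul i).trans (hfs' i)) (hpos' i)
      (q := q) (mul_pos (lt_of_le_of_ne (f.nonneg i q) (Ne.symm hq)) (hκpos q))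
  refine Finset.sum_pos hstrict ?_
  by_contra h
  rw [Finset.not_nonempty_iff_eq_empty] at h
  obtain ⟨p⟩ := ‹Nonempty M›
  have := hsum p
  simp [h] at this

end ClosedTransverse

theorem twoFormPow_smul {V : Type*} (c : ℝ) {η η' : V → V → ℝ} {k : ℕ} {v : Fin (2 * k) → V}
    (h : ∀ i j, η' (v i) (v j) = c * η (v i) (v j)) :
    twoFormPow η' k v = c ^ k * twoFormPow η k v := by
  simp only [twoFormPow, h, Finset.prod_mul_distrib, Finset.prod_const, Finset.card_univ,
    Fintype.card_fin, mul_left_comm _ (c ^ k), ← Finset.mul_sum]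

/-- The contact condition for a pair only depends on the restriction of the 2-form to the kernel of
the 1-form, up to scaling. -/
theorem IsContactPair.volume_ne_zero_of_scaled {V : Type*} [AddCommGroup V] [Module ℝ V]
    [FiniteDimensional ℝ V] {m : ℕ} {a : V →ₗ[ℝ] ℝ} {η : V →ₗ[ℝ] V →ₗ[ℝ] ℝ}
    (h : IsContactPair m a η) {c : ℝ} (hc : c ≠ 0) {a' : V → ℝ} {η' : V → V → ℝ}
    (ha : ∀ v, a' v = c * a v) (hη : ∀ v w, a v = 0 → a w = 0 → η' v w = c * η v w) :
    ∃ v, wedgeTwoFormPow a' η' (m + 1) v ≠ 0 := by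
  obtain ⟨A, hA⟩ := exists_alternating_wedgeTwoFormPow a η (m + 1)
  obtain ⟨b, hb⟩ := exists_basis_succ_mem_ker h.finrank_eq a
  obtain ⟨v, hv⟩ := h.volume_ne_zero
  have hAb : A b ≠ 0 := by
    intro h0
    rw [← hA, A.eq_smul_basis_det b, h0] at hv
    simp at hv
  refine ⟨b, ?_⟩
  have hcons : (b : Fin (2 * (m + 1) + 1) → V) = Fin.cons (b 0) (fun i => b (Fin.succ i)) :=
    (Fin.cons_self_tail (b : Fin (2 * (m + 1) + 1) → V)).symm
  rw [hA, hcons, wedgeTwoFormPow_cons_of_mem_ker (fun x => a x) _ _ _ _ hb] at hAb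
  rw [hcons, wedgeTwoFormPow_cons_of_mem_ker a' _ _ _ _ fun i => by rw [ha, hb, mul_zero],
    twoFormPow_smul c (η := fun x y => η x y) fun i j => hη _ _ (hb i) (hb j), ha]
  have h1 := left_ne_zero_of_mul hAb
  have h2 := right_ne_zero_of_mul hAb
  positivity

section Scaling

variable {m : ℕ} {M : Type*} [TopologicalSpace M]
  [ChartedSpace (EuclideanSpace ℝ (Fin (2 * m + 3))) M] [IsManifold (𝓡 (2 * m + 3)) ∞ M]
  {α : ∀ p : M, TangentSpace (𝓡 (2 * m + 3)) p →L[ℝ] ℝ} {u : M → ℝ}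

theorem IsContactForm.smul (hα : IsContactForm α) (hu : ContMDiff (𝓡 (2 * m + 3)) 𝓘(ℝ, ℝ) ∞ u)
    (hu0 : ∀ p, u p ≠ 0) : IsContactForm (fun p => u p • α p) := by
  refine ⟨hα.1.smul hu, fun p => ?_⟩
  refine (hα.isContactPair p).volume_ne_zero_of_scaled (hu0 p) (fun v => rfl) fun v w hv hw => ?_
  rw [dForm_smul hα.1 hu]
  change α p v = 0 at hv
  change α p w = 0 at hw
  rw [hv, hw, mul_zero, mul_zero, sub_zero, zero_add, dFormLin_apply]

theorem ContactStructure.IsDefinedBy.smul {ξ : ContactStructure m M} (hα : ξ.IsDefinedBy α)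
    (hu : ContMDiff (𝓡 (2 * m + 3)) 𝓘(ℝ, ℝ) ∞ u) (hu0 : ∀ p, 0 < u p) :
    ξ.IsDefinedBy (fun p => u p • α p) := by
  refine ⟨hα.1.smul hu fun p => (hu0 p).ne', fun p v => ⟨?_, ?_⟩⟩
  · rw [(hα.2 p v).1, smul_apply, smul_eq_mul, mul_eq_zero, or_iff_right (hu0 p).ne']
  · rw [(hα.2 p v).2, smul_apply, smul_eq_mul, mul_pos_iff_of_pos_left (hu0 p)]

theorem IsContactForm.eq_reeb (hα : IsContactForm α) {p : M} {Z : TangentSpace (𝓡 (2 * m + 3)) p}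
    (h1 : α p Z = 1) (h2 : ∀ w, dForm α p Z w = 0) : Z = reeb hα p := by
  refine sub_eq_zero.1 (hα.flat_injective fun w => ?_)
  rw [map_sub, h1, apply_reeb, sub_self, zero_mul, add_zero, ← dFormLin_apply, map_sub,
    LinearMap.sub_apply, dFormLin_apply, dFormLin_apply, h2, dForm_reeb, sub_self]

theorem IsContactForm.eq_contactField (hα : IsContactForm α) {x : M → ℝ}
    (hx : ContMDiff (𝓡 (2 * m + 3)) 𝓘(ℝ, ℝ) ∞ x) {p : M} {Z : TangentSpace (𝓡 (2 * m + 3)) p}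
    (h1 : α p Z = x p) (h2 : ∀ w, dForm α p Z w =
      mvfderiv (𝓡 (2 * m + 3)) x p (reeb hα p) * α p w - mvfderiv (𝓡 (2 * m + 3)) x p w) :
    Z = contactField hα hx p := by
  refine sub_eq_zero.1 (hα.flat_injective fun w => ?_)
  rw [map_sub, h1, apply_contactField, sub_self, zero_mul, add_zero, ← dFormLin_apply, map_sub,
    LinearMap.sub_apply, dFormLin_apply, dFormLin_apply, h2, dForm_contactField, sub_self]

/-- The Reeb vector field of `α / u` is the contact vector field of Hamiltonian `u`. -/
theorem reeb_inv_smul (hα : IsContactForm α) (hu : ContMDiff (𝓡 (2 * m + 3)) 𝓘(ℝ, ℝ) ∞ u)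
    (hu0 : ∀ p, u p ≠ 0) (hβ : IsContactForm (fun p => (u p)⁻¹ • α p)) (p : M) :
    reeb hβ p = contactField hα hu p := by
  have hv : ContMDiff (𝓡 (2 * m + 3)) 𝓘(ℝ, ℝ) ∞ fun p => (u p)⁻¹ := hu.inv₀ hu0
  have hd (w : TangentSpace (𝓡 (2 * m + 3)) p) :
      u p * mvfderiv (𝓡 (2 * m + 3)) (fun p => (u p)⁻¹) p w =
        - (u p)⁻¹ * mvfderiv (𝓡 (2 * m + 3)) u p w := by
    have h := mvfderiv_mul_apply (hu.mdifferentiableAt (x := p) (by simp))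
      (hv.mdifferentiableAt (by simp)) w
    have h1 : (fun q => u q * (u q)⁻¹) = fun _ => (1 : ℝ) := funext fun q => mul_inv_cancel₀ (hu0 q)
    rw [h1, mvfderiv_const] at h
    simp only [zero_apply] at h
    linarith
  have hup := hu0 p
  have hd' (w : TangentSpace (𝓡 (2 * m + 3)) p) :
      mvfderiv (𝓡 (2 * m + 3)) (fun p => (u p)⁻¹) p w =
        - (u p)⁻¹ ^ 2 * mvfderiv (𝓡 (2 * m + 3)) u p w := by
    have := hd w
    field_simp at this ⊢
    linarith
  symm
  refine hβ.eq_reeb ?_ fun w => ?_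
  · rw [smul_apply, apply_contactField, smul_eq_mul, inv_mul_cancel₀ hup]
  · have hself : mvfderiv (𝓡 (2 * m + 3)) u p (contactField hα hu p) =
        u p * mvfderiv (𝓡 (2 * m + 3)) u p (reeb hα p) := by
      rw [contactField, map_add, map_smul, mvfderiv_horizontal_self, add_zero, smul_eq_mul]
    rw [dForm_smul hα.1 hv, hd', hd', hself, apply_contactField, dForm_contactField]
    field_simp
    ring

end Scaling

section Closed

variable {d : ℕ} {M : Type*} [TopologicalSpace M]
  [ChartedSpace (EuclideanSpace ℝ (Fin d)) M] [IsManifold (𝓡 d) ∞ M]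

theorem dForm_mvfderiv {f : M → ℝ} (hf : ContMDiff (𝓡 d) 𝓘(ℝ, ℝ) ∞ f) (p : M)
    (v w : TangentSpace (𝓡 d) p) : dForm (fun p => mvfderiv (𝓡 d) f p) p v w = 0 := by
  have hp := mem_extChartAt_target (I := 𝓡 d) p
  have hloc : localForm (fun p => mvfderiv (𝓡 d) f p) p =ᶠ[𝓝 (extChartAt (𝓡 d) p p)]
      fderiv ℝ (f ∘ (extChartAt (𝓡 d) p).symm) := by
    filter_upwards [chart_target_mem_nhds hp] with y hy
    ext v
    rw [localForm_apply]
    exact mvfderiv_eq_chart hy (hf.mdifferentiableAt (by simp)) _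
  have hsym : IsSymmSndFDerivAt ℝ (f ∘ (extChartAt (𝓡 d) p).symm) (extChartAt (𝓡 d) p p) :=
    (contDiffAt_comp_chart_symm' hf hp).isSymmSndFDerivAt (by simp; norm_cast)
  rw [dForm_self, extD_apply, hloc.fderiv_eq, hsym, sub_self]

theorem dForm_sub {α β : ∀ p : M, TangentSpace (𝓡 d) p →L[ℝ] ℝ} (hα : IsSmoothForm α)
    (hβ : IsSmoothForm β) (p : M) (v w : TangentSpace (𝓡 d) p) :
    dForm (fun p => α p - β p) p v w = dForm α p v w - dForm β p v w := by
  have hp := mem_extChartAt_target (I := 𝓡 d) p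
  have h1 := (hα.contDiffAt_localForm hp).differentiableAt (by simp)
  have h2 := (hβ.contDiffAt_localForm hp).differentiableAt (by simp)
  have hloc : localForm (fun p => α p - β p) p = localForm α p - localForm β p := rfl
  simp only [dForm_self, extD_apply, hloc, (h1.hasFDerivAt.sub h2.hasFDerivAt).fderiv, sub_apply]
  ring

end Closed

section Bracket

variable {m : ℕ} {M : Type*} [TopologicalSpace M]
  [ChartedSpace (EuclideanSpace ℝ (Fin (2 * m + 3))) M] [IsManifold (𝓡 (2 * m + 3)) ∞ M]
  {α : ∀ p : M, TangentSpace (𝓡 (2 * m + 3)) p →L[ℝ] ℝ} (hα : IsContactForm α)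
  {x y : M → ℝ} (hx : ContMDiff (𝓡 (2 * m + 3)) 𝓘(ℝ, ℝ) ∞ x)
  (hy : ContMDiff (𝓡 (2 * m + 3)) 𝓘(ℝ, ℝ) ∞ y)

/-- The contact bracket `{x, y}`: the Hamiltonian of the Lie bracket of the contact vector fields
with Hamiltonians `x` and `y`. -/
def contactBracket (y : M → ℝ) (p : M) : ℝ :=
  mvfderiv (𝓡 (2 * m + 3)) y p (contactField hα hx p) -
    y p * mvfderiv (𝓡 (2 * m + 3)) x p (reeb hα p)

include hx in
theorem contMDiff_mvfderiv_reeb : ContMDiff (𝓡 (2 * m + 3)) 𝓘(ℝ, ℝ) ∞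
    fun p => mvfderiv (𝓡 (2 * m + 3)) x p (reeb hα p) :=
  (isSmoothField_reeb hα).contMDiff_mvfderiv hx

include hy in
theorem contMDiff_contactBracket :
    ContMDiff (𝓡 (2 * m + 3)) 𝓘(ℝ, ℝ) ∞ (contactBracket hα hx y) :=
  ((isSmoothField_contactField hα hx).contMDiff_mvfderiv hy).sub
    (hy.mul (contMDiff_mvfderiv_reeb hα hx))

theorem contactBracket_eq (p : M) : contactBracket hα hx y p =
    x p * mvfderiv (𝓡 (2 * m + 3)) y p (reeb hα p) -
      y p * mvfderiv (𝓡 (2 * m + 3)) x p (reeb hα p) +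
      mvfderiv (𝓡 (2 * m + 3)) y p (horizontal hα hx p) :=
  mvfderiv_contactField_sub hα hx p

theorem mvfderiv_contactField_self (p : M) :
    mvfderiv (𝓡 (2 * m + 3)) x p (contactField hα hx p) =
      x p * mvfderiv (𝓡 (2 * m + 3)) x p (reeb hα p) := by
  rw [contactField, map_add, map_smul, mvfderiv_horizontal_self, add_zero, smul_eq_mul]

theorem mvfderiv_snd_contactField (p : M) :
    mvfderiv (𝓡 (2 * m + 3)) y p (contactField hα hx p) =
      contactBracket hα hx y p + y p * mvfderiv (𝓡 (2 * m + 3)) x p (reeb hα p) := by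
  rw [contactBracket, sub_add_cancel]

theorem mvfderiv_fst_contactField (p : M) :
    mvfderiv (𝓡 (2 * m + 3)) x p (contactField hα hy p) =
      x p * mvfderiv (𝓡 (2 * m + 3)) y p (reeb hα p) - contactBracket hα hx y p := by
  rw [contactBracket_eq, mvfderiv_horizontal_skew hα hx hy, contactField, map_add, map_smul,
    smul_eq_mul]
  ring

include hy in
/-- On a closed manifold, two functions with a positive contact bracket have a common zero. -/
theorem exists_common_zero [T2Space M] [CompactSpace M] [Nonempty M]
    (hP : ∀ p, 0 < contactBracket hα hx y p) : ∃ p, x p = 0 ∧ y p = 0 := by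
  by_contra! hne
  have hq (p : M) : 0 < x p ^ 2 + y p ^ 2 := by
    by_cases h : x p = 0
    · have := hne p h
      positivity
    · positivity
  have hqs : ContMDiff (𝓡 (2 * m + 3)) 𝓘(ℝ, ℝ) ∞ fun p => x p * x p + y p * y p :=
    (hx.mul hx).add (hy.mul hy)
  have hq' (p : M) : 0 < x p * x p + y p * y p := by have := hq p; nlinarith
  set ρ : M → ℝ := fun p => √(x p * x p + y p * y p) with hρ
  have hρ0 (p : M) : 0 < ρ p := Real.sqrt_pos.2 (hq' p)
  have hρs : ContMDiff (𝓡 (2 * m + 3)) 𝓘(ℝ, ℝ) ∞ ρ := fun p =>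
    ((Real.contDiffAt_sqrt (hq' p).ne').contMDiffAt).comp p (hqs p)
  have hρ2 (p : M) : ρ p * ρ p = x p * x p + y p * y p := Real.mul_self_sqrt (hq' p).le
  set F : M → ℝ := fun p => (x p * x p + y p * y p)⁻¹ with hF
  have hFs : ContMDiff (𝓡 (2 * m + 3)) 𝓘(ℝ, ℝ) ∞ F := hqs.inv₀ fun p => (hq' p).ne'
  have hβ : IsContactForm (fun p => (ρ p)⁻¹ • α p) :=
    hα.smul (hρs.inv₀ fun p => (hρ0 p).ne') fun p => inv_ne_zero (hρ0 p).ne'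
  have dxd (p : M) := hx.mdifferentiableAt (x := p) (by simp)
  have dyd (p : M) := hy.mdifferentiableAt (x := p) (by simp)
  have dq (p : M) (v : TangentSpace (𝓡 (2 * m + 3)) p) :
      mvfderiv (𝓡 (2 * m + 3)) (fun p => x p * x p + y p * y p) p v =
        2 * (x p * mvfderiv (𝓡 (2 * m + 3)) x p v + y p * mvfderiv (𝓡 (2 * m + 3)) y p v) := by
    have h := DFunLike.congr_fun (mvfderiv_fun_add ((hx.mul hx).mdifferentiableAt (x := p) (by simp))
      ((hy.mul hy).mdifferentiableAt (by simp))) v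
    refine h.trans ?_
    have h1 := mvfderiv_mul_apply (dxd p) (dxd p) v
    have h2 := mvfderiv_mul_apply (dyd p) (dyd p) v
    rw [add_apply]
    refine (congrArg₂ (· + ·) h1 h2).trans ?_
    ring
  have dρ (p : M) (v : TangentSpace (𝓡 (2 * m + 3)) p) :
      ρ p * mvfderiv (𝓡 (2 * m + 3)) ρ p v =
        x p * mvfderiv (𝓡 (2 * m + 3)) x p v + y p * mvfderiv (𝓡 (2 * m + 3)) y p v := by
    have h := mvfderiv_mul_apply (hρs.mdifferentiableAt (x := p) (by simp))
      (hρs.mdifferentiableAt (x := p) (by simp)) v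
    rw [show (fun q => ρ q * ρ q) = _ from funext hρ2, dq] at h
    linarith
  have dF (p : M) (v : TangentSpace (𝓡 (2 * m + 3)) p) :
      mvfderiv (𝓡 (2 * m + 3)) F p v = -F p ^ 2 *
        (2 * (x p * mvfderiv (𝓡 (2 * m + 3)) x p v + y p * mvfderiv (𝓡 (2 * m + 3)) y p v)) := by
    have h := mvfderiv_mul_apply (hqs.mdifferentiableAt (x := p) (by simp))
      (hFs.mdifferentiableAt (x := p) (by simp)) v
    have h1 : (fun q => (x q * x q + y q * y q) * F q) = fun _ => (1 : ℝ) :=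
      funext fun q => mul_inv_cancel₀ (hq' q).ne'
    rw [h1, mvfderiv_const, dq] at h
    simp only [zero_apply] at h
    have h2 : (x p * x p + y p * y p) * F p = 1 := congrFun h1 p
    linear_combination (-F p) * h - (mvfderiv (𝓡 (2 * m + 3)) F p v) * h2
  set θ : ∀ p : M, TangentSpace (𝓡 (2 * m + 3)) p →L[ℝ] ℝ := fun p =>
    (F p * x p) • mvfderiv (𝓡 (2 * m + 3)) y p - (F p * y p) • mvfderiv (𝓡 (2 * m + 3)) x p with hθ
  have hdx := isSmoothForm_mvfderiv hx
  have hdy := isSmoothForm_mvfderiv hy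
  refine hβ.not_forall_closed_pos (θ := θ) ((hdy.smul (hFs.mul hx)).sub (hdx.smul (hFs.mul hy)))
    (fun p v w => ?_) fun p => ?_
  · have h1 := dForm_smul hdy (hFs.mul hx) p v w
    have h2 := dForm_smul hdx (hFs.mul hy) p v w
    have m1 (v) := mvfderiv_mul_apply (hFs.mdifferentiableAt (x := p) (by simp)) (dxd p) v
    have m2 (v) := mvfderiv_mul_apply (hFs.mdifferentiableAt (x := p) (by simp)) (dyd p) v
    have h3 : F p * (x p * x p + y p * y p) = 1 := inv_mul_cancel₀ (hq' p).ne'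
    refine (dForm_sub (hdy.smul (hFs.mul hx)) (hdx.smul (hFs.mul hy)) p v w).trans ?_
    refine (congrArg₂ (· - ·) h1 h2).trans ?_
    rw [dForm_mvfderiv hx, dForm_mvfderiv hy]
    change mvfderiv _ (fun q => F q * x q) p v * _ - mvfderiv _ (fun q => F q * x q) p w * _ + _ -
      (mvfderiv _ (fun q => F q * y q) p v * _ - mvfderiv _ (fun q => F q * y q) p w * _ + _) = 0
    rw [m1, m1, m2, m2, dF, dF]
    linear_combination (-2 * F p * (mvfderiv (𝓡 (2 * m + 3)) x p v * mvfderiv (𝓡 (2 * m + 3)) y p w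
      - mvfderiv (𝓡 (2 * m + 3)) x p w * mvfderiv (𝓡 (2 * m + 3)) y p v)) * h3
  · rw [reeb_inv_smul hα hρs (fun p => (hρ0 p).ne') hβ]
    have e1 := mvfderiv_fst_contactField hα hx hρs p
    have e2 := mvfderiv_fst_contactField hα hy hρs p
    have b1 := contactBracket_eq hα hx (y := ρ) p
    have b2 := contactBracket_eq hα hy (y := ρ) p
    have r1 := dρ p (horizontal hα hx p)
    have r2 := dρ p (horizontal hα hy p)
    rw [mvfderiv_horizontal_self] at r1 r2
    have sk := mvfderiv_horizontal_skew hα hx hy p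
    have hb := contactBracket_eq hα hx (y := y) p
    have key : ρ p * (x p * mvfderiv (𝓡 (2 * m + 3)) y p (contactField hα hρs p) -
        y p * mvfderiv (𝓡 (2 * m + 3)) x p (contactField hα hρs p)) =
        ρ p * (ρ p * contactBracket hα hx y p) := by
      rw [e1, e2, b1, b2, hb]
      linear_combination (-x p) * r2 + y p * r1 - x p * x p * sk -
        (mvfderiv (𝓡 (2 * m + 3)) y p (horizontal hα hx p)) * hρ2 p
    have key' := mul_left_cancel₀ (hρ0 p).ne' key
    have hFp : 0 < F p := inv_pos.2 (hq' p)
    have : θ p (contactField hα hρs p) = F p * (ρ p * contactBracket hα hx y p) := by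
      rw [← key', hθ]
      simp only [sub_apply, smul_apply, smul_eq_mul]
      ring
    rw [this]
    exact mul_pos hFp (mul_pos (hρ0 p) (hP p))

end Bracket

/-! ### Smooth dependence of the solutions of differential equations on initial conditions -/

section Superposition

variable {K : Type} [TopologicalSpace K] [CompactSpace K]
  {E F : Type} [NormedAddCommGroup E] [NormedSpace ℝ E] [NormedAddCommGroup F] [NormedSpace ℝ F]

/-- The pointwise application of a continuous family of linear maps to a continuous function. -/
def applyPointwise (K E F : Type) [TopologicalSpace K] [CompactSpace K] [NormedAddCommGroup E]
    [NormedSpace ℝ E] [NormedAddCommGroup F] [NormedSpace ℝ F] :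
    C(K, E →L[ℝ] F) →L[ℝ] C(K, E) →L[ℝ] C(K, F) :=
  LinearMap.mkContinuous₂
    (LinearMap.mk₂ ℝ (fun (A : C(K, E →L[ℝ] F)) (η : C(K, E)) => (⟨fun t => A t (η t), A.continuous.clm_apply η.continuous⟩ : C(K, F)))
      (fun _ _ _ => by ext; rfl) (fun _ _ _ => by ext; rfl)
      (fun _ _ _ => by ext; simp) (fun _ _ _ => by ext; simp)) 1
    fun A η => by
      rw [one_mul]
      refine (ContinuousMap.norm_le _ (by positivity)).2 fun t => ((A t).le_opNorm _).trans
        (mul_le_mul (A.norm_coe_le_norm t) (η.norm_coe_le_norm t) (norm_nonneg _) (norm_nonneg A))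

theorem hasFDerivAt_comp_continuousMap [ProperSpace E] {f : E → F} (hf : ContDiff ℝ 1 f)
    (γ : C(K, E)) :
    HasFDerivAt (fun γ : C(K, E) => (⟨f, hf.continuous⟩ : C(E, F)).comp γ)
      (applyPointwise K E F
        ((⟨fderiv ℝ f, hf.continuous_fderiv (by simp)⟩ : C(E, E →L[ℝ] F)).comp γ)) γ := by
  rw [hasFDerivAt_iff_isLittleO, Asymptotics.isLittleO_iff]
  intro c hc
  have huc := (isCompact_closedBall (0 : E) (‖γ‖ + 1)).uniformContinuousOn_of_continuous
    (hf.continuous_fderiv (by simp)).continuousOn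
  obtain ⟨δ, hδ, h⟩ := Metric.uniformContinuousOn_iff_le.1 huc c hc
  filter_upwards [Metric.closedBall_mem_nhds γ (lt_min hδ one_pos)] with η hη
  rw [Metric.mem_closedBall, dist_eq_norm, le_min_iff] at hη
  rw [ContinuousMap.norm_le _ (by positivity)]
  intro t
  have hγt := γ.norm_coe_le_norm t
  have hηt : ‖η t - γ t‖ ≤ ‖η - γ‖ := (η - γ).norm_coe_le_norm t
  have hball : ∀ z ∈ Metric.closedBall (γ t) ‖η - γ‖, ‖fderiv ℝ f z - fderiv ℝ f (γ t)‖ ≤ c := by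
    intro z hz
    rw [Metric.mem_closedBall, dist_eq_norm] at hz
    rw [← dist_eq_norm]
    refine h z ?_ (γ t) ?_ ?_
    · rw [mem_closedBall_zero_iff]
      have := norm_le_norm_add_norm_sub' z (γ t)
      linarith [hη.2]
    · rw [mem_closedBall_zero_iff]
      linarith
    · rw [dist_eq_norm]
      exact hz.trans hη.1
  have := (convex_closedBall (γ t) ‖η - γ‖).norm_image_sub_le_of_norm_fderiv_le' (𝕜 := ℝ)
    (f := f) (φ := fderiv ℝ f (γ t)) (x := γ t) (y := η t)
    (fun z _ => hf.differentiable (by simp) z) hball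
    (Metric.mem_closedBall_self (norm_nonneg _)) (by rwa [Metric.mem_closedBall, dist_eq_norm])
  exact this.trans (mul_le_mul_of_nonneg_left hηt hc.le)

/-- Superposition operators with a smooth symbol are smooth. -/
theorem contDiff_comp_continuousMap [ProperSpace E] (n : ℕ) :
    ∀ {F : Type} [NormedAddCommGroup F] [NormedSpace ℝ F] {f : E → F} (_ : ContDiff ℝ n f)
      (hc : Continuous f), ContDiff ℝ n (fun γ : C(K, E) => (⟨f, hc⟩ : C(E, F)).comp γ) := by
  induction n with
  | zero =>
    intro F _ _ f hf hc
    rw [Nat.cast_zero, contDiff_zero]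
    exact ContinuousMap.continuous_postcomp _
  | succ n ih =>
    intro F _ _ f hf hc
    have hf1 : ContDiff ℝ 1 f := hf.of_le (by norm_cast; omega)
    rw [Nat.cast_add, Nat.cast_one, contDiff_succ_iff_hasFDerivAt]
    refine ⟨_, ?_, hasFDerivAt_comp_continuousMap hf1⟩
    exact (applyPointwise K E F).contDiff.comp (ih (hf.fderiv_right (by norm_cast)) _)

end Superposition

section LocalFlow

variable {E : Type} [NormedAddCommGroup E] [NormedSpace ℝ E]

/-- The time interval on which the differential equations are solved. -/
abbrev TimeInterval : Type := Set.Icc (-2 : ℝ) 2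

/-- The primitive of a continuous function on the time interval. -/
def primitive (E : Type) [NormedAddCommGroup E] [NormedSpace ℝ E] :
    C(TimeInterval, E) →L[ℝ] C(TimeInterval, E) :=
  LinearMap.mkContinuous
    { toFun := fun γ => ⟨fun t => ∫ s in (0 : ℝ)..t, Set.IccExtend (by norm_num) γ s,
        (intervalIntegral.continuous_primitive (fun _ _ =>
          (γ.continuous.Icc_extend' (h := by norm_num)).intervalIntegrable _ _) 0).comp
            continuous_subtype_val⟩
      map_add' := fun γ η => by
        ext t
        exact intervalIntegral.integral_add
          ((γ.continuous.Icc_extend' (h := by norm_num)).intervalIntegrable _ _)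
          ((η.continuous.Icc_extend' (h := by norm_num)).intervalIntegrable _ _)
      map_smul' := fun c γ => by
        ext t
        exact intervalIntegral.integral_smul c _ } 2
    fun γ => by
      rw [ContinuousMap.norm_le _ (by positivity)]
      intro t
      have h := intervalIntegral.norm_integral_le_of_norm_le_const (a := 0) (b := (t : ℝ)) (C := ‖γ‖)
        (f := Set.IccExtend (by norm_num) γ) fun s _ => γ.norm_coe_le_norm _
      refine h.trans ?_
      rw [mul_comm, sub_zero]
      exact mul_le_mul_of_nonneg_right (abs_le.2 t.2) (norm_nonneg _)

theorem primitive_apply (γ : C(TimeInterval, E)) (t : TimeInterval) :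
    primitive E γ t = ∫ s in (0 : ℝ)..t, Set.IccExtend (by norm_num) γ s := rfl

theorem hasDerivAt_of_eq_primitive [CompleteSpace E] {γ η : C(TimeInterval, E)} {x : E}
    (h : ∀ t, γ t = x + primitive E η t) {t : ℝ} (ht : t ∈ Set.Ioo (-2 : ℝ) 2) :
    HasDerivAt (Set.IccExtend (by norm_num : (-2 : ℝ) ≤ 2) γ)
      (Set.IccExtend (by norm_num : (-2 : ℝ) ≤ 2) η t) t := by
  have hη : Continuous (Set.IccExtend (by norm_num : (-2 : ℝ) ≤ 2) η) := η.continuous.Icc_extend'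
  have h1 : HasDerivAt (fun t => x + ∫ s in (0 : ℝ)..t, Set.IccExtend (by norm_num) η s)
      (Set.IccExtend (by norm_num : (-2 : ℝ) ≤ 2) η t) t :=
    (intervalIntegral.integral_hasDerivAt_right (hη.intervalIntegrable _ _)
      (hη.stronglyMeasurableAtFilter _ _) hη.continuousAt).const_add x
  refine h1.congr_of_eventuallyEq ?_
  filter_upwards [isOpen_Ioo.mem_nhds ht] with s hs
  rw [Set.IccExtend_of_mem _ _ (Set.Ioo_subset_Icc_self hs), h, primitive_apply]

/-- Local solutions of a smooth autonomous differential equation, rescaled by `τ`, depend smoothly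
on the initial condition and on `τ`. -/
theorem exists_local_flow [FiniteDimensional ℝ E] {v : E → E} (hv : ContDiff ℝ ∞ v) (x₀ : E) :
    ∃ ψ : E × ℝ → C(TimeInterval, E), ContDiffAt ℝ ∞ ψ (x₀, 0) ∧
      ψ (x₀, 0) = ContinuousMap.const _ x₀ ∧ ∀ᶠ z in 𝓝 (x₀, (0 : ℝ)),
        ψ z ⟨0, by norm_num⟩ = z.1 ∧ ∀ t ∈ Set.Ioo (-2 : ℝ) 2,
          HasDerivAt (Set.IccExtend (by norm_num : (-2 : ℝ) ≤ 2) (ψ z))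
            (z.2 • v (Set.IccExtend (by norm_num : (-2 : ℝ) ≤ 2) (ψ z) t)) t := by
  have : ProperSpace E := FiniteDimensional.proper ℝ E
  have : CompleteSpace E := FiniteDimensional.complete ℝ E
  set N : C(TimeInterval, E) → C(TimeInterval, E) :=
    fun γ => (⟨v, hv.continuous⟩ : C(E, E)).comp γ with hN
  have hNs : ContDiff ℝ ∞ N := contDiff_infty.2 fun n =>
    contDiff_comp_continuousMap n (hv.of_le (by exact_mod_cast le_top)) hv.continuous
  let c : E →L[ℝ] C(TimeInterval, E) := ContinuousLinearMap.const ℝ TimeInterval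
  set G : (E × ℝ) × C(TimeInterval, E) → C(TimeInterval, E) :=
    fun z => z.2 - (c z.1.1 + z.1.2 • primitive E (N z.2)) with hG
  have hGs : ContDiff ℝ ∞ G := by
    refine contDiff_snd.sub ((c.contDiff.comp contDiff_fst.fst).add ?_)
    exact contDiff_fst.snd.smul ((primitive E).contDiff.comp (hNs.comp contDiff_snd))
  set u : (E × ℝ) × C(TimeInterval, E) := ((x₀, 0), c x₀) with hu
  have hd : (fderiv ℝ G u ∘L .inr ℝ (E × ℝ) C(TimeInterval, E)) = ContinuousLinearMap.id ℝ _ := by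
    have h1 : HasFDerivAt (fun γ => G ((x₀, 0), γ))
        (fderiv ℝ G u ∘L .inr ℝ (E × ℝ) C(TimeInterval, E)) (c x₀) :=
      ((hGs.differentiable (by simp)) u).hasFDerivAt.comp (c x₀)
        (hasFDerivAt_prodMk_right (𝕜 := ℝ) (x₀, (0 : ℝ)) (c x₀))
    have h2 : HasFDerivAt (fun γ => G ((x₀, 0), γ)) (ContinuousLinearMap.id ℝ _) (c x₀) := by
      have : (fun γ => G ((x₀, 0), γ)) = fun γ => γ - c x₀ := by
        funext γ
        simp [hG]
      rw [this]
      exact (hasFDerivAt_id _).sub_const _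
    exact h1.unique h2
  have hinv : (fderiv ℝ G u ∘L .inr ℝ (E × ℝ) C(TimeInterval, E)).IsInvertible := by
    rw [hd]
    exact ⟨ContinuousLinearEquiv.refl ℝ _, rfl⟩
  have hGu : ContDiffAt ℝ ∞ G u := hGs.contDiffAt
  refine ⟨hGu.implicitFunction (by simp) hinv, hGu.contDiffAt_implicitFunction (by simp) hinv,
    hGu.implicitFunction_apply_self (by simp) hinv, ?_⟩
  filter_upwards [hGu.eventually_apply_implicitFunction (by simp) hinv] with z hz
  set γ := hGu.implicitFunction (by simp) hinv z
  have hG0 : G u = 0 := by simp [hG, hu]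
  have hγ (t : TimeInterval) : γ t = z.1 + primitive E (z.2 • N γ) t := by
    rw [hG0] at hz
    have h := DFunLike.congr_fun (sub_eq_zero.1 hz) t
    rw [map_smul]
    exact h
  refine ⟨?_, fun t ht => ?_⟩
  · rw [hγ, primitive_apply]
    simp
  · exact hasDerivAt_of_eq_primitive hγ ht

end LocalFlow

/-! ### The flow of a smooth vector field on a closed manifold -/

section Flow

variable {d : ℕ} {M : Type*} [TopologicalSpace M]
  [ChartedSpace (EuclideanSpace ℝ (Fin d)) M] [IsManifold (𝓡 d) ∞ M]
  {X : ∀ p : M, TangentSpace (𝓡 d) p}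

theorem IsSmoothField.contMDiff_one (hX : IsSmoothField X) :
    ContMDiff (𝓡 d) (𝓡 d).tangent 1 (fun p => (⟨p, X p⟩ : TangentBundle (𝓡 d) M)) :=
  ContMDiff.of_le hX (by simp)

theorem exists_local_integralCurves (hX : IsSmoothField X) (p₀ : M) :
    ∃ c : M × ℝ → ℝ → M,
      ContMDiffAt ((𝓡 d).prod 𝓘(ℝ, ℝ)) (𝓡 d) ∞ (fun z => c z 1) (p₀, 0) ∧
      ∀ᶠ z in 𝓝 (p₀, (0 : ℝ)), c z 0 = z.1 ∧
        IsMIntegralCurveOn (c z) (fun p => z.2 • X p) (Set.Ioo (-2) 2) := by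
  set e := extChartAt (𝓡 d) p₀ with he
  set x₀ := e p₀ with hx₀
  have hx₀t : x₀ ∈ e.target := mem_extChartAt_target p₀
  obtain ⟨r, hr, hball⟩ := Metric.nhds_basis_closedBall.mem_iff.1
    ((isOpen_extChartAt_target (I := 𝓡 d) p₀).mem_nhds hx₀t)
  let f : ContDiffBump x₀ := ⟨r / 2, r, by positivity, by linarith⟩
  set v : EuclideanSpace ℝ (Fin d) → EuclideanSpace ℝ (Fin d) :=
    fun x => f x • localField X p₀ x with hv
  have hvs : ContDiff ℝ ∞ v := by
    rw [contDiff_iff_contDiffAt]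
    intro x
    by_cases hx : x ∈ e.target
    · exact f.contDiffAt.smul (hX.contDiffAt_localField hx)
    · refine (contDiffAt_const (c := (0 : EuclideanSpace ℝ (Fin d)))).congr_of_eventuallyEq ?_
      filter_upwards [Metric.isClosed_closedBall.isOpen_compl.mem_nhds fun h => hx (hball h)]
        with y hy
      rw [hv]
      simp only
      rw [f.zero_of_le_dist (not_le.1 (show ¬dist y x₀ ≤ r from hy)).le, zero_smul]
  obtain ⟨ψ, hψ, hψ0, hψe⟩ := exists_local_flow hvs x₀
  have he' : ContMDiffAt ((𝓡 d).prod 𝓘(ℝ, ℝ)) 𝓘(ℝ, EuclideanSpace ℝ (Fin d) × ℝ) ∞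
      (fun z : M × ℝ => (e z.1, z.2)) (p₀, 0) :=
    ((contMDiffAt_chart (mem_extChartAt_source p₀)).comp (p₀, (0 : ℝ))
      contMDiffAt_fst).prodMk_space contMDiffAt_snd
  have hψ' : ContMDiffAt ((𝓡 d).prod 𝓘(ℝ, ℝ))
      𝓘(ℝ, C(TimeInterval, EuclideanSpace ℝ (Fin d))) ∞
      (fun z : M × ℝ => ψ (e z.1, z.2)) (p₀, 0) :=
    ContMDiffAt.comp (p₀, (0 : ℝ)) (g := ψ) hψ.contMDiffAt he'
  refine ⟨fun z t => e.symm (Set.IccExtend (by norm_num : (-2 : ℝ) ≤ 2) (ψ (e z.1, z.2)) t),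
    ?_, ?_⟩
  · have h1 (z : M × ℝ) : Set.IccExtend (by norm_num : (-2 : ℝ) ≤ 2) (ψ (e z.1, z.2)) 1 =
        ψ (e z.1, z.2) ⟨1, by norm_num⟩ := Set.IccExtend_of_mem _ _ _
    simp only [h1]
    have h2 : ContDiff ℝ ∞ fun γ : C(TimeInterval, EuclideanSpace ℝ (Fin d)) =>
        γ ⟨1, by norm_num⟩ :=
      IsBoundedLinearMap.contDiff (IsLinearMap.with_bound ⟨fun _ _ => rfl, fun _ _ => rfl⟩ 1
        fun γ => by rw [one_mul]; exact γ.norm_coe_le_norm _)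
    have h2 : ContMDiffAt ((𝓡 d).prod 𝓘(ℝ, ℝ)) 𝓘(ℝ, EuclideanSpace ℝ (Fin d)) ∞
        (fun z : M × ℝ => ψ (e z.1, z.2) ⟨1, by norm_num⟩) (p₀, 0) :=
      ContMDiffAt.comp (p₀, (0 : ℝ)) (g := fun γ : C(TimeInterval, EuclideanSpace ℝ (Fin d)) =>
        γ ⟨1, by norm_num⟩) h2.contMDiff.contMDiffAt hψ'
    refine ContMDiffAt.comp (p₀, (0 : ℝ)) (g := e.symm) (contMDiffAt_chart_symm ?_) h2
    change ψ (x₀, 0) _ ∈ e.target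
    rw [hψ0]
    exact hx₀t
  · have hball' : ∀ᶠ z in 𝓝 (p₀, (0 : ℝ)), ψ (e z.1, z.2) ∈
        Metric.ball (ContinuousMap.const TimeInterval x₀) (r / 2) := by
      refine hψ'.continuousAt.eventually_mem ?_
      change _ ∈ 𝓝 (ψ (x₀, 0))
      rw [hψ0]
      exact Metric.ball_mem_nhds _ (by positivity)
    filter_upwards [he'.continuousAt.eventually hψe, hball', continuousAt_fst.eventually_mem
      (extChartAt_source_mem_nhds (I := 𝓡 d) p₀)] with z hz hzb hzs
    refine ⟨?_, fun t ht => ?_⟩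
    · rw [Set.IccExtend_of_mem _ _ (by norm_num), hz.1]
      exact e.left_inv hzs
    · set x := Set.IccExtend (by norm_num : (-2 : ℝ) ≤ 2) (ψ (e z.1, z.2)) t with hx
      have hxb : x ∈ Metric.closedBall x₀ (r / 2) := by
        rw [Metric.mem_ball] at hzb
        exact (ContinuousMap.dist_apply_le_dist (Set.projIcc _ _ _ t)).trans hzb.le
      have hxt : x ∈ e.target := hball (Metric.closedBall_subset_closedBall (by linarith) hxb)
      have hd := (hz.2 t ht).hasFDerivAt.hasMFDerivAt
      have hs : MDifferentiableAt 𝓘(ℝ, EuclideanSpace ℝ (Fin d)) (𝓡 d) e.symm x :=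
        (contMDiffAt_chart_symm hxt).mdifferentiableAt (by simp)
      have hc := hs.hasMFDerivAt.comp t hd
      have hfin : (chartSymmDeriv p₀ x).comp
          ((1 : ℝ →L[ℝ] ℝ).smulRight (z.2 • v x)) =
          (1 : ℝ →L[ℝ] ℝ).smulRight (z.2 • X (e.symm x)) := by
        ext
        simp only [ContinuousLinearMap.comp_apply, ContinuousLinearMap.smulRight_apply, map_smul]
        rw [hv]
        simp only
        rw [f.one_of_mem_closedBall hxb, one_smul, localField, chartSymmDeriv_chartDeriv hxt]
      exact Eq.subst (motive := fun L => HasMFDerivWithinAt 𝓘(ℝ, ℝ) (𝓡 d)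
        (e.symm ∘ Set.IccExtend (by norm_num : (-2 : ℝ) ≤ 2) (ψ (e z.1, z.2))) (Set.Ioo (-2) 2) t L)
        hfin hc.hasMFDerivWithinAt

variable [T2Space M] [CompactSpace M]

theorem exists_uniform_integralCurves (hX : IsSmoothField X) :
    ∃ ε > 0, ∀ p : M, ∃ γ : ℝ → M, γ 0 = p ∧ IsMIntegralCurveOn γ X (Set.Ioo (-ε) ε) := by
  suffices h : ∃ ε > 0, ∀ p ∈ (Set.univ : Set M), ∃ γ : ℝ → M, γ 0 = p ∧
      IsMIntegralCurveOn γ X (Set.Ioo (-ε) ε) by simpa using h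
  refine isCompact_univ.induction_on (p := fun S : Set M => ∃ ε > 0, ∀ p ∈ S, ∃ γ : ℝ → M,
    γ 0 = p ∧ IsMIntegralCurveOn γ X (Set.Ioo (-ε) ε)) ⟨1, one_pos, by simp⟩ ?_ ?_ ?_
  · rintro S T hST ⟨ε, hε, h⟩
    exact ⟨ε, hε, fun p hp => h p (hST hp)⟩
  · rintro S T ⟨ε, hε, h⟩ ⟨ε', hε', h'⟩
    refine ⟨min ε ε', lt_min hε hε', fun p hp => ?_⟩
    rcases hp with hp | hp
    · obtain ⟨γ, h0, h1⟩ := h p hp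
      exact ⟨γ, h0, h1.mono (Set.Ioo_subset_Ioo (neg_le_neg (min_le_left _ _)) (min_le_left _ _))⟩
    · obtain ⟨γ, h0, h1⟩ := h' p hp
      exact ⟨γ, h0, h1.mono (Set.Ioo_subset_Ioo (neg_le_neg (min_le_right _ _)) (min_le_right _ _))⟩
  · intro p₀ _
    obtain ⟨c, -, hc⟩ := exists_local_integralCurves hX p₀
    rw [nhds_prod_eq, Filter.eventually_prod_iff] at hc
    obtain ⟨Q, hQ, T, hT, h⟩ := hc
    obtain ⟨τ, hτ, hτ0⟩ := ((hT.filter_mono nhdsWithin_le_nhds).and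
      (self_mem_nhdsWithin (s := Set.Ioi (0 : ℝ)))).exists
    have hτ0 : 0 < τ := hτ0
    refine ⟨{p | Q p}, mem_nhdsWithin_of_mem_nhds hQ, τ, hτ0, fun p hp =>
      ⟨fun t => c (p, τ) (t * τ⁻¹), ?_, ?_⟩⟩
    · simpa using (h hp hτ).1
    · have h1 := (h hp hτ).2.comp_mul τ⁻¹
      have h2 : (τ⁻¹ • fun p => τ • X p) = X := by
        funext p
        rw [Pi.smul_apply, smul_smul, inv_mul_cancel₀ hτ0.ne', one_smul]
      rw [h2] at h1
      refine h1.mono fun t ht => ?_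
      have h3 : |t * τ⁻¹| < 2 := by
        rw [abs_mul, abs_inv, abs_of_pos hτ0, ← div_eq_mul_inv, div_lt_iff₀ hτ0]
        have := abs_lt.2 ht
        linarith
      exact abs_lt.1 h3

theorem exists_global_integralCurve (hX : IsSmoothField X) (p : M) :
    ∃ γ : ℝ → M, γ 0 = p ∧ IsMIntegralCurve γ X := by
  obtain ⟨ε, hε, h⟩ := exists_uniform_integralCurves hX
  exact exists_isMIntegralCurve_of_isMIntegralCurveOn hX.contMDiff_one hε h p

/-- The flow of a smooth vector field on a closed manifold. -/
def flow (hX : IsSmoothField X) (t : ℝ) (p : M) : M := (exists_global_integralCurve hX p).choose t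

variable (hX : IsSmoothField X)

theorem flow_zero (p : M) : flow hX 0 p = p := (exists_global_integralCurve hX p).choose_spec.1

theorem isMIntegralCurve_flow (p : M) : IsMIntegralCurve (fun t => flow hX t p) X :=
  (exists_global_integralCurve hX p).choose_spec.2

theorem flow_add (s t : ℝ) (p : M) : flow hX (s + t) p = flow hX s (flow hX t p) := by
  have h1 := (isMIntegralCurve_flow hX p).comp_add t
  have h2 := isMIntegralCurve_flow hX (flow hX t p)
  refine congrFun (isMIntegralCurve_Ioo_eq_of_contMDiff_boundaryless (t₀ := 0)
    hX.contMDiff_one h1 h2 ?_) s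
  simp [flow_zero]

theorem contMDiffAt_flow_zero (p₀ : M) :
    ContMDiffAt (𝓘(ℝ, ℝ).prod (𝓡 d)) (𝓡 d) ∞ (fun z : ℝ × M => flow hX z.1 z.2) (0, p₀) := by
  obtain ⟨c, hc, hce⟩ := exists_local_integralCurves hX p₀
  have hswap : ContMDiffAt (𝓘(ℝ, ℝ).prod (𝓡 d)) ((𝓡 d).prod 𝓘(ℝ, ℝ)) ∞
      (fun z : ℝ × M => (z.2, z.1)) (0, p₀) := contMDiffAt_snd.prodMk contMDiffAt_fst
  refine (ContMDiffAt.comp ((0 : ℝ), p₀) (g := fun z => c z 1) hc hswap).congr_of_eventuallyEq ?_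
  filter_upwards [hswap.continuousAt.eventually hce] with z hz
  have h1 := ((isMIntegralCurve_flow hX z.2).comp_mul z.1).isMIntegralCurveOn (Set.Ioo (-2) 2)
  have hsm : IsSmoothField (fun p => z.1 • X p) := hX.smul contMDiff_const
  have h2 := isMIntegralCurveOn_Ioo_eqOn_of_contMDiff_boundaryless (t₀ := 0) (by norm_num)
    hsm.contMDiff_one h1 hz.2 (by simp [flow_zero, hz.1]) (show (1 : ℝ) ∈ _ by norm_num)
  simpa using h2

theorem contMDiff_flow :
    ContMDiff (𝓘(ℝ, ℝ).prod (𝓡 d)) (𝓡 d) ∞ (fun z : ℝ × M => flow hX z.1 z.2) := by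
  rw [contMDiff_infty]
  intro n
  have h0 : ∀ᶠ t in 𝓝 (0 : ℝ), ∀ p ∈ (Set.univ : Set M), ContMDiffAt (𝓘(ℝ, ℝ).prod (𝓡 d)) (𝓡 d) n
      (fun z : ℝ × M => flow hX z.1 z.2) (t, p) := by
    refine isCompact_univ.eventually_forall_of_forall_eventually fun p _ => ?_
    exact ((contMDiffAt_iff_contMDiffAt_nhds (by simp)).1
      ((contMDiffAt_flow_zero hX p).of_le (mod_cast le_top)))
  obtain ⟨ε, hε, h⟩ := Metric.eventually_nhds_iff.1 h0
  have key (k : ℕ) : ∀ t : ℝ, |t| < (k + 1) * ε → ∀ p : M, ContMDiffAt (𝓘(ℝ, ℝ).prod (𝓡 d)) (𝓡 d) n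
      (fun z : ℝ × M => flow hX z.1 z.2) (t, p) := by
    induction k with
    | zero => exact fun t ht p => h (by simpa using ht) p trivial
    | succ k ih =>
      intro t ht p
      have hk : (0 : ℝ) < k + 2 := by positivity
      push_cast at ht
      have ha : |t / (k + 2)| < ε := by
        rw [abs_div, abs_of_pos hk, div_lt_iff₀ hk]
        linarith
      have hb : |t - t / (k + 2)| < (k + 1) * ε := by
        have : t - t / (k + 2) = (t / (k + 2)) * (k + 1) := by field_simp; ring
        rw [this, abs_mul, abs_of_pos (by positivity : (0 : ℝ) < k + 1), mul_comm]
        exact mul_lt_mul_of_pos_left ha (by positivity)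
      have hfun : (fun z : ℝ × M => flow hX z.1 z.2) = fun z =>
          flow hX (t / (k + 2)) (flow hX (z.1 - t / (k + 2)) z.2) := by
        funext z
        rw [← flow_add, add_sub_cancel]
      rw [hfun]
      have h1 : ContMDiffAt (𝓘(ℝ, ℝ).prod (𝓡 d)) (𝓘(ℝ, ℝ).prod (𝓡 d)) n
          (fun z : ℝ × M => (z.1 - t / (k + 2), z.2)) (t, p) :=
        (contMDiffAt_fst.sub contMDiffAt_const).prodMk contMDiffAt_snd
      have h2 := ContMDiffAt.comp (t, p) (g := fun z : ℝ × M => flow hX z.1 z.2) (ih _ hb p) h1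
      exact ContMDiffAt.comp (t, p) (g := fun z : ℝ × M => flow hX z.1 z.2)
        (h (by rwa [Real.dist_0_eq_abs]) _ trivial) (contMDiffAt_const.prodMk h2)
  intro z
  obtain ⟨k, hk⟩ := exists_nat_gt (|z.1| / ε)
  refine key k z.1 ?_ z.2
  rw [div_lt_iff₀ hε] at hk
  linarith

end Flow

/-! ### Construction of open books from flows -/

section UnitDirection

/-- The direction of a nonzero complex number. -/
def unitDir (a : ℂ) : Circle := Circle.exp (Complex.arg a)

theorem coe_unitDir {a : ℂ} (ha : a ≠ 0) : (unitDir a : ℂ) = a / ‖a‖ := by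
  have h := Complex.norm_mul_exp_arg_mul_I a
  rw [unitDir, Circle.coe_exp, eq_div_iff (by simpa using ha), mul_comm]
  exact h

theorem unitDir_mul {a b : ℂ} (ha : a ≠ 0) (hb : b ≠ 0) :
    unitDir (a * b) = unitDir a * unitDir b := by
  ext
  rw [Circle.coe_mul, coe_unitDir ha, coe_unitDir hb, coe_unitDir (mul_ne_zero ha hb), norm_mul,
    Complex.ofReal_mul, mul_div_mul_comm]

theorem unitDir_ofReal {c : ℝ} (hc : 0 < c) : unitDir c = 1 := by
  rw [unitDir, Complex.arg_ofReal_of_nonneg hc.le, Circle.exp_zero]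

theorem unitDir_exp (t : ℝ) : unitDir (Complex.exp (t * Complex.I)) = Circle.exp t := by
  ext
  rw [coe_unitDir (Complex.exp_ne_zero _), Complex.norm_exp_ofReal_mul_I, Circle.coe_exp]
  simp

theorem contDiffAt_arg {a : ℂ} (ha : a ∈ Complex.slitPlane) : ContDiffAt ℝ ∞ Complex.arg a := by
  have h : ContDiffAt ℝ ∞ Complex.log a := (Complex.contDiffAt_log ha).restrict_scalars ℝ
  have h2 := ContDiffAt.comp a (g := fun z : ℂ => z.im) Complex.imCLM.contDiff.contDiffAt h
  exact h2.congr_of_eventuallyEq (Filter.Eventually.of_forall fun z => (Complex.log_im z).symm)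

theorem contMDiffAt_unitDir {a : ℂ} (ha : a ≠ 0) : ContMDiffAt 𝓘(ℝ, ℂ) (𝓡 1) ∞ unitDir a := by
  have h : unitDir =ᶠ[𝓝 a] fun b => unitDir a * Circle.exp (Complex.arg (b * a⁻¹)) := by
    filter_upwards [isOpen_ne.mem_nhds ha] with b hb
    conv_lhs => rw [show b = a * (b * a⁻¹) by field_simp]
    rw [unitDir_mul ha (mul_ne_zero hb (inv_ne_zero ha))]
    rfl
  refine ContMDiffAt.congr_of_eventuallyEq ?_ h
  have h1 : ContDiffAt ℝ ∞ (fun b : ℂ => Complex.arg (b * a⁻¹)) a := by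
    refine ContDiffAt.comp a (g := Complex.arg) (contDiffAt_arg ?_)
      (contDiffAt_id.mul contDiffAt_const)
    simp [mul_inv_cancel₀ ha]
  exact contMDiffAt_const.mul ((contMDiff_circleExp (m := ∞)).contMDiffAt.comp a h1.contMDiffAt)

theorem contMDiffAt_coe_circle (w : Circle) :
    ContMDiffAt (𝓡 1) 𝓘(ℝ, ℂ) ∞ (fun w : Circle => (w : ℂ)) w := by
  have : Fact (Module.finrank ℝ ℂ = 1 + 1) := ⟨Complex.finrank_real_complex⟩
  exact (contMDiff_coe_sphere (n := 1) (E := ℂ) (m := ∞)) w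

end UnitDirection

section AlongFlow

variable {d : ℕ} {M : Type*} [TopologicalSpace M]
  [ChartedSpace (EuclideanSpace ℝ (Fin d)) M] [IsManifold (𝓡 d) ∞ M] [T2Space M] [CompactSpace M]
  {X : ∀ p : M, TangentSpace (𝓡 d) p} (hX : IsSmoothField X)
  {F : Type*} [NormedAddCommGroup F] [NormedSpace ℝ F]

theorem hasDerivAt_flow {f : M → F} (hf : ContMDiff (𝓡 d) 𝓘(ℝ, F) ∞ f) (p : M) (t : ℝ) :
    HasDerivAt (fun t => f (flow hX t p))
      (mvfderiv (𝓡 d) f (flow hX t p) (X (flow hX t p))) t := by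
  have h1 := (hf.mdifferentiableAt (x := flow hX t p) (by simp)).hasMFDerivAt.comp t
    (isMIntegralCurve_flow hX p t)
  have h2 : HasFDerivAt (fun t => f (flow hX t p)) ((1 : ℝ →L[ℝ] ℝ).smulRight
      (mvfderiv (𝓡 d) f (flow hX t p) (X (flow hX t p)))) t := by
    refine Eq.subst (motive := fun L => HasFDerivAt (fun t => f (flow hX t p)) L t) ?_ h1.hasFDerivAt
    ext
    exact map_smul (mfderiv (𝓡 d) 𝓘(ℝ, F) f (flow hX t p)) (1 : ℝ) _
  have h3 := h2.hasDerivAt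
  simpa using h3

theorem continuous_flow (p : M) : Continuous fun t => flow hX t p :=
  (contMDiff_flow hX).continuous.comp (continuous_id.prodMk continuous_const)

theorem flow_neg_flow (t : ℝ) (p : M) : flow hX (-t) (flow hX t p) = p := by
  rw [← flow_add, neg_add_cancel, flow_zero]

theorem flow_flow_neg (t : ℝ) (p : M) : flow hX t (flow hX (-t) p) = p := by
  rw [← flow_add, add_neg_cancel, flow_zero]

/-- The values of a function along the flow of a vector field which moves them on a straight
line. -/
theorem flow_straight {h : M → ℂ} (hh : ContMDiff (𝓡 d) 𝓘(ℝ, ℂ) ∞ h) {χ : M → ℝ} {c : ℂ}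
    (hc : ‖c‖ = 1) {R : ℝ} (hχ0 : ∀ p, 0 ≤ χ p) (hχ1 : ∀ p, χ p ≤ 1)
    (hχR : ∀ p, ‖h p‖ ≤ R → χ p = 1) (hd : ∀ p, mvfderiv (𝓡 d) h p (X p) = χ p * c)
    {p : M} {t : ℝ} (ht : ‖h p‖ + |t| ≤ R) : h (flow hX t p) = h p + t * c := by
  have hder (s : ℝ) : HasDerivAt (fun s => h (flow hX s p)) (χ (flow hX s p) * c) s := by
    have := hasDerivAt_flow hX hh p s
    rwa [hd] at this
  have hlip (s : ℝ) : ‖h (flow hX s p) - h p‖ ≤ |s| := by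
    have := convex_univ.norm_image_sub_le_of_norm_hasDerivWithin_le (C := 1) (x := 0) (y := s)
      (fun s _ => (hder s).hasDerivWithinAt) (fun s _ => by
        rw [norm_mul, hc, mul_one, Complex.norm_real, Real.norm_of_nonneg (hχ0 _)]
        exact hχ1 _) trivial trivial
    simpa [flow_zero] using this
  have hder' (s : ℝ) (hs : s ∈ Set.Icc (-|t|) |t|) :
      HasDerivWithinAt (fun s => h (flow hX s p) - s * c) 0 (Set.Icc (-|t|) |t|) s := by
    have h1 : χ (flow hX s p) = 1 := by
      refine hχR _ ?_
      have h2 := hlip s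
      have h3 := norm_le_norm_add_norm_sub' (h (flow hX s p)) (h p)
      have h4 := abs_le.2 hs
      linarith
    have h2 := hder s
    rw [h1] at h2
    have h3 := h2.sub ((Complex.ofRealCLM.hasDerivAt (x := s)).mul_const c)
    have h4 : HasDerivAt (fun s : ℝ => h (flow hX s p) - s * c) 0 s := by
      refine h3.congr_deriv ?_
      simp
    exact h4.hasDerivWithinAt
  have := (convex_Icc (-|t|) |t|).norm_image_sub_le_of_norm_hasDerivWithin_le (C := 0) (x := 0)
    (y := t) hder' (by simp) (by simp) (by simp [neg_abs_le, le_abs_self])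
  rw [zero_mul, norm_le_zero_iff, sub_eq_zero] at this
  simp only [flow_zero, Complex.ofReal_zero, zero_mul, sub_zero] at this
  rw [← this]
  ring

/-- The values of a function along the flow of a vector field which rotates them. -/
theorem flow_rotate {h : M → ℂ} (hh : ContMDiff (𝓡 d) 𝓘(ℝ, ℂ) ∞ h) {ρ : M → ℝ}
    (hρ : Continuous ρ)
    (hd : ∀ p, mvfderiv (𝓡 d) h p (X p) = (Complex.I + ρ p) * h p) (p : M) (t : ℝ) :
    ∃ c : ℝ, 0 < c ∧ h (flow hX t p) = c * Complex.exp (t * Complex.I) * h p := by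
  have hρc : Continuous fun s => ρ (flow hX s p) := hρ.comp (continuous_flow hX p)
  set L : ℝ → ℝ := fun s => ∫ u in (0 : ℝ)..s, ρ (flow hX u p) with hL
  have hLd (s : ℝ) : HasDerivAt L (ρ (flow hX s p)) s :=
    intervalIntegral.integral_hasDerivAt_right (hρc.intervalIntegrable _ _)
      (hρc.stronglyMeasurableAtFilter _ _) hρc.continuousAt
  have hder (s : ℝ) : HasDerivAt
      (fun s : ℝ => Complex.exp (-(L s + s * Complex.I)) * h (flow hX s p)) 0 s := by
    have h1 := hasDerivAt_flow hX hh p s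
    rw [hd] at h1
    have h2 : HasDerivAt (fun s : ℝ => -((L s : ℂ) + s * Complex.I))
        (-((ρ (flow hX s p) : ℂ) + Complex.I)) s := by
      have := ((hLd s).ofReal_comp.add ((Complex.ofRealCLM.hasDerivAt (x := s)).mul_const
        Complex.I)).neg
      refine this.congr_deriv ?_
      simp
    have h3 := h2.cexp.mul h1
    refine h3.congr_deriv ?_
    ring
  have hconst := is_const_of_deriv_eq_zero (fun s => (hder s).differentiableAt)
    (fun s => (hder s).deriv) t 0
  refine ⟨Real.exp (L t), Real.exp_pos _, ?_⟩
  have hL0 : L 0 = 0 := by simp [hL]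
  simp only [flow_zero, hL0, Complex.ofReal_zero, zero_mul, add_zero, neg_zero, Complex.exp_zero,
    one_mul] at hconst
  rw [← hconst, Complex.ofReal_exp, ← Complex.exp_add, ← mul_assoc, ← Complex.exp_add,
    add_neg_cancel, Complex.exp_zero, one_mul]

end AlongFlow

section Construction

variable {d : ℕ} {M : Type*} [TopologicalSpace M]
  [ChartedSpace (EuclideanSpace ℝ (Fin d)) M] [IsManifold (𝓡 d) ∞ M] [T2Space M] [CompactSpace M]
  {h : M → ℂ} (hh : ContMDiff (𝓡 d) 𝓘(ℝ, ℂ) ∞ h)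

omit [IsManifold (𝓡 d) ∞ M] [T2Space M] [CompactSpace M] in
include hh in
theorem contMDiffOn_unitDir : ContMDiffOn (𝓡 d) (𝓡 1) ∞ (fun p => unitDir (h p)) {p | h p = 0}ᶜ :=
  fun p hp => ((contMDiffAt_unitDir (show h p ≠ 0 from hp)).comp p hh.contMDiffAt).contMDiffWithinAt

include hh in
theorem exists_local_trivialization {T : ∀ p : M, TangentSpace (𝓡 d) p} (hT : IsSmoothField T)
    {ρ : M → ℝ} (hρ : Continuous ρ)
    (hd : ∀ p, mvfderiv (𝓡 d) h p (T p) = (Complex.I + ρ p) * h p) (z : Circle) :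
    ∃ (V : Set Circle) (e : PartialEquiv M (M × Circle)),
    IsOpen V ∧ z ∈ V ∧
    e.source = {p | h p = 0}ᶜ ∩ (fun p => unitDir (h p)) ⁻¹' V ∧
    e.target = ({p | h p = 0}ᶜ ∩ (fun p => unitDir (h p)) ⁻¹' {z}) ×ˢ V ∧
    ContMDiffOn (𝓡 d) ((𝓡 d).prod (𝓡 1)) ∞ e e.source ∧
    ContMDiffOn ((𝓡 d).prod (𝓡 1)) (𝓡 d) ∞ e.symm e.target ∧
    ∀ p ∈ e.source, (e p).2 = unitDir (h p) := by
  have hrot (p : M) (t : ℝ) (hp : h p ≠ 0) : h (flow hT t p) ≠ 0 ∧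
      unitDir (h (flow hT t p)) = Circle.exp t * unitDir (h p) := by
    obtain ⟨c, hc, hcp⟩ := flow_rotate hT hh hρ hd p t
    have h1 : (c : ℂ) * Complex.exp (t * Complex.I) ≠ 0 :=
      mul_ne_zero (by exact_mod_cast hc.ne') (Complex.exp_ne_zero _)
    refine ⟨?_, ?_⟩
    · rw [hcp]
      exact mul_ne_zero h1 hp
    · rw [hcp, unitDir_mul h1 hp, unitDir_mul (by exact_mod_cast hc.ne') (Complex.exp_ne_zero _),
        unitDir_ofReal hc, unitDir_exp, one_mul]
  set τ : Circle → ℝ := fun w => Complex.arg ((w : ℂ) * (z⁻¹ : Circle)) with hτ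
  have hexp (w : Circle) : Circle.exp (τ w) = w * z⁻¹ := Circle.exp_arg (w * z⁻¹)
  set V : Set Circle := {w | (w : ℂ) * (z⁻¹ : Circle) ∈ Complex.slitPlane} with hV
  have hVo : IsOpen V := Complex.isOpen_slitPlane.preimage
    ((continuous_subtype_val : Continuous fun w : Circle => (w : ℂ)).mul continuous_const)
  have hτs (w : Circle) (hw : w ∈ V) : ContMDiffAt (𝓡 1) 𝓘(ℝ, ℝ) ∞ τ w := by
    have h1 : ContDiffAt ℝ ∞ (fun a : ℂ => Complex.arg (a * (z⁻¹ : Circle))) (w : ℂ) :=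
      ContDiffAt.comp (w : ℂ) (g := Complex.arg) (contDiffAt_arg hw)
        (contDiffAt_id.mul contDiffAt_const)
    exact ContMDiffAt.comp w (g := fun a : ℂ => Complex.arg (a * (z⁻¹ : Circle)))
      h1.contMDiffAt (contMDiffAt_coe_circle w)
  let e : PartialEquiv M (M × Circle) :=
    { toFun := fun p => (flow hT (-τ (unitDir (h p))) p, unitDir (h p))
      invFun := fun q => flow hT (τ q.2) q.1
      source := {p | h p = 0}ᶜ ∩ (fun p => unitDir (h p)) ⁻¹' V
      target := ({p | h p = 0}ᶜ ∩ (fun p => unitDir (h p)) ⁻¹' {z}) ×ˢ V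
      map_source' := by
        rintro p ⟨hp, hpV⟩
        obtain ⟨h1, h2⟩ := hrot p (-τ (unitDir (h p))) hp
        refine ⟨⟨h1, ?_⟩, hpV⟩
        rw [Set.mem_preimage, Set.mem_singleton_iff, h2, Circle.exp_neg, hexp]
        group
      map_target' := by
        rintro ⟨q, w⟩ ⟨⟨hq, hqz⟩, hw⟩
        obtain ⟨h1, h2⟩ := hrot q (τ w) hq
        refine ⟨h1, ?_⟩
        rw [Set.mem_preimage, Set.mem_singleton_iff] at hqz
        rw [Set.mem_preimage, h2, hqz, hexp, inv_mul_cancel_right]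
        exact hw
      left_inv' := fun p _ => flow_flow_neg hT _ p
      right_inv' := by
        rintro ⟨q, w⟩ ⟨⟨hq, hqz⟩, hw⟩
        obtain ⟨h1, h2⟩ := hrot q (τ w) hq
        rw [Set.mem_preimage, Set.mem_singleton_iff] at hqz
        have h3 : unitDir (h (flow hT (τ w) q)) = w := by
          rw [h2, hqz, hexp, inv_mul_cancel_right]
        simp only [h3, flow_neg_flow] }
  refine ⟨V, e, hVo, ?_, rfl, rfl, ?_, ?_, fun p _ => rfl⟩
  · simp [hV]
  · rintro p ⟨hp, hpV⟩
    have h1 := (contMDiffAt_unitDir (show h p ≠ 0 from hp)).comp p hh.contMDiffAt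
    have h2 : ContMDiffAt (𝓡 d) 𝓘(ℝ, ℝ) ∞ (fun p => -τ (unitDir (h p))) p :=
      (ContMDiffAt.comp p (g := τ) (hτs _ hpV) h1).neg
    exact (((contMDiff_flow hT).contMDiffAt.comp p (h2.prodMk contMDiffAt_id)).prodMk
      h1).contMDiffWithinAt
  · rintro ⟨q, w⟩ ⟨-, hw⟩
    have h2 : ContMDiffAt ((𝓡 d).prod (𝓡 1)) 𝓘(ℝ, ℝ) ∞ (fun z : M × Circle => τ z.2) (q, w) :=
      ContMDiffAt.comp (q, w) (g := τ) (hτs _ hw) contMDiffAt_snd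
    exact ((contMDiff_flow hT).contMDiffAt.comp (q, w)
      (h2.prodMk contMDiffAt_fst)).contMDiffWithinAt

include hh in
theorem exists_tubular_neighbourhood {E₁ E₂ : ∀ p : M, TangentSpace (𝓡 d) p}
    (hE₁ : IsSmoothField E₁) (hE₂ : IsSmoothField E₂) {χ : M → ℝ} {R : ℝ} (hR : 0 < R)
    (hχ0 : ∀ p, 0 ≤ χ p) (hχ1 : ∀ p, χ p ≤ 1) (hχR : ∀ p, ‖h p‖ ≤ R → χ p = 1)
    (hd₁ : ∀ p, mvfderiv (𝓡 d) h p (E₁ p) = χ p * 1)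
    (hd₂ : ∀ p, mvfderiv (𝓡 d) h p (E₂ p) = χ p * Complex.I) :
    ∃ Ψ : PartialEquiv (M × ℂ) M,
    Ψ.source = {p | h p = 0} ×ˢ Metric.ball (0 : ℂ) 1 ∧ IsOpen Ψ.target ∧
    ContMDiffOn ((𝓡 d).prod 𝓘(ℝ, ℂ)) (𝓡 d) ∞ Ψ Ψ.source ∧
    ContMDiffOn (𝓡 d) ((𝓡 d).prod 𝓘(ℝ, ℂ)) ∞ Ψ.symm Ψ.target ∧
    (∀ b ∈ {p | h p = 0}, Ψ (b, 0) = b) ∧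
    ∀ b ∈ {p | h p = 0}, ∀ z ∈ Metric.ball (0 : ℂ) 1, z ≠ 0 →
      (unitDir (h (Ψ (b, z))) : ℂ) = z / ‖z‖ := by
  set ε := R / 2 with hε
  have hε0 : 0 < ε := by positivity
  have s₁ {p : M} {t : ℝ} (ht : ‖h p‖ + |t| ≤ R) : h (flow hE₁ t p) = h p + t := by
    have := flow_straight hE₁ hh (c := 1) (by simp) hχ0 hχ1 hχR hd₁ ht
    simpa using this
  have s₂ {p : M} {t : ℝ} (ht : ‖h p‖ + |t| ≤ R) : h (flow hE₂ t p) = h p + t * Complex.I :=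
    flow_straight hE₂ hh (c := Complex.I) (by simp) hχ0 hχ1 hχR hd₂ ht
  have hfor (b : M) (hb : h b = 0) (z : ℂ) (hz : ‖z‖ < 1) :
      h (flow hE₁ (ε * z.re) b) = (ε * z.re : ℝ) ∧
      h (flow hE₂ (ε * z.im) (flow hE₁ (ε * z.re) b)) = ε * z := by
    have hre : |ε * z.re| ≤ ε := by
      rw [abs_mul, abs_of_pos hε0]
      exact mul_le_of_le_one_right hε0.le ((Complex.abs_re_le_norm z).trans hz.le)
    have him : |ε * z.im| ≤ ε := by
      rw [abs_mul, abs_of_pos hε0]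
      exact mul_le_of_le_one_right hε0.le ((Complex.abs_im_le_norm z).trans hz.le)
    have h1 : h (flow hE₁ (ε * z.re) b) = (ε * z.re : ℝ) := by
      rw [s₁, hb, zero_add]
      rw [hb, norm_zero]
      linarith
    refine ⟨h1, ?_⟩
    rw [s₂, h1]
    · conv_rhs => rw [← Complex.re_add_im z]
      push_cast
      ring
    · rw [h1, Complex.norm_real, Real.norm_eq_abs]
      linarith
  have hback (p : M) (hp : ‖h p‖ < ε) : h (flow hE₂ (-(h p).im) p) = (h p).re ∧
      h (flow hE₁ (-(h p).re) (flow hE₂ (-(h p).im) p)) = 0 := by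
    have hre := Complex.abs_re_le_norm (h p)
    have him := Complex.abs_im_le_norm (h p)
    have h1 : h (flow hE₂ (-(h p).im) p) = (h p).re := by
      rw [s₂]
      · rw [Complex.ofReal_neg, neg_mul, ← sub_eq_add_neg, sub_eq_iff_eq_add]
        exact (Complex.re_add_im (h p)).symm
      · rw [abs_neg]
        linarith
    refine ⟨h1, ?_⟩
    rw [s₁, h1]
    · simp
    · rw [h1, abs_neg, Complex.norm_real, Real.norm_eq_abs]
      linarith
  let Ψ : PartialEquiv (M × ℂ) M :=
    { toFun := fun q => flow hE₂ (ε * q.2.im) (flow hE₁ (ε * q.2.re) q.1)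
      invFun := fun p => (flow hE₁ (-(h p).re) (flow hE₂ (-(h p).im) p), (ε⁻¹ : ℝ) * h p)
      source := {p | h p = 0} ×ˢ Metric.ball (0 : ℂ) 1
      target := {p | ‖h p‖ < ε}
      map_source' := by
        rintro ⟨b, z⟩ ⟨hb, hz⟩
        rw [mem_ball_zero_iff] at hz
        change ‖h (flow hE₂ (ε * z.im) (flow hE₁ (ε * z.re) b))‖ < ε
        rw [(hfor b hb z hz).2, norm_mul, Complex.norm_real, Real.norm_of_nonneg hε0.le]
        exact mul_lt_of_lt_one_right hε0 hz
      map_target' := by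
        intro p hp
        refine ⟨(hback p hp).2, ?_⟩
        rw [mem_ball_zero_iff, norm_mul, Complex.norm_real, Real.norm_of_nonneg (by positivity),
          inv_mul_lt_iff₀ hε0, mul_one]
        exact hp
      left_inv' := by
        rintro ⟨b, z⟩ ⟨hb, hz⟩
        rw [mem_ball_zero_iff] at hz
        have h2 := (hfor b hb z hz).2
        refine Prod.ext ?_ ?_
        · simp only [h2, Complex.re_ofReal_mul, Complex.im_ofReal_mul, flow_neg_flow]
        · simp only [h2]
          rw [← mul_assoc, ← Complex.ofReal_mul, inv_mul_cancel₀ hε0.ne', Complex.ofReal_one,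
            one_mul]
      right_inv' := by
        intro p hp
        simp only [Complex.re_ofReal_mul, Complex.im_ofReal_mul, mul_inv_cancel_left₀ hε0.ne',
          flow_flow_neg] }
  refine ⟨Ψ, rfl, isOpen_lt hh.continuous.norm continuous_const, ?_, ?_, ?_, ?_⟩
  · refine ContMDiff.contMDiffOn ?_
    have hre : ContMDiff ((𝓡 d).prod 𝓘(ℝ, ℂ)) 𝓘(ℝ, ℝ) ∞ (fun q : M × ℂ => ε * q.2.re) :=
      ((contDiff_const.mul Complex.reCLM.contDiff).contMDiff (f := fun z : ℂ => ε * z.re)).comp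
        contMDiff_snd
    have him : ContMDiff ((𝓡 d).prod 𝓘(ℝ, ℂ)) 𝓘(ℝ, ℝ) ∞ (fun q : M × ℂ => ε * q.2.im) :=
      ((contDiff_const.mul Complex.imCLM.contDiff).contMDiff (f := fun z : ℂ => ε * z.im)).comp
        contMDiff_snd
    exact (contMDiff_flow hE₂).comp (him.prodMk ((contMDiff_flow hE₁).comp
      (hre.prodMk contMDiff_fst)))
  · refine ContMDiff.contMDiffOn ?_
    have hre : ContMDiff (𝓡 d) 𝓘(ℝ, ℝ) ∞ (fun p => -(h p).re) :=
      (Complex.reCLM.contDiff.neg.contMDiff (f := fun z : ℂ => -z.re)).comp hh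
    have him : ContMDiff (𝓡 d) 𝓘(ℝ, ℝ) ∞ (fun p => -(h p).im) :=
      (Complex.imCLM.contDiff.neg.contMDiff (f := fun z : ℂ => -z.im)).comp hh
    have hm : ContMDiff (𝓡 d) 𝓘(ℝ, ℂ) ∞ (fun p => ((ε⁻¹ : ℝ) : ℂ) * h p) :=
      ((contDiff_const.mul contDiff_id).contMDiff
        (f := fun z : ℂ => ((ε⁻¹ : ℝ) : ℂ) * z)).comp hh
    exact ((contMDiff_flow hE₁).comp (hre.prodMk ((contMDiff_flow hE₂).comp
      (him.prodMk contMDiff_id)))).prodMk hm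
  · intro b _
    change flow hE₂ (ε * (0 : ℂ).im) (flow hE₁ (ε * (0 : ℂ).re) b) = b
    simp [flow_zero]
  · intro b hb z hz hz0
    rw [mem_ball_zero_iff] at hz
    change (unitDir (h (flow hE₂ (ε * z.im) (flow hE₁ (ε * z.re) b))) : ℂ) = _
    rw [(hfor b hb z hz).2, unitDir_mul (by exact_mod_cast hε0.ne') hz0, unitDir_ofReal hε0,
      one_mul, coe_unitDir hz0]

include hh in
/-- A map to the plane with suitable lifts of the rotation field and of the constant fields defines
an open book. -/
theorem exists_openBook_of_fields {T E₁ E₂ : ∀ p : M, TangentSpace (𝓡 d) p}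
    (hT : IsSmoothField T) {ρ : M → ℝ} (hρ : Continuous ρ)
    (hd : ∀ p, mvfderiv (𝓡 d) h p (T p) = (Complex.I + ρ p) * h p)
    (hE₁ : IsSmoothField E₁) (hE₂ : IsSmoothField E₂) {χ : M → ℝ} {R : ℝ} (hR : 0 < R)
    (hχ0 : ∀ p, 0 ≤ χ p) (hχ1 : ∀ p, χ p ≤ 1) (hχR : ∀ p, ‖h p‖ ≤ R → χ p = 1)
    (hd₁ : ∀ p, mvfderiv (𝓡 d) h p (E₁ p) = χ p * 1)
    (hd₂ : ∀ p, mvfderiv (𝓡 d) h p (E₂ p) = χ p * Complex.I) :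
    ∃ O : OpenBook d M, O.binding = {p | h p = 0} ∧ (∀ p, O.angle p = unitDir (h p)) ∧
      O.IsDefinedBy h := by
  refine ⟨{ binding := {p | h p = 0}
            angle := fun p => unitDir (h p)
            isClosed_binding := isClosed_eq hh.continuous continuous_const
            smooth_angle := contMDiffOn_unitDir hh
            locally_trivial := exists_local_trivialization hh hT hρ hd
            normal_form := exists_tubular_neighbourhood hh hE₁ hE₂ hR hχ0 hχ1 hχR hd₁ hd₂ },
    rfl, fun _ => rfl, isOpen_univ, hh.contMDiffOn, fun _ _ => Iff.rfl, ?_, ?_⟩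
  · rintro p ⟨-, hp⟩ w
    have h1 : χ p = 1 := hχR p (by rw [show h p = 0 from hp, norm_zero]; exact hR.le)
    refine ⟨w.re • E₁ p + w.im • E₂ p, ?_⟩
    rw [map_add, map_smul, map_smul, hd₁, hd₂, h1]
    conv_rhs => rw [← Complex.re_add_im w]
    simp
  · rintro p ⟨-, hp⟩
    exact coe_unitDir hp

end Construction

section PlanarMaps

variable {d : ℕ} {M : Type*} [TopologicalSpace M]
  [ChartedSpace (EuclideanSpace ℝ (Fin d)) M] {x y : M → ℝ}

theorem contMDiff_complex_mk (hx : ContMDiff (𝓡 d) 𝓘(ℝ, ℝ) ∞ x)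
    (hy : ContMDiff (𝓡 d) 𝓘(ℝ, ℝ) ∞ y) :
    ContMDiff (𝓡 d) 𝓘(ℝ, ℂ) ∞ (fun p => (⟨x p, y p⟩ : ℂ)) :=
  Complex.equivRealProdCLM.symm.contDiff.contMDiff.comp (hx.prodMk_space hy)

theorem mvfderiv_complex_mk (hx : ContMDiff (𝓡 d) 𝓘(ℝ, ℝ) ∞ x)
    (hy : ContMDiff (𝓡 d) 𝓘(ℝ, ℝ) ∞ y) (p : M) (v : TangentSpace (𝓡 d) p) :
    mvfderiv (𝓡 d) (fun p => (⟨x p, y p⟩ : ℂ)) p v =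
      ⟨mvfderiv (𝓡 d) x p v, mvfderiv (𝓡 d) y p v⟩ := by
  have hd := (contMDiff_complex_mk hx hy).mdifferentiableAt (x := p) (by simp)
  exact Complex.ext (mvfderiv_re hd v).symm (mvfderiv_im hd v).symm

end PlanarMaps

section ContactOpenBook

variable {m : ℕ} {M : Type*} [TopologicalSpace M]
  [ChartedSpace (EuclideanSpace ℝ (Fin (2 * m + 3))) M] [IsManifold (𝓡 (2 * m + 3)) ∞ M]
  [T2Space M] [CompactSpace M]
  {α : ∀ p : M, TangentSpace (𝓡 (2 * m + 3)) p →L[ℝ] ℝ} (hα : IsContactForm α)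
  {x y : M → ℝ} (hx : ContMDiff (𝓡 (2 * m + 3)) 𝓘(ℝ, ℝ) ∞ x)
  (hy : ContMDiff (𝓡 (2 * m + 3)) 𝓘(ℝ, ℝ) ∞ y)

include hy in
/-- Two functions with a positive contact bracket define an open book. -/
theorem exists_openBook_of_contactBracket_pos (hP : ∀ p, 0 < contactBracket hα hx y p) :
    ∃ O : OpenBook (2 * m + 3) M, O.IsDefinedBy fun p => (⟨x p, y p⟩ : ℂ) := by
  set r : M → ℝ := fun p => mvfderiv (𝓡 (2 * m + 3)) x p (reeb hα p) with hr
  set s : M → ℝ := fun p => mvfderiv (𝓡 (2 * m + 3)) y p (reeb hα p) with hs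
  set P : M → ℝ := contactBracket hα hx y with hPdef
  have hrs : ContMDiff (𝓡 (2 * m + 3)) 𝓘(ℝ, ℝ) ∞ r := contMDiff_mvfderiv_reeb hα hx
  have hss : ContMDiff (𝓡 (2 * m + 3)) 𝓘(ℝ, ℝ) ∞ s := contMDiff_mvfderiv_reeb hα hy
  have hPs : ContMDiff (𝓡 (2 * m + 3)) 𝓘(ℝ, ℝ) ∞ P := contMDiff_contactBracket hα hx hy
  set q : M → ℝ := fun p => x p * x p + y p * y p with hq
  have hqs : ContMDiff (𝓡 (2 * m + 3)) 𝓘(ℝ, ℝ) ∞ q := (hx.mul hx).add (hy.mul hy)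
  set D : M → ℝ := fun p => P p - (x p * s p - y p * r p) with hD
  have hDs : ContMDiff (𝓡 (2 * m + 3)) 𝓘(ℝ, ℝ) ∞ D := hPs.sub ((hx.mul hss).sub (hy.mul hrs))
  obtain ⟨δ, hδ, hδD⟩ : ∃ δ : ℝ, 0 < δ ∧ ∀ p, q p < 4 * δ → 0 < D p := by
    have hC : IsCompact {p | D p ≤ 0} :=
      (isClosed_le hDs.continuous continuous_const).isCompact
    obtain ⟨c, hc, h⟩ := hC.exists_forall_le' hqs.continuous.continuousOn (a := 0) fun p hp => by
      by_contra hcon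
      have h1 : x p * x p = 0 := by nlinarith [mul_self_nonneg (x p), mul_self_nonneg (y p)]
      have h2 : y p * y p = 0 := by nlinarith [mul_self_nonneg (x p), mul_self_nonneg (y p)]
      rw [mul_self_eq_zero] at h1 h2
      have h3 : D p ≤ 0 := hp
      simp only [hD, h1, h2, zero_mul, sub_zero] at h3
      linarith [hP p]
    refine ⟨c / 4, by positivity, fun p hp => ?_⟩
    by_contra hcon
    have := h p (not_lt.1 hcon)
    linarith
  let b : ℝ → ℝ → ℝ := fun c t => Real.smoothTransition (2 - t / c)
  have hb (c : ℝ) : ContDiff ℝ ∞ (b c) :=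
    Real.smoothTransition.contDiff.comp (contDiff_const.sub (contDiff_id.div_const c))
  have hb1 {c t : ℝ} (hc : 0 < c) (ht : t ≤ c) : b c t = 1 := by
    refine Real.smoothTransition.one_of_one_le ?_
    have := (div_le_one hc).2 ht
    linarith
  have hb0 {c t : ℝ} (hc : 0 < c) (ht : 2 * c ≤ t) : b c t = 0 := by
    refine Real.smoothTransition.zero_of_nonpos ?_
    have := (le_div_iff₀ hc).2 ht
    linarith
  set D' : M → ℝ := fun p => b (2 * δ) (q p) * D p + (1 - b (2 * δ) (q p)) with hD'
  have hbs (c : ℝ) : ContMDiff (𝓡 (2 * m + 3)) 𝓘(ℝ, ℝ) ∞ (fun p => b c (q p)) :=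
    (hb c).contMDiff.comp hqs
  have hD's : ContMDiff (𝓡 (2 * m + 3)) 𝓘(ℝ, ℝ) ∞ D' :=
    ((hbs _).mul hDs).add (contMDiff_const.sub (hbs _))
  have hD'0 (p : M) : 0 < D' p := by
    have h0 : 0 ≤ b (2 * δ) (q p) := Real.smoothTransition.nonneg _
    have h1 : b (2 * δ) (q p) ≤ 1 := Real.smoothTransition.le_one _
    rcases lt_or_ge (q p) (4 * δ) with h | h
    · have := hδD p h
      simp only [hD']
      rcases h0.lt_or_eq with h2 | h2
      · have := mul_pos h2 this
        linarith
      · rw [← h2]; norm_num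
    · simp only [hD']
      rw [hb0 (by positivity) (by linarith)]
      norm_num
  set χ : M → ℝ := fun p => b δ (q p) with hχ
  have hχs : ContMDiff (𝓡 (2 * m + 3)) 𝓘(ℝ, ℝ) ∞ χ := hbs δ
  have hχD (p : M) : χ p * D p = χ p * D' p := by
    rcases le_or_gt (q p) (2 * δ) with h | h
    · have : D' p = D p := by
        simp only [hD']
        rw [hb1 (by positivity) h]
        ring
      rw [this]
    · have : χ p = 0 := hb0 hδ h.le
      rw [this, zero_mul, zero_mul]
  have hk : ContMDiff (𝓡 (2 * m + 3)) 𝓘(ℝ, ℝ) ∞ fun p => χ p * (P p * D' p)⁻¹ :=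
    hχs.mul ((hPs.mul hD's).inv₀ fun p => (mul_pos (hP p) (hD'0 p)).ne')
  have dxX := mvfderiv_contactField_self hα hx
  have dyX (p : M) := mvfderiv_snd_contactField hα hx (y := y) p
  have dxW (p : M) := mvfderiv_fst_contactField hα hx hy p
  have dyW := mvfderiv_contactField_self hα hy
  have hX := isSmoothField_contactField hα hx
  have hW := isSmoothField_contactField hα hy
  have hPne (p : M) : P p ≠ 0 := (hP p).ne'
  have hkP (p : M) : χ p * (P p * D' p)⁻¹ * (P p * D p) = χ p := by
    have h1 := hPne p
    have h2 := (hD'0 p).ne'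
    have h3 := hχD p
    field_simp
    linear_combination h3
  refine (exists_openBook_of_fields (contMDiff_complex_mk hx hy)
    (T := fun p => (P p)⁻¹ • (x p • contactField hα hx p + y p • contactField hα hy p))
    (((hX.smul hx).add (hW.smul hy)).smul (hPs.inv₀ hPne))
    (ρ := fun p => (P p)⁻¹ * (x p * r p + y p * s p))
    ((hPs.inv₀ hPne).mul ((hx.mul hrs).add (hy.mul hss))).continuous (fun p => ?_)
    (E₁ := fun p => (χ p * (P p * D' p)⁻¹) • ((y p * s p) • contactField hα hx p -
      (P p + y p * r p) • contactField hα hy p))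
    (E₂ := fun p => (χ p * (P p * D' p)⁻¹) • ((P p - x p * s p) • contactField hα hx p +
      (x p * r p) • contactField hα hy p))
    ?_ ?_ (χ := χ) (R := √δ) (Real.sqrt_pos.2 hδ) (fun p => Real.smoothTransition.nonneg _)
    (fun p => Real.smoothTransition.le_one _) (fun p hp => ?_) (fun p => ?_) fun p => ?_).imp
    fun O hO => hO.2.2
  · rw [mvfderiv_complex_mk hx hy]
    simp only [map_smul, map_add, smul_eq_mul, dxX, dyX, dxW, dyW]
    have h1 := hPne p
    apply Complex.ext
    · simp
      field_simp
      simp only [hr, hs, hPdef]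
      ring
    · simp
      field_simp
      simp only [hr, hs, hPdef]
      ring
  · refine IsSmoothField.smul ?_ hk
    have h1 := hX.smul (hy.mul hss)
    have h2 := hW.smul (hPs.add (hy.mul hrs)).neg
    convert h1.add h2 using 1
    funext p
    rw [sub_eq_add_neg, ← neg_smul]
    rfl
  · exact ((hX.smul (hPs.sub (hx.mul hss))).add (hW.smul (hx.mul hrs))).smul hk
  · refine hb1 hδ ?_
    rw [Real.le_sqrt (norm_nonneg _) hδ.le, ← Complex.normSq_eq_norm_sq, Complex.normSq_mk] at hp
    exact hp
  · rw [mvfderiv_complex_mk hx hy]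
    simp only [map_smul, map_sub, smul_eq_mul, dxX, dyX, dxW, dyW]
    apply Complex.ext
    · simp only [Complex.ofReal_re, mul_one]
      refine Eq.trans ?_ (hkP p)
      simp only [hr, hs, hPdef, hD]
      ring
    · simp only [mul_one, Complex.ofReal_im]
      simp only [hr, hs, hPdef]
      ring
  · rw [mvfderiv_complex_mk hx hy]
    simp only [map_smul, map_add, smul_eq_mul, dxX, dyX, dxW, dyW]
    apply Complex.ext
    · simp only [Complex.mul_re, Complex.ofReal_re, Complex.I_re, Complex.ofReal_im,
        Complex.I_im, mul_zero, zero_mul, sub_zero]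
      simp only [hr, hs, hPdef]
      ring
    · simp only [Complex.mul_im, Complex.ofReal_re, Complex.I_re, mul_one, Complex.ofReal_im,
        Complex.I_im, mul_zero, add_zero]
      refine Eq.trans ?_ (hkP p)
      simp only [hr, hs, hPdef, hD]
      ring

end ContactOpenBook

section DerivApply

variable {d : ℕ} {M : Type*} [TopologicalSpace M] [ChartedSpace (EuclideanSpace ℝ (Fin d)) M]
  {f g : M → ℝ} {p : M}

theorem mvfderiv_add_apply (hf : MDifferentiableAt (𝓡 d) 𝓘(ℝ, ℝ) f p)
    (hg : MDifferentiableAt (𝓡 d) 𝓘(ℝ, ℝ) g p) (v : TangentSpace (𝓡 d) p) :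
    mvfderiv (𝓡 d) (fun q => f q + g q) p v = mvfderiv (𝓡 d) f p v + mvfderiv (𝓡 d) g p v :=
  DFunLike.congr_fun (mvfderiv_fun_add hf hg) v

theorem mvfderiv_sub_apply (hf : MDifferentiableAt (𝓡 d) 𝓘(ℝ, ℝ) f p)
    (hg : MDifferentiableAt (𝓡 d) 𝓘(ℝ, ℝ) g p) (v : TangentSpace (𝓡 d) p) :
    mvfderiv (𝓡 d) (fun q => f q - g q) p v = mvfderiv (𝓡 d) f p v - mvfderiv (𝓡 d) g p v :=
  DFunLike.congr_fun (mvfderiv_fun_sub hf hg) v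

end DerivApply

section SupportingForm

variable {m : ℕ} {M : Type*} [TopologicalSpace M]
  [ChartedSpace (EuclideanSpace ℝ (Fin (2 * m + 3))) M] [IsManifold (𝓡 (2 * m + 3)) ∞ M]
  [CompactSpace M]
  {α : ∀ p : M, TangentSpace (𝓡 (2 * m + 3)) p →L[ℝ] ℝ} (hα : IsContactForm α)
  {x y : M → ℝ} (hx : ContMDiff (𝓡 (2 * m + 3)) 𝓘(ℝ, ℝ) ∞ x)
  (hy : ContMDiff (𝓡 (2 * m + 3)) 𝓘(ℝ, ℝ) ∞ y)

theorem abs_quadratic_le (a b c x y : ℝ) :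
    |a * x ^ 2 + b * (x * y) + c * y ^ 2| ≤ (|a| + |b| + |c|) * (x ^ 2 + y ^ 2) := by
  have h1 : |x * y| ≤ x ^ 2 + y ^ 2 := abs_le.2
    ⟨by nlinarith [sq_nonneg (x + y), sq_nonneg x, sq_nonneg y],
      by nlinarith [sq_nonneg (x - y), sq_nonneg x, sq_nonneg y]⟩
  have h2 := abs_add_three (a * x ^ 2) (b * (x * y)) (c * y ^ 2)
  rw [abs_mul a, abs_mul b, abs_mul c, abs_of_nonneg (sq_nonneg x),
    abs_of_nonneg (sq_nonneg y)] at h2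
  have h3 := mul_le_mul_of_nonneg_left h1 (abs_nonneg b)
  nlinarith [mul_nonneg (abs_nonneg a) (sq_nonneg y), mul_nonneg (abs_nonneg c) (sq_nonneg x)]

include hy in
/-- A positive function whose contact vector field rotates positively around the common zeros of
two functions with a positive contact bracket. -/
theorem exists_contactField_rotates (hP : ∀ p, 0 < contactBracket hα hx y p) :
    ∃ (u : M → ℝ) (hu : ContMDiff (𝓡 (2 * m + 3)) 𝓘(ℝ, ℝ) ∞ u), (∀ p, 0 < u p) ∧
      ∀ p, 0 < x p ^ 2 + y p ^ 2 →
        0 < x p * mvfderiv (𝓡 (2 * m + 3)) y p (contactField hα hu p) -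
          y p * mvfderiv (𝓡 (2 * m + 3)) x p (contactField hα hu p) := by
  set r : M → ℝ := fun p => mvfderiv (𝓡 (2 * m + 3)) x p (reeb hα p) with hr
  set s : M → ℝ := fun p => mvfderiv (𝓡 (2 * m + 3)) y p (reeb hα p) with hs
  set P : M → ℝ := contactBracket hα hx y with hPdef
  have hrs : ContMDiff (𝓡 (2 * m + 3)) 𝓘(ℝ, ℝ) ∞ r := contMDiff_mvfderiv_reeb hα hx
  have hss : ContMDiff (𝓡 (2 * m + 3)) 𝓘(ℝ, ℝ) ∞ s := contMDiff_mvfderiv_reeb hα hy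
  have hPs : ContMDiff (𝓡 (2 * m + 3)) 𝓘(ℝ, ℝ) ∞ P := contMDiff_contactBracket hα hx hy
  have hPne (p : M) : P p ≠ 0 := (hP p).ne'
  have hX := isSmoothField_contactField hα hx
  have hW := isSmoothField_contactField hα hy
  have md {f : M → ℝ} (hf : ContMDiff (𝓡 (2 * m + 3)) 𝓘(ℝ, ℝ) ∞ f) (p : M) :
      MDifferentiableAt (𝓡 (2 * m + 3)) 𝓘(ℝ, ℝ) f p := hf.mdifferentiableAt (by simp)
  -- the derivatives along the two contact fields
  set d₁ : (M → ℝ) → M → ℝ := fun f p => mvfderiv (𝓡 (2 * m + 3)) f p (contactField hα hx p)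
    with hd₁
  set d₂ : (M → ℝ) → M → ℝ := fun f p => mvfderiv (𝓡 (2 * m + 3)) f p (contactField hα hy p)
    with hd₂
  have c₁ {f : M → ℝ} (hf : ContMDiff (𝓡 (2 * m + 3)) 𝓘(ℝ, ℝ) ∞ f) : Continuous (d₁ f) :=
    (hX.contMDiff_mvfderiv hf).continuous
  have c₂ {f : M → ℝ} (hf : ContMDiff (𝓡 (2 * m + 3)) 𝓘(ℝ, ℝ) ∞ f) : Continuous (d₂ f) :=
    (hW.contMDiff_mvfderiv hf).continuous
  set a : M → ℝ := fun p => x p * s p - y p * r p with ha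
  have has : ContMDiff (𝓡 (2 * m + 3)) 𝓘(ℝ, ℝ) ∞ a := (hx.mul hss).sub (hy.mul hrs)
  set z : M → ℝ := fun p => (-2) * (a p * (P p)⁻¹) with hz
  have hzs : ContMDiff (𝓡 (2 * m + 3)) 𝓘(ℝ, ℝ) ∞ z :=
    contMDiff_const.mul (has.mul (hPs.inv₀ hPne))
  have hzP (p : M) : z p * P p = (-2) * a p := by
    have := hPne p
    simp only [hz]
    field_simp
  set A : M → ℝ := fun p => s p ^ 2 + d₂ s p - s p * d₂ P p * (P p)⁻¹ with hA
  set B : M → ℝ := fun p => -2 * s p * r p - d₁ s p - d₂ r p +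
    (s p * d₁ P p + r p * d₂ P p) * (P p)⁻¹ with hB
  set C : M → ℝ := fun p => r p ^ 2 + d₁ r p - r p * d₁ P p * (P p)⁻¹ with hC
  have iP : Continuous fun p => (P p)⁻¹ := hPs.continuous.inv₀ hPne
  have hAc : Continuous A := ((hss.continuous.pow 2).add (c₂ hss)).sub
    ((hss.continuous.mul (c₂ hPs)).mul iP)
  have hBc : Continuous B := ((((continuous_const.mul hss.continuous).mul hrs.continuous).sub
    (c₁ hss)).sub (c₂ hrs)).add
    (((hss.continuous.mul (c₁ hPs)).add (hrs.continuous.mul (c₂ hPs))).mul iP)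
  have hCc : Continuous C := ((hrs.continuous.pow 2).add (c₁ hrs)).sub
    ((hrs.continuous.mul (c₁ hPs)).mul iP)
  obtain ⟨c, hc⟩ := isCompact_univ.exists_bound_of_continuousOn (f := fun p : M =>
    Real.exp (z p) * (|A p| + |B p| + |C p|) * ((P p)⁻¹ * (P p)⁻¹))
    (((Real.continuous_exp.comp hzs.continuous).mul
      ((hAc.abs.add hBc.abs).add hCc.abs)).mul (iP.mul iP)).continuousOn
  set e : ℝ := (|c| + 1)⁻¹ with he
  have he0 : 0 < e := by positivity
  set q : M → ℝ := fun p => (x p * x p + y p * y p) + e * Real.exp (z p) with hq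
  have hexp : ContMDiff (𝓡 (2 * m + 3)) 𝓘(ℝ, ℝ) ∞ fun p => Real.exp (z p) :=
    Real.contDiff_exp.contMDiff.comp hzs
  have hqs : ContMDiff (𝓡 (2 * m + 3)) 𝓘(ℝ, ℝ) ∞ q :=
    ((hx.mul hx).add (hy.mul hy)).add (contMDiff_const.mul hexp)
  have hq0 (p : M) : 0 < q p := by
    have := mul_pos he0 (Real.exp_pos (z p))
    have h1 := mul_self_nonneg (x p)
    have h2 := mul_self_nonneg (y p)
    simp only [hq]
    linarith
  have hu : ContMDiff (𝓡 (2 * m + 3)) 𝓘(ℝ, ℝ) ∞ fun p => √(q p) := fun p =>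
    ((Real.contDiffAt_sqrt (hq0 p).ne').contMDiffAt).comp p (hqs p)
  have hu0 (p : M) : 0 < √(q p) := Real.sqrt_pos.2 (hq0 p)
  refine ⟨fun p => √(q p), hu, hu0, fun p hp => ?_⟩
  have dq (v : TangentSpace (𝓡 (2 * m + 3)) p) : mvfderiv (𝓡 (2 * m + 3)) q p v =
      2 * x p * mvfderiv (𝓡 (2 * m + 3)) x p v + 2 * y p * mvfderiv (𝓡 (2 * m + 3)) y p v +
        e * (Real.exp (z p) * mvfderiv (𝓡 (2 * m + 3)) z p v) := by
    simp only [hq]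
    rw [mvfderiv_add_apply (f := fun p => x p * x p + y p * y p)
        (g := fun p => e * Real.exp (z p)) (md ((hx.mul hx).add (hy.mul hy)) p)
        (md (contMDiff_const.mul hexp) p),
      mvfderiv_add_apply (f := fun p => x p * x p) (g := fun p => y p * y p)
        (md (hx.mul hx) p) (md (hy.mul hy) p),
      mvfderiv_mul_apply (md hx p) (md hx p), mvfderiv_mul_apply (md hy p) (md hy p),
      mvfderiv_mul_apply (md contMDiff_const p) (md hexp p), mvfderiv_const,
      mvfderiv_comp_left Real.differentiableAt_exp (md hzs p)]
    simp
    ring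
  have du (v : TangentSpace (𝓡 (2 * m + 3)) p) : 2 * √(q p) *
      mvfderiv (𝓡 (2 * m + 3)) (fun p => √(q p)) p v = mvfderiv (𝓡 (2 * m + 3)) q p v := by
    have h1 : q = fun p => √(q p) * √(q p) := funext fun p => (Real.mul_self_sqrt (hq0 p).le).symm
    have h2 := mvfderiv_mul_apply (md hu p) (md hu p) v
    rw [← h1] at h2
    linarith
  have da (v : TangentSpace (𝓡 (2 * m + 3)) p) : mvfderiv (𝓡 (2 * m + 3)) a p v =
      x p * mvfderiv (𝓡 (2 * m + 3)) s p v + s p * mvfderiv (𝓡 (2 * m + 3)) x p v -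
        (y p * mvfderiv (𝓡 (2 * m + 3)) r p v + r p * mvfderiv (𝓡 (2 * m + 3)) y p v) := by
    simp only [ha]
    rw [mvfderiv_sub_apply (f := fun p => x p * s p) (g := fun p => y p * r p) (md (hx.mul hss) p) (md (hy.mul hrs) p),
      mvfderiv_mul_apply (md hx p) (md hss p), mvfderiv_mul_apply (md hy p) (md hrs p)]
  have dz (v : TangentSpace (𝓡 (2 * m + 3)) p) : z p * mvfderiv (𝓡 (2 * m + 3)) P p v +
      P p * mvfderiv (𝓡 (2 * m + 3)) z p v = (-2) * mvfderiv (𝓡 (2 * m + 3)) a p v := by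
    rw [← mvfderiv_mul_apply (md hzs p) (md hPs p), funext hzP,
      mvfderiv_mul_apply (md contMDiff_const p) (md has p), mvfderiv_const]
    simp
  have x₁ : d₁ x p = x p * r p := mvfderiv_contactField_self hα hx p
  have y₁ : d₁ y p = P p + y p * r p := mvfderiv_snd_contactField hα hx (y := y) p
  have x₂ : d₂ x p = x p * s p - P p := mvfderiv_fst_contactField hα hx hy p
  have y₂ : d₂ y p = y p * s p := mvfderiv_contactField_self hα hy p
  have xu := mvfderiv_fst_contactField hα hx hu p
  have yu := mvfderiv_fst_contactField hα hy hu p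
  rw [contactBracket] at xu yu
  rw [xu, yu]
  set u : ℝ := √(q p) with hudef
  have huq : u * u = q p := Real.mul_self_sqrt (hq0 p).le
  set k := mvfderiv (𝓡 (2 * m + 3)) (fun p => √(q p)) p (reeb hα p)
  have du₁ := du (contactField hα hx p)
  have du₂ := du (contactField hα hy p)
  set k₁ := mvfderiv (𝓡 (2 * m + 3)) (fun p => √(q p)) p (contactField hα hx p)
  set k₂ := mvfderiv (𝓡 (2 * m + 3)) (fun p => √(q p)) p (contactField hα hy p)
  rw [dq] at du₁ du₂
  have dz₁ := dz (contactField hα hx p)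
  have dz₂ := dz (contactField hα hy p)
  rw [da] at dz₁ dz₂
  have hN := abs_quadratic_le (A p) (B p) (C p) (x p) (y p)
  have hcp := hc p trivial
  simp only [hd₁] at x₁ y₁
  simp only [hd₂] at x₂ y₂
  rw [x₁, y₁] at du₁ dz₁
  rw [x₂, y₂] at du₂ dz₂
  set N : ℝ := A p * x p ^ 2 + B p * (x p * y p) + C p * y p ^ 2 with hNdef
  have hPi : P p * (P p)⁻¹ = 1 := mul_inv_cancel₀ (hPne p)
  have key : 2 * u * P p * (x p * (y p * k - (k₂ - u * s p)) - y p * (x p * k - (k₁ - u * r p))) =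
      2 * (P p ^ 2 * (x p ^ 2 + y p ^ 2) + e * Real.exp (z p) * N) := by
    have hqp : q p = (x p * x p + y p * y p) + e * Real.exp (z p) := rfl
    have hzp : z p = (-2) * (a p * (P p)⁻¹) := rfl
    have hap : a p = x p * s p - y p * r p := rfl
    have hAp : A p = s p ^ 2 + mvfderiv (𝓡 (2 * m + 3)) s p (contactField hα hy p) -
      s p * mvfderiv (𝓡 (2 * m + 3)) P p (contactField hα hy p) * (P p)⁻¹ := rfl
    have hBp : B p = -2 * s p * r p - mvfderiv (𝓡 (2 * m + 3)) s p (contactField hα hx p) -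
      mvfderiv (𝓡 (2 * m + 3)) r p (contactField hα hy p) +
      (s p * mvfderiv (𝓡 (2 * m + 3)) P p (contactField hα hx p) +
        r p * mvfderiv (𝓡 (2 * m + 3)) P p (contactField hα hy p)) * (P p)⁻¹ := rfl
    have hCp : C p = r p ^ 2 + mvfderiv (𝓡 (2 * m + 3)) r p (contactField hα hx p) -
      r p * mvfderiv (𝓡 (2 * m + 3)) P p (contactField hα hx p) * (P p)⁻¹ := rfl
    rw [hNdef, hAp, hBp, hCp]
    rw [hap] at hzp
    generalize Real.exp (z p) = E at *
    rw [hzp] at dz₁ dz₂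
    linear_combination (2 * P p * (x p * s p - y p * r p)) * (huq + hqp) - P p * x p * du₂ +
      P p * y p * du₁ - x p * e * E * dz₂ + y p * e * E * dz₁
  have hN' : -(P p ^ 2 * (x p ^ 2 + y p ^ 2)) < e * Real.exp (z p) * N := by
    have hPp := hP p
    have h1 : Real.exp (z p) * (|A p| + |B p| + |C p|) ≤ |c| * P p ^ 2 := by
      have h2 := ((le_abs_self _).trans hcp).trans (le_abs_self c)
      have h3 := mul_le_mul_of_nonneg_right h2 (sq_nonneg (P p))
      calc _ = _ := ?_
        _ ≤ _ := h3
      have := hPne p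
      field_simp
    have h4 : e * |c| < 1 := by
      rw [he, inv_mul_lt_one₀ (by positivity)]
      linarith
    have h5 : e * Real.exp (z p) * |N| ≤ e * |c| * (P p ^ 2 * (x p ^ 2 + y p ^ 2)) := by
      calc e * Real.exp (z p) * |N| ≤ e * Real.exp (z p) *
            ((|A p| + |B p| + |C p|) * (x p ^ 2 + y p ^ 2)) :=
            mul_le_mul_of_nonneg_left hN (by positivity)
        _ = e * (x p ^ 2 + y p ^ 2) * (Real.exp (z p) * (|A p| + |B p| + |C p|)) := by ring
        _ ≤ e * (x p ^ 2 + y p ^ 2) * (|c| * P p ^ 2) :=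
            mul_le_mul_of_nonneg_left h1 (by positivity)
        _ = _ := by ring
    have h6 : e * |c| * (P p ^ 2 * (x p ^ 2 + y p ^ 2)) < P p ^ 2 * (x p ^ 2 + y p ^ 2) :=
      mul_lt_of_lt_one_left (by positivity) h4
    have h7 : -(e * Real.exp (z p) * |N|) ≤ e * Real.exp (z p) * N := by
      rw [← mul_neg]
      exact mul_le_mul_of_nonneg_left (neg_abs_le N) (by positivity)
    linarith
  have : 0 < 2 * u * P p *
      (x p * (y p * k - (k₂ - u * s p)) - y p * (x p * k - (k₁ - u * r p))) := by
    rw [key]; linarith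
  exact (mul_pos_iff_of_pos_left (mul_pos (mul_pos two_pos (hu0 p)) (hP p))).1 this

include hy in
theorem exists_isDefinedBy_pagesPositive {ξ : ContactStructure m M} (hξ : ξ.IsDefinedBy α)
    (hP : ∀ p, 0 < contactBracket hα hx y p) {O : OpenBook (2 * m + 3) M}
    (hO : O.IsDefinedBy fun p => (⟨x p, y p⟩ : ℂ)) :
    ∃ α', ξ.IsDefinedBy α' ∧ O.PagesPositive α' := by
  obtain ⟨u, hu, hu0, h⟩ := exists_contactField_rotates hα hx hy hP
  have hβ := hξ.smul (hu.inv₀ fun p => (hu0 p).ne') fun p => inv_pos.2 (hu0 p)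
  refine ⟨_, hβ, OpenBook.pagesPositive_of_dAngle_reeb_pos hβ.1 fun p hp => ?_⟩
  rw [reeb_inv_smul hα hu (fun p => (hu0 p).ne') hβ.1]
  have hq : 0 < x p ^ 2 + y p ^ 2 := by
    rw [hO.mem_iff, Complex.ext_iff] at hp
    by_cases h : x p = 0
    · have : y p ≠ 0 := fun h' => hp ⟨h, h'⟩
      positivity
    · positivity
  refine (mul_pos_iff_of_pos_left hq).1 ?_
  rw [hO.sq_mul_dAngle rfl hp]
  exact h p hq

end SupportingForm

theorem eq_exp_iff {w : ℂ} (hw : w ≠ 0) (t : ℝ) : w / ‖w‖ = (Circle.exp t : ℂ) ↔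
    w.im * Real.cos t - w.re * Real.sin t = 0 ∧ 0 < w.re * Real.cos t + w.im * Real.sin t := by
  have hn : 0 < ‖w‖ := norm_pos_iff.2 hw
  have hcs := Real.sin_sq_add_cos_sq t
  have he : (Circle.exp t : ℂ) = ⟨Real.cos t, Real.sin t⟩ := by
    rw [Circle.coe_exp]
    apply Complex.ext
    · rw [Complex.exp_ofReal_mul_I_re]
    · rw [Complex.exp_ofReal_mul_I_im]
  rw [div_eq_iff (Complex.ofReal_ne_zero.2 hn.ne'), he, Complex.ext_iff]
  simp only [Complex.mul_re, Complex.mul_im, Complex.ofReal_re, Complex.ofReal_im, mul_zero,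
    sub_zero, zero_add]
  constructor
  · rintro ⟨h1, h2⟩
    constructor
    · linear_combination Real.cos t * h2 - Real.sin t * h1
    · have : w.re * Real.cos t + w.im * Real.sin t = ‖w‖ := by
        linear_combination Real.cos t * h1 + Real.sin t * h2 + ‖w‖ * hcs
      rwa [this]
  · rintro ⟨h1, h2⟩
    set k := w.re * Real.cos t + w.im * Real.sin t with hk
    have hre : w.re = k * Real.cos t := by
      linear_combination -w.re * hcs + Real.cos t * hk.symm - Real.sin t * h1
    have him : w.im = k * Real.sin t := by
      linear_combination -w.im * hcs + Real.sin t * hk.symm + Real.cos t * h1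
    have hnk : ‖w‖ = k := by
      refine (sq_eq_sq₀ hn.le h2.le).1 ?_
      rw [← Complex.normSq_eq_norm_sq, Complex.normSq_apply, hre, him]
      linear_combination k ^ 2 * hcs
    rw [hnk, hre, him]
    constructor <;> ring

section Rotations

variable {m : ℕ} {M : Type*} [TopologicalSpace M]
  [ChartedSpace (EuclideanSpace ℝ (Fin (2 * m + 3))) M] [IsManifold (𝓡 (2 * m + 3)) ∞ M]
  {α : ∀ p : M, TangentSpace (𝓡 (2 * m + 3)) p →L[ℝ] ℝ} {ξ : ContactStructure m M}
  {X Y : ∀ p : M, TangentSpace (𝓡 (2 * m + 3)) p}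

theorem apply_rotField (α : ∀ p : M, TangentSpace (𝓡 (2 * m + 3)) p →L[ℝ] ℝ)
    (X Y : ∀ p : M, TangentSpace (𝓡 (2 * m + 3)) p) (θ : ℝ) (p : M) :
    α p (rotField X Y θ p) = Real.cos θ * α p (X p) + Real.sin θ * α p (Y p) := by
  rw [rotField, map_add, map_smul, map_smul, smul_eq_mul, smul_eq_mul]

theorem mvfderiv_linear_combination {f g : M → ℝ} {p : M}
    (hf : MDifferentiableAt (𝓡 (2 * m + 3)) 𝓘(ℝ, ℝ) f p)
    (hg : MDifferentiableAt (𝓡 (2 * m + 3)) 𝓘(ℝ, ℝ) g p) (a b : ℝ)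
    (v : TangentSpace (𝓡 (2 * m + 3)) p) :
    mvfderiv (𝓡 (2 * m + 3)) (fun q => a * f q + b * g q) p v =
      a * mvfderiv (𝓡 (2 * m + 3)) f p v + b * mvfderiv (𝓡 (2 * m + 3)) g p v := by
  have ha : MDifferentiableAt (𝓡 (2 * m + 3)) 𝓘(ℝ, ℝ) (fun _ : M => a) p :=
    mdifferentiableAt_const
  have hb : MDifferentiableAt (𝓡 (2 * m + 3)) 𝓘(ℝ, ℝ) (fun _ : M => b) p :=
    mdifferentiableAt_const
  rw [mvfderiv_add_apply (f := fun q => a * f q) (g := fun q => b * g q) (ha.mul hf) (hb.mul hg),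
    mvfderiv_mul_apply ha hf, mvfderiv_mul_apply hb hg, mvfderiv_const, mvfderiv_const]
  simp

theorem mvfderiv_apply_rotField (hα : IsSmoothForm α) (hX : IsSmoothField X)
    (hY : IsSmoothField Y) (θ : ℝ) (p : M) (v : TangentSpace (𝓡 (2 * m + 3)) p) :
    mvfderiv (𝓡 (2 * m + 3)) (fun q => α q (rotField X Y θ q)) p v =
      Real.cos θ * mvfderiv (𝓡 (2 * m + 3)) (fun q => α q (X q)) p v +
        Real.sin θ * mvfderiv (𝓡 (2 * m + 3)) (fun q => α q (Y q)) p v := by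
  rw [funext (apply_rotField α X Y θ)]
  exact mvfderiv_linear_combination ((hα.contMDiff_apply hX).mdifferentiableAt (by simp))
    ((hα.contMDiff_apply hY).mdifferentiableAt (by simp)) _ _ v

theorem IsSmoothField.rotField (hX : IsSmoothField X) (hY : IsSmoothField Y) (θ : ℝ) :
    IsSmoothField (rotField X Y θ) :=
  (hX.smul contMDiff_const).add (hY.smul contMDiff_const)

namespace ContactStructure

theorem exists_isDefinedBy (ξ : ContactStructure m M) : ∃ α, ξ.IsDefinedBy α := ξ.exists_form

theorem IsContactField.rotField (hX : ξ.IsContactField X) (hY : ξ.IsContactField Y) (θ : ℝ) :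
    ξ.IsContactField (rotField X Y θ) := by
  refine ⟨hX.1.rotField hY.1 θ, fun α hα => ?_⟩
  obtain ⟨g, hg⟩ := hX.2 α hα
  obtain ⟨k, hk⟩ := hY.2 α hα
  refine ⟨fun p => Real.cos θ * g p + Real.sin θ * k p, fun p v => ?_⟩
  have h1 := hg p v
  have h2 := hk p v
  rw [lieForm] at h1 h2
  rw [lieForm, mvfderiv_apply_rotField hα.1.1 hX.1 hY.1, ← dFormLin_apply, OBD.rotField, map_add,
    map_smul, map_smul]
  simp only [LinearMap.add_apply, LinearMap.smul_apply, dFormLin_apply, smul_eq_mul]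
  linear_combination Real.cos θ * h1 + Real.sin θ * h2

theorem IsContactField.apply_mlieBracket_rotField (hX : ξ.IsContactField X)
    (hY : ξ.IsContactField Y) (hα : ξ.IsDefinedBy α) (θ θ' : ℝ) (p : M) :
    α p (VectorField.mlieBracket (𝓡 (2 * m + 3)) (OBD.rotField X Y θ) (OBD.rotField X Y θ') p) =
      Real.sin (θ' - θ) * α p (VectorField.mlieBracket (𝓡 (2 * m + 3)) X Y p) := by
  have h1 := hX.apply_mlieBracket hY.1 hα p
  have h2 := IsContactField.apply_mlieBracket' hX.1 hY hα p
  have h3 := hX.mvfderiv_self hα p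
  have h4 := hY.mvfderiv_self hα p
  rw [(hX.rotField hY θ).apply_mlieBracket (hX.1.rotField hY.1 θ') hα,
    mvfderiv_apply_rotField hα.1.1 hX.1 hY.1, mvfderiv_apply_rotField hα.1.1 hX.1 hY.1,
    apply_rotField, Real.sin_sub]
  simp only [OBD.rotField, map_add, map_smul, smul_eq_mul]
  linear_combination Real.cos θ * Real.cos θ' * h3 + Real.sin θ * Real.sin θ' * h4 +
    Real.sin θ * Real.cos θ' * h2 - Real.cos θ * Real.sin θ' * h1

theorem NegTransverse.apply_neg {Z : ∀ p : M, TangentSpace (𝓡 (2 * m + 3)) p}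
    (hZ : ξ.NegTransverse Z) (hα : ξ.IsDefinedBy α) (p : M) : α p (Z p) < 0 := by
  have := (hα.2 p _).2.1 (hZ p)
  rwa [map_neg, neg_pos] at this

theorem NegTransverse.rotField (hX : ξ.IsContactField X) (hY : ξ.IsContactField Y)
    (hN : ξ.NegTransverse (VectorField.mlieBracket (𝓡 (2 * m + 3)) X Y)) (θ : ℝ) :
    ξ.NegTransverse (VectorField.mlieBracket (𝓡 (2 * m + 3)) (OBD.rotField X Y θ)
      (OBD.rotField X Y (θ + Real.pi / 2))) := by
  obtain ⟨α, hα⟩ := ξ.exists_isDefinedBy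
  intro p
  rw [(hα.2 p _).2, map_neg, neg_pos, hX.apply_mlieBracket_rotField hY hα, add_sub_cancel_left,
    Real.sin_pi_div_two, one_mul]
  exact hN.apply_neg hα p

theorem IsDefinedBy.mem_sigmaSet (hα : ξ.IsDefinedBy α) {θ : ℝ} {p : M} :
    p ∈ sigmaSet ξ X Y θ ↔ α p (OBD.rotField X Y θ p) = 0 :=
  (hα.2 p _).1

theorem IsDefinedBy.mem_zeroSet (hα : ξ.IsDefinedBy α) {p : M} :
    p ∈ zeroSet ξ X Y ↔ α p (X p) = 0 ∧ α p (Y p) = 0 :=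
  and_congr (hα.2 p _).1 (hα.2 p _).1

theorem IsDefinedBy.mem_pageSet (hα : ξ.IsDefinedBy α) {θ : ℝ} {p : M} :
    p ∈ pageSet ξ X Y θ ↔ Real.cos θ * α p (X p) + Real.sin θ * α p (Y p) = 0 ∧
      0 < -Real.sin θ * α p (X p) + Real.cos θ * α p (Y p) := by
  refine and_congr ?_ ?_
  · rw [← apply_rotField, hα.mem_sigmaSet]
  · rw [(hα.2 p _).2, apply_rotField, Real.cos_add_pi_div_two, Real.sin_add_pi_div_two]

theorem zeroSet_rotField (ξ : ContactStructure m M)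
    (X Y : ∀ p : M, TangentSpace (𝓡 (2 * m + 3)) p) (θ : ℝ) :
    zeroSet ξ (OBD.rotField X Y θ) (OBD.rotField X Y (θ + Real.pi / 2)) = zeroSet ξ X Y := by
  obtain ⟨α, hα⟩ := ξ.exists_isDefinedBy
  ext p
  rw [hα.mem_zeroSet, hα.mem_zeroSet, apply_rotField, apply_rotField, Real.cos_add_pi_div_two,
    Real.sin_add_pi_div_two]
  have hcs := Real.sin_sq_add_cos_sq θ
  constructor
  · rintro ⟨h1, h2⟩
    constructor
    · linear_combination Real.cos θ * h1 - Real.sin θ * h2 - α p (X p) * hcs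
    · linear_combination Real.sin θ * h1 + Real.cos θ * h2 - α p (Y p) * hcs
  · rintro ⟨h1, h2⟩
    rw [h1, h2]
    constructor <;> ring

section Sigma

variable (hX : ξ.IsContactField X) (hY : ξ.IsContactField Y)
  (hN : ξ.NegTransverse (VectorField.mlieBracket (𝓡 (2 * m + 3)) X Y))
include hX hY

theorem mvfderiv_apply_rotField_of_mem (hα : ξ.IsDefinedBy α) {θ : ℝ} {p : M}
    (hp : p ∈ sigmaSet ξ X Y θ) (θ' : ℝ) :
    mvfderiv (𝓡 (2 * m + 3)) (fun q => α q (OBD.rotField X Y θ q)) p (OBD.rotField X Y θ' p) =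
      -(Real.sin (θ' - θ) * α p (VectorField.mlieBracket (𝓡 (2 * m + 3)) X Y p)) := by
  rw [hα.mem_sigmaSet] at hp
  rw [← hX.apply_mlieBracket_rotField hY hα,
    IsContactField.apply_mlieBracket' (hX.1.rotField hY.1 θ) (hX.rotField hY θ') hα, hp]
  ring

include hN

theorem mvfderiv_apply_rotField_orthogonal (hα : ξ.IsDefinedBy α) {θ : ℝ} {p : M}
    (hp : p ∈ sigmaSet ξ X Y θ) :
    0 < mvfderiv (𝓡 (2 * m + 3)) (fun q => α q (OBD.rotField X Y θ q)) p
      (OBD.rotField X Y (θ + Real.pi / 2) p) := by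
  rw [mvfderiv_apply_rotField_of_mem hX hY hα hp, add_sub_cancel_left, Real.sin_pi_div_two,
    one_mul, neg_pos]
  exact hN.apply_neg hα p

theorem isLocalEquation_sigmaSet (hα : ξ.IsDefinedBy α) (θ : ℝ) :
    IsLocalEquation (d := 2 * m + 3) (sigmaSet ξ X Y θ) Set.univ
      (fun q => α q (OBD.rotField X Y θ q)) := by
  refine ⟨isOpen_univ, (hα.1.1.contMDiff_apply (hX.1.rotField hY.1 θ)).contMDiffOn,
    fun p _ => hα.mem_sigmaSet, fun p hp h => ?_⟩
  have := mvfderiv_apply_rotField_orthogonal hX hY hN hα hp.2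
  rw [h] at this
  exact lt_irrefl _ this

theorem isHypersurface_sigmaSet (θ : ℝ) : IsHypersurface (2 * m + 3) (sigmaSet ξ X Y θ) := by
  obtain ⟨α, hα⟩ := ξ.exists_isDefinedBy
  exact fun p _ => ⟨_, _, Set.mem_univ p, isLocalEquation_sigmaSet hX hY hN hα θ⟩

theorem isConvex_sigmaSet (θ : ℝ) : ξ.IsConvex (sigmaSet ξ X Y θ) := by
  obtain ⟨α, hα⟩ := ξ.exists_isDefinedBy
  exact ⟨isHypersurface_sigmaSet hX hY hN θ, _, hX.rotField hY (θ + Real.pi / 2), fun p hp =>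
    ⟨_, _, Set.mem_univ p, isLocalEquation_sigmaSet hX hY hN hα θ,
      (mvfderiv_apply_rotField_orthogonal hX hY hN hα hp).ne'⟩⟩

omit hX hY hN in
theorem zeroSet_subset_sigmaSet (ξ : ContactStructure m M)
    (X Y : ∀ p : M, TangentSpace (𝓡 (2 * m + 3)) p) (θ : ℝ) :
    zeroSet ξ X Y ⊆ sigmaSet ξ X Y θ := by
  obtain ⟨α, hα⟩ := ξ.exists_isDefinedBy
  intro p hp
  rw [hα.mem_zeroSet] at hp
  rw [hα.mem_sigmaSet, apply_rotField, hp.1, hp.2, mul_zero, mul_zero, add_zero]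

omit hX hY hN in
theorem sigmaSet_diff_zeroSet (ξ : ContactStructure m M)
    (X Y : ∀ p : M, TangentSpace (𝓡 (2 * m + 3)) p) (θ : ℝ) :
    sigmaSet ξ X Y θ \ zeroSet ξ X Y = pageSet ξ X Y θ ∪ pageSet ξ X Y (θ + Real.pi) := by
  obtain ⟨α, hα⟩ := ξ.exists_isDefinedBy
  have hcs := Real.sin_sq_add_cos_sq θ
  ext p
  rw [Set.mem_sdiff, Set.mem_union, hα.mem_sigmaSet, hα.mem_zeroSet, hα.mem_pageSet, hα.mem_pageSet,
    apply_rotField, Real.cos_add_pi, Real.sin_add_pi]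
  constructor
  · rintro ⟨h1, h2⟩
    rcases lt_trichotomy 0 (-Real.sin θ * α p (X p) + Real.cos θ * α p (Y p)) with h | h | h
    · exact Or.inl ⟨h1, h⟩
    · refine absurd ⟨?_, ?_⟩ h2
      · linear_combination Real.cos θ * h1 + Real.sin θ * h - α p (X p) * hcs
      · linear_combination Real.sin θ * h1 - Real.cos θ * h - α p (Y p) * hcs
    · exact Or.inr ⟨by linarith, by linarith⟩
  · rintro (⟨h1, h2⟩ | ⟨h1, h2⟩)
    · refine ⟨h1, fun h => ?_⟩
      rw [h.1, h.2] at h2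
      simp at h2
    · refine ⟨by linarith, fun h => ?_⟩
      rw [h.1, h.2] at h2
      simp at h2

omit hX hY hN in
theorem sigmaSet_inter_sigmaSet (ξ : ContactStructure m M)
    (X Y : ∀ p : M, TangentSpace (𝓡 (2 * m + 3)) p) {θ θ' : ℝ} (h : Real.sin (θ' - θ) ≠ 0) :
    sigmaSet ξ X Y θ ∩ sigmaSet ξ X Y θ' = zeroSet ξ X Y := by
  refine Set.Subset.antisymm (fun p hp => ?_) (Set.subset_inter (zeroSet_subset_sigmaSet ξ X Y θ)
    (zeroSet_subset_sigmaSet ξ X Y θ'))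
  obtain ⟨α, hα⟩ := ξ.exists_isDefinedBy
  rw [Set.mem_inter_iff, hα.mem_sigmaSet, hα.mem_sigmaSet, apply_rotField, apply_rotField] at hp
  rw [hα.mem_zeroSet]
  rw [Real.sin_sub] at h
  constructor
  · refine (mul_eq_zero_iff_left h).1 ?_
    linear_combination Real.sin θ' * hp.1 - Real.sin θ * hp.2
  · refine (mul_eq_zero_iff_left h).1 ?_
    linear_combination Real.cos θ * hp.2 - Real.cos θ' * hp.1

theorem areTransverse_sigmaSet {θ θ' : ℝ} (h : Real.sin (θ' - θ) ≠ 0) :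
    AreTransverse (2 * m + 3) (sigmaSet ξ X Y θ) (sigmaSet ξ X Y θ') := by
  obtain ⟨α, hα⟩ := ξ.exists_isDefinedBy
  intro p hp
  refine ⟨_, _, _, _, Set.mem_univ p, Set.mem_univ p, isLocalEquation_sigmaSet hX hY hN hα θ,
    isLocalEquation_sigmaSet hX hY hN hα θ', ?_⟩
  have h1 := mvfderiv_apply_rotField_of_mem hX hY hα hp.1 θ'
  have h2 := mvfderiv_apply_rotField_of_mem hX hY hα hp.2 θ'
  rw [sub_self, Real.sin_zero, zero_mul, neg_zero] at h2
  have h3 : mvfderiv (𝓡 (2 * m + 3)) (fun q => α q (OBD.rotField X Y θ q)) p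
      (OBD.rotField X Y θ' p) ≠ 0 := by
    rw [h1]
    exact neg_ne_zero.2 (mul_ne_zero h (hN.apply_neg hα p).ne)
  refine eq_top_iff.2 fun v _ => ?_
  set L := mvfderiv (𝓡 (2 * m + 3)) (fun q => α q (OBD.rotField X Y θ q)) p
  set L' := mvfderiv (𝓡 (2 * m + 3)) (fun q => α q (OBD.rotField X Y θ' q)) p
  set e := OBD.rotField X Y θ' p
  refine Submodule.mem_sup.2 ⟨v - (L v / L e) • e, ?_, (L v / L e) • e, ?_, sub_add_cancel _ _⟩
  · change L _ = 0
    rw [map_sub, map_smul, smul_eq_mul, div_mul_cancel₀ _ h3, sub_self]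
  · change L' _ = 0
    rw [map_smul, h2, smul_zero]

end Sigma

end ContactStructure

end Rotations

section PairOpenBook

variable {m : ℕ} {M : Type*} [TopologicalSpace M]
  [ChartedSpace (EuclideanSpace ℝ (Fin (2 * m + 3))) M] [IsManifold (𝓡 (2 * m + 3)) ∞ M]
  [T2Space M] [CompactSpace M]
  {ξ : ContactStructure m M} {X Y : ∀ p : M, TangentSpace (𝓡 (2 * m + 3)) p}
  (hX : ξ.IsContactField X) (hY : ξ.IsContactField Y)
  (hN : ξ.NegTransverse (VectorField.mlieBracket (𝓡 (2 * m + 3)) X Y))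

namespace ContactStructure

omit [T2Space M] [CompactSpace M] in
include hX hY hN in
theorem contactBracket_hamiltonians_pos
    {α : ∀ p : M, TangentSpace (𝓡 (2 * m + 3)) p →L[ℝ] ℝ} (hα : ξ.IsDefinedBy α) (p : M) :
    0 < contactBracket hα.1 (hα.1.1.contMDiff_apply hX.1) (fun p => -α p (Y p)) p := by
  have h1 : X p = contactField hα.1 (hα.1.1.contMDiff_apply hX.1) p :=
    hα.1.eq_contactField _ rfl (hX.dForm_eq hα p)
  have h2 := hX.apply_mlieBracket hY.1 hα p
  have h3 := hN.apply_neg hα p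
  have h4 : mvfderiv (𝓡 (2 * m + 3)) (fun p => -α p (Y p)) p (X p) =
      -mvfderiv (𝓡 (2 * m + 3)) (fun p => α p (Y p)) p (X p) :=
    DFunLike.congr_fun (mvfderiv_fun_neg (g := fun p => α p (Y p))) (X p)
  rw [contactBracket, ← h1, h4]
  linarith

include hX hY hN in
theorem zeroSet_nonempty [Nonempty M] : (zeroSet ξ X Y).Nonempty := by
  obtain ⟨α, hα⟩ := ξ.exists_isDefinedBy
  obtain ⟨p, h1, h2⟩ := exists_common_zero hα.1 (hα.1.1.contMDiff_apply hX.1)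
    (hα.1.1.contMDiff_apply hY.1).neg (contactBracket_hamiltonians_pos hX hY hN hα)
  exact ⟨p, hα.mem_zeroSet.2 ⟨h1, neg_eq_zero.1 h2⟩⟩

include hX hY hN in
/-- The open book of a pair of contact vector fields whose bracket is negatively transverse. -/
theorem exists_openBook_of_contactFields : ∃ O : OpenBook (2 * m + 3) M,
    O.binding = zeroSet ξ X Y ∧
    (∀ α, ξ.IsDefinedBy α → O.IsDefinedBy fun p => (⟨α p (X p), -α p (Y p)⟩ : ℂ)) ∧
    O.Supports ξ := by
  obtain ⟨α, hα⟩ := ξ.exists_isDefinedBy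
  have hP := contactBracket_hamiltonians_pos hX hY hN hα
  obtain ⟨O, hO⟩ := exists_openBook_of_contactBracket_pos hα.1 (hα.1.1.contMDiff_apply hX.1)
    (hα.1.1.contMDiff_apply hY.1).neg hP
  have hdef (β : ∀ p : M, TangentSpace (𝓡 (2 * m + 3)) p →L[ℝ] ℝ) (hβ : ξ.IsDefinedBy β) :
      O.IsDefinedBy fun p => (⟨β p (X p), -β p (Y p)⟩ : ℂ) := by
    obtain ⟨u, hu, hu0, rfl⟩ := hα.exists_smul hβ
    convert hO.smul_pos hu hu0 using 1
    funext p
    apply Complex.ext <;> simp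
  refine ⟨O, ?_, hdef, fun β hβ => ?_,
    exists_isDefinedBy_pagesPositive hα.1 _ (hα.1.1.contMDiff_apply hY.1).neg hα hP hO⟩
  · ext p
    rw [hO.mem_iff, hα.mem_zeroSet, Complex.ext_iff]
    simp
  · refine (hdef β hβ).bindingPositive hβ.1 (hβ.1.1.contMDiff_apply hX.1)
      (hβ.1.1.contMDiff_apply hY.1).neg rfl fun p hp => ?_
    have h1 := contactBracket_hamiltonians_pos hX hY hN hβ p
    rw [(hdef β hβ).mem_iff, Complex.ext_iff] at hp
    simp only [Complex.zero_re, Complex.zero_im] at hp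
    rw [contactBracket_eq, hp.1, hp.2] at h1
    simpa using h1

end ContactStructure

omit [IsManifold (𝓡 (2 * m + 3)) ∞ M] [T2Space M] [CompactSpace M] in
theorem OpenBook.IsDefinedBy.angle_eq_exp_iff {O : OpenBook (2 * m + 3) M} {h : M → ℂ}
    (hh : O.IsDefinedBy h) {p : M} (hp : p ∉ O.binding) (t : ℝ) : O.angle p = Circle.exp t ↔
      (h p).im * Real.cos t - (h p).re * Real.sin t = 0 ∧
        0 < (h p).re * Real.cos t + (h p).im * Real.sin t := by
  rw [← eq_exp_iff (fun h0 => hp ((hh.mem_iff p).2 h0)), ← hh.2.2.2.2 p ⟨trivial, hp⟩,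
    Circle.ext_iff]

end PairOpenBook

end OBD

end

theorem mainTheorem6 (m : ℕ) {M : Type*} [TopologicalSpace M] [T2Space M]
    [SecondCountableTopology M] [ChartedSpace (EuclideanSpace ℝ (Fin (2 * m + 3))) M]
    [IsManifold (𝓡 (2 * m + 3)) ∞ M] (ξ : OBD.ContactStructure m M) :
    -- from supporting open books to contact vector fields
    (∀ O : OBD.OpenBook (2 * m + 3) M, O.Supports ξ →
      ∀ α : ∀ p : M, TangentSpace (𝓡 (2 * m + 3)) p →L[ℝ] ℝ,
        ξ.IsDefinedBy α → O.PagesPositive α →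
        ∃ h : M → ℂ, O.IsDefinedBy h ∧
          ∃ X Y : ∀ p : M, TangentSpace (𝓡 (2 * m + 3)) p,
            ξ.IsContactField X ∧ ξ.IsContactField Y ∧
            (∀ p, α p (X p) = (h p).re) ∧ (∀ p, α p (Y p) = -(h p).im) ∧
            ξ.NegTransverse (VectorField.mlieBracket (𝓡 (2 * m + 3)) X Y)) ∧
    -- from contact vector fields to supporting open books, on closed manifolds
    (CompactSpace M → Nonempty M →
      ∀ X Y : ∀ p : M, TangentSpace (𝓡 (2 * m + 3)) p,
        ξ.IsContactField X → ξ.IsContactField Y →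
        ξ.NegTransverse (VectorField.mlieBracket (𝓡 (2 * m + 3)) X Y) →
        (∀ θ : ℝ, (OBD.sigmaSet ξ X Y θ).Nonempty ∧
          OBD.IsHypersurface (2 * m + 3) (OBD.sigmaSet ξ X Y θ) ∧
          ξ.IsConvex (OBD.sigmaSet ξ X Y θ) ∧
          OBD.sigmaSet ξ X Y θ \ OBD.zeroSet ξ X Y =
            OBD.pageSet ξ X Y θ ∪ OBD.pageSet ξ X Y (θ + Real.pi)) ∧
        (OBD.zeroSet ξ X Y).Nonempty ∧
        (∀ θ θ' : ℝ, (∀ k : ℤ, θ - θ' ≠ k * Real.pi) →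
          OBD.sigmaSet ξ X Y θ ∩ OBD.sigmaSet ξ X Y θ' = OBD.zeroSet ξ X Y ∧
          OBD.AreTransverse (2 * m + 3) (OBD.sigmaSet ξ X Y θ) (OBD.sigmaSet ξ X Y θ')) ∧
        (∃ O : OBD.OpenBook (2 * m + 3) M,
          O.binding = OBD.zeroSet ξ X Y ∧
          (∀ p ∉ OBD.zeroSet ξ X Y, ∀ t : ℝ,
            O.angle p = Circle.exp t ↔ p ∈ OBD.pageSet ξ X Y (-t)) ∧
          O.Supports ξ) ∧
        (∃ O : OBD.OpenBook (2 * m + 3) M,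
          O.binding = OBD.zeroSet ξ X Y ∧
          (∀ p ∉ OBD.zeroSet ξ X Y, ∀ t : ℝ,
            O.angle p = Circle.exp t ↔ p ∈ OBD.pageSet ξ X Y (-t - Real.pi / 2)) ∧
          (∀ α : ∀ p : M, TangentSpace (𝓡 (2 * m + 3)) p →L[ℝ] ℝ, ξ.IsDefinedBy α →
            O.IsDefinedBy fun p => (⟨α p (X p), -α p (Y p)⟩ : ℂ)) ∧
          O.Supports ξ)) := by
  refine ⟨fun O hO α hα hP => hO.exists_contactFields hα hP, fun _ _ X Y hX hY hN => ⟨fun θ => ?_,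
    OBD.ContactStructure.zeroSet_nonempty hX hY hN, fun θ θ' hθ => ?_, ?_, ?_⟩⟩
  · exact ⟨(OBD.ContactStructure.zeroSet_nonempty hX hY hN).mono
      (OBD.ContactStructure.zeroSet_subset_sigmaSet ξ X Y θ),
      OBD.ContactStructure.isHypersurface_sigmaSet hX hY hN θ,
      OBD.ContactStructure.isConvex_sigmaSet hX hY hN θ,
      OBD.ContactStructure.sigmaSet_diff_zeroSet ξ X Y θ⟩
  · have h : Real.sin (θ' - θ) ≠ 0 := by
      intro h
      obtain ⟨k, hk⟩ := Real.sin_eq_zero_iff.1 h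
      refine hθ (-k) ?_
      push_cast
      linarith
    exact ⟨OBD.ContactStructure.sigmaSet_inter_sigmaSet ξ X Y h,
      OBD.ContactStructure.areTransverse_sigmaSet hX hY hN h⟩
  · obtain ⟨α, hα⟩ := ξ.exists_isDefinedBy
    obtain ⟨O, hO, hdef, hS⟩ := OBD.ContactStructure.exists_openBook_of_contactFields
      (hX.rotField hY (Real.pi / 2)) (hX.rotField hY (Real.pi / 2 + Real.pi / 2))
      (OBD.ContactStructure.NegTransverse.rotField hX hY hN (Real.pi / 2))
    rw [OBD.ContactStructure.zeroSet_rotField] at hO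
    refine ⟨O, hO, fun p hp t => ?_, hS⟩
    rw [← hO] at hp
    rw [(hdef α hα).angle_eq_exp_iff hp, hα.mem_pageSet]
    simp only [OBD.apply_rotField, add_halves, Real.cos_pi_div_two, Real.sin_pi_div_two,
      Real.cos_pi, Real.sin_pi, Real.cos_neg, Real.sin_neg]
    refine and_congr (Eq.congr ?_ rfl) ((iff_of_eq (congrArg _ ?_)))
    · ring
    · ring
  · obtain ⟨α, hα⟩ := ξ.exists_isDefinedBy
    obtain ⟨O, hO, hdef, hS⟩ := OBD.ContactStructure.exists_openBook_of_contactFields hX hY hN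
    refine ⟨O, hO, fun p hp t => ?_, hdef, hS⟩
    rw [← hO] at hp
    rw [(hdef α hα).angle_eq_exp_iff hp, hα.mem_pageSet, Real.cos_sub_pi_div_two,
      Real.sin_sub_pi_div_two, Real.cos_neg, Real.sin_neg]
    refine and_congr (Eq.congr ?_ rfl) ((iff_of_eq (congrArg _ ?_)))
    · ring
    · ring
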